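/- Let $M\subset\mathbb C^2$ be a real-analytic hypersurface and let $p\in M$ be a generic point of $1$-infinite type: in some local holomorphic coordinates $(z,w)$, $w=u+iv$, centred at $p$, $M$ is given near $p$ by $v=u\,\psi(z,\bar z,u)$, where $u\psi$ is a convergent real-valued power series, $\psi(z,0,u)=\psi(0,\bar z,u)=0$ and $\psi_{z\bar z}(0,0,0)\neq 0$ (in particular $M$ is Levi-nonflat). Local holomorphic coordinates $(z,w)$ centred at $p$ are called admissible if in them $M$ is given near $p$ by $$v=\tfrac12\,u\,h(z,\bar z,u),\qquad h(z,\bar z,u)=\epsilon|z|^2+\sum_{k,l\ge 2}h_{kl}(u)z^k\bar z^l,\qquad \epsilon=\pm1,$$ with $h$ a convergent real-valued power series. $M$ is in normal form in such coordinates if moreover $h_{22}(u)$, $h_{23}(u)$, $h_{32}(u)$, $h_{33}(u)$ are constant. In admissible coordinates write $M$ in complex form as $w=\Theta(z,\bar z,\bar w)$. There is a unique germ $\Phi(z,w,\zeta)$, holomorphic at the origin of $\mathbb C^3$ with $\Phi=O(\zeta^2)$, such that all functions $w(z)=\Theta(z,\chi,\tau)$, $\tau\neq0$ small, satisfy $w''=w\,\Phi(z,w,w'/w)$.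 Let $\alpha_j,\beta_j,\gamma_j$ be the Taylor coefficients of $z^jw^0\zeta^2$, $z^jw^0\zeta^3$, $z^jw^0\zeta^4$ in $\Phi$. The point $p$ is non-resonant for $M$ if, in admissible coordinates, the $8\times8$ matrix $$\begin{pmatrix}0&I\\ A&I+B\end{pmatrix},\quad A=\begin{pmatrix}0&3\beta_0&\alpha_1&0\\0&-\beta_1&-\frac23\alpha_2&-\frac13\alpha_1\\0&-4\gamma_0&-\beta_1&\beta_0\\0&-2\beta_0(\alpha_0-1)-4\gamma_1&-2\beta_2&0\end{pmatrix},\quad B=\begin{pmatrix}\alpha_0-2&0&0&2\\-\frac13\alpha_1&\alpha_0-2&0&0\\-2\beta_0&0&-\alpha_0&0\\-2\beta_1&0&-\alpha_1&-\alpha_0\end{pmatrix}$$ has no positive integer eigenvalue. (This matrix is the linear part at the origin of the Briot–Bouquet system satisfied by the Cauchy data at $z=0$ of a normalizing transformation of the equation; the condition does not depend on the choice of admissible coordinates.) Theorem. If $p$ is a non-resonant point for $M$, then there exists a biholomorphic map germ $H:(\mathbb C^2,p)\to(\mathbb C^2,0)$ bringing $M$ into normal form. The normalizing map is uniquely determined,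 up to a dilation $(z,w)\mapsto(z,\mu w)$ with $\mu\in\mathbb R\setminus\{0\}$, by the restriction of $dH|_p$ to $T^{1,0}_pM$: if $H_1,H_2$ are two normalizing maps whose differentials at $p$ agree on $T^{1,0}_pM$, then $H_2=(z,\mu w)\circ H_1$ near $p$ for some $\mu\in\mathbb R\setminus\{0\}$. In particular, $H$ is uniquely determined by its full differential $dH|_p$. -/

import Mathlib

open Filter Topology Complex ComplexConjugate

noncomputable section

/-! ### Local biholomorphisms and real hypersurfaces -/

/-- `H` is (a representative of the germ of) a biholomorphic map `(ℂ², p) → (ℂ², 0)`. -/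
structure IsLocalBiholomorphism (H : ℂ × ℂ → ℂ × ℂ) (p : ℂ × ℂ) : Prop where
  analyticAt : AnalyticAt ℂ H p
  map_base : H p = 0
  isInvertible : (fderiv ℂ H p).IsInvertible

/-- `ρ` is a real-analytic local defining function, with nonzero differential, of `M` at `p`. -/
structure IsDefiningFunctionAt (ρ : ℂ × ℂ → ℝ) (M : Set (ℂ × ℂ)) (p : ℂ × ℂ) : Prop where
  analyticAt : AnalyticAt ℝ ρ p
  fderiv_ne : fderiv ℝ ρ p ≠ 0
  mem_iff : ∀ᶠ q in 𝓝 p, q ∈ M ↔ ρ q = 0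

/-- Near its point `p`, the set `M` is a (smooth) real-analytic hypersurface in `ℂ²`. -/
def IsRealAnalyticHypersurfaceAt (M : Set (ℂ × ℂ)) (p : ℂ × ℂ) : Prop :=
  p ∈ M ∧ ∃ ρ, IsDefiningFunctionAt ρ M p

/-- The complex tangent space `T^{1,0}_p M = T_p M ∩ i T_p M`, as a complex subspace of `ℂ²`. -/
def holTangentSpace (M : Set (ℂ × ℂ)) (p : ℂ × ℂ) : Submodule ℂ (ℂ × ℂ) where
  carrier := {v | ∀ ρ, IsDefiningFunctionAt ρ M p →
    fderiv ℝ ρ p v = 0 ∧ fderiv ℝ ρ p (I • v) = 0}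
  zero_mem' := by
    intro ρ _
    simp
  add_mem' := by
    intro v w hv hw ρ hρ
    obtain ⟨h1, h2⟩ := hv ρ hρ
    obtain ⟨h3, h4⟩ := hw ρ hρ
    exact ⟨by rw [map_add, h1, h3, add_zero], by rw [smul_add, map_add, h2, h4, add_zero]⟩
  smul_mem' := by
    intro c v hv ρ hρ
    obtain ⟨h1, h2⟩ := hv ρ hρ
    have e1 : c • v = c.re • v + c.im • (I • v) := by
      rw [← Complex.coe_smul, ← Complex.coe_smul, smul_smul, ← add_smul, re_add_im]
    have e2 : I • (c • v) = c.re • (I • v) - c.im • v := by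
      rw [← Complex.coe_smul, ← Complex.coe_smul, smul_smul, smul_smul, ← sub_smul]
      congr 1
      apply Complex.ext <;> simp
    refine ⟨?_, ?_⟩
    · rw [e1, map_add, (fderiv ℝ ρ p).map_smul, (fderiv ℝ ρ p).map_smul, h1, h2, smul_zero,
        smul_zero, add_zero]
    · rw [e2, map_sub, (fderiv ℝ ρ p).map_smul c.re, (fderiv ℝ ρ p).map_smul c.im, h1, h2,
        smul_zero, smul_zero, sub_zero]

/-- The germ at `p` of the map `Z` takes `M` to the hypersurface `v = F(z, z̄, u)`,
where `w = u + iv` and `F` is a function of three complex variables `(z, χ, u)`. -/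
def MapsToGraph (M : Set (ℂ × ℂ)) (p : ℂ × ℂ) (Z : ℂ × ℂ → ℂ × ℂ) (F : ℂ × ℂ × ℂ → ℂ) : Prop :=
  ∀ᶠ q in 𝓝 p, q ∈ M ↔
    (((Z q).2.im : ℝ) : ℂ) = F ((Z q).1, conj (Z q).1, (((Z q).2.re : ℝ) : ℂ))

/-- The Taylor coefficient of `x ^ k * y ^ l` at the origin. -/
def taylorCoeff (f : ℂ → ℂ → ℂ) (k l : ℕ) : ℂ :=
  iteratedDeriv k (fun x => iteratedDeriv l (fun y => f x y) 0) 0 / (k.factorial * l.factorial)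

/-! ### Infinite type -/

/-- `Z` are normal coordinates for `M` at `p`, with defining equation `v = F(z, z̄, u)`. -/
structure IsNormalCoordinates (M : Set (ℂ × ℂ)) (p : ℂ × ℂ) (Z : ℂ × ℂ → ℂ × ℂ)
    (F : ℂ × ℂ × ℂ → ℂ) : Prop where
  biholomorphism : IsLocalBiholomorphism Z p
  analyticAt : AnalyticAt ℂ F 0
  left_zero : ∀ᶠ x : ℂ × ℂ in 𝓝 0, F (0, x.1, x.2) = 0
  right_zero : ∀ᶠ x : ℂ × ℂ in 𝓝 0, F (x.1, 0, x.2) = 0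
  real : ∀ᶠ x : ℂ × ℝ in 𝓝 0, (F (x.1, conj x.1, (x.2 : ℂ))).im = 0
  graph : MapsToGraph M p Z F

/-- `M` is of `m`-infinite type at `p`, and `p` is a generic infinite type point: in normal
coordinates `M` is given by `v = u ^ m * ψ(z, z̄, u)` with `ψ_{z z̄}(0, 0, 0) ≠ 0`. -/
def IsGenericInfiniteTypeAt (m : ℕ) (M : Set (ℂ × ℂ)) (p : ℂ × ℂ) : Prop :=
  1 ≤ m ∧ ∃ (Z : ℂ × ℂ → ℂ × ℂ) (F ψ : ℂ × ℂ × ℂ → ℂ),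
    IsNormalCoordinates M p Z F ∧ AnalyticAt ℂ ψ 0 ∧
      (∀ᶠ x : ℂ × ℂ × ℂ in 𝓝 0, F x = x.2.2 ^ m * ψ x) ∧
      taylorCoeff (fun z χ => ψ (z, χ, 0)) 1 1 ≠ 0

/-! ### Admissible coordinates (for `m = 1`) -/

/-- The coefficient `h_{kl}(u)` in the expansion of `h(z, χ, u)` in powers of `z` and `χ`. -/
def hCoeff (h : ℂ × ℂ × ℂ → ℂ) (k l : ℕ) (u : ℂ) : ℂ :=
  taylorCoeff (fun z χ => h (z, χ, u)) k l

/-- `h(z, z̄, u) = ε |z|² + ∑_{k, l ≥ 2} h_{kl}(u) z^k z̄^l` is a convergent real-valued power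
series, with `ε = ± 1`. -/
structure IsAdmissibleFunction (ε : ℝ) (h : ℂ × ℂ × ℂ → ℂ) : Prop where
  sign : ε = 1 ∨ ε = -1
  analyticAt : AnalyticAt ℂ h 0
  real : ∀ᶠ x : ℂ × ℝ in 𝓝 0, (h (x.1, conj x.1, (x.2 : ℂ))).im = 0
  coeff : ∀ᶠ u in 𝓝 (0 : ℂ), ∀ k l : ℕ, (k < 2 ∨ l < 2) →
    hCoeff h k l u = if k = 1 ∧ l = 1 then (ε : ℂ) else 0

/-- `Z` are admissible coordinates for the hypersurface `M` of `1`-infinite type at `p`, in which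
`M` is given by `v = (1/2) u (ε |z|² + ∑_{k, l ≥ 2} h_{kl}(u) z^k z̄^l)`. -/
structure IsAdmissibleCoordinates (M : Set (ℂ × ℂ)) (p : ℂ × ℂ) (Z : ℂ × ℂ → ℂ × ℂ)
    (ε : ℝ) (h : ℂ × ℂ × ℂ → ℂ) : Prop where
  biholomorphism : IsLocalBiholomorphism Z p
  admissible : IsAdmissibleFunction ε h
  graph : MapsToGraph M p Z (fun x => 1 / 2 * x.2.2 * h x)

/-! ### The associated singular differential equation and resonances -/

/-- `w = Θ(z, χ, τ)`, with `χ = z̄` and `τ = w̄`, is the complex form of the equation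
`v = (1/2) u h(z, z̄, u)`; so `z ↦ Θ(z, χ, τ)` parametrize the Segre varieties. -/
structure IsComplexDefiningFunction (h Θ : ℂ × ℂ × ℂ → ℂ) : Prop where
  analyticAt : AnalyticAt ℂ Θ 0
  map_zero : Θ 0 = 0
  eqn : ∀ᶠ x : ℂ × ℂ × ℂ in 𝓝 0,
    (Θ x - x.2.2) / (2 * I) =
      1 / 2 * ((Θ x + x.2.2) / 2) * h (x.1, x.2.1, (Θ x + x.2.2) / 2)

/-- `w'' = w Φ(z, w, w' / w)`, with `Φ` holomorphic at the origin and `Φ(z, w, ζ) = O(ζ²)`, is the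
differential equation satisfied by all the Segre varieties `w(z) = Θ(z, χ, τ)`, `τ ≠ 0`. -/
structure IsAssociatedODE (Θ Φ : ℂ × ℂ × ℂ → ℂ) : Prop where
  analyticAt : AnalyticAt ℂ Φ 0
  order_two : ∀ᶠ x : ℂ × ℂ in 𝓝 0,
    Φ (x.1, x.2, 0) = 0 ∧ deriv (fun ζ => Φ (x.1, x.2, ζ)) 0 = 0
  eqn : ∀ᶠ x : ℂ × ℂ × ℂ in 𝓝 0, x.2.2 ≠ 0 →
    iteratedDeriv 2 (fun z => Θ (z, x.2.1, x.2.2)) x.1 =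
      Θ x * Φ (x.1, Θ x, deriv (fun z => Θ (z, x.2.1, x.2.2)) x.1 / Θ x)

/-- The Taylor coefficient of `z ^ j * w ^ 0 * ζ ^ l` of `Φ(z, w, ζ)`. For `l = 2, 3, 4` these are
the numbers `α_j = A_j(0)`, `β_j = B_j(0)`, `γ_j = C_j(0)`. -/
def odeCoeff (Φ : ℂ × ℂ × ℂ → ℂ) (j l : ℕ) : ℂ :=
  taylorCoeff (fun z ζ => Φ (z, 0, ζ)) j l

/-- The matrix `∂T/∂H` at the origin of the system `w² H'' = T(w, H, w H')` for the Cauchy data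
`H = (g₀, g₁, f₀, f₁)` of a transformation
`z ↦ z + f₀(w) + f₁(w) z + ⋯`, `w ↦ w + w g₀(w) + w g₁(w) z + ⋯` into the equation
`w'' = w Φ(z, w, w' / w)` from one whose coefficients of `ζ², z ζ², ζ³, z ζ³` do not depend
on `w`. -/
def cauchyMatrixH (Φ : ℂ × ℂ × ℂ → ℂ) : Matrix (Fin 4) (Fin 4) ℂ :=
  let α := fun j => odeCoeff Φ j 2
  let β := fun j => odeCoeff Φ j 3
  let γ := fun j => odeCoeff Φ j 4
  !![0, 3 * β 0, α 1, 0;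
     0, -β 1, -(2 / 3) * α 2, -(1 / 3) * α 1;
     0, -4 * γ 0, -β 1, β 0;
     0, -(2 * β 0 * (α 0 - 1) + 4 * γ 1), -2 * β 2, 0]

/-- The matrix `∂T/∂G` at the origin, `G = w H'`, of the same system. -/
def cauchyMatrixG (Φ : ℂ × ℂ × ℂ → ℂ) : Matrix (Fin 4) (Fin 4) ℂ :=
  let α := fun j => odeCoeff Φ j 2
  let β := fun j => odeCoeff Φ j 3
  !![α 0 - 2, 0, 0, 2;
     -(1 / 3) * α 1, α 0 - 2, 0, 0;
     -2 * β 0, 0, -α 0, 0;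
     -2 * β 1, 0, -α 1, -α 0]

/-- The linearization matrix of the Briot-Bouquet system `w H' = G`, `w G' = G + T(w, H, G)`. -/
def principalMatrix (Φ : ℂ × ℂ × ℂ → ℂ) : Matrix (Fin 4 ⊕ Fin 4) (Fin 4 ⊕ Fin 4) ℂ :=
  Matrix.fromBlocks 0 1 (cauchyMatrixH Φ) (1 + cauchyMatrixG Φ)

/-- The equation `w'' = w Φ(z, w, w' / w)` is non-resonant: its principal matrix has no positive
integer eigenvalues. -/
def IsNonResonantODE (Φ : ℂ × ℂ × ℂ → ℂ) : Prop :=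
  ∀ k : ℕ, 1 ≤ k → ¬ Module.End.HasEigenvalue (Matrix.toLin' (principalMatrix Φ)) (k : ℂ)

/-- `p` is a non-resonant point for `M`: in admissible coordinates the differential equation
associated with `M` is non-resonant. -/
def IsNonResonantAt (M : Set (ℂ × ℂ)) (p : ℂ × ℂ) : Prop :=
  ∀ (Z : ℂ × ℂ → ℂ × ℂ) (ε : ℝ) (h Θ Φ : ℂ × ℂ × ℂ → ℂ),
    IsAdmissibleCoordinates M p Z ε h → IsComplexDefiningFunction h Θ → IsAssociatedODE Θ Φ →
      IsNonResonantODE Φ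

/-! ### The normal form -/

/-- The normal form conditions on `h` for `m = 1`: the coefficients `h₂₂`, `h₂₃`, `h₃₂` and `h₃₃`
are constant. -/
def IsInNormalForm (h : ℂ × ℂ × ℂ → ℂ) : Prop :=
  ∀ᶠ u in 𝓝 (0 : ℂ), hCoeff h 2 2 u = hCoeff h 2 2 0 ∧ hCoeff h 2 3 u = hCoeff h 2 3 0 ∧
    hCoeff h 3 2 u = hCoeff h 3 2 0 ∧ hCoeff h 3 3 u = hCoeff h 3 3 0

/-- The germ at `p` of `H` is a biholomorphic map `(ℂ², p) → (ℂ², 0)` bringing `M` into normal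
form. -/
def IsNormalizing (M : Set (ℂ × ℂ)) (p : ℂ × ℂ) (H : ℂ × ℂ → ℂ × ℂ) : Prop :=
  ∃ (ε : ℝ) (h : ℂ × ℂ × ℂ → ℂ), IsAdmissibleCoordinates M p H ε h ∧ IsInNormalForm h

end

-- Complexified, the hypersurface `v = u h / 2` reads `w = τ e ^ Λ(z, χ, τ)`, so in the variable `y
-- = log w` its Segre varieties are the curves `y = log τ + Λ(z, χ, τ)`. They solve an equation `y''
-- = Ψ(z, e ^ y, y')` with `Ψ = Φ - ζ²`. Admissibility means that `Λ` vanishes for `z = 0` and for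
-- `χ = 0`, that `Λ_z = c χ` on `z = 0` and that `Λ_χ = c z` on `χ = 0`, where `c = i ε`. Hence the
-- Segre varieties cross `z = 0` with slope `c χ`, and the normal form condition says that the
-- coefficients of `χ²` and `χ³` in `Λ_zz` and `Λ_zzz` at `z = 0` do not depend on `τ`
-- (`LogForm.constantJet_iff`, `isInNormalForm_iff`).
--
-- The relevant coordinate changes are `(z, w) ↦ (f, w e ^ γ)`. On the complexified hypersurface
-- such a map has a companion `(f', τ e ^ γ')` acting on `(χ, τ)`, treated as independent until
-- reality is needed. Under the change the equation transforms by an explicit rule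
-- (`TransformationPair.pullback_eq`). At `z = 0` the orders `ζ⁰` and `ζ¹` of this rule express
-- `f_zz` and `γ_zz` through the Cauchy data `(γ, γ_z, f, f_z - 1)` at `z = 0`. The orders `ζ²` and
-- `ζ³`, together with their `z`-derivatives, then turn the normal form condition into four
-- equations `sys = 0` for the Cauchy data, of second order in the Euler operator `w d/dw`
-- (`constantJet_iff`). The linear part of this system is encoded by the matrix in the definition of
-- non-resonance, so Briot–Bouquet theory (`briotBouquet_second_order`) gives exactly one analytic
-- solution vanishing at the origin (`exists_cauchyData`).
--
-- For existence, admissible coordinates come from straightening the coefficient of `χ` in `h`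
-- (`exists_isAdmissibleCoordinates`). Any Cauchy data extend to a transformation whose source is
-- again admissible (`exists_initialRelations`, `InitialRelations.logAdmissible`); applied to the
-- solution of `sys = 0` this yields a source in normal form. Reality is a consequence of
-- uniqueness: conjugation turns the transformation into another normalizing one with the same
-- target, so both have the same Cauchy data, and the Cauchy data determine the companion
-- (`TransformationPair.companion_unique`). Thus the companion is the conjugate of the map
-- (`exists_normalization`).
--
-- For uniqueness, the transition map between two normalizing maps has second component `μ w e ^ γ`
-- with `μ` real (`exists_snd_eq_mul_exp`). After removing the dilation, agreement of the
-- differentials on the complex tangent space gives `f_z(0) = 1`. The Cauchy data of the transition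
-- map and of the identity then solve the same system, so they coincide, and the map is the identity
-- (`TransformationGerms.eventuallyEq_id`).

attribute [fun_prop] analyticAt_fst analyticAt_snd

namespace InfiniteType

/-! ### Directional derivatives, the implicit function theorem and conjugation of analytic germs -/

section Calculus

variable {E F : Type*} [NormedAddCommGroup E] [NormedSpace ℂ E]
  [NormedAddCommGroup F] [NormedSpace ℂ F]

/-- The derivative of `F` in the direction `v`. -/
noncomputable def pd (v : E) (G : E → F) (x : E) : F := fderiv ℂ G x v

@[fun_prop]
lemma analyticAt_pd [CompleteSpace F] {G : E → F} {x : E} (v : E) (h : AnalyticAt ℂ G x) :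
    AnalyticAt ℂ (pd v G) x := by
  exact ((ContinuousLinearMap.apply ℂ F v).analyticAt _).comp h.fderiv

lemma pd_congr {G G' : E → F} {x : E} (v : E) (h : G =ᶠ[𝓝 x] G') : pd v G x = pd v G' x := by
  simp only [pd, h.fderiv_eq]

lemma pd_eventuallyEq {G G' : E → F} {x : E} (v : E) (h : G =ᶠ[𝓝 x] G') :
    pd v G =ᶠ[𝓝 x] pd v G' := by
  filter_upwards [h.eventuallyEq_nhds] with y hy using pd_congr v hy

lemma pd_comm [CompleteSpace F] {G : E → F} {x : E} (h : AnalyticAt ℂ G x) (v w : E) :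
    pd v (pd w G) x = pd w (pd v G) x := by
  have hs : IsSymmSndFDerivAt ℂ G x :=
    (h.contDiffAt (n := 2)).isSymmSndFDerivAt (by simp)
  have key : ∀ a b : E, pd a (pd b G) x = fderiv ℂ (fderiv ℂ G) x a b := by
    intro a b
    have : HasFDerivAt (fun y => fderiv ℂ G y b)
        ((fderiv ℂ (fderiv ℂ G) x).flip b) x := by
      have := h.fderiv.differentiableAt.hasFDerivAt.clm_apply (hasFDerivAt_const b x)
      simpa using this
    have h2 : fderiv ℂ (pd b G) x = (fderiv ℂ (fderiv ℂ G) x).flip b := this.fderiv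
    rw [pd, h2]; rfl
  rw [key, key, hs v w]

lemma hasDerivAt_comp_pd {G : E → F} {c : ℂ → E} {c' : E} {t : ℂ}
    (hG : DifferentiableAt ℂ G (c t)) (hc : HasDerivAt c c' t) :
    HasDerivAt (fun s => G (c s)) (pd c' G (c t)) t :=
  hG.hasFDerivAt.comp_hasDerivAt t hc

lemma pd_add (G : E → F) (x v w : E) : pd (v + w) G x = pd v G x + pd w G x := by simp [pd]
lemma pd_smul (G : E → F) (x v : E) (c : ℂ) : pd (c • v) G x = c • pd v G x := by simp [pd]
lemma pd_zero (G : E → F) (x : E) : pd 0 G x = 0 := by simp [pd]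

lemma pd_pair (G : ℂ × ℂ → F) (x : ℂ × ℂ) (a b : ℂ) :
    pd (a, b) G x = a • pd (1, 0) G x + b • pd (0, 1) G x := by
  rw [← pd_smul, ← pd_smul, ← pd_add]; simp

lemma pd_triple (G : ℂ × ℂ × ℂ → F) (x : ℂ × ℂ × ℂ) (a b c : ℂ) :
    pd (a, b, c) G x
      = a • pd (1, 0, 0) G x + b • pd (0, 1, 0) G x + c • pd (0, 0, 1) G x := by
  rw [← pd_smul, ← pd_smul, ← pd_smul, ← pd_add, ← pd_add]; simp

lemma hasDerivAt_comp₂ {G : ℂ × ℂ → ℂ} {a b : ℂ → ℂ} {a' b' t : ℂ}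
    (hG : DifferentiableAt ℂ G (a t, b t)) (ha : HasDerivAt a a' t) (hb : HasDerivAt b b' t) :
    HasDerivAt (fun s => G (a s, b s))
      (a' * pd (1, 0) G (a t, b t) + b' * pd (0, 1) G (a t, b t)) t := by
  have := hasDerivAt_comp_pd (G := G) (c := fun s => (a s, b s)) hG (ha.prodMk hb)
  rw [pd_pair] at this
  simpa only [smul_eq_mul] using this

lemma hasDerivAt_comp₃ {G : ℂ × ℂ × ℂ → ℂ} {a b c : ℂ → ℂ} {a' b' c' t : ℂ}
    (hG : DifferentiableAt ℂ G (a t, b t, c t)) (ha : HasDerivAt a a' t)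
    (hb : HasDerivAt b b' t) (hc : HasDerivAt c c' t) :
    HasDerivAt (fun s => G (a s, b s, c s))
      (a' * pd (1, 0, 0) G (a t, b t, c t) + b' * pd (0, 1, 0) G (a t, b t, c t)
        + c' * pd (0, 0, 1) G (a t, b t, c t)) t := by
  have := hasDerivAt_comp_pd (G := G) (c := fun s => (a s, b s, c s)) hG
    (ha.prodMk (hb.prodMk hc))
  rw [pd_triple] at this
  simpa only [smul_eq_mul] using this

lemma _root_.AnalyticAt.comp_at {E' : Type*} [NormedAddCommGroup E'] [NormedSpace ℂ E']
    {G : E → F} {g : E' → E} {x : E'} {y : E} (hG : AnalyticAt ℂ G y)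
    (hg : AnalyticAt ℂ g x) (h : g x = y) : AnalyticAt ℂ (fun s => G (g s)) x :=
  hG.fun_comp_of_eq hg h

lemma tendsto_of_analyticAt {G : E → F} {x : E} {y : F} (hG : AnalyticAt ℂ G x) (h : G x = y) :
    Tendsto G (𝓝 x) (𝓝 y) := h ▸ hG.continuousAt.tendsto

/-- Implicit function theorem for analytic functions, for an unknown in finite dimension. -/
lemma exists_implicit [CompleteSpace E] [FiniteDimensional ℂ F] {G : E × F → F} {a : E} {b : F}
    (hG : AnalyticAt ℂ G (a, b)) (h0 : G (a, b) = 0)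
    (hinj : ∀ v, pd (0, v) G (a, b) = 0 → v = 0) :
    ∃ φ : E → F, AnalyticAt ℂ φ a ∧ φ a = b ∧ (∀ᶠ x in 𝓝 a, G (x, φ x) = 0) ∧
      ∀ᶠ p in 𝓝 (a, b), G p = 0 → p.2 = φ p.1 := by
  have : CompleteSpace F := FiniteDimensional.complete ℂ F
  have hc : ContDiffAt ℂ ⊤ G (a, b) := hG.contDiffAt
  have hinv : (fderiv ℂ G (a, b) ∘L .inr ℂ E F).IsInvertible := by
    set L : F →L[ℂ] F := fderiv ℂ G (a, b) ∘L .inr ℂ E F with hL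
    have hi : Function.Injective L.toLinearMap := by
      rw [← LinearMap.ker_eq_bot, LinearMap.ker_eq_bot']
      intro v hv
      exact hinj v hv
    refine ⟨(LinearEquiv.ofInjectiveEndo L.toLinearMap hi).toContinuousLinearEquiv, ?_⟩
    ext v; rfl
  refine ⟨hc.implicitFunction (by simp) hinv, (hc.contDiffAt_implicitFunction _ hinv).analyticAt,
    hc.implicitFunction_apply_self _ hinv, ?_, ?_⟩
  · simpa [h0] using hc.eventually_apply_implicitFunction (by simp) hinv
  · filter_upwards [hc.eventually_apply_eq_iff_implicitFunction (by simp) hinv] with p hp h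
    exact (hp.1 (h.trans h0.symm)).symm

/-- If `G` is analytic, then so is `conj ∘ G ∘ conj`. -/
lemma analyticAt_conj_conj (σ : E ≃ₗᵢ⋆[ℂ] E) {G : E → ℂ} {x : E} (hG : AnalyticAt ℂ G (σ x)) :
    AnalyticAt ℂ (fun y => conj (G (σ y))) x := by
  obtain ⟨p, r, hp⟩ := hG
  -- Conjugating both the value and the arguments of each term keeps it complex multilinear, since
  -- the two antilinearities cancel.
  let q : FormalMultilinearSeries ℂ E ℂ := fun n =>
    MultilinearMap.mkContinuous
      { toFun := fun v => conj (p n (fun i => σ (v i)))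
        map_update_add' := by
          intro _ m i a b
          have h : ∀ c : E, (fun j => σ (Function.update m i c j))
              = Function.update (fun j => σ (m j)) i (σ c) := by
            intro c; ext j; by_cases hj : j = i
            · subst hj; simp
            · simp [hj]
          simp only [h, map_add, ContinuousMultilinearMap.map_update_add]
        map_update_smul' := by
          intro _ m i c a
          have h : ∀ c : E, (fun j => σ (Function.update m i c j))
              = Function.update (fun j => σ (m j)) i (σ c) := by
            intro c; ext j; by_cases hj : j = i
            · subst hj; simp
            · simp [hj]
          have h' : σ (c • a) = conj c • σ a := σ.map_smulₛₗ c a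
          simp [h, h'] } ‖p n‖ (by
          intro v
          simp only [MultilinearMap.coe_mk, RCLike.norm_conj]
          refine ((p n).le_opNorm _).trans ?_
          simp)
  refine ⟨q, r, ⟨hp.r_le.trans (FormalMultilinearSeries.radius_le_of_le fun n =>
    MultilinearMap.mkContinuous_norm_le _ (norm_nonneg _) _), hp.r_pos, ?_⟩⟩
  intro y hy
  have hy' : σ y ∈ Metric.eball (0 : E) r := by
    simpa [Metric.mem_eball, edist_zero_right, enorm_eq_nnnorm] using hy
  have := hp.hasSum hy'
  rw [← map_add] at this
  exact (hasSum_conj'.2 this)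

/-- `v ↦ (conj v.1, conj v.2)` -/
noncomputable def conjPair : ℂ × ℂ ≃ₗᵢ⋆[ℂ] ℂ × ℂ := starₗᵢ ℂ
noncomputable def conjTriple : ℂ × ℂ × ℂ ≃ₗᵢ⋆[ℂ] ℂ × ℂ × ℂ := starₗᵢ ℂ

end Calculus

/-! ### Identity theorems on totally real sets -/

section RealPoints

/-- The real points `(r / 2) / (n + 1)` accumulate at the centre of the ball, which is connected. -/
lemma eqOn_ball_of_real {g : ℂ → ℂ} {r : ℝ} (hr : 0 < r)
    (hg : ∀ z ∈ Metric.ball (0 : ℂ) r, AnalyticAt ℂ g z)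
    (h : ∀ t : ℝ, |t| < r → g t = 0) : ∀ z ∈ Metric.ball (0 : ℂ) r, g z = 0 := by
  have h1 : AnalyticOnNhd ℂ g (Metric.ball 0 r) := hg
  refine h1.eqOn_zero_of_preconnected_of_frequently_eq_zero
    (convex_ball _ _).isPreconnected (Metric.mem_ball_self hr) ?_
  have ht : Tendsto (fun n : ℕ => (((r / 2) / ((n : ℝ) + 1) : ℝ) : ℂ)) atTop (𝓝[≠] 0) := by
    rw [tendsto_nhdsWithin_iff]
    constructor
    · have h2 : Tendsto (fun n : ℕ => (r / 2) / ((n : ℝ) + 1)) atTop (𝓝 0) :=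
        tendsto_const_nhds.div_atTop
          (tendsto_atTop_add_const_right _ _ tendsto_natCast_atTop_atTop)
      exact_mod_cast (continuous_ofReal.tendsto 0).comp h2
    · refine Eventually.of_forall fun n => ?_
      have : (r / 2) / ((n : ℝ) + 1) ≠ 0 := by positivity
      simpa only [Set.mem_compl_iff, Set.mem_singleton_iff, ofReal_eq_zero] using this
  refine ht.frequently (Eventually.frequently (Eventually.of_forall fun n => ?_))
  apply h
  rw [abs_of_pos (by positivity), div_lt_iff₀ (by positivity)]
  have : (0 : ℝ) ≤ n := n.cast_nonneg
  nlinarith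

/-- An analytic function vanishing at real points vanishes. -/
lemma eventually_eq_zero_of_real {G : ℂ × ℂ × ℂ → ℂ} (hG : AnalyticAt ℂ G 0)
    (h : ∀ᶠ x : ℝ × ℝ × ℝ in 𝓝 0, G (x.1, x.2.1, x.2.2) = 0) : ∀ᶠ x in 𝓝 0, G x = 0 := by
  obtain ⟨r₁, hr₁, h1⟩ := Metric.eventually_nhds_iff_ball.1 hG.eventually_analyticAt
  obtain ⟨r₂, hr₂, h2⟩ := Metric.eventually_nhds_iff_ball.1 h
  set r := min r₁ r₂
  have hr : 0 < r := lt_min hr₁ hr₂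
  have hA : ∀ x y z : ℂ, ‖x‖ < r → ‖y‖ < r → ‖z‖ < r → AnalyticAt ℂ G (x, y, z) := by
    intro x y z hx hy hz
    apply h1
    simp only [mem_ball_zero_iff, Prod.norm_def, max_lt_iff]
    exact ⟨hx.trans_le (min_le_left _ _), hy.trans_le (min_le_left _ _),
      hz.trans_le (min_le_left _ _)⟩
  have hR : ∀ x y z : ℝ, |x| < r → |y| < r → |z| < r → G (x, y, z) = 0 := by
    intro x y z hx hy hz
    apply h2 (x, y, z)
    simp only [mem_ball_zero_iff, Prod.norm_def, max_lt_iff, Real.norm_eq_abs]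
    exact ⟨hx.trans_le (min_le_right _ _), hy.trans_le (min_le_right _ _),
      hz.trans_le (min_le_right _ _)⟩
  -- The variables are freed one at a time, on a polydisc of fixed radius.
  have s1 : ∀ x y : ℝ, ∀ z : ℂ, |x| < r → |y| < r → ‖z‖ < r → G (x, y, z) = 0 := by
    intro x y z hx hy hz
    refine eqOn_ball_of_real (g := fun t => G (x, y, t)) hr (fun t ht => ?_)
      (fun t ht => hR x y t hx hy ht) z (by simpa using hz)
    exact (hA x y t (by simpa using hx) (by simpa using hy) (by simpa using ht)).comp_at
      (by fun_prop) rfl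
  have s2 : ∀ x : ℝ, ∀ y z : ℂ, |x| < r → ‖y‖ < r → ‖z‖ < r → G (x, y, z) = 0 := by
    intro x y z hx hy hz
    refine eqOn_ball_of_real (g := fun t => G (x, t, z)) hr (fun t ht => ?_)
      (fun t ht => s1 x t z hx ht hz) y (by simpa using hy)
    exact (hA x t z (by simpa using hx) (by simpa using ht) hz).comp_at (by fun_prop) rfl
  refine Metric.eventually_nhds_iff_ball.2 ⟨r, hr, fun p hp => ?_⟩
  simp only [mem_ball_zero_iff, Prod.norm_def, max_lt_iff] at hp
  exact eqOn_ball_of_real (g := fun t => G (t, p.2.1, p.2.2)) hr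
      (fun t ht => (hA t p.2.1 p.2.2 (by simpa using ht) hp.2.1 hp.2.2).comp_at
        (by fun_prop) rfl)
      (fun t ht => s2 t _ _ ht hp.2.1 hp.2.2) p.1 (by simpa using hp.1)

/-- An analytic function of `(z, χ, u)` vanishing at the points with `χ = conj z` and `u` real
vanishes. -/
lemma eventually_eq_zero_of_conj {G : ℂ × ℂ × ℂ → ℂ} (hG : AnalyticAt ℂ G 0)
    (h : ∀ᶠ x : ℂ × ℝ in 𝓝 0, G (x.1, conj x.1, x.2) = 0) : ∀ᶠ x in 𝓝 0, G x = 0 := by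
  -- With `z = x + i y` and `χ = x - i y`, the points `χ = conj z` are those with real `x` and `y`.
  have key : ∀ᶠ x in 𝓝 (0 : ℂ × ℂ × ℂ), G (x.1 + I * x.2.1, x.1 - I * x.2.1, x.2.2) = 0 := by
    refine eventually_eq_zero_of_real
      (G := fun x => G (x.1 + I * x.2.1, x.1 - I * x.2.1, x.2.2)) ?_ ?_
    · exact AnalyticAt.comp_at (y := 0) hG (by fun_prop) (by simp)
    · have hc : Tendsto (fun x : ℝ × ℝ × ℝ => (((x.1 : ℂ) + I * x.2.1, x.2.2) : ℂ × ℝ))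
          (𝓝 0) (𝓝 0) := by
        have : Continuous (fun x : ℝ × ℝ × ℝ => (((x.1 : ℂ) + I * x.2.1, x.2.2) : ℂ × ℝ)) := by
          fun_prop
        simpa [Prod.zero_eq_mk] using this.tendsto 0
      filter_upwards [hc.eventually h] with x hx
      simpa [sub_eq_add_neg] using hx
  have hc : Tendsto (fun x : ℂ × ℂ × ℂ =>
      ((x.1 + x.2.1) / 2, (x.1 - x.2.1) / (2 * I), x.2.2)) (𝓝 0) (𝓝 0) := by
    refine tendsto_of_analyticAt (by fun_prop (disch := simp [I_ne_zero])) (by simp)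
  filter_upwards [hc.eventually key] with x hx
  rw [← hx]
  congr 1
  have hI : I ≠ 0 := I_ne_zero
  ext <;> simp <;> field_simp <;> ring

end RealPoints

/-! ### The Briot–Bouquet theorem for first order systems -/

section BriotBouquet

variable {E : Type*} [NormedAddCommGroup E] [NormedSpace ℂ E]

/-- Integrating a bound `K |w| ^ (N - 1)` on the derivative along the segment from `0` gains the
factor `1 / N`. This gain makes the Picard iteration below contract. -/
lemma norm_le_of_norm_smul_deriv_le {v : ℂ → E} [CompleteSpace E] {R K : ℝ} {N : ℕ}
    (hv : DifferentiableOn ℂ v (Metric.ball 0 R)) (hv0 : v 0 = 0) (hN : 1 ≤ N)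
    (h : ∀ w ∈ Metric.ball (0 : ℂ) R, ‖w • deriv v w‖ ≤ K * ‖w‖ ^ N) :
    ∀ w ∈ Metric.ball (0 : ℂ) R, ‖v w‖ ≤ K / N * ‖w‖ ^ N := by
  intro w hw
  have hR : 0 < R := lt_of_le_of_lt (norm_nonneg w) (by simpa using hw)
  have hN' : (N : ℝ) ≠ 0 := by positivity
  have hd : ∀ z ∈ Metric.ball (0 : ℂ) R, ‖deriv v z‖ ≤ K * ‖z‖ ^ (N - 1) := by
    have h1 : ∀ z ∈ Metric.ball (0 : ℂ) R, z ≠ 0 → ‖deriv v z‖ ≤ K * ‖z‖ ^ (N - 1) := by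
      intro z hz hz0
      have := h z hz
      rw [norm_smul] at this
      have hz' : 0 < ‖z‖ := norm_pos_iff.2 hz0
      refine le_of_mul_le_mul_left (this.trans_eq ?_) hz'
      obtain ⟨k, rfl⟩ := Nat.exists_eq_add_of_le hN
      simp [pow_add]; ring
    intro z hz
    -- Dividing by `‖z‖` is impossible at the origin; there the bound follows by continuity.
    by_cases hz0 : z = 0
    · subst hz0
      have hc : ContinuousAt (deriv v) 0 :=
        ((hv.analyticAt (Metric.ball_mem_nhds 0 hR)).deriv).continuousAt
      have e1 : Tendsto (fun z => ‖deriv v z‖) (𝓝[≠] 0) (𝓝 ‖deriv v 0‖) :=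
        (hc.norm.tendsto).mono_left nhdsWithin_le_nhds
      have e2 : Tendsto (fun z : ℂ => K * ‖z‖ ^ (N - 1)) (𝓝[≠] 0) (𝓝 (K * ‖(0 : ℂ)‖ ^ (N - 1))) := by
        refine Tendsto.mono_left ?_ nhdsWithin_le_nhds
        exact (by fun_prop : Continuous (fun z : ℂ => K * ‖z‖ ^ (N - 1))).tendsto 0
      refine le_of_tendsto_of_tendsto e1 e2 ?_
      filter_upwards [self_mem_nhdsWithin, mem_nhdsWithin_of_mem_nhds (Metric.ball_mem_nhds 0 hR)]
        with z hz hz' using h1 z hz' hz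
    · exact h1 z hz hz0
  have hmem : ∀ s ∈ Set.Icc (0 : ℝ) 1, (s : ℂ) * w ∈ Metric.ball (0 : ℂ) R := by
    intro s hs
    have hw' : ‖w‖ < R := by simpa using hw
    simp only [mem_ball_zero_iff, norm_mul, norm_real, Real.norm_eq_abs, abs_of_nonneg hs.1]
    nlinarith [norm_nonneg w, hs.2]
  have hder : ∀ s ∈ Set.Icc (0 : ℝ) 1,
      HasDerivAt (fun s : ℝ => v (s * w)) (w • deriv v (s * w)) s := by
    intro s hs
    have h1 : HasDerivAt v (deriv v (s * w)) (s * w) :=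
      (hv.differentiableAt (Metric.isOpen_ball.mem_nhds (hmem s hs))).hasDerivAt
    have h2 : HasDerivAt (fun s : ℝ => (s : ℂ) * w) w s := by
      simpa using (ofRealCLM.hasDerivAt (x := s)).mul_const w
    exact h1.scomp s h2
  have := image_norm_le_of_norm_deriv_right_le_deriv_boundary (E := E) (a := 0) (b := 1)
    (f := fun s : ℝ => v (s * w)) (f' := fun s => w • deriv v (s * w))
    (B := fun s => K / N * ‖w‖ ^ N * s ^ N) (B' := fun s => K * ‖w‖ ^ N * s ^ (N - 1))
    (fun s hs => (hder s hs).continuousAt.continuousWithinAt)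
    (fun s hs => (hder s ⟨hs.1, hs.2.le⟩).hasDerivWithinAt) (by rw [zero_pow (by omega)]; simp [hv0])
    (fun s => by
      convert! (hasDerivAt_pow N s).const_mul (K / N * ‖w‖ ^ N) using 1
      field_simp)
    (fun s hs => by
      rw [norm_smul]
      refine (mul_le_mul_of_nonneg_left (hd _ (hmem s ⟨hs.1, hs.2.le⟩)) (norm_nonneg w)).trans_eq ?_
      simp only [norm_mul, norm_real, Real.norm_eq_abs, abs_of_nonneg hs.1]
      obtain ⟨k, rfl⟩ := Nat.exists_eq_add_of_le hN
      simp [pow_add, mul_pow]; ring)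
    (x := 1) ⟨zero_le_one, le_rfl⟩
  simpa using this

/-- Because `g 0 = 0`, the quotient `g w / w` extends holomorphically and has a primitive on the
disc. -/
lemma exists_smul_deriv_eq [CompleteSpace E] {g : ℂ → E} {R : ℝ} (hR : 0 < R)
    (hg : DifferentiableOn ℂ g (Metric.ball 0 R)) (hg0 : g 0 = 0) :
    ∃ v : ℂ → E, DifferentiableOn ℂ v (Metric.ball 0 R) ∧ v 0 = 0 ∧
      ∀ w ∈ Metric.ball (0 : ℂ) R, w • deriv v w = g w := by
  have hq : DifferentiableOn ℂ (dslope g 0) (Metric.ball 0 R) :=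
    (Complex.differentiableOn_dslope (Metric.ball_mem_nhds 0 hR)).2 hg
  obtain ⟨v, hv, hv'⟩ := hq.isExactOn_ball.with_val_at 0 0
  refine ⟨v, fun z hz => (hv' z hz).differentiableAt.differentiableWithinAt, hv, fun w hw => ?_⟩
  rw [(hv' w hw).deriv]
  have := sub_smul_dslope g 0 w
  simpa [hg0] using this

/-- Picard iteration among holomorphic functions bounded by `C |w| ^ N`: given `v`, the next iterate
`u` solves `w u' = Q(w, v)`. The Lipschitz constant `M` of `Q` and the gain `1 / N` from integration
make the ratio `M / N < 1`. -/
lemma exists_solution_of_lipschitz [CompleteSpace E] {Q : ℂ × E → E} {R ρ M K : ℝ} {N : ℕ}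
    (hR : 0 < R) (hM : 0 ≤ M) (hMN : M < N) (hN : 1 ≤ N) (hK : 0 ≤ K)
    (hρ : K / (N - M) * R ^ N < ρ)
    (hQ : ∀ w ∈ Metric.ball (0 : ℂ) R, ∀ a ∈ Metric.ball (0 : E) ρ, DifferentiableAt ℂ Q (w, a))
    (hlip : ∀ w ∈ Metric.ball (0 : ℂ) R, ∀ a ∈ Metric.ball (0 : E) ρ, ∀ b ∈ Metric.ball (0 : E) ρ,
      ‖Q (w, a) - Q (w, b)‖ ≤ M * ‖a - b‖)
    (h0 : ∀ w ∈ Metric.ball (0 : ℂ) R, ‖Q (w, 0)‖ ≤ K * ‖w‖ ^ N) :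
    ∃ v : ℂ → E, DifferentiableOn ℂ v (Metric.ball 0 R) ∧ v 0 = 0 ∧
      ∀ w ∈ Metric.ball (0 : ℂ) R, w • deriv v w = Q (w, v w) := by
  set C := K / (N - M) with hC
  have hNM : (0 : ℝ) < N - M := by linarith
  have hC0 : 0 ≤ C := by positivity
  -- The constant `C` is chosen so that the bound `C |w| ^ N` reproduces itself under one iteration.
  have hCK : K + M * C = C * N := by rw [hC]; field_simp; ring
  have hN0 : (0 : ℝ) < N := by exact_mod_cast hN
  let A := {v : ℂ → E // DifferentiableOn ℂ v (Metric.ball 0 R) ∧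
    ∀ w ∈ Metric.ball (0 : ℂ) R, ‖v w‖ ≤ C * ‖w‖ ^ N}
  have hball : ∀ v : A, ∀ w ∈ Metric.ball (0 : ℂ) R, v.1 w ∈ Metric.ball (0 : E) ρ := by
    intro v w hw
    rw [mem_ball_zero_iff] at hw ⊢
    refine (v.2.2 w (by simpa using hw)).trans_lt (lt_of_le_of_lt ?_ hρ)
    gcongr
  have hstep : ∀ v : A, ∃ v' : A, v'.1 0 = 0 ∧
      ∀ w ∈ Metric.ball (0 : ℂ) R, w • deriv v'.1 w = Q (w, v.1 w) := by
    intro v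
    have hQd : DifferentiableOn ℂ (fun w => Q (w, v.1 w)) (Metric.ball 0 R) := by
      intro w hw
      have h1 := (v.2.1.differentiableAt (Metric.isOpen_ball.mem_nhds hw))
      exact ((hQ w hw _ (hball v w hw)).comp w
        (differentiableAt_id.prodMk h1)).differentiableWithinAt
    have hb : ∀ w ∈ Metric.ball (0 : ℂ) R, ‖Q (w, v.1 w)‖ ≤ (C * N) * ‖w‖ ^ N := by
      intro w hw
      have h1 := hlip w hw _ (hball v w hw) 0
        (Metric.mem_ball_self (lt_of_le_of_lt (by positivity) hρ))
      rw [sub_zero] at h1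
      calc ‖Q (w, v.1 w)‖ = ‖Q (w, 0) + (Q (w, v.1 w) - Q (w, 0))‖ := by congr 1; abel
        _ ≤ K * ‖w‖ ^ N + M * (C * ‖w‖ ^ N) :=
          (norm_add_le _ _).trans (add_le_add (h0 w hw)
            (h1.trans (mul_le_mul_of_nonneg_left (v.2.2 w hw) hM)))
        _ = _ := by rw [← hCK]; ring
    have hz : Q (0, v.1 0) = 0 := by
      have := hb 0 (Metric.mem_ball_self hR)
      have hN' : N ≠ 0 := by omega
      simpa [hN'] using this
    obtain ⟨u, hu, hu0, hu'⟩ := exists_smul_deriv_eq hR hQd hz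
    refine ⟨⟨u, hu, fun w hw => ?_⟩, hu0, hu'⟩
    have := norm_le_of_norm_smul_deriv_le (K := C * N) hu hu0 hN
      (fun w hw => by rw [hu' w hw]; exact hb w hw) w hw
    rwa [mul_div_cancel_right₀ _ hN0.ne'] at this
  choose step step0 hstep using hstep
  let v0 : A := ⟨0, differentiableOn_const 0, fun w _ => by simp; positivity⟩
  let vs : ℕ → A := fun n => step^[n] v0
  have hvs : ∀ n, vs (n + 1) = step (vs n) := fun n => Function.iterate_succ_apply' _ _ _
  set q := M / N with hq
  have hq1 : q < 1 := by rw [hq, div_lt_one hN0]; exact hMN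
  have hq0 : 0 ≤ q := by positivity
  have hdiff : ∀ n, ∀ w ∈ Metric.ball (0 : ℂ) R,
      ‖(vs (n + 1)).1 w - (vs n).1 w‖ ≤ C * q ^ n * ‖w‖ ^ N := by
    intro n
    induction n with
    | zero =>
      intro w hw
      have : (vs 0).1 w = 0 := rfl
      rw [this, sub_zero, pow_zero, mul_one]
      exact (vs 1).2.2 w hw
    | succ n ih =>
      intro w hw
      have e := norm_le_of_norm_smul_deriv_le (K := M * (C * q ^ n)) (N := N)
        (v := fun w => (vs (n + 2)).1 w - (vs (n + 1)).1 w)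
        ((vs (n + 2)).2.1.fun_sub (vs (n + 1)).2.1)
        (by simp [hvs, step0]) hN (fun w hw => by
          have d1 := ((vs (n + 2)).2.1.differentiableAt (Metric.isOpen_ball.mem_nhds hw))
          have d2 := ((vs (n + 1)).2.1.differentiableAt (Metric.isOpen_ball.mem_nhds hw))
          rw [deriv_fun_sub d1 d2, smul_sub, hvs (n + 1), hstep _ _ hw, hvs n, hstep _ _ hw, ← hvs n]
          refine (hlip w hw _ (hball _ w hw) _ (hball _ w hw)).trans ?_
          rw [mul_assoc M]
          exact mul_le_mul_of_nonneg_left (ih w hw) hM) w hw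
      refine e.trans_eq ?_
      rw [pow_succ, hq]; ring
  have hdist : ∀ n, ∀ w ∈ Metric.ball (0 : ℂ) R,
      dist ((vs n).1 w) ((vs (n + 1)).1 w) ≤ (C * R ^ N) * q ^ n := by
    intro n w hw
    rw [dist_comm, dist_eq_norm]
    refine (hdiff n w hw).trans ?_
    rw [mul_right_comm]
    have : ‖w‖ ≤ R := (mem_ball_zero_iff.1 hw).le
    gcongr
  have hlim : ∀ w, ∃ a, w ∈ Metric.ball (0 : ℂ) R → Tendsto (fun n => (vs n).1 w) atTop (𝓝 a) := by
    intro w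
    by_cases hw : w ∈ Metric.ball (0 : ℂ) R
    · obtain ⟨a, ha⟩ := cauchySeq_tendsto_of_complete
        (cauchySeq_of_le_geometric q _ hq1 (fun n => hdist n w hw))
      exact ⟨a, fun _ => ha⟩
    · exact ⟨0, fun h => absurd h hw⟩
  choose v hv using hlim
  have hunif : TendstoUniformlyOn (fun n => (vs n).1) v atTop (Metric.ball 0 R) := by
    rw [Metric.tendstoUniformlyOn_iff]
    intro ε hε
    have ht : Tendsto (fun n : ℕ => (C * R ^ N) * q ^ n / (1 - q)) atTop (𝓝 0) := by
      have := ((tendsto_pow_atTop_nhds_zero_of_lt_one hq0 hq1).const_mul (C * R ^ N)).div_const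
        (1 - q)
      simpa using this
    filter_upwards [ht.eventually (gt_mem_nhds hε)] with n hn w hw
    rw [dist_comm]
    exact (dist_le_of_le_geometric_of_tendsto q _ hq1 (fun n => hdist n w hw) (hv w hw) n).trans_lt
      hn
  have hloc := hunif.tendstoLocallyUniformlyOn
  have hdv := hloc.differentiableOn (Eventually.of_forall fun n => (vs n).2.1) Metric.isOpen_ball
  have hderiv := hloc.deriv (Eventually.of_forall fun n => (vs n).2.1) Metric.isOpen_ball
  have hvb : ∀ w ∈ Metric.ball (0 : ℂ) R, ‖v w‖ ≤ C * ‖w‖ ^ N := fun w hw =>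
    le_of_tendsto (hv w hw).norm (Eventually.of_forall fun n => (vs n).2.2 w hw)
  refine ⟨v, hdv, ?_, fun w hw => ?_⟩
  · have := hvb 0 (Metric.mem_ball_self hR)
    have hN' : N ≠ 0 := by omega
    simpa [hN'] using this
  · have t1 : Tendsto (fun n => w • deriv (vs (n + 1)).1 w) atTop (𝓝 (w • deriv v w)) :=
      ((hderiv.tendsto_at hw).comp (tendsto_add_atTop_nat 1)).const_smul w
    have hvρ : v w ∈ Metric.ball (0 : E) ρ := by
      rw [mem_ball_zero_iff]
      refine (hvb w hw).trans_lt (lt_of_le_of_lt ?_ hρ)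
      have : ‖w‖ ≤ R := (mem_ball_zero_iff.1 hw).le
      gcongr
    have t2 : Tendsto (fun n => Q (w, (vs n).1 w)) atTop (𝓝 (Q (w, v w))) := by
      have : ContinuousAt Q (w, v w) := (hQ w hw _ hvρ).continuousAt
      exact this.tendsto.comp (tendsto_const_nhds.prodMk_nhds (hv w hw))
    refine tendsto_nhds_unique t1 (t2.congr fun n => ?_)
    rw [hvs, hstep _ _ hw]

/-- If `r` vanished to order `k ≤ m` only, it would be `w ^ k g` with `g 0 ≠ 0`, which is not `o(w ^
m)`. -/
lemma exists_pow_smul_of_isLittleO [CompleteSpace E] {r : ℂ → E} (hr : AnalyticAt ℂ r 0) {m : ℕ}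
    (h : r =o[𝓝 0] fun w : ℂ => w ^ m) :
    ∃ e : ℂ → E, AnalyticAt ℂ e 0 ∧ ∀ᶠ w in 𝓝 0, r w = w ^ (m + 1) • e w := by
  have : ((m + 1 : ℕ) : ℕ∞) ≤ analyticOrderAt r 0 := by
    by_contra hlt
    rw [not_le] at hlt
    have hne : analyticOrderAt r 0 ≠ ⊤ := ne_top_of_lt hlt
    obtain ⟨k, hk⟩ := ENat.ne_top_iff_exists.1 hne
    rw [← hk] at hlt
    have hkm : k < m + 1 := by exact_mod_cast hlt
    obtain ⟨g, hg, hg0, hgr⟩ := (hr.analyticOrderAt_eq_natCast).1 hk.symm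
    have h1 : (fun w : ℂ => w ^ k • g w) =o[𝓝 0] fun w : ℂ => w ^ k := by
      refine Asymptotics.IsLittleO.trans_isBigO (h.congr' (hgr.mono fun w hw => by simpa using hw)
        (EventuallyEq.refl _ _)) ?_
      refine Asymptotics.IsBigO.of_bound 1 ?_
      filter_upwards [Metric.ball_mem_nhds (0 : ℂ) one_pos] with w hw
      rw [one_mul, norm_pow, norm_pow]
      exact pow_le_pow_of_le_one (norm_nonneg _) (mem_ball_zero_iff.1 hw).le (by omega)
    have h2 : Tendsto g (𝓝[≠] 0) (𝓝 0) := by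
      rw [← Asymptotics.isLittleO_one_iff ℂ]
      rw [Asymptotics.isLittleO_iff] at h1 ⊢
      intro c hc
      filter_upwards [mem_nhdsWithin_of_mem_nhds (h1 hc), self_mem_nhdsWithin] with w hw hw0
      have : 0 < ‖w‖ ^ k := pow_pos (norm_pos_iff.2 hw0) k
      simp only [norm_smul, norm_pow] at hw
      simp only [norm_one, mul_one]
      nlinarith
    exact hg0 (tendsto_nhds_unique (hg.continuousAt.tendsto.mono_left nhdsWithin_le_nhds) h2)
  obtain ⟨e, he, h⟩ := (natCast_le_analyticOrderAt hr).1 this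
  exact ⟨e, he, by simpa using h⟩

/-- Existence part of the Briot–Bouquet theorem. -/
theorem exists_briotBouquet [FiniteDimensional ℂ E] {𝓕 : ℂ × E → E} (h𝓕 : AnalyticAt ℂ 𝓕 0)
    (h0 : 𝓕 0 = 0) (hres : ∀ k : ℕ, 1 ≤ k → ∀ v, pd (0, v) 𝓕 0 = (k : ℂ) • v → v = 0) :
    ∃ y : ℂ → E, AnalyticAt ℂ y 0 ∧ y 0 = 0 ∧ ∀ᶠ w in 𝓝 0, w • deriv y w = 𝓕 (w, y w) := by
  have : CompleteSpace E := FiniteDimensional.complete ℂ E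
  have hstrict : HasStrictFDerivAt 𝓕 (fderiv ℂ 𝓕 0) 0 :=
    h𝓕.hasStrictFDerivAt
  -- The formal solution is built order by order, with a residual divisible by `w ^ (n + 1)`.
  have happrox : ∀ n : ℕ, ∃ P e : ℂ → E, AnalyticAt ℂ P 0 ∧ P 0 = 0 ∧ AnalyticAt ℂ e 0 ∧
      ∀ᶠ w in 𝓝 0, 𝓕 (w, P w) - w • deriv P w = w ^ (n + 1) • e w := by
    intro n
    induction n with
    | zero =>
      have ha : AnalyticAt ℂ (fun w : ℂ => 𝓕 (w, (0 : E))) 0 :=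
        AnalyticAt.comp_at (y := 0) h𝓕 (by fun_prop) rfl
      obtain ⟨e, he, he'⟩ := exists_pow_smul_of_isLittleO (m := 0) ha (by
        simp only [pow_zero]
        rw [Asymptotics.isLittleO_one_iff]
        exact tendsto_of_analyticAt ha h0)
      refine ⟨0, e, analyticAt_const, rfl, he, ?_⟩
      filter_upwards [he'] with w hw
      simpa using hw
    | succ n ih =>
      obtain ⟨P, e, hP, hP0, he, hPe⟩ := ih
      -- With `L` the linear part of `𝓕` in the unknown, adding `w ^ (n + 1) c` changes the residual
      -- to leading order by `w ^ (n + 1) (L c - (n + 1) c)`. Non-resonance makes `n + 1 - L`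
      -- invertible.
      obtain ⟨c, hc⟩ : ∃ c : E, ((n + 1 : ℕ) : ℂ) • c - pd (0, c) 𝓕 0 = e 0 := by
        let T : E →ₗ[ℂ] E :=
          ((n + 1 : ℕ) : ℂ) • LinearMap.id - (fderiv ℂ 𝓕 0 ∘L .inr ℂ ℂ E).toLinearMap
        have hT : Function.Injective T := by
          rw [← LinearMap.ker_eq_bot, LinearMap.ker_eq_bot']
          intro v hv
          refine hres (n + 1) (by omega) v ?_
          have : ((n + 1 : ℕ) : ℂ) • v - pd (0, v) 𝓕 0 = 0 := hv
          exact (sub_eq_zero.1 this).symm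
        exact (LinearMap.injective_iff_surjective.1 hT) (e 0)
      set P' : ℂ → E := fun w => P w + w ^ (n + 1) • c with hP'
      have hP'a : AnalyticAt ℂ P' 0 := by fun_prop
      have hP'0 : P' 0 = 0 := by simp [hP', hP0]
      have hra : AnalyticAt ℂ (fun w => 𝓕 (w, P' w) - w • deriv P' w) 0 := by
        have h1 : AnalyticAt ℂ (fun w => 𝓕 (w, P' w)) 0 :=
          AnalyticAt.comp_at (y := 0) h𝓕 (by fun_prop) (by simp [hP'0])
        exact h1.fun_sub (analyticAt_id.fun_smul hP'a.deriv)
      obtain ⟨e', he', hr⟩ := exists_pow_smul_of_isLittleO (m := n + 1) hra (by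
        have t1 : Tendsto (fun w : ℂ => (((w, P' w) : ℂ × E), ((w, P w) : ℂ × E)))
            (𝓝 0) (𝓝 (0, 0)) := by
          refine Tendsto.prodMk_nhds ?_ ?_
          · exact tendsto_of_analyticAt (by fun_prop) (by simp [hP'0])
          · exact tendsto_of_analyticAt (by fun_prop) (by simp [hP0])
        have h1 := (hstrict.isLittleO).comp_tendsto t1
        have h2 : (fun w : ℂ => 𝓕 (w, P' w) - 𝓕 (w, P w) - w ^ (n + 1) • pd (0, c) 𝓕 0)
            =o[𝓝 0] fun w : ℂ => w ^ (n + 1) := by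
          refine (h1.congr_left fun w => ?_).trans_isBigO ?_
          · simp only [Function.comp, Prod.mk_sub_mk, sub_self, hP', add_sub_cancel_left]
            congr 1
            rw [← pd_smul]; simp [pd]
          · refine Asymptotics.IsBigO.of_bound ‖c‖ (Eventually.of_forall fun w => ?_)
            simp [hP', Prod.norm_def, norm_smul, mul_comm]
            positivity
        have h3 : (fun w : ℂ => w ^ (n + 1) • (e w - e 0)) =o[𝓝 0] fun w : ℂ => w ^ (n + 1) := by
          have : (fun w => e w - e 0) =o[𝓝 0] fun _ : ℂ => (1 : ℂ) := by
            rw [Asymptotics.isLittleO_one_iff]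
            exact tendsto_of_analyticAt (by fun_prop) (by simp)
          simpa using (Asymptotics.isBigO_refl (fun w : ℂ => w ^ (n + 1)) (𝓝 0)).smul_isLittleO this
        refine (h2.add h3).congr' ?_ (EventuallyEq.refl _ _)
        filter_upwards [hPe, hP.eventually_analyticAt] with w hw hwa
        have hd : deriv P' w = deriv P w + (((n + 1 : ℕ) : ℂ) * w ^ n) • c := by
          have := hwa.differentiableAt.hasDerivAt.fun_add
            ((hasDerivAt_pow (n + 1) w).smul_const c)
          simpa using this.deriv
        have hPw : 𝓕 (w, P w) = w ^ (n + 1) • e w + w • deriv P w := by rw [← hw]; abel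
        rw [hd, hPw, ← hc]
        module)
      exact ⟨P', e', hP'a, hP'0, he', hr⟩
  set L := fderiv ℂ 𝓕 0
  set M : NNReal := ‖L‖₊ + 1 with hM
  obtain ⟨s, hs, hlip⟩ := hstrict.exists_lipschitzOnWith_of_nnnorm_lt M (by simp [hM, L])
  -- The approximation is taken beyond the Lipschitz constant, so that the ratio `M / N` is less
  -- than one.
  obtain ⟨n, hn⟩ := exists_nat_gt (M : ℝ)
  obtain ⟨P, e, hP, hP0, he, hPe⟩ := happrox n
  set N := n + 1 with hN
  have hMN : (M : ℝ) < N := hn.trans (by rw [hN]; push_cast; linarith)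
  -- The right-hand side of the equation for the correction to `P`; it is `O(w ^ N)` at zero
  -- correction.
  set Q : ℂ × E → E := fun p => 𝓕 (p.1, P p.1 + p.2) - p.1 • deriv P p.1 with hQ
  set K := ‖e 0‖ + 1 with hK
  have hPd : AnalyticAt ℂ (deriv P) 0 := hP.deriv
  have ev1 : ∀ᶠ p : ℂ × E in 𝓝 0, DifferentiableAt ℂ Q p := by
    have : AnalyticAt ℂ Q 0 := by
      have h1 : AnalyticAt ℂ (fun p : ℂ × E => P p.1) 0 := AnalyticAt.comp_at hP (by fun_prop) rfl
      have h1' : AnalyticAt ℂ (fun p : ℂ × E => deriv P p.1) 0 :=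
        AnalyticAt.comp_at hPd (by fun_prop) rfl
      have h2 : AnalyticAt ℂ (fun p : ℂ × E => 𝓕 (p.1, P p.1 + p.2)) 0 :=
        AnalyticAt.comp_at (y := 0) h𝓕 (by fun_prop) (by simp [hP0])
      exact h2.fun_sub (analyticAt_fst.fun_smul h1')
    filter_upwards [this.eventually_analyticAt] with p hp using hp.differentiableAt
  have ev2 : ∀ᶠ p : ℂ × E in 𝓝 0, (p.1, P p.1 + p.2) ∈ s := by
    have h1 : AnalyticAt ℂ (fun p : ℂ × E => P p.1) 0 := AnalyticAt.comp_at hP (by fun_prop) rfl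
    have : Tendsto (fun p : ℂ × E => (p.1, P p.1 + p.2)) (𝓝 0) (𝓝 0) :=
      tendsto_of_analyticAt (by fun_prop) (by simp [hP0])
    exact this.eventually hs
  have ev3 : ∀ᶠ w in 𝓝 (0 : ℂ), ‖Q (w, 0)‖ ≤ K * ‖w‖ ^ N := by
    have : ∀ᶠ w in 𝓝 (0 : ℂ), ‖e w‖ < K :=
      (he.continuousAt.norm.tendsto).eventually (gt_mem_nhds (by simp [hK]))
    filter_upwards [hPe, this] with w hw hw'
    simp only [hQ, add_zero, hw, norm_smul, norm_pow]
    rw [mul_comm]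
    gcongr
  obtain ⟨r₁, hr₁, h1⟩ := Metric.eventually_nhds_iff_ball.1 (ev1.and ev2)
  obtain ⟨r₂, hr₂, h2⟩ := Metric.eventually_nhds_iff_ball.1 ev3
  have hNM : (0 : ℝ) < N - M := by linarith
  obtain ⟨R, hR, hRr₁, hRr₂, hRρ⟩ : ∃ R : ℝ, 0 < R ∧ R ≤ r₁ ∧ R ≤ r₂ ∧
      K / (N - M) * R ^ N < r₁ := by
    have t : Tendsto (fun R : ℝ => K / (N - M) * R ^ N) (𝓝[>] 0) (𝓝 0) := by
      have : Continuous (fun R : ℝ => K / (N - M) * R ^ N) := by fun_prop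
      simpa [hN] using (this.tendsto 0).mono_left nhdsWithin_le_nhds
    have e2 : ∀ᶠ R : ℝ in 𝓝[>] 0, R < min r₁ r₂ :=
      mem_nhdsWithin_of_mem_nhds (gt_mem_nhds (lt_min hr₁ hr₂))
    obtain ⟨R, ha, hb, hc⟩ := ((t.eventually (gt_mem_nhds hr₁)).and
      (e2.and self_mem_nhdsWithin)).exists
    exact ⟨R, hc, hb.le.trans (min_le_left _ _), hb.le.trans (min_le_right _ _), ha⟩
  have hmem : ∀ w ∈ Metric.ball (0 : ℂ) R, ∀ a ∈ Metric.ball (0 : E) r₁,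
      ((w, a) : ℂ × E) ∈ Metric.ball (0 : ℂ × E) r₁ := by
    intro w hw a ha
    simp only [mem_ball_zero_iff, Prod.norm_def, max_lt_iff] at *
    exact ⟨hw.trans_le hRr₁, ha⟩
  obtain ⟨v, hv, hv0, hvQ⟩ := exists_solution_of_lipschitz (Q := Q) (K := K) (N := N) (ρ := r₁) hR
    M.coe_nonneg hMN (by omega) (by positivity) hRρ
    (fun w hw a ha => (h1 _ (hmem w hw a ha)).1)
    (fun w hw a ha b hb => by
      have := hlip.norm_sub_le (h1 _ (hmem w hw a ha)).2 (h1 _ (hmem w hw b hb)).2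
      simpa [hQ, Prod.norm_def] using this)
    (fun w hw => h2 w (Metric.ball_subset_ball hRr₂ hw))
  have hva : AnalyticAt ℂ v 0 := hv.analyticAt (Metric.ball_mem_nhds 0 hR)
  refine ⟨fun w => P w + v w, by fun_prop, by simp [hP0, hv0], ?_⟩
  filter_upwards [hP.eventually_analyticAt, hva.eventually_analyticAt, Metric.ball_mem_nhds 0 hR]
    with w hw1 hw2 hw3
  rw [deriv_fun_add hw1.differentiableAt hw2.differentiableAt, smul_add, hvQ w hw3]
  simp [hQ]

/-- Uniqueness part of the Briot–Bouquet theorem. -/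
theorem eventuallyEq_of_briotBouquet [CompleteSpace E] {𝓕 : ℂ × E → E} (h𝓕 : AnalyticAt ℂ 𝓕 0)
    (hres : ∀ k : ℕ, 1 ≤ k → ∀ v, pd (0, v) 𝓕 0 = (k : ℂ) • v → v = 0)
    {y₁ y₂ : ℂ → E} (h₁ : AnalyticAt ℂ y₁ 0) (h₁0 : y₁ 0 = 0)
    (e₁ : ∀ᶠ w in 𝓝 0, w • deriv y₁ w = 𝓕 (w, y₁ w)) (h₂ : AnalyticAt ℂ y₂ 0) (h₂0 : y₂ 0 = 0)
    (e₂ : ∀ᶠ w in 𝓝 0, w • deriv y₂ w = 𝓕 (w, y₂ w)) : y₁ =ᶠ[𝓝 0] y₂ := by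
  have hda : AnalyticAt ℂ (fun w => y₁ w - y₂ w) 0 := h₁.fun_sub h₂
  by_contra hne
  have hnt : ¬ ∀ᶠ w in 𝓝 0, (fun w => y₁ w - y₂ w) w = 0 := fun h =>
    hne (h.mono fun w hw => sub_eq_zero.1 hw)
  -- Two distinct solutions differ by `w ^ m e(w)` with `e 0 ≠ 0`. Comparing leading terms makes `e
  -- 0` an eigenvector of the linear part with eigenvalue `m`, and `m ≥ 1` since both solutions
  -- vanish at `0`.
  obtain ⟨m, e, he, he0, hde⟩ := hda.exists_eventuallyEq_pow_smul_nonzero_iff.2 hnt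
  simp only [sub_zero] at hde
  have hm : 1 ≤ m := by
    rcases Nat.eq_zero_or_pos m with rfl | h
    · have := hde.self_of_nhds
      simp [h₁0, h₂0] at this
      exact absurd this.symm he0
    · exact h
  refine he0 (hres m hm (e 0) ?_)
  have hstrict : HasStrictFDerivAt 𝓕 (fderiv ℂ 𝓕 0) 0 := h𝓕.hasStrictFDerivAt
  have t1 : Tendsto (fun w : ℂ => (((w, y₁ w) : ℂ × E), ((w, y₂ w) : ℂ × E)))
      (𝓝 0) (𝓝 (0, 0)) := by
    refine Tendsto.prodMk_nhds ?_ ?_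
    · exact tendsto_of_analyticAt (by fun_prop) (by simp [h₁0])
    · exact tendsto_of_analyticAt (by fun_prop) (by simp [h₂0])
  have h1 := (hstrict.isLittleO).comp_tendsto t1
  have hede : ∀ᶠ w in 𝓝 (0 : ℂ), deriv (fun w => y₁ w - y₂ w) w = deriv (fun w => w ^ m • e w) w :=
    (EventuallyEq.eventuallyEq_nhds (f := fun w => y₁ w - y₂ w) (g := fun w => w ^ m • e w) hde).mono
      fun w hw => hw.deriv_eq
  have h2 : (fun w : ℂ => w ^ m • ((m : ℂ) • e w + w • deriv e w - pd (0, e w) 𝓕 0))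
      =o[𝓝 0] fun w : ℂ => w ^ m := by
    refine (h1.congr' ?_ (EventuallyEq.refl _ _)).trans_isBigO ?_
    · filter_upwards [e₁, e₂, hde, hede, h₁.eventually_analyticAt, h₂.eventually_analyticAt,
        he.eventually_analyticAt] with w e1 e2 e3 e4 a1 a2 a3
      simp only [Function.comp, Prod.mk_sub_mk, sub_self, ← e1, ← e2, e3]
      rw [← smul_sub, ← deriv_fun_sub a1.differentiableAt a2.differentiableAt, e4]
      have hd : deriv (fun w : ℂ => w ^ m • e w) w
          = w ^ m • deriv e w + ((m : ℂ) * w ^ (m - 1)) • e w := by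
        simpa using ((hasDerivAt_pow m w).fun_smul a3.differentiableAt.hasDerivAt).deriv
      rw [hd]
      have hp : w * w ^ (m - 1) = w ^ m := by
        rw [← pow_succ', Nat.sub_add_cancel hm]
      have hL : (fderiv ℂ 𝓕 0) (0, w ^ m • e w) = w ^ m • pd (0, e w) 𝓕 0 := by
        rw [← pd_smul]; simp [pd]
      rw [hL, ← hp]
      module
    · have hb : Tendsto (fun w => ‖e w‖) (𝓝 0) (𝓝 ‖e 0‖) := he.continuousAt.norm.tendsto
      refine Asymptotics.IsBigO.of_bound (‖e 0‖ + 1) ?_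
      filter_upwards [hde, hb.eventually (gt_mem_nhds (lt_add_one _))] with w hw hw'
      simp only [Function.comp, Prod.mk_sub_mk, sub_self, hw, Prod.norm_def, norm_zero, norm_smul,
        norm_pow]
      rw [max_eq_right (by positivity), mul_comm]
      gcongr
  have h3 : Tendsto (fun w : ℂ => (m : ℂ) • e w + w • deriv e w - pd (0, e w) 𝓕 0) (𝓝[≠] 0)
      (𝓝 0) := by
    rw [← Asymptotics.isLittleO_one_iff ℂ]
    rw [Asymptotics.isLittleO_iff] at h2 ⊢
    intro c hc
    filter_upwards [mem_nhdsWithin_of_mem_nhds (h2 hc), self_mem_nhdsWithin] with w hw hw0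
    have : 0 < ‖w‖ ^ m := pow_pos (norm_pos_iff.2 hw0) m
    simp only [norm_smul, norm_pow] at hw
    simp only [norm_one, mul_one]
    nlinarith
  have h4 : Tendsto (fun w : ℂ => (m : ℂ) • e w + w • deriv e w - pd (0, e w) 𝓕 0) (𝓝[≠] 0)
      (𝓝 ((m : ℂ) • e 0 + (0 : ℂ) • deriv e 0 - pd (0, e 0) 𝓕 0)) := by
    have c1 : ContinuousAt e 0 := he.continuousAt
    have c2 : ContinuousAt (deriv e) 0 := he.deriv.continuousAt
    have : ContinuousAt (fun w : ℂ => (m : ℂ) • e w + w • deriv e w - pd (0, e w) 𝓕 0) 0 := by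
      unfold pd; fun_prop
    exact this.tendsto.mono_left nhdsWithin_le_nhds
  have := tendsto_nhds_unique h4 h3
  rw [zero_smul, add_zero] at this
  exact (sub_eq_zero.1 this).symm

end BriotBouquet

/-! ### Implicit systems of second order in the Euler operator -/

section SecondOrder

variable {E : Type*} [NormedAddCommGroup E] [NormedSpace ℂ E]

/-- The Euler operator `w d/dw`. -/
noncomputable def euler (H : ℂ → E) (w : ℂ) : E := w • deriv H w

@[fun_prop]
lemma analyticAt_euler [CompleteSpace E] {H : ℂ → E} {w : ℂ} (h : AnalyticAt ℂ H w) :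
    AnalyticAt ℂ (euler H) w :=
  analyticAt_id.fun_smul h.deriv

lemma euler_zero (H : ℂ → E) : euler H 0 = 0 := by simp [euler]

lemma euler_congr {H H' : ℂ → E} {w : ℂ} (h : H =ᶠ[𝓝 w] H') : euler H w = euler H' w := by
  simp [euler, h.deriv_eq]

lemma euler_eventuallyEq {H H' : ℂ → E} {w : ℂ} (h : H =ᶠ[𝓝 w] H') :
    euler H =ᶠ[𝓝 w] euler H' := by
  filter_upwards [h.eventuallyEq_nhds] with y hy using euler_congr hy

/-- Solving `G = 0` for its last argument gives `κ` and the first order system `w H' = G₁`, `w G₁' =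
κ(w, H, G₁)`. An eigenvector of its linear part for the eigenvalue `k` is `(v, k v)`, where the
differential of `G` kills `(0, v, k v, k² v)`. This is the shape of `hres`. -/
lemma reduce_order [FiniteDimensional ℂ E] {G : ℂ × E × E × E → E} (hG : AnalyticAt ℂ G 0)
    (h0 : G 0 = 0) (hinv : ∀ v, pd (0, 0, 0, v) G 0 = 0 → v = 0)
    (hres : ∀ k : ℕ, 1 ≤ k → ∀ v, pd (0, v, (k : ℂ) • v, (k : ℂ) ^ 2 • v) G 0 = 0 → v = 0) :
    ∃ 𝓕 : ℂ × E × E → E × E, AnalyticAt ℂ 𝓕 0 ∧ 𝓕 0 = 0 ∧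
      (∀ k : ℕ, 1 ≤ k → ∀ v, pd (0, v) 𝓕 0 = (k : ℂ) • v → v = 0) ∧
      (∀ᶠ p in 𝓝 0, (𝓕 p).1 = p.2.2 ∧ G (p.1, p.2.1, p.2.2, (𝓕 p).2) = 0) ∧
      ∀ᶠ p : ℂ × E × E × E in 𝓝 0, G p = 0 → p.2.2.2 = (𝓕 (p.1, p.2.1, p.2.2.1)).2 := by
  have : CompleteSpace E := FiniteDimensional.complete ℂ E
  obtain ⟨κ, hκ, hκ0, hκ1, hκ2⟩ := exists_implicit (E := ℂ × E × E) (F := E) (a := 0) (b := 0)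
    (G := fun p => G (p.1.1, p.1.2.1, p.1.2.2, p.2))
    (AnalyticAt.comp_at (y := 0) hG (by fun_prop) rfl) h0 (fun v hv => hinv v (by
      have h1 : HasDerivAt (fun s : ℂ => s • (((0, 0, 0), v) : (ℂ × E × E) × E))
          ((0, 0, 0), v) 0 := by
        simpa using (hasDerivAt_id (0 : ℂ)).smul_const (((0, 0, 0), v) : (ℂ × E × E) × E)
      have ha : AnalyticAt ℂ (fun p : (ℂ × E × E) × E => G (p.1.1, p.1.2.1, p.1.2.2, p.2)) 0 :=
        AnalyticAt.comp_at (y := 0) hG (by fun_prop) rfl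
      have h2 := hasDerivAt_comp_pd (c := fun s : ℂ => s • (((0, 0, 0), v) : (ℂ × E × E) × E))
        (t := 0) (G := fun p : (ℂ × E × E) × E => G (p.1.1, p.1.2.1, p.1.2.2, p.2))
        (by rw [zero_smul]; exact ha.differentiableAt) h1
      have h3 : HasDerivAt (fun s : ℂ => s • ((0, 0, 0, v) : ℂ × E × E × E)) (0, 0, 0, v) 0 := by
        simpa using (hasDerivAt_id (0 : ℂ)).smul_const ((0, 0, 0, v) : ℂ × E × E × E)
      have h4 := hasDerivAt_comp_pd (c := fun s : ℂ => s • ((0, 0, 0, v) : ℂ × E × E × E))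
        (t := 0) (G := G) (by rw [zero_smul]; exact hG.differentiableAt) h3
      rw [zero_smul] at h2 h4
      have := h4.unique h2
      rw [this]; exact hv))
  refine ⟨fun p => (p.2.2, κ p), by fun_prop, by simpa using hκ0, ?_, ?_, ?_⟩
  · intro k hk v hv
    have hd : DifferentiableAt ℂ κ 0 := hκ.differentiableAt
    have hfd : HasFDerivAt (fun p : ℂ × E × E => (p.2.2, κ p))
        (((ContinuousLinearMap.snd ℂ E E).comp (ContinuousLinearMap.snd ℂ ℂ (E × E))).prod
          (fderiv ℂ κ 0)) 0 :=
      HasFDerivAt.prodMk (((ContinuousLinearMap.snd ℂ E E).comp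
        (ContinuousLinearMap.snd ℂ ℂ (E × E))).hasFDerivAt) hd.hasFDerivAt
    have e1 : pd (0, v) (fun p : ℂ × E × E => (p.2.2, κ p)) 0 = (v.2, pd (0, v) κ 0) := by
      rw [pd, hfd.fderiv]; rfl
    rw [e1] at hv
    have e2 : v.2 = (k : ℂ) • v.1 := congrArg Prod.fst hv
    have e3 : pd (0, v) κ 0 = (k : ℂ) • v.2 := congrArg Prod.snd hv
    have hc : HasDerivAt (fun s : ℂ => s • ((0, v) : ℂ × E × E)) (0, v) 0 := by
      simpa using (hasDerivAt_id (0 : ℂ)).smul_const ((0, v) : ℂ × E × E)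
    have hκd := hasDerivAt_comp_pd (c := fun s : ℂ => s • ((0, v) : ℂ × E × E))
        (t := 0) (G := κ) (by rw [zero_smul]; exact hd) hc
    rw [zero_smul] at hκd
    -- A curve inside the zero set of `G`, tangent to the eigenvector.
    have hw : HasDerivAt (fun s : ℂ => ((0, s • v.1, s • v.2, κ (s • ((0, v) : ℂ × E × E))) :
        ℂ × E × E × E)) (0, v.1, v.2, pd (0, v) κ 0) 0 := by
      refine (hasDerivAt_const _ _).prodMk (HasDerivAt.prodMk ?_ (HasDerivAt.prodMk ?_ hκd))
      · simpa using (hasDerivAt_id (0 : ℂ)).smul_const v.1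
      · simpa using (hasDerivAt_id (0 : ℂ)).smul_const v.2
    have hb : ((0, (0 : ℂ) • v.1, (0 : ℂ) • v.2, κ ((0 : ℂ) • ((0, v) : ℂ × E × E))) :
        ℂ × E × E × E) = 0 := by
      rw [zero_smul, zero_smul, zero_smul, hκ0]; rfl
    have hG' := hasDerivAt_comp_pd (G := G) (by rw [hb]; exact hG.differentiableAt) hw
    rw [hb] at hG'
    have hz : (fun s : ℂ => G (0, s • v.1, s • v.2, κ (s • ((0, v) : ℂ × E × E))))
        =ᶠ[𝓝 0] fun _ => 0 := by
      have ht : Tendsto (fun s : ℂ => s • ((0, v) : ℂ × E × E)) (𝓝 0) (𝓝 0) := by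
        have := hc.continuousAt.tendsto
        rwa [zero_smul] at this
      filter_upwards [ht.eventually hκ1] with s hs
      simpa using hs
    have h0' := (hG'.congr_of_eventuallyEq hz.symm).unique (hasDerivAt_const 0 (0 : E))
    have hv1 : v.1 = 0 := by
      refine hres k hk v.1 ?_
      rw [e3, e2, smul_smul, ← pow_two] at h0'
      exact h0'
    ext1
    · exact hv1
    · rw [e2, hv1, smul_zero]; rfl
  · filter_upwards [hκ1] with p hp using ⟨rfl, hp⟩
  · have ht : Tendsto (fun p : ℂ × E × E × E => (((p.1, p.2.1, p.2.2.1), p.2.2.2) :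
        (ℂ × E × E) × E)) (𝓝 0) (𝓝 (0, 0)) :=
      tendsto_of_analyticAt (by fun_prop) rfl
    filter_upwards [ht.eventually hκ2] with p hp h using hp h

/-- The Briot–Bouquet theorem for an implicit second order system. -/
theorem briotBouquet_second_order [FiniteDimensional ℂ E] {G : ℂ × E × E × E → E}
    (hG : AnalyticAt ℂ G 0)
    (h0 : G 0 = 0) (hinv : ∀ v, pd (0, 0, 0, v) G 0 = 0 → v = 0)
    (hres : ∀ k : ℕ, 1 ≤ k → ∀ v, pd (0, v, (k : ℂ) • v, (k : ℂ) ^ 2 • v) G 0 = 0 → v = 0) :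
    (∃ H : ℂ → E, AnalyticAt ℂ H 0 ∧ H 0 = 0 ∧
      ∀ᶠ w in 𝓝 0, G (w, H w, euler H w, euler (euler H) w) = 0) ∧
    ∀ H₁ H₂ : ℂ → E, AnalyticAt ℂ H₁ 0 → H₁ 0 = 0 →
      (∀ᶠ w in 𝓝 0, G (w, H₁ w, euler H₁ w, euler (euler H₁) w) = 0) →
      AnalyticAt ℂ H₂ 0 → H₂ 0 = 0 →
      (∀ᶠ w in 𝓝 0, G (w, H₂ w, euler H₂ w, euler (euler H₂) w) = 0) → H₁ =ᶠ[𝓝 0] H₂ := by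
  have : CompleteSpace E := FiniteDimensional.complete ℂ E
  obtain ⟨𝓕, h𝓕, h𝓕0, hr, hs1, hs2⟩ := reduce_order hG h0 hinv hres
  constructor
  · obtain ⟨y, hy, hy0, hye⟩ := exists_briotBouquet h𝓕 h𝓕0 hr
    have hy1 : AnalyticAt ℂ (fun w => (y w).1) 0 := analyticAt_fst.comp_at hy rfl
    have hy2 : AnalyticAt ℂ (fun w => (y w).2) 0 := analyticAt_snd.comp_at hy rfl
    have ht : Tendsto (fun w => (w, y w)) (𝓝 0) (𝓝 0) :=
      tendsto_of_analyticAt (by fun_prop) (by rw [hy0]; rfl)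
    have hder : ∀ᶠ w in 𝓝 0, deriv y w = (deriv (fun w => (y w).1) w, deriv (fun w => (y w).2) w) := by
      filter_upwards [hy1.eventually_analyticAt, hy2.eventually_analyticAt] with w h1 h2
      exact (h1.differentiableAt.hasDerivAt.prodMk h2.differentiableAt.hasDerivAt).deriv
    have e1 : euler (fun w => (y w).1) =ᶠ[𝓝 0] fun w => (y w).2 := by
      filter_upwards [hye, hder, ht.eventually hs1] with w h1 h2 h3
      rw [h2] at h1
      have := congrArg Prod.fst h1
      rw [h3.1] at this
      exact this
    refine ⟨fun w => (y w).1, hy1, congrArg Prod.fst hy0, ?_⟩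
    filter_upwards [hye, hder, ht.eventually hs1, e1, euler_eventuallyEq e1] with w h1 h2 h3 h4 h5
    rw [h5, h4]
    rw [h2] at h1
    have : euler (fun w => (y w).2) w = _ := congrArg Prod.snd h1
    rw [this]
    exact h3.2
  · intro H₁ H₂ a1 z1 e1 a2 z2 e2
    have key : ∀ H : ℂ → E, AnalyticAt ℂ H 0 → H 0 = 0 →
        (∀ᶠ w in 𝓝 0, G (w, H w, euler H w, euler (euler H) w) = 0) →
        ∀ᶠ w in 𝓝 0, w • deriv (fun w => (H w, euler H w)) w = 𝓕 (w, H w, euler H w) := by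
      intro H a z e
      have ht : Tendsto (fun w => (w, H w, euler H w)) (𝓝 0) (𝓝 0) :=
        tendsto_of_analyticAt (by fun_prop) (by rw [z, euler_zero]; rfl)
      have ht' : Tendsto (fun w => (w, H w, euler H w, euler (euler H) w)) (𝓝 0) (𝓝 0) :=
        tendsto_of_analyticAt (by fun_prop) (by rw [z, euler_zero, euler_zero]; rfl)
      filter_upwards [e, ht.eventually hs1, ht'.eventually hs2, a.eventually_analyticAt,
        (analyticAt_euler a).eventually_analyticAt] with w h1 h2 h3 h4 h5
      rw [(h4.differentiableAt.hasDerivAt.prodMk h5.differentiableAt.hasDerivAt).deriv]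
      ext1
      · exact h2.1.symm
      · exact h3 h1
    have := eventuallyEq_of_briotBouquet (y₁ := fun w => (H₁ w, euler H₁ w))
      (y₂ := fun w => (H₂ w, euler H₂ w)) h𝓕 hr (by fun_prop) (by simp [z1, euler_zero])
      (key H₁ a1 z1 e1) (by fun_prop) (by simp [z2, euler_zero]) (key H₂ a2 z2 e2)
    filter_upwards [this] with w hw using congrArg Prod.fst hw

end SecondOrder

/-! ### Taylor coefficients and their dependence on parameters -/

section Coefficients

/-- The `j`-th Taylor coefficient at the origin. -/
noncomputable def cf (j : ℕ) (g : ℂ → ℂ) : ℂ := iteratedDeriv j g 0 / j.factorial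

lemma cf_congr (j : ℕ) {g g' : ℂ → ℂ} (h : g =ᶠ[𝓝 0] g') : cf j g = cf j g' := by
  rw [cf, cf, h.iteratedDeriv_eq j]

lemma cf_zero (g : ℂ → ℂ) : cf 0 g = g 0 := by simp [cf]

lemma cf_one (g : ℂ → ℂ) : cf 1 g = deriv g 0 := by simp [cf]

lemma cf_const (j : ℕ) (a : ℂ) : cf j (fun _ => a) = if j = 0 then a else 0 := by
  by_cases h : j = 0 <;> simp [cf, h, iteratedDeriv_const]

lemma cf_add (j : ℕ) {g g' : ℂ → ℂ} (h : AnalyticAt ℂ g 0) (h' : AnalyticAt ℂ g' 0) :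
    cf j (fun t => g t + g' t) = cf j g + cf j g' := by
  rw [cf, iteratedDeriv_fun_add h.contDiffAt h'.contDiffAt, add_div]; rfl

lemma cf_sub (j : ℕ) {g g' : ℂ → ℂ} (h : AnalyticAt ℂ g 0) (h' : AnalyticAt ℂ g' 0) :
    cf j (fun t => g t - g' t) = cf j g - cf j g' := by
  rw [cf, iteratedDeriv_fun_sub h.contDiffAt h'.contDiffAt, sub_div]; rfl

lemma cf_const_mul (j : ℕ) (a : ℂ) (g : ℂ → ℂ) : cf j (fun t => a * g t) = a * cf j g := by
  rw [cf, iteratedDeriv_const_mul_field, mul_div_assoc]; rfl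

lemma cf_mul (j : ℕ) {g g' : ℂ → ℂ} (h : AnalyticAt ℂ g 0) (h' : AnalyticAt ℂ g' 0) :
    cf j (fun t => g t * g' t) = ∑ i ∈ Finset.range (j + 1), cf i g * cf (j - i) g' := by
  rw [cf, iteratedDeriv_fun_mul h.contDiffAt h'.contDiffAt, Finset.sum_div]
  refine Finset.sum_congr rfl fun i hi => ?_
  have hij : i ≤ j := Nat.lt_succ_iff.1 (Finset.mem_range.1 hi)
  have hc : (j.choose i : ℂ) * (i.factorial * (j - i).factorial) = j.factorial := by
    rw [← mul_assoc]; exact_mod_cast Nat.choose_mul_factorial_mul_factorial hij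
  have h1 : (i.factorial : ℂ) ≠ 0 := by exact_mod_cast i.factorial_ne_zero
  have h2 : ((j - i).factorial : ℂ) ≠ 0 := by exact_mod_cast (j - i).factorial_ne_zero
  have h3 : (j.choose i : ℂ) ≠ 0 := by exact_mod_cast (Nat.choose_pos hij).ne'
  rw [cf, cf, ← hc]
  field_simp

lemma cf_id (j : ℕ) : cf j (fun t => t) = if j = 1 then 1 else 0 := by
  rw [cf, iteratedDeriv_fun_id_zero]
  by_cases h : j = 1 <;> simp [h]

lemma cf_id_mul_zero (g : ℂ → ℂ) : cf 0 (fun t => t * g t) = 0 := by simp [cf_zero]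

lemma cf_id_mul_succ (j : ℕ) {g : ℂ → ℂ} (h : AnalyticAt ℂ g 0) :
    cf (j + 1) (fun t => t * g t) = cf j g := by
  rw [cf_mul _ (g := fun t => t) analyticAt_id h, Finset.sum_eq_single 1]
  · have := cf_id 1
    simp at this
    simp [this]
  · intro i _ hi
    have := cf_id i
    simp [hi] at this
    simp [this]
  · intro h; simp at h

lemma cf_deriv (j : ℕ) (g : ℂ → ℂ) : cf j (deriv g) = (j + 1) * cf (j + 1) g := by
  have : (j.factorial : ℂ) ≠ 0 := by exact_mod_cast j.factorial_ne_zero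
  have : (j : ℂ) + 1 ≠ 0 := by exact_mod_cast j.succ_ne_zero
  rw [cf, cf, iteratedDeriv_succ', Nat.factorial_succ]
  push_cast
  field_simp

lemma cf_comp_const_mul (j : ℕ) (c : ℂ) (g : ℂ → ℂ) :
    cf j (fun t => g (c * t)) = c ^ j * cf j g := by
  have : ∀ (j : ℕ) (g : ℂ → ℂ), iteratedDeriv j (fun t => g (c * t)) 0
      = c ^ j * iteratedDeriv j g 0 := by
    intro j
    induction j with
    | zero => intro g; simp
    | succ n ih =>
      intro g
      rw [iteratedDeriv_succ', iteratedDeriv_succ']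
      have : deriv (fun t => g (c * t)) = fun t => c * deriv g (c * t) := by
        ext t; exact deriv_comp_mul_left c g t
      rw [this, iteratedDeriv_const_mul_field, ih]; ring
  rw [cf, this, mul_div_assoc]; rfl

lemma eventually_eq_zero_of_cf {g : ℂ → ℂ} (h : AnalyticAt ℂ g 0) (h' : ∀ j, cf j g = 0) :
    ∀ᶠ t in 𝓝 0, g t = 0 := by
  rw [← analyticOrderAt_eq_top]
  by_contra hne
  obtain ⟨k, hk⟩ := ENat.ne_top_iff_exists.1 hne
  have : ((k + 1 : ℕ) : ℕ∞) ≤ analyticOrderAt g 0 := by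
    rw [natCast_le_analyticOrderAt_iff_iteratedDeriv_eq_zero h]
    intro i _
    have hi := h' i
    rw [cf, div_eq_zero_iff] at hi
    exact hi.resolve_right (by exact_mod_cast i.factorial_ne_zero)
  rw [← hk] at this
  have : k + 1 ≤ k := by exact_mod_cast this
  omega

variable {E : Type*} [NormedAddCommGroup E] [NormedSpace ℂ E]

lemma analyticAt_pd_iterate {G : E → ℂ} {x : E} (v : E) (j : ℕ) (h : AnalyticAt ℂ G x) :
    AnalyticAt ℂ ((pd v)^[j] G) x := by
  induction j with
  | zero => exact h
  | succ n ih => rw [Function.iterate_succ_apply']; exact analyticAt_pd v ih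

lemma iteratedDeriv_line {G : E → ℂ} (a v : E) (j : ℕ) {t : ℂ} (h : AnalyticAt ℂ G (a + t • v)) :
    iteratedDeriv j (fun s => G (a + s • v)) t = (pd v)^[j] G (a + t • v) := by
  induction j generalizing t with
  | zero => simp
  | succ n ih =>
    have hl : ∀ t : ℂ, HasDerivAt (fun s : ℂ => a + s • v) v t := fun t => by
      simpa using ((hasDerivAt_id t).smul_const v).const_add a
    have hev : iteratedDeriv n (fun s => G (a + s • v)) =ᶠ[𝓝 t]
        fun s => (pd v)^[n] G (a + s • v) := by
      filter_upwards [(hl t).continuousAt.eventually h.eventually_analyticAt] with s hs using ih hs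
    rw [iteratedDeriv_succ, hev.deriv_eq, Function.iterate_succ_apply']
    exact (hasDerivAt_comp_pd (analyticAt_pd_iterate v n h).differentiableAt (hl t)).deriv

lemma pd_iterate_comm {G : E → ℂ} {x : E} (h : AnalyticAt ℂ G x) (v w : E) (j : ℕ) :
    pd w ((pd v)^[j] G) x = (pd v)^[j] (pd w G) x := by
  induction j generalizing x with
  | zero => rfl
  | succ n ih =>
    rw [Function.iterate_succ_apply', Function.iterate_succ_apply',
      pd_comm (analyticAt_pd_iterate v n h)]
    exact pd_congr v (h.eventually_analyticAt.mono fun y hy => ih hy)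

/-- As iterated directional derivatives on the total space, the coefficients visibly depend
analytically on the parameter. -/
lemma cf_eq_pd_iterate {G : E × ℂ → ℂ} {e : E} (j : ℕ) (h : AnalyticAt ℂ G (e, 0)) :
    cf j (fun t => G (e, t)) = (pd (0, 1))^[j] G (e, 0) / j.factorial := by
  have := iteratedDeriv_line (G := G) (e, 0) (0, 1) j (t := 0) (by simpa using h)
  simp only [Prod.smul_mk, smul_zero, smul_eq_mul, mul_one, Prod.mk_add_mk, add_zero, zero_add]
    at this
  rw [cf, this]

lemma cf_eventuallyEq {G : E × ℂ → ℂ} {e : E} (j : ℕ) (h : AnalyticAt ℂ G (e, 0)) :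
    (fun e => cf j (fun t => G (e, t))) =ᶠ[𝓝 e]
      fun e => (pd (0, 1))^[j] G (e, 0) / j.factorial := by
  have hc : Tendsto (fun e : E => (e, (0 : ℂ))) (𝓝 e) (𝓝 (e, 0)) := by
    have : Continuous (fun e : E => (e, (0 : ℂ))) := by fun_prop
    exact this.tendsto e
  filter_upwards [hc.eventually h.eventually_analyticAt] with e' he' using cf_eq_pd_iterate j he'

lemma analyticAt_cf {G : E × ℂ → ℂ} {e : E} (j : ℕ) (h : AnalyticAt ℂ G (e, 0)) :
    AnalyticAt ℂ (fun e => cf j (fun t => G (e, t))) e := by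
  refine AnalyticAt.congr ?_ (cf_eventuallyEq j h).symm
  have := (analyticAt_pd_iterate (0, 1) j h).comp_at (g := fun e : E => (e, (0 : ℂ)))
    (by fun_prop) rfl
  fun_prop

/-- Mixed directional derivatives commute, so a parameter may be differentiated inside the
coefficient. -/
lemma pd_cf {G : E × ℂ → ℂ} {e : E} (j : ℕ) (v : E) (h : AnalyticAt ℂ G (e, 0)) :
    pd v (fun e => cf j (fun t => G (e, t))) e = cf j (fun t => pd (v, 0) G (e, t)) := by
  have hl : HasDerivAt (fun s : ℂ => e + s • v) v 0 := by
    simpa using ((hasDerivAt_id (0 : ℂ)).smul_const v).const_add e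
  have hl' : HasDerivAt (fun s : ℂ => ((e + s • v, 0) : E × ℂ)) (v, 0) 0 :=
    hl.prodMk (hasDerivAt_const _ _)
  rw [cf_eq_pd_iterate j (analyticAt_pd (v, 0) h), ← pd_iterate_comm h (0, 1) (v, 0) j,
    pd_congr v (cf_eventuallyEq j h)]
  have ha := analyticAt_pd_iterate (0, 1) j h
  have h1 := (hasDerivAt_comp_pd (c := fun s : ℂ => ((e + s • v, 0) : E × ℂ)) (t := 0)
    (by simpa using ha.differentiableAt) hl').div_const (j.factorial : ℂ)
  have h2 := hasDerivAt_comp_pd (c := fun s : ℂ => e + s • v) (t := 0)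
    (G := fun e => (pd (0, 1))^[j] G (e, 0) / (j.factorial : ℂ)) (by
      have := ha.comp_at (g := fun e : E => (e, (0 : ℂ))) (by fun_prop) rfl
      have h3 : AnalyticAt ℂ (fun e => (pd (0, 1))^[j] G (e, 0) / (j.factorial : ℂ)) e := by
        fun_prop
      simpa using h3.differentiableAt) hl
  simpa using h2.unique h1

lemma cf_cf_eq {G : ℂ × ℂ → ℂ} (k l : ℕ) (h : AnalyticAt ℂ G 0) :
    cf k (fun x => cf l (fun y => G (x, y)))
      = (pd (1, 0))^[k] ((pd (0, 1))^[l] G) 0 / (k.factorial * l.factorial) := by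
  have h' : AnalyticAt ℂ G ((0 : ℂ), 0) := h
  rw [cf_congr k (cf_eventuallyEq l h')]
  have := iteratedDeriv_line (G := (pd (0, 1))^[l] G) (0, 0) (1, 0) k (t := 0)
    (by simpa using analyticAt_pd_iterate (0, 1) l h')
  simp only [Prod.smul_mk, mul_zero, smul_eq_mul, mul_one, Prod.mk_add_mk, add_zero, zero_add]
    at this
  have e : cf k (fun x => (pd (0, 1))^[l] G (x, 0) / (l.factorial : ℂ))
      = cf k (fun x => (l.factorial : ℂ)⁻¹ * (pd (0, 1))^[l] G (x, 0)) := by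
    congr 1; ext x; rw [div_eq_inv_mul]
  rw [e, cf_const_mul, cf, this]
  simp only [← Prod.zero_eq_mk]
  field_simp

lemma taylorCoeff_eq_cf (f : ℂ → ℂ → ℂ) (k l : ℕ) :
    taylorCoeff f k l = cf k (fun x => cf l (fun y => f x y)) := by
  have e : cf k (fun x => cf l (fun y => f x y))
      = cf k (fun x => (l.factorial : ℂ)⁻¹ * iteratedDeriv l (fun y => f x y) 0) := by
    congr 1; ext x; rw [cf, div_eq_inv_mul]
  rw [e, cf_const_mul, cf, taylorCoeff]
  field_simp

lemma pd_iterate_iterate_comm {G : E → ℂ} {x : E} (h : AnalyticAt ℂ G x) (v w : E) (k l : ℕ) :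
    (pd w)^[k] ((pd v)^[l] G) x = (pd v)^[l] ((pd w)^[k] G) x := by
  induction k generalizing x with
  | zero => rfl
  | succ n ih =>
    rw [Function.iterate_succ_apply', Function.iterate_succ_apply',
      pd_congr w (h.eventually_analyticAt.mono fun y hy => ih hy),
      pd_iterate_comm (analyticAt_pd_iterate w n h)]

lemma cf_cf_swap {G : ℂ × ℂ → ℂ} (k l : ℕ) (h : AnalyticAt ℂ G 0) :
    cf k (fun x => cf l (fun y => G (x, y))) = cf l (fun y => cf k (fun x => G (x, y))) := by
  rw [cf_cf_eq k l h]
  have h' : AnalyticAt ℂ G ((0 : ℂ), 0) := h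
  have ev : (fun y => cf k (fun x => G (x, y))) =ᶠ[𝓝 0]
      fun y => (pd (1, 0))^[k] G (0, y) / k.factorial := by
    have hc : Tendsto (fun y : ℂ => ((0 : ℂ), y)) (𝓝 0) (𝓝 0) :=
      tendsto_of_analyticAt (by fun_prop) rfl
    filter_upwards [hc.eventually h.eventually_analyticAt] with y hy
    have := iteratedDeriv_line (G := G) (0, y) (1, 0) k (t := 0) (by simpa using hy)
    simp only [Prod.smul_mk, mul_zero, smul_eq_mul, mul_one, Prod.mk_add_mk, add_zero, zero_add]
      at this
    rw [cf, this]
  rw [cf_congr l ev]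
  have e : cf l (fun y => (pd (1, 0))^[k] G (0, y) / (k.factorial : ℂ))
      = cf l (fun y => (k.factorial : ℂ)⁻¹ * (pd (1, 0))^[k] G (0, y)) := by
    congr 1; ext x; rw [div_eq_inv_mul]
  rw [e, cf_const_mul, cf_eq_pd_iterate l (analyticAt_pd_iterate (1, 0) k h'),
    pd_iterate_iterate_comm h]
  simp only [← Prod.zero_eq_mk]
  field_simp

/-- An analytic function of two variables is zero if so are all its Taylor coefficients with
respect to the first one. -/
lemma eventually_eq_zero_of_cf₂ {G : ℂ × ℂ → ℂ} (h : AnalyticAt ℂ G 0)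
    (h' : ∀ᶠ u in 𝓝 0, ∀ j, cf j (fun t => G (t, u)) = 0) : ∀ᶠ p in 𝓝 0, G p = 0 := by
  obtain ⟨r, hr, h1⟩ := Metric.eventually_nhds_iff_ball.1 h.eventually_analyticAt
  obtain ⟨r₂, hr₂, h2⟩ := Metric.eventually_nhds_iff_ball.1 h'
  refine Metric.eventually_nhds_iff_ball.2 ⟨min r r₂, lt_min hr hr₂, fun p hp => ?_⟩
  simp only [mem_ball_zero_iff, Prod.norm_def, max_lt_iff, lt_min_iff] at hp
  have ha : ∀ t ∈ Metric.ball (0 : ℂ) r, AnalyticAt ℂ (fun t => G (t, p.2)) t := by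
    intro t ht
    refine (h1 (t, p.2) ?_).comp_at (by fun_prop) rfl
    simp only [mem_ball_zero_iff, Prod.norm_def, max_lt_iff] at *
    exact ⟨ht, hp.1.2⟩
  have hz := eventually_eq_zero_of_cf (ha 0 (Metric.mem_ball_self hr))
    (h2 p.2 (by simpa using hp.2.2))
  have hA : AnalyticOnNhd ℂ (fun t => G (t, p.2)) (Metric.ball 0 r) := ha
  exact hA.eqOn_zero_of_preconnected_of_eventuallyEq_zero (convex_ball _ _).isPreconnected
    (Metric.mem_ball_self hr) hz (by simpa using hp.1.1)

end Coefficients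

/-! ### The transformed right-hand side as a function of the 1-jet of the transformation -/

section JetSystem

/-- Values of `f, γ, w, f_z, γ_z, w f_w, w γ_w`. -/
abbrev V7 := ℂ × ℂ × ℂ × ℂ × ℂ × ℂ × ℂ

/-- Cauchy data `γ₀, γ₁, f₀, f₁ - 1`. -/
abbrev V4 := ℂ × ℂ × ℂ × ℂ

/-- The nonlinear term of the transformation rule for the equation `y'' = Ψ(x, e ^ y, y')` under
`(z, log w) ↦ (f(z, w), log w + γ(z, w))`. -/
noncomputable def jetS (Ψ : ℂ × ℂ × ℂ → ℂ) (p : V7 × ℂ) : ℂ :=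
  (p.1.2.2.2.1 + p.2 * p.1.2.2.2.2.2.1) ^ 3 *
    Ψ (p.1.1, p.1.2.2.1 * exp p.1.2.1,
      (p.1.2.2.2.2.1 + p.2 * (1 + p.1.2.2.2.2.2.2)) / (p.1.2.2.2.1 + p.2 * p.1.2.2.2.2.2.1))

noncomputable def jetSCoeff (Ψ : ℂ × ℂ × ℂ → ℂ) (j : ℕ) (m : V7) : ℂ :=
  cf j fun ζ => jetS Ψ (m, ζ)

/-- The jet at the origin of a transformation with the usual normalization, such as the identity. -/
def jetBase : V7 := (0, 0, 0, 1, 0, 0, 0)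

noncomputable def coeffAt (Ψ : ℂ × ℂ × ℂ → ℂ) (j : ℕ) (x : ℂ) : ℂ := cf j fun ζ => Ψ (x, 0, ζ)

variable {Ψ : ℂ × ℂ × ℂ → ℂ}

lemma analyticAt_jetS (hΨ : AnalyticAt ℂ Ψ 0) : AnalyticAt ℂ (jetS Ψ) (jetBase, 0) := by
  unfold jetS
  have h1 : AnalyticAt ℂ (fun p : V7 × ℂ => ((p.1.1, p.1.2.2.1 * exp p.1.2.1,
      (p.1.2.2.2.2.1 + p.2 * (1 + p.1.2.2.2.2.2.2)) / (p.1.2.2.2.1 + p.2 * p.1.2.2.2.2.2.1)) :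
      ℂ × ℂ × ℂ)) (jetBase, 0) := by
    fun_prop (disch := simp [jetBase])
  have h2 := AnalyticAt.comp_at (y := 0) hΨ h1 (by simp [jetBase])
  exact AnalyticAt.fun_mul (by fun_prop) h2

lemma analyticAt_jetSCoeff (hΨ : AnalyticAt ℂ Ψ 0) (j : ℕ) :
    AnalyticAt ℂ (jetSCoeff Ψ j) jetBase := analyticAt_cf j (analyticAt_jetS hΨ)

lemma analyticAt_slice (hΨ : AnalyticAt ℂ Ψ 0) :
    AnalyticAt ℂ (fun p : ℂ × ℂ => Ψ (p.1, 0, p.2)) (0, 0) :=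
  AnalyticAt.comp_at (y := 0) hΨ (by fun_prop) rfl

lemma analyticAt_coeffAt (hΨ : AnalyticAt ℂ Ψ 0) (j : ℕ) : AnalyticAt ℂ (coeffAt Ψ j) 0 :=
  analyticAt_cf j (analyticAt_slice hΨ)

lemma eventually_slice {P : ℂ × ℂ → Prop} (h : ∀ᶠ p in 𝓝 (0 : ℂ × ℂ), P p) :
    ∀ᶠ x in 𝓝 (0 : ℂ), ∀ᶠ t in 𝓝 (0 : ℂ), P (x, t) := by
  rw [← Prod.mk_zero_zero, nhds_prod_eq] at h
  exact h.curry

lemma deriv_coeffAt (hΨ : AnalyticAt ℂ Ψ 0) (j : ℕ) :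
    ∀ᶠ x in 𝓝 0, deriv (coeffAt Ψ j) x = cf j fun ζ => pd (1, 0, 0) Ψ (x, 0, ζ) := by
  have hc : Tendsto (fun x : ℂ => ((x, 0) : ℂ × ℂ)) (𝓝 0) (𝓝 (0, 0)) :=
    tendsto_of_analyticAt (by fun_prop) rfl
  have hc3 : Tendsto (fun p : ℂ × ℂ => ((p.1, 0, p.2) : ℂ × ℂ × ℂ)) (𝓝 0) (𝓝 0) :=
    tendsto_of_analyticAt (by fun_prop) rfl
  filter_upwards [hc.eventually (analyticAt_slice hΨ).eventually_analyticAt,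
    eventually_slice (hc3.eventually hΨ.eventually_analyticAt)] with x hx hx3
  have := pd_cf j 1 hx
  rw [pd, fderiv_apply_one_eq_deriv] at this
  refine this.trans (cf_congr j ?_)
  filter_upwards [hx3] with t ht
  have h1 : HasDerivAt (fun s : ℂ => ((x + s, t) : ℂ × ℂ)) (1, 0) 0 :=
    ((hasDerivAt_id (0 : ℂ)).const_add x).prodMk (hasDerivAt_const _ _)
  have h2 : HasDerivAt (fun s : ℂ => ((x + s, 0, t) : ℂ × ℂ × ℂ)) (1, 0, 0) 0 :=
    ((hasDerivAt_id (0 : ℂ)).const_add x).prodMk (hasDerivAt_const _ _)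
  have ht' : AnalyticAt ℂ (fun p : ℂ × ℂ => Ψ (p.1, 0, p.2)) (x, t) :=
    ht.comp_at (by fun_prop) rfl
  have e1 := hasDerivAt_comp_pd (G := fun p : ℂ × ℂ => Ψ (p.1, 0, p.2)) (t := 0)
    (by simpa using ht'.differentiableAt) h1
  have e2 := hasDerivAt_comp_pd (G := Ψ) (t := 0)
    (by simpa using ht.differentiableAt) h2
  simpa using e1.unique e2

/-- The base points have `w = 0` and the direction has no `w`-component, so the middle argument of
`Ψ` stays `0` and the component `b` along `γ` has no effect. The base moves along the line of the
first coordinate because the equations obtained by differentiating in `z` need one further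
derivative along that line. -/
lemma pd_jetS (hΨ : AnalyticAt ℂ Ψ 0) (a b c d e f : ℂ) :
    ∀ᶠ p : ℂ × ℂ in 𝓝 0,
      pd ((a, b, 0, c, d, e, f), 0) (jetS Ψ) (jetBase + p.1 • (1, 0), p.2)
        = 3 * (c + p.2 * e) * Ψ (p.1, 0, p.2) + a * pd (1, 0, 0) Ψ (p.1, 0, p.2)
          + (d + p.2 * f - p.2 * c - p.2 ^ 2 * e) * pd (0, 0, 1) Ψ (p.1, 0, p.2) := by
  have hc3 : Tendsto (fun p : ℂ × ℂ => ((p.1, 0, p.2) : ℂ × ℂ × ℂ)) (𝓝 0) (𝓝 0) :=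
    tendsto_of_analyticAt (by fun_prop) rfl
  have hc7 : Tendsto (fun p : ℂ × ℂ => ((jetBase + p.1 • (1, 0), p.2) : V7 × ℂ)) (𝓝 0)
      (𝓝 (jetBase, 0)) := by
    have : Continuous (fun p : ℂ × ℂ => ((jetBase + p.1 • (1, 0), p.2) : V7 × ℂ)) := by fun_prop
    simpa using this.tendsto 0
  filter_upwards [hc3.eventually hΨ.eventually_analyticAt,
    hc7.eventually (analyticAt_jetS hΨ).eventually_analyticAt] with p h1 h2
  obtain ⟨x, ζ⟩ := p
  simp only at h1 h2 ⊢
  have hl : HasDerivAt (fun s : ℂ => ((jetBase + x • (1, 0) + s • (a, b, 0, c, d, e, f), ζ) : V7 × ℂ))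
      ((a, b, 0, c, d, e, f), 0) 0 := by
    refine HasDerivAt.prodMk ?_ (hasDerivAt_const _ _)
    simpa using ((hasDerivAt_id (0 : ℂ)).smul_const ((a, b, 0, c, d, e, f) : V7)).const_add
      (jetBase + x • (1, 0))
  have e1 := hasDerivAt_comp_pd (G := jetS Ψ) (t := 0) (by simpa using h2.differentiableAt) hl
  simp only [zero_smul, add_zero] at e1
  have hx' : HasDerivAt (fun s : ℂ => 1 + s * c + ζ * (s * e)) (c + ζ * e) 0 := by
    simpa using (((hasDerivAt_id (0 : ℂ)).mul_const c).const_add 1).fun_add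
      (((hasDerivAt_id (0 : ℂ)).mul_const e).const_mul ζ)
  have hy' : HasDerivAt (fun s : ℂ => s * d + ζ * (1 + s * f)) (d + ζ * f) 0 := by
    simpa using ((hasDerivAt_id (0 : ℂ)).mul_const d).fun_add
      ((((hasDerivAt_id (0 : ℂ)).mul_const f).const_add 1).const_mul ζ)
  have hq := hy'.fun_div hx' (by simp)
  have ha : HasDerivAt (fun s : ℂ => x + s * a) a 0 := by
    simpa using ((hasDerivAt_id (0 : ℂ)).mul_const a).const_add x
  have e2 := (hx'.fun_pow 3).fun_mul (hasDerivAt_comp₃ (G := Ψ) (t := 0)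
    (by simpa using h1.differentiableAt) ha (hasDerivAt_const 0 (0 : ℂ)) hq)
  have e3 : (fun s : ℂ => jetS Ψ (jetBase + x • (1, 0) + s • (a, b, 0, c, d, e, f), ζ))
      = fun s : ℂ => (1 + s * c + ζ * (s * e)) ^ 3 * Ψ (x + s * a, 0,
        (s * d + ζ * (1 + s * f)) / (1 + s * c + ζ * (s * e))) := by
    ext s
    simp [jetS, jetBase]
  rw [e3] at e1
  rw [e1.unique e2]
  simp
  ring

lemma pd_jetSCoeff (hΨ : AnalyticAt ℂ Ψ 0) (j : ℕ) (a b c d e f : ℂ) :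
    ∀ᶠ x in 𝓝 0, pd (a, b, 0, c, d, e, f) (jetSCoeff Ψ j) (jetBase + x • (1, 0))
      = 3 * c * coeffAt Ψ j x
        + 3 * e * cf j (fun ζ => ζ * Ψ (x, 0, ζ)) + a * deriv (coeffAt Ψ j) x
        + d * cf j (deriv fun ζ => Ψ (x, 0, ζ))
        + (f - c) * cf j (fun ζ => ζ * deriv (fun ζ => Ψ (x, 0, ζ)) ζ)
        - e * cf j (fun ζ => ζ * (ζ * deriv (fun ζ => Ψ (x, 0, ζ)) ζ)) := by
  have hc3 : Tendsto (fun p : ℂ × ℂ => ((p.1, 0, p.2) : ℂ × ℂ × ℂ)) (𝓝 0) (𝓝 0) :=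
    tendsto_of_analyticAt (by fun_prop) rfl
  have hc2 : Tendsto (fun x : ℂ => ((x, 0) : ℂ × ℂ)) (𝓝 0) (𝓝 0) :=
    tendsto_of_analyticAt (by fun_prop) rfl
  have hc7 : Tendsto (fun x : ℂ => ((jetBase + x • (1, 0), 0) : V7 × ℂ)) (𝓝 0)
      (𝓝 (jetBase, 0)) := by
    have : Continuous (fun x : ℂ => ((jetBase + x • (1, 0), 0) : V7 × ℂ)) := by fun_prop
    simpa using this.tendsto 0
  filter_upwards [eventually_slice (pd_jetS hΨ a b c d e f),
    hc7.eventually (analyticAt_jetS hΨ).eventually_analyticAt,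
    eventually_slice (hc3.eventually hΨ.eventually_analyticAt),
    (hc3.comp hc2).eventually hΨ.eventually_analyticAt, deriv_coeffAt hΨ j] with x h1 h2 h3 h4 h5
  unfold jetSCoeff
  rw [pd_cf j _ h2, cf_congr j h1]
  simp only [Function.comp] at h4
  have hd : ∀ᶠ ζ in 𝓝 0, pd (0, 0, 1) Ψ (x, 0, ζ) = deriv (fun ζ => Ψ (x, 0, ζ)) ζ := by
    filter_upwards [h3] with ζ hζ
    have := hasDerivAt_comp₃ (G := Ψ) (t := ζ) (a := fun _ => x) (b := fun _ => 0) (c := fun s => s)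
      hζ.differentiableAt (hasDerivAt_const _ _) (hasDerivAt_const _ _) (hasDerivAt_id _)
    rw [this.deriv]; simp
  have g1 : AnalyticAt ℂ (fun ζ => Ψ (x, 0, ζ)) 0 := h4.comp_at (by fun_prop) rfl
  have g2 : AnalyticAt ℂ (fun ζ => pd (1, 0, 0) Ψ (x, 0, ζ)) 0 :=
    (analyticAt_pd (1, 0, 0) h4).comp_at (by fun_prop) rfl
  have g3 : AnalyticAt ℂ (deriv fun ζ => Ψ (x, 0, ζ)) 0 := g1.deriv
  have e0 : cf j (fun t => 3 * (c + t * e) * Ψ (x, 0, t) + a * pd (1, 0, 0) Ψ (x, 0, t)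
          + (d + t * f - t * c - t ^ 2 * e) * pd (0, 0, 1) Ψ (x, 0, t))
      = cf j (fun t => (((((3 * c) * Ψ (x, 0, t) + (3 * e) * (t * Ψ (x, 0, t)))
          + a * pd (1, 0, 0) Ψ (x, 0, t)) + d * deriv (fun ζ => Ψ (x, 0, ζ)) t)
          + (f - c) * (t * deriv (fun ζ => Ψ (x, 0, ζ)) t))
          - e * (t * (t * deriv (fun ζ => Ψ (x, 0, ζ)) t))) := by
    refine cf_congr j ?_
    filter_upwards [hd] with t ht
    rw [ht]; ring
  rw [e0, cf_sub, cf_add, cf_add, cf_add, cf_add, cf_const_mul, cf_const_mul, cf_const_mul,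
    cf_const_mul, cf_const_mul, cf_const_mul, h5]
  · rfl
  all_goals fun_prop

variable (Ψ) in
/-- `Ψ(z, w, ζ) = O(ζ²)` -/
def OrderTwo : Prop := ∀ᶠ x : ℂ × ℂ in 𝓝 0,
    Ψ (x.1, x.2, 0) = 0 ∧ deriv (fun ζ => Ψ (x.1, x.2, ζ)) 0 = 0

lemma OrderTwo.coeffAt (h : OrderTwo Ψ) :
    ∀ᶠ x in 𝓝 0, coeffAt Ψ 0 x = 0 ∧ coeffAt Ψ 1 x = 0 := by
  have hc2 : Tendsto (fun x : ℂ => ((x, 0) : ℂ × ℂ)) (𝓝 0) (𝓝 0) :=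
    tendsto_of_analyticAt (by fun_prop) rfl
  filter_upwards [hc2.eventually h] with x hx
  simpa only [InfiniteType.coeffAt, cf_zero, cf_one] using hx

/-- The component `d` along `γ_z` shifts `ζ` and so raises the index by one, which is why the
coefficient of `ζ⁴` enters. Terms with `ζ⁰` and `ζ¹` drop out because `Ψ = O(ζ²)`. -/
lemma pd_jetSCoeff_values (hΨ : AnalyticAt ℂ Ψ 0) (h2 : OrderTwo Ψ) (a b c d e f : ℂ) :
    ∀ᶠ x in 𝓝 0,
      pd (a, b, 0, c, d, e, f) (jetSCoeff Ψ 0) (jetBase + x • (1, 0)) = 0 ∧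
      pd (a, b, 0, c, d, e, f) (jetSCoeff Ψ 1) (jetBase + x • (1, 0)) = 2 * d * coeffAt Ψ 2 x ∧
      pd (a, b, 0, c, d, e, f) (jetSCoeff Ψ 2) (jetBase + x • (1, 0)) =
        (c + 2 * f) * coeffAt Ψ 2 x + a * deriv (coeffAt Ψ 2) x + 3 * d * coeffAt Ψ 3 x ∧
      pd (a, b, 0, c, d, e, f) (jetSCoeff Ψ 3) (jetBase + x • (1, 0)) =
        3 * f * coeffAt Ψ 3 x + e * coeffAt Ψ 2 x + a * deriv (coeffAt Ψ 3) x
          + 4 * d * coeffAt Ψ 4 x := by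
  have hc3 : Tendsto (fun x : ℂ => ((x, 0, 0) : ℂ × ℂ × ℂ)) (𝓝 0) (𝓝 0) :=
    tendsto_of_analyticAt (by fun_prop) rfl
  have hz0 : ∀ᶠ x in 𝓝 0, deriv (coeffAt Ψ 0) x = 0 := by
    have : coeffAt Ψ 0 =ᶠ[𝓝 0] fun _ => 0 := h2.coeffAt.mono fun x hx => hx.1
    filter_upwards [this.eventuallyEq_nhds] with x hx
    rw [hx.deriv_eq]; simp
  have hz1 : ∀ᶠ x in 𝓝 0, deriv (coeffAt Ψ 1) x = 0 := by
    have : coeffAt Ψ 1 =ᶠ[𝓝 0] fun _ => 0 := h2.coeffAt.mono fun x hx => hx.2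
    filter_upwards [this.eventuallyEq_nhds] with x hx
    rw [hx.deriv_eq]; simp
  filter_upwards [pd_jetSCoeff hΨ 0 a b c d e f, pd_jetSCoeff hΨ 1 a b c d e f,
    pd_jetSCoeff hΨ 2 a b c d e f, pd_jetSCoeff hΨ 3 a b c d e f, h2.coeffAt,
    hc3.eventually hΨ.eventually_analyticAt, hz0, hz1] with x h0 h1 h2 h3 hx h4 z0 z1
  have g1 : AnalyticAt ℂ (fun ζ => Ψ (x, 0, ζ)) 0 := h4.comp_at (by fun_prop) rfl
  have g3 : AnalyticAt ℂ (deriv fun ζ => Ψ (x, 0, ζ)) 0 := g1.deriv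
  have g4 : AnalyticAt ℂ (fun t => t * deriv (fun ζ => Ψ (x, 0, ζ)) t) 0 := by fun_prop
  have hcf : ∀ j, cf j (fun ζ => Ψ (x, 0, ζ)) = coeffAt Ψ j x := fun _ => rfl
  refine ⟨?_, ?_, ?_, ?_⟩
  · rw [h0]
    simp only [cf_id_mul_zero, cf_deriv, hcf, hx.1, hx.2, z0]
    norm_num
  · rw [h1]
    simp only [cf_id_mul_zero, cf_id_mul_succ _ g1, cf_id_mul_succ _ g3, cf_id_mul_succ _ g4,
      cf_deriv, hcf, hx.1, hx.2, z1, zero_add]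
    norm_num
    ring
  · rw [h2]
    simp only [cf_id_mul_succ _ g1, cf_id_mul_succ _ g3, cf_id_mul_succ _ g4, cf_deriv, hcf, hx.2,
      zero_add]
    norm_num
    ring
  · rw [h3]
    simp only [cf_id_mul_succ _ g1, cf_id_mul_succ _ g3, cf_id_mul_succ _ g4, cf_deriv, hcf]
    norm_num
    ring

end JetSystem

/-! ### The system for the Cauchy data -/

section JetSystem

lemma analyticAt_fderiv_apply {E E' F : Type*} [NormedAddCommGroup E] [NormedSpace ℂ E]
    [NormedAddCommGroup E'] [NormedSpace ℂ E'] [NormedAddCommGroup F] [NormedSpace ℂ F]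
    [CompleteSpace F] {G : E → F} {a v : E' → E} {t : E'} (hG : AnalyticAt ℂ G (a t))
    (ha : AnalyticAt ℂ a t) (hv : AnalyticAt ℂ v t) :
    AnalyticAt ℂ (fun s => pd (v s) G (a s)) t := by
  have h1 : AnalyticAt ℂ (fun s => fderiv ℂ G (a s)) t := hG.fderiv.comp_at ha rfl
  exact ((ContinuousLinearMap.id ℂ (E →L[ℂ] F)).analyticAt_bilinear _).comp_at
    (g := fun s => (fderiv ℂ G (a s), v s)) (by fun_prop) rfl

/-- Product rule for a differential taken at a moving point in a moving direction. -/
lemma hasDerivAt_fderiv_apply {E F : Type*} [NormedAddCommGroup E] [NormedSpace ℂ E]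
    [NormedAddCommGroup F] [NormedSpace ℂ F]
    [CompleteSpace F] {G : E → F} {a v : ℂ → E} {a' v' : E} {t : ℂ} (hG : AnalyticAt ℂ G (a t))
    (ha : HasDerivAt a a' t) (hv : HasDerivAt v v' t) :
    HasDerivAt (fun s => pd (v s) G (a s)) (pd a' (pd (v t) G) (a t) + pd v' G (a t)) t := by
  have h1 : HasDerivAt (fun s => fderiv ℂ G (a s)) (fderiv ℂ (fderiv ℂ G) (a t) a') t :=
    hG.fderiv.differentiableAt.hasFDerivAt.comp_hasDerivAt t ha
  have h2 := h1.clm_apply hv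
  have h3 : pd a' (pd (v t) G) (a t) = fderiv ℂ (fderiv ℂ G) (a t) a' (v t) := by
    have h4 : HasFDerivAt (fun y => fderiv ℂ G y (v t))
        ((fderiv ℂ (fderiv ℂ G) (a t)).flip (v t)) (a t) := by
      simpa using hG.fderiv.differentiableAt.hasFDerivAt.clm_apply (hasFDerivAt_const (v t) (a t))
    have h5 : fderiv ℂ (pd (v t) G) (a t) = _ := h4.fderiv
    rw [pd, h5]; rfl
  rw [h3]
  exact h2

/-- The values at `z = 0`, as a function of `(w, H, w H')`. -/
def jetVal (y : ℂ × V4 × V4) : V7 :=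
  (y.2.1.2.2.1, y.2.1.1, y.1, 1 + y.2.1.2.2.2, y.2.1.2.1, y.2.2.2.2.1, y.2.2.1)

def jetJac (y : ℂ × V4 × V4) : ℂ :=
  (1 + y.2.1.2.2.2) * (1 + y.2.2.1) - y.2.1.2.1 * y.2.2.2.2.1

variable (Ψ : ℂ × ℂ × ℂ → ℂ)

/-- The part of the `ζ¹` coefficient of the transformed equation that is free of second
`z`-derivatives. The `ζ⁰` and `ζ¹` coefficients must vanish at `z = 0`; they are linear in `γ_zz`
and `f_zz` with determinant given up to sign by the Jacobian, and Cramer's rule gives the next two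
functions. -/
noncomputable def jetX (y : ℂ × V4 × V4) : ℂ :=
  jetSCoeff Ψ 1 (jetVal y) - 2 * (1 + y.2.1.2.2.2) * y.2.2.2.1 + 2 * y.2.1.2.1 * y.2.2.2.2.2

/-- `γ_zz` at `z = 0` -/
noncomputable def jetG2 (y : ℂ × V4 × V4) : ℂ :=
  ((1 + y.2.2.1) * jetSCoeff Ψ 0 (jetVal y) - y.2.1.2.1 * jetX Ψ y) / jetJac y

/-- `f_zz` at `z = 0` -/
noncomputable def jetF2 (y : ℂ × V4 × V4) : ℂ :=
  (y.2.2.2.2.1 * jetSCoeff Ψ 0 (jetVal y) - (1 + y.2.1.2.2.2) * jetX Ψ y) / jetJac y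

/-- The `z`-derivatives of the values in `jetVal`. -/
noncomputable def jetDir (y : ℂ × V4 × V4) : V7 :=
  (1 + y.2.1.2.2.2, y.2.1.2.1, 0, jetF2 Ψ y, jetG2 Ψ y, y.2.2.2.2.2, y.2.2.2.1)

/-- By the chain rule, the `z`-derivative at `z = 0` of the coefficient along the jet of a
transformation whose second `z`-derivatives are `jetF2` and `jetG2`. -/
noncomputable def jetSDeriv (j : ℕ) (y : ℂ × V4 × V4) : ℂ :=
  pd (jetDir Ψ y) (jetSCoeff Ψ j) (jetVal y)

/-- The argument stands for `(w, H, δH, δ²H)` with `δ = w d/dw`. Then `jetVel` is the image of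
`jetPt` under `δ` along a solution. -/
def jetPt (x : ℂ × V4 × V4 × V4) : ℂ × V4 × V4 := (x.1, x.2.1, x.2.2.1)

def jetVel (x : ℂ × V4 × V4 × V4) : ℂ × V4 × V4 := (x.1, x.2.2.1, x.2.2.2)

noncomputable def jacDeriv (y : ℂ × V4 × V4) : ℂ :=
  jetF2 Ψ y * (1 + y.2.2.1) + (1 + y.2.1.2.2.2) * y.2.2.2.1 - jetG2 Ψ y * y.2.2.2.2.1
    - y.2.1.2.1 * y.2.2.2.2.2

/-- The coefficient of `ζ²` at `z = 0` in the transformed equation, before division by the Jacobian,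
minus the Jacobian times the constant it has to equal. That constant is the coefficient of `Ψ`
itself at the origin, because the transformation has the jet of the identity there. `sysB` does the
same for `ζ³`. -/
noncomputable def sysA (x : ℂ × V4 × V4 × V4) : ℂ :=
  jetSCoeff Ψ 2 (jetVal (jetPt x)) - 2 * x.2.2.1.2.2.1 * x.2.2.1.2.1
    - (1 + x.2.1.2.2.2) * x.2.2.2.1 + 2 * (1 + x.2.2.1.1) * x.2.2.1.2.2.2
    + x.2.1.2.1 * x.2.2.2.2.2.1 - jetJac (jetPt x) * coeffAt Ψ 2 0

noncomputable def sysB (x : ℂ × V4 × V4 × V4) : ℂ :=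
  jetSCoeff Ψ 3 (jetVal (jetPt x)) - x.2.2.1.2.2.1 * x.2.2.2.1
    + (1 + x.2.2.1.1) * x.2.2.2.2.2.1 - jetJac (jetPt x) * coeffAt Ψ 3 0

/-- The `z`-derivative of the expression behind `sysA`, as `sysD` is that of `sysB`. Derivatives of
`jetG2` and `jetF2` along `jetVel` stand for `w ∂_w γ_zz` and `w ∂_w f_zz`. -/
noncomputable def sysC (x : ℂ × V4 × V4 × V4) : ℂ :=
  jetSDeriv Ψ 2 (jetPt x)
    - (2 * x.2.2.1.2.2.2 * x.2.2.1.2.1 + 2 * x.2.2.1.2.2.1 * pd (jetVel x) (jetG2 Ψ) (jetPt x)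
      + jetF2 Ψ (jetPt x) * x.2.2.2.1 + (1 + x.2.1.2.2.2) * x.2.2.2.2.1)
    + 2 * x.2.2.1.2.1 * x.2.2.1.2.2.2 + 2 * (1 + x.2.2.1.1) * pd (jetVel x) (jetF2 Ψ) (jetPt x)
    + jetG2 Ψ (jetPt x) * x.2.2.2.2.2.1 + x.2.1.2.1 * x.2.2.2.2.2.2
    - jacDeriv Ψ (jetPt x) * coeffAt Ψ 2 0 - jetJac (jetPt x) * deriv (coeffAt Ψ 2) 0

noncomputable def sysD (x : ℂ × V4 × V4 × V4) : ℂ :=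
  jetSDeriv Ψ 3 (jetPt x)
    - x.2.2.1.2.2.2 * x.2.2.2.1 - x.2.2.1.2.2.1 * x.2.2.2.2.1
    + x.2.2.1.2.1 * x.2.2.2.2.2.1 + (1 + x.2.2.1.1) * x.2.2.2.2.2.2
    - jacDeriv Ψ (jetPt x) * coeffAt Ψ 3 0 - jetJac (jetPt x) * deriv (coeffAt Ψ 3) 0

/-- The system for the Cauchy data of a normalizing transformation. -/
noncomputable def sys (x : ℂ × V4 × V4 × V4) : V4 := (sysA Ψ x, sysB Ψ x, sysC Ψ x, sysD Ψ x)

variable {Ψ}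

lemma jetVal_zero : jetVal 0 = jetBase := by simp [jetVal, jetBase]

lemma jetPt_zero : jetPt 0 = 0 := rfl
lemma jetVel_zero : jetVel 0 = 0 := rfl

@[fun_prop] lemma analyticAt_jetVal (y) : AnalyticAt ℂ jetVal y := by unfold jetVal; fun_prop
@[fun_prop] lemma analyticAt_jetJac (y) : AnalyticAt ℂ jetJac y := by unfold jetJac; fun_prop
@[fun_prop] lemma analyticAt_jetPt (x) : AnalyticAt ℂ jetPt x := by unfold jetPt; fun_prop
@[fun_prop] lemma analyticAt_jetVel (x) : AnalyticAt ℂ jetVel x := by unfold jetVel; fun_prop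

lemma analyticAt_jetSCoeff_val (hΨ : AnalyticAt ℂ Ψ 0) (j : ℕ) :
    AnalyticAt ℂ (fun y => jetSCoeff Ψ j (jetVal y)) 0 :=
  (analyticAt_jetSCoeff hΨ j).comp_at (by fun_prop) jetVal_zero

lemma jetJac_zero : jetJac 0 = 1 := by simp [jetJac]

lemma analyticAt_jetX (hΨ : AnalyticAt ℂ Ψ 0) : AnalyticAt ℂ (jetX Ψ) 0 := by
  unfold jetX
  have := analyticAt_jetSCoeff_val hΨ 1
  fun_prop

lemma analyticAt_jetG2 (hΨ : AnalyticAt ℂ Ψ 0) : AnalyticAt ℂ (jetG2 Ψ) 0 := by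
  unfold jetG2
  have h1 := analyticAt_jetSCoeff_val hΨ 0
  have h2 := analyticAt_jetX hΨ
  exact AnalyticAt.fun_div (by fun_prop) (by fun_prop) (by simp [jetJac_zero])

lemma analyticAt_jetF2 (hΨ : AnalyticAt ℂ Ψ 0) : AnalyticAt ℂ (jetF2 Ψ) 0 := by
  unfold jetF2
  have h1 := analyticAt_jetSCoeff_val hΨ 0
  have h2 := analyticAt_jetX hΨ
  exact AnalyticAt.fun_div (by fun_prop) (by fun_prop) (by simp [jetJac_zero])

lemma analyticAt_jetSDeriv (hΨ : AnalyticAt ℂ Ψ 0) (j : ℕ) :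
    AnalyticAt ℂ (jetSDeriv Ψ j) 0 := by
  have h1 := analyticAt_jetF2 hΨ
  have h2 := analyticAt_jetG2 hΨ
  refine analyticAt_fderiv_apply (v := jetDir Ψ) ?_ (by fun_prop) ?_
  · rw [jetVal_zero]; exact analyticAt_jetSCoeff hΨ j
  · unfold jetDir; fun_prop

lemma analyticAt_sys (hΨ : AnalyticAt ℂ Ψ 0) : AnalyticAt ℂ (sys Ψ) 0 := by
  have hp : ∀ {G : ℂ × V4 × V4 → ℂ}, AnalyticAt ℂ G 0 → AnalyticAt ℂ (fun x => G (jetPt x)) 0 :=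
    fun h => AnalyticAt.comp_at h (by fun_prop) jetPt_zero
  have s2 := hp (analyticAt_jetSCoeff_val hΨ 2)
  have s3 := hp (analyticAt_jetSCoeff_val hΨ 3)
  have t2 := hp (analyticAt_jetSDeriv hΨ 2)
  have t3 := hp (analyticAt_jetSDeriv hΨ 3)
  have j1 := hp (analyticAt_jetJac 0)
  have g2 := hp (analyticAt_jetG2 hΨ)
  have f2 := hp (analyticAt_jetF2 hΨ)
  have jd : AnalyticAt ℂ (fun x => jacDeriv Ψ (jetPt x)) 0 := by
    refine hp ?_
    have h1 := analyticAt_jetF2 hΨ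
    have h2 := analyticAt_jetG2 hΨ
    unfold jacDeriv; fun_prop
  have dg : AnalyticAt ℂ (fun x => pd (jetVel x) (jetG2 Ψ) (jetPt x)) 0 :=
    analyticAt_fderiv_apply (by rw [jetPt_zero]; exact analyticAt_jetG2 hΨ) (by fun_prop)
      (by fun_prop)
  have df : AnalyticAt ℂ (fun x => pd (jetVel x) (jetF2 Ψ) (jetPt x)) 0 :=
    analyticAt_fderiv_apply (by rw [jetPt_zero]; exact analyticAt_jetF2 hΨ) (by fun_prop)
      (by fun_prop)
  unfold sys
  refine AnalyticAt.prod ?_ (AnalyticAt.prod ?_ (AnalyticAt.prod ?_ ?_))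
  · unfold sysA; fun_prop
  · unfold sysB; fun_prop
  · unfold sysC; fun_prop
  · unfold sysD; fun_prop

lemma jetSCoeff_base (Ψ : ℂ × ℂ × ℂ → ℂ) (j : ℕ) :
    jetSCoeff Ψ j jetBase = coeffAt Ψ j 0 := by
  simp [jetSCoeff, coeffAt, jetS, jetBase]

lemma jetX_zero (h2 : OrderTwo Ψ) : jetX Ψ 0 = 0 := by
  have := h2.coeffAt.self_of_nhds
  simp [jetX, jetVal_zero, jetSCoeff_base, this.2]

lemma jetG2_zero (h2 : OrderTwo Ψ) : jetG2 Ψ 0 = 0 := by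
  have := h2.coeffAt.self_of_nhds
  simp [jetG2, jetVal_zero, jetSCoeff_base, this.1]

lemma jetF2_zero (h2 : OrderTwo Ψ) : jetF2 Ψ 0 = 0 := by
  simp [jetF2, jetX_zero h2]

lemma jetDir_zero (h2 : OrderTwo Ψ) : jetDir Ψ 0 = (1, 0) := by
  simp [jetDir, jetF2_zero h2, jetG2_zero h2]

lemma pd_base_jetSCoeff (hΨ : AnalyticAt ℂ Ψ 0) (j : ℕ) :
    ∀ᶠ x in 𝓝 0, pd (1, 0) (jetSCoeff Ψ j) (jetBase + x • (1, 0)) = deriv (coeffAt Ψ j) x := by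
  have := pd_jetSCoeff hΨ j 1 0 0 0 0 0
  filter_upwards [this] with x hx
  refine hx.trans ?_
  simp

lemma jetSDeriv_zero (hΨ : AnalyticAt ℂ Ψ 0) (h2 : OrderTwo Ψ) (j : ℕ) :
    jetSDeriv Ψ j 0 = deriv (coeffAt Ψ j) 0 := by
  rw [jetSDeriv, jetDir_zero h2, jetVal_zero]
  simpa using (pd_base_jetSCoeff hΨ j).self_of_nhds

lemma sys_zero (hΨ : AnalyticAt ℂ Ψ 0) (h2 : OrderTwo Ψ) : sys Ψ 0 = 0 := by
  have hA : sysA Ψ 0 = 0 := by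
    simp [sysA, jetPt_zero, jetVal_zero, jetSCoeff_base, jetJac_zero]
  have hB : sysB Ψ 0 = 0 := by
    simp [sysB, jetPt_zero, jetVal_zero, jetSCoeff_base, jetJac_zero]
  have hJ : jacDeriv Ψ 0 = 0 := by simp [jacDeriv, jetF2_zero h2]
  have hv := fun G : ℂ × V4 × V4 → ℂ => pd_zero G 0
  have hC : sysC Ψ 0 = 0 := by
    simp [sysC, jetPt_zero, jetVel_zero, jetSDeriv_zero hΨ h2, jetJac_zero, hJ, hv]
  have hD : sysD Ψ 0 = 0 := by
    simp [sysD, jetPt_zero, jetSDeriv_zero hΨ h2, jetJac_zero, hJ]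
  rw [sys, hA, hB, hC, hD]; rfl

/-! ### First order variation of the ingredients of the system -/

section Linearization

variable (hΨ : AnalyticAt ℂ Ψ 0) (h2 : OrderTwo Ψ) (H G K : V4)

lemma hasDerivAt_lin (a : ℂ) : HasDerivAt (fun s : ℂ => s * a) a 0 := by
  simpa using (hasDerivAt_id (0 : ℂ)).mul_const a

/-- The `w`-component stays `0`: only the derivative in the unknowns matters for resonance. -/
def linPt (H G : V4) (s : ℂ) : ℂ × V4 × V4 :=
  (0, (s * H.1, s * H.2.1, s * H.2.2.1, s * H.2.2.2), (s * G.1, s * G.2.1, s * G.2.2.1, s * G.2.2.2))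

lemma linPt_zero : linPt H G 0 = 0 := by simp [linPt]

lemma hasDerivAt_linPt : HasDerivAt (linPt H G) (0, H, G) 0 := by
  have h := hasDerivAt_lin
  exact (hasDerivAt_const _ _).prodMk (((h _).prodMk ((h _).prodMk ((h _).prodMk (h _)))).prodMk
    ((h _).prodMk ((h _).prodMk ((h _).prodMk (h _)))))

lemma hasDerivAt_jetVal_lin : HasDerivAt (fun s => jetVal (linPt H G s))
    (H.2.2.1, H.1, 0, H.2.2.2, H.2.1, G.2.2.1, G.1) 0 := by
  have h := hasDerivAt_lin
  exact (h _).prodMk ((h _).prodMk ((hasDerivAt_const _ _).prodMk (((h _).const_add 1).prodMk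
    ((h _).prodMk ((h _).prodMk (h _))))))

include hΨ in
lemma hasDerivAt_jetSCoeff_lin (j : ℕ) : HasDerivAt (fun s => jetSCoeff Ψ j (jetVal (linPt H G s)))
    (pd (H.2.2.1, H.1, 0, H.2.2.2, H.2.1, G.2.2.1, G.1) (jetSCoeff Ψ j) jetBase) 0 := by
  have hb : jetVal (linPt H G 0) = jetBase := by rw [linPt_zero, jetVal_zero]
  have := hasDerivAt_comp_pd (G := jetSCoeff Ψ j) (c := fun s => jetVal (linPt H G s)) (t := 0)
    (by rw [hb]; exact (analyticAt_jetSCoeff hΨ j).differentiableAt) (hasDerivAt_jetVal_lin H G)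
  rwa [hb] at this

lemma hasDerivAt_jetJac_lin :
    HasDerivAt (fun s => jetJac (linPt H G s)) (H.2.2.2 + G.1) 0 := by
  have h := hasDerivAt_lin
  have := ((((h H.2.2.2).const_add 1).fun_mul ((h G.1).const_add 1)).fun_sub
    ((h H.2.1).fun_mul (h G.2.2.1)))
  exact this.congr_deriv (by simp)

include h2 in
lemma jetSCoeff_lin_zero : jetSCoeff Ψ 0 (jetVal (linPt H G 0)) = 0 := by
  rw [linPt_zero, jetVal_zero, jetSCoeff_base, h2.coeffAt.self_of_nhds.1]

include hΨ h2

lemma jetSCoeff_lin_values :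
    HasDerivAt (fun s => jetSCoeff Ψ 0 (jetVal (linPt H G s))) 0 0 ∧
    HasDerivAt (fun s => jetSCoeff Ψ 1 (jetVal (linPt H G s))) (2 * H.2.1 * coeffAt Ψ 2 0) 0 ∧
    HasDerivAt (fun s => jetSCoeff Ψ 2 (jetVal (linPt H G s)))
      ((H.2.2.2 + 2 * G.1) * coeffAt Ψ 2 0 + H.2.2.1 * deriv (coeffAt Ψ 2) 0
        + 3 * H.2.1 * coeffAt Ψ 3 0) 0 ∧
    HasDerivAt (fun s => jetSCoeff Ψ 3 (jetVal (linPt H G s)))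
      (3 * G.1 * coeffAt Ψ 3 0 + G.2.2.1 * coeffAt Ψ 2 0 + H.2.2.1 * deriv (coeffAt Ψ 3) 0
          + 4 * H.2.1 * coeffAt Ψ 4 0) 0 := by
  have := (pd_jetSCoeff_values hΨ h2 H.2.2.1 H.1 H.2.2.2 H.2.1 G.2.2.1 G.1).self_of_nhds
  simp only [zero_smul, add_zero] at this
  obtain ⟨e0, e1, e2, e3⟩ := this
  have hl := hasDerivAt_jetSCoeff_lin hΨ H G
  exact ⟨(hl 0).congr_deriv e0, (hl 1).congr_deriv e1, (hl 2).congr_deriv e2,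
    (hl 3).congr_deriv e3⟩

lemma hasDerivAt_jetX_lin : HasDerivAt (fun s => jetX Ψ (linPt H G s))
    (2 * H.2.1 * coeffAt Ψ 2 0 - 2 * G.2.1) 0 := by
  have h := hasDerivAt_lin
  have := ((jetSCoeff_lin_values hΨ h2 H G).2.1.fun_sub
    ((((h H.2.2.2).const_add 1).const_mul 2).fun_mul (h G.2.1))).fun_add
      (((h H.2.1).const_mul 2).fun_mul (h G.2.2.2))
  exact this.congr_deriv (by simp)

/-- The `ζ⁰` coefficient has neither value nor linear part, and `γ_z` times `jetX` is a product of
two vanishing factors. -/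
lemma hasDerivAt_jetG2_lin : HasDerivAt (fun s => jetG2 Ψ (linPt H G s)) 0 0 := by
  have h := hasDerivAt_lin
  have := ((((h G.1).const_add 1).fun_mul (jetSCoeff_lin_values hΨ h2 H G).1).fun_sub
    ((h H.2.1).fun_mul (hasDerivAt_jetX_lin hΨ h2 H G))).fun_div (hasDerivAt_jetJac_lin H G)
    (by rw [linPt_zero, jetJac_zero]; simp)
  refine this.congr_deriv ?_
  rw [jetSCoeff_lin_zero h2]
  simp [linPt_zero, jetX_zero h2]

lemma hasDerivAt_jetF2_lin : HasDerivAt (fun s => jetF2 Ψ (linPt H G s))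
    (2 * G.2.1 - 2 * H.2.1 * coeffAt Ψ 2 0) 0 := by
  have h := hasDerivAt_lin
  have := (((h G.2.2.1).fun_mul (jetSCoeff_lin_values hΨ h2 H G).1).fun_sub
    (((h H.2.2.2).const_add 1).fun_mul (hasDerivAt_jetX_lin hΨ h2 H G))).fun_div
    (hasDerivAt_jetJac_lin H G)
    (by rw [linPt_zero, jetJac_zero]; simp)
  refine this.congr_deriv ?_
  rw [jetSCoeff_lin_zero h2]
  simp [linPt_zero, jetX_zero h2, jetJac_zero]

lemma pd_jetG2 : pd (0, H, G) (jetG2 Ψ) 0 = 0 := by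
  have := hasDerivAt_comp_pd (G := jetG2 Ψ) (t := 0)
    (by rw [linPt_zero]; exact (analyticAt_jetG2 hΨ).differentiableAt) (hasDerivAt_linPt H G)
  rw [linPt_zero] at this
  exact this.unique (hasDerivAt_jetG2_lin hΨ h2 H G)

lemma pd_jetF2 : pd (0, H, G) (jetF2 Ψ) 0 = 2 * G.2.1 - 2 * H.2.1 * coeffAt Ψ 2 0 := by
  have := hasDerivAt_comp_pd (G := jetF2 Ψ) (t := 0)
    (by rw [linPt_zero]; exact (analyticAt_jetF2 hΨ).differentiableAt) (hasDerivAt_linPt H G)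
  rw [linPt_zero] at this
  exact this.unique (hasDerivAt_jetF2_lin hΨ h2 H G)

lemma hasDerivAt_jetDir_lin : HasDerivAt (fun s => jetDir Ψ (linPt H G s))
    (H.2.2.2, H.2.1, 0, 2 * G.2.1 - 2 * H.2.1 * coeffAt Ψ 2 0, 0, G.2.2.2, G.2.1) 0 := by
  have h := hasDerivAt_lin
  exact ((h _).const_add 1).prodMk ((h _).prodMk ((hasDerivAt_const _ _).prodMk
    ((hasDerivAt_jetF2_lin hΨ h2 H G).prodMk ((hasDerivAt_jetG2_lin hΨ h2 H G).prodMk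
      ((h _).prodMk (h _))))))

/-- At the base the direction `jetDir` is `(1, 0)`, so moving the point contributes a mixed second
derivative. It is commuted so that the outer derivative runs along the line on which the inner one
is known. -/
lemma hasDerivAt_jetSDeriv_lin (j : ℕ) : HasDerivAt (fun s => jetSDeriv Ψ j (linPt H G s))
    (pd (1, 0) (pd (H.2.2.1, H.1, 0, H.2.2.2, H.2.1, G.2.2.1, G.1) (jetSCoeff Ψ j)) jetBase
      + pd (H.2.2.2, H.2.1, 0, 2 * G.2.1 - 2 * H.2.1 * coeffAt Ψ 2 0, 0, G.2.2.2, G.2.1)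
        (jetSCoeff Ψ j) jetBase) 0 := by
  have hb : jetVal (linPt H G 0) = jetBase := by rw [linPt_zero, jetVal_zero]
  have := hasDerivAt_fderiv_apply (G := jetSCoeff Ψ j) (t := 0)
    (by rw [hb]; exact analyticAt_jetSCoeff hΨ j) (hasDerivAt_jetVal_lin H G)
    (hasDerivAt_jetDir_lin hΨ h2 H G)
  rw [hb, linPt_zero, jetDir_zero h2, pd_comm (analyticAt_jetSCoeff hΨ j)] at this
  exact this

omit hΨ h2 in
lemma pd_base_eq_deriv {g : V7 → ℂ} {φ : ℂ → ℂ} (hg : AnalyticAt ℂ g jetBase)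
    (h : ∀ᶠ x in 𝓝 0, g (jetBase + x • (1, 0)) = φ x) : pd (1, 0) g jetBase = deriv φ 0 := by
  have hl : HasDerivAt (fun s : ℂ => jetBase + s • ((1, 0) : V7)) (1, 0) 0 := by
    simpa using ((hasDerivAt_id (0 : ℂ)).smul_const ((1, 0) : V7)).const_add jetBase
  have := hasDerivAt_comp_pd (G := g) (t := 0) (by simpa using hg.differentiableAt) hl
  have h1 := (this.congr_of_eventuallyEq (EventuallyEq.symm h)).deriv
  simpa using h1.symm

lemma jetSDeriv_lin_values :
    HasDerivAt (fun s => jetSDeriv Ψ 2 (linPt H G s))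
      ((H.2.2.2 + 2 * G.1) * deriv (coeffAt Ψ 2) 0 + H.2.2.1 * deriv (deriv (coeffAt Ψ 2)) 0
        + 3 * H.2.1 * deriv (coeffAt Ψ 3) 0
       + ((2 * G.2.1 - 2 * H.2.1 * coeffAt Ψ 2 0 + 2 * G.2.1) * coeffAt Ψ 2 0
        + H.2.2.2 * deriv (coeffAt Ψ 2) 0)) 0 ∧
    HasDerivAt (fun s => jetSDeriv Ψ 3 (linPt H G s))
      (3 * G.1 * deriv (coeffAt Ψ 3) 0 + G.2.2.1 * deriv (coeffAt Ψ 2) 0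
          + H.2.2.1 * deriv (deriv (coeffAt Ψ 3)) 0
          + 4 * H.2.1 * deriv (coeffAt Ψ 4) 0
       + (3 * G.2.1 * coeffAt Ψ 3 0 + G.2.2.2 * coeffAt Ψ 2 0
          + H.2.2.2 * deriv (coeffAt Ψ 3) 0)) 0 := by
  have hv := pd_jetSCoeff_values hΨ h2 H.2.2.1 H.1 H.2.2.2 H.2.1 G.2.2.1 G.1
  have hv' := (pd_jetSCoeff_values hΨ h2 H.2.2.2 H.2.1 (2 * G.2.1 - 2 * H.2.1 * coeffAt Ψ 2 0) 0
    G.2.2.2 G.2.1).self_of_nhds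
  simp only [zero_smul, add_zero] at hv'
  have d : ∀ j, HasDerivAt (coeffAt Ψ j) (deriv (coeffAt Ψ j) 0) 0 := fun j =>
    (analyticAt_coeffAt hΨ j).differentiableAt.hasDerivAt
  have d' : ∀ j, HasDerivAt (deriv (coeffAt Ψ j)) (deriv (deriv (coeffAt Ψ j)) 0) 0 := fun j =>
    (analyticAt_coeffAt hΨ j).deriv.differentiableAt.hasDerivAt
  constructor
  · have e := hasDerivAt_jetSDeriv_lin hΨ h2 H G 2
    rw [pd_base_eq_deriv (analyticAt_pd _ (analyticAt_jetSCoeff hΨ 2)) (hv.mono fun x hx => hx.2.2.1),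
      hv'.2.2.1, ((((d 2).const_mul _).fun_add ((d' 2).const_mul _)).fun_add
        ((d 3).const_mul _)).deriv] at e
    exact e.congr_deriv (by ring)
  · have e := hasDerivAt_jetSDeriv_lin hΨ h2 H G 3
    rw [pd_base_eq_deriv (analyticAt_pd _ (analyticAt_jetSCoeff hΨ 3)) (hv.mono fun x hx => hx.2.2.2),
      hv'.2.2.2, (((((d 3).const_mul _).fun_add ((d 2).const_mul _)).fun_add
        ((d' 3).const_mul _)).fun_add ((d 4).const_mul _)).deriv] at e
    exact e.congr_deriv (by ring)

end Linearization

end JetSystem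

/-! ### Linear part of the system, and its solution under non-resonance -/

section Linearization

variable {Ψ : ℂ × ℂ × ℂ → ℂ} (hΨ : AnalyticAt ℂ Ψ 0) (h2 : OrderTwo Ψ) (H G K : V4)

def linPt₃ (H G K : V4) (s : ℂ) : ℂ × V4 × V4 × V4 :=
  (0, (s * H.1, s * H.2.1, s * H.2.2.1, s * H.2.2.2),
    (s * G.1, s * G.2.1, s * G.2.2.1, s * G.2.2.2), (s * K.1, s * K.2.1, s * K.2.2.1, s * K.2.2.2))

lemma hasDerivAt_linPt₃ : HasDerivAt (linPt₃ H G K) (0, H, G, K) 0 := by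
  have h := hasDerivAt_lin
  exact (hasDerivAt_const _ _).prodMk (((h _).prodMk ((h _).prodMk ((h _).prodMk (h _)))).prodMk
    (((h _).prodMk ((h _).prodMk ((h _).prodMk (h _)))).prodMk
    ((h _).prodMk ((h _).prodMk ((h _).prodMk (h _))))))

lemma pd_zero_left {E F : Type*} [NormedAddCommGroup E] [NormedSpace ℂ E]
    [NormedAddCommGroup F] [NormedSpace ℂ F] (g : E → F) : pd 0 g = fun _ => 0 := by
  funext x; simp [pd]

/-- The velocity vanishes at `s = 0`, so no second derivative of `g` survives. -/
lemma hasDerivAt_velocity {g : ℂ × V4 × V4 → ℂ} (hg : AnalyticAt ℂ g 0) :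
    HasDerivAt (fun s => pd (linPt G K s) g (linPt H G s)) (pd (0, G, K) g 0) 0 := by
  have := hasDerivAt_fderiv_apply (G := g) (t := 0) (by rwa [linPt_zero])
    (hasDerivAt_linPt H G) (hasDerivAt_linPt G K)
  rw [linPt_zero, linPt_zero, pd_zero_left, pd] at this
  simpa using this

include hΨ h2

lemma hasDerivAt_sysA_lin : HasDerivAt (fun s => sysA Ψ (linPt₃ H G K s))
    (coeffAt Ψ 2 0 * G.1 + deriv (coeffAt Ψ 2) 0 * H.2.2.1 + 3 * coeffAt Ψ 3 0 * H.2.1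
      + 2 * G.2.2.2 - K.1) 0 := by
  have h := hasDerivAt_lin
  have := (((((jetSCoeff_lin_values hΨ h2 H G).2.2.1.fun_sub
    (((h G.2.2.1).const_mul 2).fun_mul (h G.2.1))).fun_sub
    (((h H.2.2.2).const_add 1).fun_mul (h K.1))).fun_add
    ((((h G.1).const_add 1).const_mul 2).fun_mul (h G.2.2.2))).fun_add
    ((h H.2.1).fun_mul (h K.2.2.1))).fun_sub ((hasDerivAt_jetJac_lin H G).mul_const (coeffAt Ψ 2 0))
  exact this.congr_deriv (by ring)

lemma hasDerivAt_sysB_lin : HasDerivAt (fun s => sysB Ψ (linPt₃ H G K s))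
    (coeffAt Ψ 2 0 * G.2.2.1 + deriv (coeffAt Ψ 3) 0 * H.2.2.1 + 4 * coeffAt Ψ 4 0 * H.2.1
      + 2 * coeffAt Ψ 3 0 * G.1 - coeffAt Ψ 3 0 * H.2.2.2 + K.2.2.1) 0 := by
  have h := hasDerivAt_lin
  have := ((((jetSCoeff_lin_values hΨ h2 H G).2.2.2.fun_sub
    ((h G.2.2.1).fun_mul (h K.1))).fun_add
    (((h G.1).const_add 1).fun_mul (h K.2.2.1)))).fun_sub
    ((hasDerivAt_jetJac_lin H G).mul_const (coeffAt Ψ 3 0))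
  exact this.congr_deriv (by ring)

lemma hasDerivAt_jacDeriv_lin : HasDerivAt (fun s => jacDeriv Ψ (linPt H G s))
    (3 * G.2.1 - 2 * H.2.1 * coeffAt Ψ 2 0) 0 := by
  have h := hasDerivAt_lin
  have := ((((hasDerivAt_jetF2_lin hΨ h2 H G).fun_mul ((h G.1).const_add 1)).fun_add
    (((h H.2.2.2).const_add 1).fun_mul (h G.2.1))).fun_sub
    ((hasDerivAt_jetG2_lin hΨ h2 H G).fun_mul (h G.2.2.1))).fun_sub
    ((h H.2.1).fun_mul (h G.2.2.2))
  refine this.congr_deriv ?_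
  simp only [linPt_zero, jetF2_zero h2, jetG2_zero h2]
  ring

lemma hasDerivAt_sysC_lin : HasDerivAt (fun s => sysC Ψ (linPt₃ H G K s))
    (3 * K.2.1 - 3 * coeffAt Ψ 2 0 * G.2.1 + deriv (coeffAt Ψ 2) 0 * G.1
      + deriv (coeffAt Ψ 2) 0 * H.2.2.2 + deriv (deriv (coeffAt Ψ 2)) 0 * H.2.2.1
      + 3 * deriv (coeffAt Ψ 3) 0 * H.2.1) 0 := by
  have h := hasDerivAt_lin
  have v1 := hasDerivAt_velocity H G K (analyticAt_jetG2 hΨ)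
  have v2 := hasDerivAt_velocity H G K (analyticAt_jetF2 hΨ)
  rw [pd_jetG2 hΨ h2] at v1
  rw [pd_jetF2 hΨ h2] at v2
  have hf := hasDerivAt_jetF2_lin hΨ h2 H G
  have hg := hasDerivAt_jetG2_lin hΨ h2 H G
  have := (((((((jetSDeriv_lin_values hΨ h2 H G).1.fun_sub
    ((((((h G.2.2.2).const_mul 2).fun_mul (h G.2.1)).fun_add
      (((h G.2.2.1).const_mul 2).fun_mul v1)).fun_add (hf.fun_mul (h K.1))).fun_add
      (((h H.2.2.2).const_add 1).fun_mul (h K.2.1)))).fun_add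
    (((h G.2.1).const_mul 2).fun_mul (h G.2.2.2))).fun_add
    ((((h G.1).const_add 1).const_mul 2).fun_mul v2)).fun_add
    (hg.fun_mul (h K.2.2.1))).fun_add ((h H.2.1).fun_mul (h K.2.2.2))).fun_sub
    ((hasDerivAt_jacDeriv_lin hΨ h2 H G).mul_const (coeffAt Ψ 2 0))).fun_sub
    ((hasDerivAt_jetJac_lin H G).mul_const (deriv (coeffAt Ψ 2) 0))
  refine this.congr_deriv ?_
  simp only [linPt_zero, jetF2_zero h2, jetG2_zero h2]
  rw [show pd 0 (jetG2 Ψ) 0 = 0 by simp [pd], show pd 0 (jetF2 Ψ) 0 = 0 by simp [pd]]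
  ring

lemma hasDerivAt_sysD_lin : HasDerivAt (fun s => sysD Ψ (linPt₃ H G K s))
    (deriv (coeffAt Ψ 2) 0 * G.2.2.1 + deriv (deriv (coeffAt Ψ 3)) 0 * H.2.2.1
      + 4 * deriv (coeffAt Ψ 4) 0 * H.2.1 + 2 * deriv (coeffAt Ψ 3) 0 * G.1
      + coeffAt Ψ 2 0 * G.2.2.2 + 2 * coeffAt Ψ 2 0 * coeffAt Ψ 3 0 * H.2.1 + K.2.2.2) 0 := by
  have h := hasDerivAt_lin
  have := ((((((jetSDeriv_lin_values hΨ h2 H G).2.fun_sub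
    ((h G.2.2.2).fun_mul (h K.1))).fun_sub
    ((h G.2.2.1).fun_mul (h K.2.1))).fun_add
    ((h G.2.1).fun_mul (h K.2.2.1))).fun_add
    (((h G.1).const_add 1).fun_mul (h K.2.2.2))).fun_sub
    ((hasDerivAt_jacDeriv_lin hΨ h2 H G).mul_const (coeffAt Ψ 3 0))).fun_sub
    ((hasDerivAt_jetJac_lin H G).mul_const (deriv (coeffAt Ψ 3) 0))
  exact this.congr_deriv (by ring)

/-- Assembles the linear parts of the four equations. The highest order unknowns appear as `-K₁`,
`K₃`, `3 K₂` and `K₄`, one in each equation, so the system can be solved for them. -/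
lemma pd_sys : pd (0, H, G, K) (sys Ψ) 0 =
    (coeffAt Ψ 2 0 * G.1 + deriv (coeffAt Ψ 2) 0 * H.2.2.1 + 3 * coeffAt Ψ 3 0 * H.2.1
      + 2 * G.2.2.2 - K.1,
    coeffAt Ψ 2 0 * G.2.2.1 + deriv (coeffAt Ψ 3) 0 * H.2.2.1 + 4 * coeffAt Ψ 4 0 * H.2.1
      + 2 * coeffAt Ψ 3 0 * G.1 - coeffAt Ψ 3 0 * H.2.2.2 + K.2.2.1,
    3 * K.2.1 - 3 * coeffAt Ψ 2 0 * G.2.1 + deriv (coeffAt Ψ 2) 0 * G.1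
      + deriv (coeffAt Ψ 2) 0 * H.2.2.2 + deriv (deriv (coeffAt Ψ 2)) 0 * H.2.2.1
      + 3 * deriv (coeffAt Ψ 3) 0 * H.2.1,
    deriv (coeffAt Ψ 2) 0 * G.2.2.1 + deriv (deriv (coeffAt Ψ 3)) 0 * H.2.2.1
      + 4 * deriv (coeffAt Ψ 4) 0 * H.2.1 + 2 * deriv (coeffAt Ψ 3) 0 * G.1
      + coeffAt Ψ 2 0 * G.2.2.2 + 2 * coeffAt Ψ 2 0 * coeffAt Ψ 3 0 * H.2.1 + K.2.2.2) := by
  have h0 : linPt₃ H G K 0 = 0 := by simp [linPt₃]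
  have := hasDerivAt_comp_pd (G := sys Ψ) (t := 0)
    (by rw [h0]; exact (analyticAt_sys hΨ).differentiableAt) (hasDerivAt_linPt₃ H G K)
  rw [h0] at this
  exact this.unique ((hasDerivAt_sysA_lin hΨ h2 H G K).prodMk
    ((hasDerivAt_sysB_lin hΨ h2 H G K).prodMk ((hasDerivAt_sysC_lin hΨ h2 H G K).prodMk
      (hasDerivAt_sysD_lin hΨ h2 H G K))))

omit hΨ h2

/-- `Φ(z, w, ζ) - ζ²`, the right-hand side in the logarithmic coordinate `log w`. -/
def logODE (Φ : ℂ × ℂ × ℂ → ℂ) (x : ℂ × ℂ × ℂ) : ℂ := Φ x - x.2.2 ^ 2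

lemma analyticAt_logODE {Φ : ℂ × ℂ × ℂ → ℂ} {x} (hΦ : AnalyticAt ℂ Φ x) :
    AnalyticAt ℂ (logODE Φ) x := by
  unfold logODE; fun_prop

lemma orderTwo_logODE {Φ : ℂ × ℂ × ℂ → ℂ} (hΦ : AnalyticAt ℂ Φ 0) (h2 : OrderTwo Φ) :
    OrderTwo (logODE Φ) := by
  have hc : Tendsto (fun x : ℂ × ℂ => ((x.1, x.2, 0) : ℂ × ℂ × ℂ)) (𝓝 0) (𝓝 0) :=
    tendsto_of_analyticAt (by fun_prop) rfl
  filter_upwards [h2, hc.eventually hΦ.eventually_analyticAt] with x hx ha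
  refine ⟨by simp [logODE, hx.1], ?_⟩
  have h1 : AnalyticAt ℂ (fun ζ => Φ (x.1, x.2, ζ)) 0 := ha.comp_at (by fun_prop) rfl
  have h3 : HasDerivAt (fun ζ : ℂ => ζ ^ 2) 0 0 := by simpa using hasDerivAt_pow 2 (0 : ℂ)
  have := h1.differentiableAt.hasDerivAt.fun_sub h3
  rw [hx.2, sub_zero] at this
  exact this.deriv

lemma cf_sq (j : ℕ) : cf (j + 2) (fun ζ : ℂ => ζ ^ 2) = if j = 0 then 1 else 0 := by
  have e : (fun ζ : ℂ => ζ ^ 2) = fun ζ => ζ * (ζ * 1) := by ext; ring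
  rw [e, cf_id_mul_succ _ (by fun_prop), cf_id_mul_succ _ (by fun_prop), cf_const]

lemma coeffAt_logODE {Φ : ℂ × ℂ × ℂ → ℂ} (hΦ : AnalyticAt ℂ Φ 0) (j : ℕ) :
    ∀ᶠ x in 𝓝 0, coeffAt (logODE Φ) (j + 2) x = coeffAt Φ (j + 2) x - if j = 0 then 1 else 0 := by
  have hc : Tendsto (fun x : ℂ => ((x, 0, 0) : ℂ × ℂ × ℂ)) (𝓝 0) (𝓝 0) :=
    tendsto_of_analyticAt (by fun_prop) rfl
  filter_upwards [hc.eventually hΦ.eventually_analyticAt] with x ha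
  have h1 : AnalyticAt ℂ (fun ζ => Φ (x, 0, ζ)) 0 := ha.comp_at (by fun_prop) rfl
  rw [← cf_sq, coeffAt, coeffAt, ← cf_sub _ h1 (by fun_prop)]
  rfl

/-- Passing to `log w` subtracts `ζ²`, which affects `α₀` only. -/
lemma odeCoeff_eq {Φ : ℂ × ℂ × ℂ → ℂ} (hΦ : AnalyticAt ℂ Φ 0) :
    let a := coeffAt (logODE Φ)
    odeCoeff Φ 0 2 = a 2 0 + 1 ∧ odeCoeff Φ 1 2 = deriv (a 2) 0 ∧
    odeCoeff Φ 2 2 = deriv (deriv (a 2)) 0 / 2 ∧ odeCoeff Φ 0 3 = a 3 0 ∧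
    odeCoeff Φ 1 3 = deriv (a 3) 0 ∧ odeCoeff Φ 2 3 = deriv (deriv (a 3)) 0 / 2 ∧
    odeCoeff Φ 0 4 = a 4 0 ∧ odeCoeff Φ 1 4 = deriv (a 4) 0 := by
  have e : ∀ j l, odeCoeff Φ j l = cf j (coeffAt Φ l) := fun j l => by
    rw [odeCoeff, taylorCoeff_eq_cf]; rfl
  have c2 : ∀ g : ℂ → ℂ, cf 2 g = deriv (deriv g) 0 / 2 := fun g => by
    simp [cf, iteratedDeriv_succ]
  have h2' : coeffAt (logODE Φ) 2 =ᶠ[𝓝 0] fun x => coeffAt Φ 2 x - 1 := coeffAt_logODE hΦ 0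
  have h3 : coeffAt (logODE Φ) 3 =ᶠ[𝓝 0] coeffAt Φ 3 := by
    simpa [EventuallyEq] using coeffAt_logODE hΦ 1
  have h4 : coeffAt (logODE Φ) 4 =ᶠ[𝓝 0] coeffAt Φ 4 := by
    simpa [EventuallyEq] using coeffAt_logODE hΦ 2
  have hd : deriv (coeffAt (logODE Φ) 2) =ᶠ[𝓝 0] deriv (coeffAt Φ 2) := by
    refine h2'.deriv.trans (Eventually.of_forall fun x => ?_)
    simp
  simp only [e, c2, cf_zero, cf_one]
  refine ⟨?_, hd.eq_of_nhds.symm, ?_, h3.eq_of_nhds.symm, h3.deriv.eq_of_nhds.symm, ?_,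
    h4.eq_of_nhds.symm, h4.deriv.eq_of_nhds.symm⟩
  · rw [h2'.eq_of_nhds]; ring
  · rw [hd.deriv.eq_of_nhds]
  · rw [h3.deriv.deriv.eq_of_nhds]

/-- The Cauchy data of a normalizing transformation exist and are unique when the equation is
non-resonant. -/
theorem exists_cauchyData {Φ : ℂ × ℂ × ℂ → ℂ} (hΦ : AnalyticAt ℂ Φ 0) (h2 : OrderTwo Φ)
    (hres : IsNonResonantODE Φ) :
    (∃ H : ℂ → V4, AnalyticAt ℂ H 0 ∧ H 0 = 0 ∧ ∀ᶠ w in 𝓝 0,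
      sys (logODE Φ) (w, H w, euler H w, euler (euler H) w) = 0) ∧
    ∀ H₁ H₂ : ℂ → V4, AnalyticAt ℂ H₁ 0 → H₁ 0 = 0 →
      (∀ᶠ w in 𝓝 0, sys (logODE Φ) (w, H₁ w, euler H₁ w, euler (euler H₁) w) = 0) →
      AnalyticAt ℂ H₂ 0 → H₂ 0 = 0 →
      (∀ᶠ w in 𝓝 0, sys (logODE Φ) (w, H₂ w, euler H₂ w, euler (euler H₂) w) = 0) →
      H₁ =ᶠ[𝓝 0] H₂ := by
  have hΨ := analyticAt_logODE hΦ
  have h2' := orderTwo_logODE hΦ h2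
  have hp := pd_sys hΨ h2'
  refine briotBouquet_second_order (analyticAt_sys hΨ) (sys_zero hΨ h2') ?_ ?_
  · rintro ⟨v1, v2, v3, v4⟩ hv
    have hv' := (hp 0 0 (v1, v2, v3, v4)).symm.trans hv
    simpa [Prod.ext_iff, and_left_comm] using hv'
  · rintro k hk ⟨v1, v2, v3, v4⟩ hv
    have hv' := (hp _ _ _).symm.trans hv
    by_contra hne
    -- A vector `v` for which the linear part kills `(v, k v, k² v)` gives the eigenvector `(v, k
    -- v)` of the block matrix.
    refine hres k hk (Module.End.hasEigenvalue_of_hasEigenvector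
      (x := Sum.elim ![v1, v2, v3, v4] ((k : ℂ) • ![v1, v2, v3, v4]))
      (Module.End.hasEigenvector_iff.mpr ⟨Module.End.mem_eigenspace_iff.mpr ?_, ?_⟩))
    · obtain ⟨q1, q2, q3, q4, q5, q6, q7, q8⟩ := odeCoeff_eq hΦ
      simp only [Prod.mk_eq_zero, Prod.smul_mk, smul_eq_mul] at hv'
      obtain ⟨r1, r2, r3, r4⟩ := hv'
      rw [Matrix.toLin'_apply, principalMatrix, Matrix.fromBlocks_mulVec]
      ext i
      rcases i with i | i
      · fin_cases i <;> simp
      · fin_cases i <;>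
        simp [cauchyMatrixH, cauchyMatrixG, Matrix.mulVec, dotProduct, Fin.sum_univ_four,
          q1, q2, q3, q4, q5, q6, q7, q8, Matrix.one_apply]
        -- The matrix rows follow the order `γ₀, γ₁, f₀, f₁`, whereas the four equations have
        -- leading terms `-γ₀`, `f₀`, `3 γ₁` and `f₁`. This accounts for the permutation and the
        -- factor `1 / 3`.
        · linear_combination r1
        · linear_combination -r3/3
        · linear_combination -r2
        · linear_combination -r4
    · intro h
      have h' : ∀ i, ![v1, v2, v3, v4] i = 0 := fun i => congrFun h (Sum.inl i)
      have e0 : v1 = 0 := h' 0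
      have e1 : v2 = 0 := h' 1
      have e2 : v3 = 0 := h' 2
      have e3 : v4 = 0 := h' 3
      exact hne (by rw [e0, e1, e2, e3]; rfl)

end Linearization

/-! ### Jets at `z = 0` of admissible complex defining functions -/

section LogAdmissible

/-- Normalization of the function `λ` in the complex defining equation `w = τ e ^ λ(z, χ, τ)`. -/
structure LogAdmissible (c : ℂ) (Λ : ℂ × ℂ × ℂ → ℂ) : Prop where
  analyticAt : AnalyticAt ℂ Λ 0
  left : ∀ᶠ x : ℂ × ℂ in 𝓝 0, Λ (0, x.1, x.2) = 0
  right : ∀ᶠ x : ℂ × ℂ in 𝓝 0, Λ (x.1, 0, x.2) = 0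
  pd_left : ∀ᶠ x : ℂ × ℂ in 𝓝 0, pd (1, 0, 0) Λ (0, x.1, x.2) = c * x.1
  pd_right : ∀ᶠ x : ℂ × ℂ in 𝓝 0, pd (0, 1, 0) Λ (x.1, 0, x.2) = c * x.1

/-- `∂²Λ/∂z²` at `(0, χ, τ)`, as a function of `(τ, χ)` -/
noncomputable def secondJet (Λ : ℂ × ℂ × ℂ → ℂ) (x : ℂ × ℂ) : ℂ :=
  pd (1, 0, 0) (pd (1, 0, 0) Λ) (0, x.2, x.1)

/-- `∂³Λ/∂z³` at `(0, χ, τ)`, as a function of `(τ, χ)` -/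
noncomputable def thirdJet (Λ : ℂ × ℂ × ℂ → ℂ) (x : ℂ × ℂ) : ℂ :=
  pd (1, 0, 0) (pd (1, 0, 0) (pd (1, 0, 0) Λ)) (0, x.2, x.1)

noncomputable def secondCoeff (Λ : ℂ × ℂ × ℂ → ℂ) (j : ℕ) (τ : ℂ) : ℂ :=
  cf j fun χ => secondJet Λ (τ, χ)

noncomputable def thirdCoeff (Λ : ℂ × ℂ × ℂ → ℂ) (j : ℕ) (τ : ℂ) : ℂ :=
  cf j fun χ => thirdJet Λ (τ, χ)

lemma pd_slice_right {G : ℂ × ℂ × ℂ → ℂ} {g g' : ℂ → ℂ} (hG : AnalyticAt ℂ G 0)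
    (hg : ∀ z, HasDerivAt g (g' z) z) (h : ∀ᶠ x : ℂ × ℂ in 𝓝 0, G (x.1, 0, x.2) = g x.1) :
    ∀ᶠ x : ℂ × ℂ in 𝓝 0, pd (1, 0, 0) G (x.1, 0, x.2) = g' x.1 := by
  have hc : Tendsto (fun x : ℂ × ℂ => ((x.1, 0, x.2) : ℂ × ℂ × ℂ)) (𝓝 0) (𝓝 0) :=
    tendsto_of_analyticAt (by fun_prop) rfl
  filter_upwards [h.eventually_nhds, hc.eventually hG.eventually_analyticAt] with x hx ha
  have hl : Tendsto (fun s : ℂ => (s, x.2)) (𝓝 x.1) (𝓝 x) :=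
    tendsto_of_analyticAt (by fun_prop) rfl
  have h1 := hasDerivAt_comp₃ (G := G) (a := fun s => s) (b := fun _ => 0) (c := fun _ => x.2)
    (t := x.1) ha.differentiableAt (hasDerivAt_id _) (hasDerivAt_const _ _) (hasDerivAt_const _ _)
  have h2 := h1.congr_of_eventuallyEq (EventuallyEq.symm (hl.eventually hx))
  simpa using h2.unique (hg x.1)

variable {c : ℂ} {Λ : ℂ × ℂ × ℂ → ℂ}

@[fun_prop]
lemma analyticAt_secondJet {x : ℂ × ℂ} (h : AnalyticAt ℂ Λ (0, x.2, x.1)) :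
    AnalyticAt ℂ (secondJet Λ) x :=
  (analyticAt_pd (1, 0, 0) (analyticAt_pd (1, 0, 0) h)).comp_at (by fun_prop) rfl

@[fun_prop]
lemma analyticAt_thirdJet {x : ℂ × ℂ} (h : AnalyticAt ℂ Λ (0, x.2, x.1)) :
    AnalyticAt ℂ (thirdJet Λ) x :=
  (analyticAt_pd (1, 0, 0) (analyticAt_pd (1, 0, 0) (analyticAt_pd (1, 0, 0) h))).comp_at
    (by fun_prop) rfl

/-- On `χ = 0` the function vanishes and its `χ`-derivative is linear in `z`, so `z`-derivatives of
order two and three of both are zero there. -/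
lemma LogAdmissible.coeff_eq_zero (h : LogAdmissible c Λ) : ∀ᶠ τ in 𝓝 0,
    secondCoeff Λ 0 τ = 0 ∧ secondCoeff Λ 1 τ = 0 ∧ thirdCoeff Λ 0 τ = 0 ∧
      thirdCoeff Λ 1 τ = 0 := by
  have hc : Tendsto (fun τ : ℂ => ((0, 0, τ) : ℂ × ℂ × ℂ)) (𝓝 0) (𝓝 0) :=
    tendsto_of_analyticAt (by fun_prop) rfl
  have hc2 : Tendsto (fun τ : ℂ => ((0, τ) : ℂ × ℂ)) (𝓝 0) (𝓝 0) :=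
    tendsto_of_analyticAt (by fun_prop) rfl
  have ha := h.analyticAt
  have z0 : ∀ z : ℂ, HasDerivAt (fun _ : ℂ => (0 : ℂ)) ((fun _ => 0) z) z :=
    fun z => hasDerivAt_const _ _
  have p1 := pd_slice_right (g' := fun _ => 0) ha z0 h.right
  have p2 := pd_slice_right (g' := fun _ => 0) (analyticAt_pd _ ha) z0 p1
  have p3 := pd_slice_right (g' := fun _ => 0) (analyticAt_pd _ (analyticAt_pd _ ha)) z0 p2
  have q1 := pd_slice_right (g := fun z => c * z) (g' := fun _ => c) (analyticAt_pd _ ha)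
    (fun z => by simpa using (hasDerivAt_id z).const_mul c) h.pd_right
  have q2 := pd_slice_right (g' := fun _ => 0) (analyticAt_pd _ (analyticAt_pd _ ha))
    (fun z => hasDerivAt_const _ _) q1
  have q3 := pd_slice_right (g' := fun _ => 0)
    (analyticAt_pd _ (analyticAt_pd _ (analyticAt_pd _ ha))) z0 q2
  have hd : ∀ {G : ℂ × ℂ × ℂ → ℂ} {τ : ℂ}, AnalyticAt ℂ G (0, 0, τ) →
      cf 1 (fun χ => G (0, χ, τ)) = pd (0, 1, 0) G (0, 0, τ) := fun {G τ} hG => by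
    have := hasDerivAt_comp₃ (G := G) (a := fun _ => 0) (b := fun s => s) (c := fun _ => τ)
      (t := 0) hG.differentiableAt (hasDerivAt_const _ _) (hasDerivAt_id _)
      (hasDerivAt_const _ _)
    rw [cf_one, this.deriv]; simp
  filter_upwards [hc.eventually ha.eventually_analyticAt.eventually_nhds, hc2.eventually p2,
    hc2.eventually p3, hc2.eventually q2, hc2.eventually q3] with τ e1 e2 e3 e4 e5
  have e := e1.self_of_nhds
  have s1 : pd (0, 1, 0) (pd (1, 0, 0) (pd (1, 0, 0) Λ)) =ᶠ[𝓝 (0, 0, τ)]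
      pd (1, 0, 0) (pd (1, 0, 0) (pd (0, 1, 0) Λ)) := by
    have t1 : pd (0, 1, 0) (pd (1, 0, 0) Λ) =ᶠ[𝓝 (0, 0, τ)] pd (1, 0, 0) (pd (0, 1, 0) Λ) := by
      filter_upwards [e1] with y hy using pd_comm hy _ _
    refine EventuallyEq.trans ?_ (pd_eventuallyEq (1, 0, 0) t1)
    filter_upwards [e1] with y hy using pd_comm (analyticAt_pd _ hy) _ _
  have s2 : pd (0, 1, 0) (pd (1, 0, 0) (pd (1, 0, 0) (pd (1, 0, 0) Λ))) (0, 0, τ) =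
      pd (1, 0, 0) (pd (1, 0, 0) (pd (1, 0, 0) (pd (0, 1, 0) Λ))) (0, 0, τ) := by
    rw [pd_comm (analyticAt_pd _ (analyticAt_pd _ e))]
    exact pd_congr _ s1
  refine ⟨?_, ?_, ?_, ?_⟩
  · rw [secondCoeff, cf_zero]; exact e2
  · rw [secondCoeff]
    exact (hd (analyticAt_pd _ (analyticAt_pd _ e))).trans (s1.eq_of_nhds.trans e4)
  · rw [thirdCoeff, cf_zero]; exact e3
  · rw [thirdCoeff]
    exact (hd (analyticAt_pd _ (analyticAt_pd _ (analyticAt_pd _ e)))).trans (s2.trans e5)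

variable {R : (ℂ × ℂ) × ℂ → ℂ} {J : ℂ × ℂ → ℂ}

lemma tendsto_left : Tendsto (fun x : ℂ × ℂ => ((0, x.2, x.1) : ℂ × ℂ × ℂ)) (𝓝 0) (𝓝 0) :=
  tendsto_of_analyticAt (by fun_prop) rfl

lemma LogAdmissible.eventually_left (h : LogAdmissible c Λ) : ∀ᶠ x : ℂ × ℂ in 𝓝 0,
    Λ (0, x.2, x.1) = 0 ∧ pd (1, 0, 0) Λ (0, x.2, x.1) = c * x.2 := by
  have hc : Tendsto (fun x : ℂ × ℂ => ((x.2, x.1) : ℂ × ℂ)) (𝓝 0) (𝓝 0) :=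
    tendsto_of_analyticAt (by fun_prop) rfl
  exact (hc.eventually h.left).and (hc.eventually h.pd_left)

/-- The Segre curve with parameters `(χ, τ)` passes through `(0, τ)` with logarithmic slope `c χ`.
-/
lemma LogAdmissible.jet_zero (h : LogAdmissible c Λ)
    (hpb : ∀ᶠ x : ℂ × ℂ × ℂ in 𝓝 0, pd (1, 0, 0) (pd (1, 0, 0) Λ) x * J (x.1, x.2.2 * exp (Λ x)) =
      R ((x.1, x.2.2 * exp (Λ x)), pd (1, 0, 0) Λ x)) :
    ∀ᶠ x : ℂ × ℂ in 𝓝 0, R ((0, x.1), c * x.2) = secondJet Λ x * J (0, x.1) := by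
  filter_upwards [tendsto_left.eventually hpb, h.eventually_left] with x h1 h2
  simp only [h2.1, h2.2, exp_zero, mul_one] at h1
  exact h1.symm

/-- Comparison of the coefficients of `ζ ^ j` at `z = 0`. -/
lemma LogAdmissible.cf_jet_zero (h : LogAdmissible c Λ)
    (hpb : ∀ᶠ x : ℂ × ℂ × ℂ in 𝓝 0, pd (1, 0, 0) (pd (1, 0, 0) Λ) x * J (x.1, x.2.2 * exp (Λ x)) =
      R ((x.1, x.2.2 * exp (Λ x)), pd (1, 0, 0) Λ x)) :
    ∀ᶠ τ in 𝓝 0, ∀ j, c ^ j * cf j (fun ζ => R ((0, τ), ζ)) = J (0, τ) * secondCoeff Λ j τ := by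
  filter_upwards [eventually_slice (h.jet_zero hpb)] with τ hτ j
  rw [← cf_comp_const_mul, secondCoeff, ← cf_const_mul]
  refine cf_congr j ?_
  filter_upwards [hτ] with χ hχ
  rw [hχ, mul_comm]

/-- Differentiating the equation along a Segre curve at `z = 0` also produces derivatives of `R` in
`w` and in `ζ`. They are eliminated by differentiating the identity at `z = 0` in `τ` and in `χ`.
The factor `c` avoids a division in the second elimination. -/
lemma LogAdmissible.jet_one (h : LogAdmissible c Λ) (hR : AnalyticAt ℂ R 0)
    (hJ : AnalyticAt ℂ J 0)
    (hpb : ∀ᶠ x : ℂ × ℂ × ℂ in 𝓝 0, pd (1, 0, 0) (pd (1, 0, 0) Λ) x * J (x.1, x.2.2 * exp (Λ x)) =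
      R ((x.1, x.2.2 * exp (Λ x)), pd (1, 0, 0) Λ x)) :
    ∀ᶠ x : ℂ × ℂ in 𝓝 0, c * pd ((1, 0), 0) R ((0, x.1), c * x.2) =
      c * (J (0, x.1) * thirdJet Λ x + pd (1, 0) J (0, x.1) * secondJet Λ x)
        - c ^ 2 * (x.1 * J (0, x.1)) * (x.2 * pd (1, 0) (secondJet Λ) x)
        - J (0, x.1) * (secondJet Λ x * pd (0, 1) (secondJet Λ) x) := by
  have hc : Tendsto (fun x : ℂ × ℂ => (((0, x.1), c * x.2) : (ℂ × ℂ) × ℂ)) (𝓝 0) (𝓝 0) :=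
    tendsto_of_analyticAt (by fun_prop) (by simp)
  have hc' : Tendsto (fun x : ℂ × ℂ => ((0, x.1) : ℂ × ℂ)) (𝓝 0) (𝓝 0) :=
    tendsto_of_analyticAt (by fun_prop) rfl
  filter_upwards [tendsto_left.eventually hpb.eventually_nhds, h.eventually_left,
    (h.jet_zero hpb).eventually_nhds, hc.eventually hR.eventually_analyticAt,
    hc'.eventually hJ.eventually_analyticAt, tendsto_left.eventually
    h.analyticAt.eventually_analyticAt] with x h1 h2 h3 h4 h5 h6
  obtain ⟨τ, χ⟩ := x
  simp only at h1 h2 h3 h4 h5 h6 ⊢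
  have hN : AnalyticAt ℂ (secondJet Λ) (τ, χ) := analyticAt_secondJet h6
  have hl : ∀ {G : ℂ × ℂ × ℂ → ℂ}, AnalyticAt ℂ G (0, χ, τ) →
      HasDerivAt (fun z => G (z, χ, τ)) (pd (1, 0, 0) G (0, χ, τ)) 0 := fun {G} hG => by
    simpa using hasDerivAt_comp₃ (G := G) (a := fun s => s) (b := fun _ => χ) (c := fun _ => τ)
      (t := 0) hG.differentiableAt (hasDerivAt_id _) (hasDerivAt_const _ _) (hasDerivAt_const _ _)
  have hΛ := hl h6
  have hΛ1 := hl (analyticAt_pd (1, 0, 0) h6)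
  have hΛ2 := hl (analyticAt_pd (1, 0, 0) (analyticAt_pd (1, 0, 0) h6))
  have hW : HasDerivAt (fun z => τ * exp (Λ (z, χ, τ))) (τ * (c * χ)) 0 := by
    have := (hΛ.cexp).const_mul τ
    rw [h2.1, h2.2, exp_zero, one_mul] at this
    exact this
  -- derivative in `z`
  have d1 := hΛ2.fun_mul (hasDerivAt_comp₂ (G := J) (t := 0)
    (by simpa [h2.1] using h5.differentiableAt) (hasDerivAt_id (0 : ℂ)) hW)
  have d2 := hasDerivAt_comp_pd (G := R) (t := 0) (c := fun z =>
      ((z, τ * exp (Λ (z, χ, τ))), pd (1, 0, 0) Λ (z, χ, τ)))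
    (by simpa [h2.1, h2.2] using h4.differentiableAt) (((hasDerivAt_id (0 : ℂ)).prodMk hW).prodMk hΛ1)
  have hcz : Tendsto (fun z : ℂ => ((z, χ, τ) : ℂ × ℂ × ℂ)) (𝓝 0) (𝓝 (0, χ, τ)) :=
    tendsto_of_analyticAt (by fun_prop) rfl
  have d3 := d1.unique (d2.congr_of_eventuallyEq (hcz.eventually h1))
  simp only [h2.1, h2.2, exp_zero, mul_one, id] at d3
  have split : ∀ a b d : ℂ, pd ((a, b), d) R ((0, τ), c * χ) = a * pd ((1, 0), 0) R ((0, τ), c * χ)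
      + b * pd ((0, 1), 0) R ((0, τ), c * χ) + d * pd ((0, 0), 1) R ((0, τ), c * χ) := by
    intro a b d
    have e : (((a, b), d) : (ℂ × ℂ) × ℂ) = a • ((1, 0), 0) + b • ((0, 1), 0) + d • ((0, 0), 1) := by
      simp
    rw [e, pd_add, pd_add, pd_smul, pd_smul, pd_smul]; rfl
  rw [split] at d3
  -- derivatives in `τ` and `χ`
  have t1 := hasDerivAt_comp_pd (G := R) (t := τ) (c := fun s => ((0, s), c * χ))
    h4.differentiableAt (((hasDerivAt_const _ _).prodMk (hasDerivAt_id τ)).prodMk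
      (hasDerivAt_const _ _))
  have t2 := (hasDerivAt_comp₂ (G := secondJet Λ) (t := τ) (b := fun _ => χ)
    hN.differentiableAt (hasDerivAt_id τ) (hasDerivAt_const _ _)).fun_mul
    (hasDerivAt_comp₂ (G := J) (t := τ) (a := fun _ => 0) h5.differentiableAt
      (hasDerivAt_const _ _) (hasDerivAt_id τ))
  have hct : Tendsto (fun s : ℂ => ((s, χ) : ℂ × ℂ)) (𝓝 τ) (𝓝 (τ, χ)) :=
    tendsto_of_analyticAt (by fun_prop) rfl
  have t3 := t1.unique (t2.congr_of_eventuallyEq (hct.eventually h3))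
  have u1 := hasDerivAt_comp_pd (G := R) (t := χ) (c := fun s => ((0, τ), c * s))
    h4.differentiableAt ((hasDerivAt_const _ _).prodMk ((hasDerivAt_id χ).const_mul c))
  have u2 := (hasDerivAt_comp₂ (G := secondJet Λ) (t := χ) (a := fun _ => τ)
    hN.differentiableAt (hasDerivAt_const _ _) (hasDerivAt_id χ)).mul_const (J (0, τ))
  have hcu : Tendsto (fun s : ℂ => ((τ, s) : ℂ × ℂ)) (𝓝 χ) (𝓝 (τ, χ)) :=
    tendsto_of_analyticAt (by fun_prop) rfl
  have u3 := u1.unique (u2.congr_of_eventuallyEq (hcu.eventually h3))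
  rw [← Prod.mk_zero_zero, split] at u3
  simp only [id, mul_one, one_mul, zero_mul, zero_add, add_zero] at t3 u3 d3
  rw [t3] at d3
  have e2 : pd (1, 0, 0) (pd (1, 0, 0) Λ) (0, χ, τ) = secondJet Λ (τ, χ) := rfl
  have e3 : pd (1, 0, 0) (pd (1, 0, 0) (pd (1, 0, 0) Λ)) (0, χ, τ) = thirdJet Λ (τ, χ) := rfl
  rw [e2, e3] at d3
  have u3' : c * pd ((0, 0), 1) R ((0, τ), c * χ) = pd (0, 1) (secondJet Λ) (τ, χ) * J (0, τ) := by
    rw [← u3]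
  linear_combination -c * d3 - secondJet Λ (τ, χ) * u3'

lemma cf_mul_deriv_two {g : ℂ → ℂ} (h : AnalyticAt ℂ g 0) (h0 : cf 0 g = 0) (h1 : cf 1 g = 0) :
    cf 2 (fun t => g t * deriv g t) = 0 := by
  rw [cf_mul _ h h.deriv]
  simp [Finset.sum_range_succ, h0, h1, cf_deriv]

lemma cf_mul_deriv_three {g : ℂ → ℂ} (h : AnalyticAt ℂ g 0) (h0 : cf 0 g = 0) (h1 : cf 1 g = 0) :
    cf 3 (fun t => g t * deriv g t) = 2 * cf 2 g ^ 2 := by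
  rw [cf_mul _ h h.deriv]
  simp [Finset.sum_range_succ, h0, h1, cf_deriv]
  ring

/-- Comparison of the coefficients of `z * ζ ^ 2` and `z * ζ ^ 3`. -/
lemma LogAdmissible.cf_jet_one (h : LogAdmissible c Λ) (hR : AnalyticAt ℂ R 0)
    (hJ : AnalyticAt ℂ J 0)
    (hpb : ∀ᶠ x : ℂ × ℂ × ℂ in 𝓝 0, pd (1, 0, 0) (pd (1, 0, 0) Λ) x * J (x.1, x.2.2 * exp (Λ x)) =
      R ((x.1, x.2.2 * exp (Λ x)), pd (1, 0, 0) Λ x)) :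
    ∀ᶠ τ in 𝓝 0,
      c * (c ^ 2 * cf 2 (fun ζ => pd ((1, 0), 0) R ((0, τ), ζ))) =
        c * (J (0, τ) * thirdCoeff Λ 2 τ + pd (1, 0) J (0, τ) * secondCoeff Λ 2 τ) ∧
      c * (c ^ 3 * cf 3 (fun ζ => pd ((1, 0), 0) R ((0, τ), ζ))) =
        c * (J (0, τ) * thirdCoeff Λ 3 τ + pd (1, 0) J (0, τ) * secondCoeff Λ 3 τ)
          - c ^ 2 * (τ * J (0, τ)) * deriv (secondCoeff Λ 2) τ
          - J (0, τ) * (2 * secondCoeff Λ 2 τ ^ 2) := by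
  have hc : Tendsto (fun τ : ℂ => ((0, 0, τ) : ℂ × ℂ × ℂ)) (𝓝 0) (𝓝 0) :=
    tendsto_of_analyticAt (by fun_prop) rfl
  filter_upwards [eventually_slice (h.jet_one hR hJ hpb), hc.eventually
    h.analyticAt.eventually_analyticAt, h.coeff_eq_zero.eventually_nhds,
    eventually_slice (tendsto_left.eventually h.analyticAt.eventually_analyticAt)] with τ h1 h2 h3 h4
  have hN : AnalyticAt ℂ (secondJet Λ) (τ, 0) := analyticAt_secondJet h2
  have hV : AnalyticAt ℂ (thirdJet Λ) (τ, 0) := analyticAt_thirdJet h2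
  have a1 : AnalyticAt ℂ (fun χ => secondJet Λ (τ, χ)) 0 := hN.comp_at (by fun_prop) rfl
  have a2 : AnalyticAt ℂ (fun χ => thirdJet Λ (τ, χ)) 0 := hV.comp_at (by fun_prop) rfl
  have a3 : AnalyticAt ℂ (fun χ => pd (1, 0) (secondJet Λ) (τ, χ)) 0 :=
    (analyticAt_pd (1, 0) hN).comp_at (by fun_prop) rfl
  have a4 := a1.deriv
  have b0 : cf 0 (fun χ => secondJet Λ (τ, χ)) = 0 := h3.self_of_nhds.1
  have b1 : cf 1 (fun χ => secondJet Λ (τ, χ)) = 0 := h3.self_of_nhds.2.1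
  have dτ : ∀ j, cf j (fun χ => pd (1, 0) (secondJet Λ) (τ, χ)) = deriv (secondCoeff Λ j) τ := by
    intro j
    rw [← pd_cf j 1 hN, pd, fderiv_apply_one_eq_deriv]; rfl
  have d1 : deriv (secondCoeff Λ 1) τ = 0 := by
    have : secondCoeff Λ 1 =ᶠ[𝓝 τ] fun _ => 0 := h3.mono fun y hy => hy.2.1
    rw [this.deriv_eq]; simp
  -- The factor `χ` in front of the `τ`-derivative of the second jet lowers the index, whence
  -- `secondCoeff Λ j` on the right.
  have key : ∀ j, c * (c ^ (j + 1) * cf (j + 1) (fun ζ => pd ((1, 0), 0) R ((0, τ), ζ))) =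
      c * (J (0, τ) * thirdCoeff Λ (j + 1) τ + pd (1, 0) J (0, τ) * secondCoeff Λ (j + 1) τ)
        - c ^ 2 * (τ * J (0, τ)) * deriv (secondCoeff Λ j) τ
        - J (0, τ) * cf (j + 1) (fun χ => secondJet Λ (τ, χ) *
          deriv (fun χ => secondJet Λ (τ, χ)) χ) := by
    intro j
    rw [← cf_comp_const_mul, ← cf_const_mul, ← dτ, ← cf_id_mul_succ j a3, thirdCoeff, secondCoeff,
      ← cf_const_mul, ← cf_const_mul, ← cf_add _ (by fun_prop) (by fun_prop), ← cf_const_mul,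
      ← cf_const_mul, ← cf_const_mul, ← cf_sub _ (by fun_prop) (by fun_prop),
      ← cf_sub _ (by fun_prop) (by fun_prop)]
    refine cf_congr _ ?_
    filter_upwards [h1, h4] with χ hχ hχ'
    have hN' : AnalyticAt ℂ (secondJet Λ) (τ, χ) := analyticAt_secondJet hχ'
    have := hasDerivAt_comp₂ (G := secondJet Λ) (a := fun _ => τ) (t := χ)
      hN'.differentiableAt (hasDerivAt_const _ _) (hasDerivAt_id _)
    simp only [id, zero_mul, one_mul, zero_add] at this
    rw [hχ, this.deriv]
  constructor
  -- The second jet starts at `χ²`, so its `χ¹` coefficient is identically zero and its product with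
  -- its `χ`-derivative starts at `χ³`.
  · rw [key 1, d1, cf_mul_deriv_two a1 b0 b1]; ring
  · rw [key 2, cf_mul_deriv_three a1 b0 b1]; rfl

end LogAdmissible

/-! ### The transformation rule for second order equations -/

section Transformation

/-- `∂/∂z` -/
noncomputable def dz (g : ℂ × ℂ → ℂ) : ℂ × ℂ → ℂ := pd (1, 0) g

/-- `w ∂/∂w` -/
noncomputable def dw (g : ℂ × ℂ → ℂ) (x : ℂ × ℂ) : ℂ := x.2 * pd (0, 1) g x

@[fun_prop]
lemma analyticAt_dz {g : ℂ × ℂ → ℂ} {x} (h : AnalyticAt ℂ g x) : AnalyticAt ℂ (dz g) x :=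
  analyticAt_pd _ h

@[fun_prop]
lemma analyticAt_dw {g : ℂ × ℂ → ℂ} {x} (h : AnalyticAt ℂ g x) : AnalyticAt ℂ (dw g) x := by
  unfold dw; fun_prop

lemma dw_eventuallyEq {g g' : ℂ × ℂ → ℂ} {x} (h : g =ᶠ[𝓝 x] g') : dw g =ᶠ[𝓝 x] dw g' := by
  filter_upwards [pd_eventuallyEq (0, 1) h] with y hy
  rw [dw, dw, hy]

lemma hasDerivAt_dz {g : ℂ × ℂ → ℂ} {z w : ℂ} (h : AnalyticAt ℂ g (z, w)) :
    HasDerivAt (fun s => g (s, w)) (dz g (z, w)) z := by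
  simpa [dz] using hasDerivAt_comp₂ (G := g) (b := fun _ => w) h.differentiableAt (hasDerivAt_id z)
    (hasDerivAt_const _ _)

lemma dz_dw {g : ℂ × ℂ → ℂ} {x} (h : AnalyticAt ℂ g x) : dz (dw g) x = dw (dz g) x := by
  have h1 := (hasDerivAt_dz (g := pd (0, 1) g) (z := x.1) (w := x.2) (by fun_prop)).const_mul x.2
  have h2 := hasDerivAt_dz (g := dw g) (z := x.1) (w := x.2) (by fun_prop)
  rw [h2.unique h1, dz, pd_comm h]; rfl

lemma dz_dw_eventuallyEq {g : ℂ × ℂ → ℂ} {x} (h : AnalyticAt ℂ g x) :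
    dz (dw g) =ᶠ[𝓝 x] dw (dz g) := h.eventually_analyticAt.mono fun _ hy => dz_dw hy

lemma dw_left {g : ℂ × ℂ → ℂ} {w : ℂ} (h : AnalyticAt ℂ g (0, w)) :
    dw g (0, w) = euler (fun w => g (0, w)) w := by
  have := hasDerivAt_comp₂ (G := g) (a := fun _ => 0) h.differentiableAt (hasDerivAt_const w _)
    (hasDerivAt_id w)
  simp only [id, zero_mul, one_mul, zero_add] at this
  rw [euler, this.deriv]; rfl

/-- The chain rule along the curve `w = W(z)`, with `W' = ζ W`. -/
lemma hasDerivAt_along {g : ℂ × ℂ → ℂ} {W : ℂ → ℂ} {z ζ : ℂ} (h : AnalyticAt ℂ g (z, W z))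
    (hW : HasDerivAt W (W z * ζ) z) :
    HasDerivAt (fun s => g (s, W s)) (dz g (z, W z) + ζ * dw g (z, W z)) z := by
  refine (hasDerivAt_comp₂ (G := g) h.differentiableAt (hasDerivAt_id z) hW).congr_deriv ?_
  simp only [dz, dw, id]; ring

variable (f γ : ℂ × ℂ → ℂ)

/-- Jacobian of `(z, log w) ↦ (f, log w + γ)` -/
noncomputable def logJac (x : ℂ × ℂ) : ℂ := dz f x * (1 + dw γ x) - dz γ x * dw f x

noncomputable def jetOf (x : ℂ × ℂ) : V7 := (f x, γ x, x.2, dz f x, dz γ x, dw f x, dw γ x)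

/-- Along a curve `y(z)` with slope `ζ`, put `X = f` and `Y = y + γ`. Then `Y'' X' - Y' X''` is the
Jacobian times `y''` minus a cubic polynomial in `ζ`; the `pull` functions are the coefficients of
this cubic. -/
noncomputable def pull0 (x : ℂ × ℂ) : ℂ := - dz f x * dz (dz γ) x + dz γ x * dz (dz f) x

noncomputable def pull1 (x : ℂ × ℂ) : ℂ :=
  - dw f x * dz (dz γ) x - 2 * dz f x * dw (dz γ) x + (1 + dw γ x) * dz (dz f) x
    + 2 * dz γ x * dw (dz f) x

noncomputable def pull2 (x : ℂ × ℂ) : ℂ :=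
  - 2 * dw f x * dw (dz γ) x - dz f x * dw (dw γ) x + 2 * (1 + dw γ x) * dw (dz f) x
    + dz γ x * dw (dw f) x

noncomputable def pull3 (x : ℂ × ℂ) : ℂ := - dw f x * dw (dw γ) x + (1 + dw γ x) * dw (dw f) x

/-- The transformed right-hand side, multiplied by the Jacobian. -/
noncomputable def pullback (Ψ : ℂ × ℂ × ℂ → ℂ) (y : (ℂ × ℂ) × ℂ) : ℂ :=
  jetS Ψ (jetOf f γ y.1, y.2) + (pull0 f γ y.1 + pull1 f γ y.1 * y.2 + pull2 f γ y.1 * y.2 ^ 2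
    + pull3 f γ y.1 * y.2 ^ 3)

variable {f γ} {Ψ : ℂ × ℂ × ℂ → ℂ}

@[fun_prop]
lemma analyticAt_logJac {x} (hf : AnalyticAt ℂ f x) (hγ : AnalyticAt ℂ γ x) :
    AnalyticAt ℂ (logJac f γ) x := by unfold logJac; fun_prop

@[fun_prop]
lemma analyticAt_jetOf {x} (hf : AnalyticAt ℂ f x) (hγ : AnalyticAt ℂ γ x) :
    AnalyticAt ℂ (jetOf f γ) x := by unfold jetOf; fun_prop

@[fun_prop]
lemma analyticAt_pull0 {x} (hf : AnalyticAt ℂ f x) (hγ : AnalyticAt ℂ γ x) :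
    AnalyticAt ℂ (pull0 f γ) x := by unfold pull0; fun_prop

@[fun_prop]
lemma analyticAt_pull1 {x} (hf : AnalyticAt ℂ f x) (hγ : AnalyticAt ℂ γ x) :
    AnalyticAt ℂ (pull1 f γ) x := by unfold pull1; fun_prop

@[fun_prop]
lemma analyticAt_pull2 {x} (hf : AnalyticAt ℂ f x) (hγ : AnalyticAt ℂ γ x) :
    AnalyticAt ℂ (pull2 f γ) x := by unfold pull2; fun_prop

@[fun_prop]
lemma analyticAt_pull3 {x} (hf : AnalyticAt ℂ f x) (hγ : AnalyticAt ℂ γ x) :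
    AnalyticAt ℂ (pull3 f γ) x := by unfold pull3; fun_prop

lemma cf_cubic {g : ℂ → ℂ} (hg : AnalyticAt ℂ g 0) (a b c d : ℂ) :
    cf 0 (fun t => g t + (a + b * t + c * t ^ 2 + d * t ^ 3)) = cf 0 g + a ∧
    cf 1 (fun t => g t + (a + b * t + c * t ^ 2 + d * t ^ 3)) = cf 1 g + b ∧
    cf 2 (fun t => g t + (a + b * t + c * t ^ 2 + d * t ^ 3)) = cf 2 g + c ∧
    cf 3 (fun t => g t + (a + b * t + c * t ^ 2 + d * t ^ 3)) = cf 3 g + d := by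
  have e : (fun t => g t + (a + b * t + c * t ^ 2 + d * t ^ 3)) =
      fun t => g t + (a + t * (b + t * (c + t * d))) := by ext; ring
  rw [e]
  refine ⟨?_, ?_, ?_, ?_⟩ <;> rw [cf_add _ hg (by fun_prop)] <;> congr 1
  · simp [cf_zero]
  · rw [cf_add _ (by fun_prop) (by fun_prop), cf_id_mul_succ _ (by fun_prop), cf_const, cf_zero]
    simp
  · rw [cf_add _ (by fun_prop) (by fun_prop), cf_id_mul_succ _ (by fun_prop),
      cf_add _ (by fun_prop) (by fun_prop), cf_id_mul_succ _ (by fun_prop), cf_const, cf_const,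
      cf_zero]
    simp
  · rw [cf_add _ (by fun_prop) (by fun_prop), cf_id_mul_succ _ (by fun_prop),
      cf_add _ (by fun_prop) (by fun_prop), cf_id_mul_succ _ (by fun_prop),
      cf_add _ (by fun_prop) (by fun_prop), cf_id_mul_succ _ (by fun_prop), cf_const, cf_const,
      cf_const, cf_const]
    simp

variable (f γ) in
/-- The germ at `0` of the transformation `(f, w e ^ γ)`, with the usual normalization. -/
structure NormalizedMap : Prop where
  analyticAt_fst : AnalyticAt ℂ f 0
  analyticAt_snd : AnalyticAt ℂ γ 0
  fst_zero : f 0 = 0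
  snd_zero : γ 0 = 0
  dz_fst : dz f 0 = 1
  dz_snd : dz γ 0 = 0

lemma NormalizedMap.jetOf_zero (h : NormalizedMap f γ) : jetOf f γ 0 = jetBase := by
  simp [jetOf, jetBase, h.fst_zero, h.snd_zero, h.dz_fst, h.dz_snd, dw]

lemma NormalizedMap.analyticAt_pullback (h : NormalizedMap f γ) (hΨ : AnalyticAt ℂ Ψ 0) :
    AnalyticAt ℂ (pullback f γ Ψ) 0 := by
  have hf := h.analyticAt_fst
  have hγ := h.analyticAt_snd
  have h1 : AnalyticAt ℂ (fun y : (ℂ × ℂ) × ℂ => jetS Ψ (jetOf f γ y.1, y.2)) 0 :=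
    (analyticAt_jetS hΨ).comp_at (g := fun y : (ℂ × ℂ) × ℂ => (jetOf f γ y.1, y.2))
      (by fun_prop (disch := simp [*])) (by simp [h.jetOf_zero])
  have c0 : AnalyticAt ℂ (fun y : (ℂ × ℂ) × ℂ => pull0 f γ y.1) 0 :=
    (analyticAt_pull0 hf hγ).comp_at (by fun_prop) rfl
  have c1 : AnalyticAt ℂ (fun y : (ℂ × ℂ) × ℂ => pull1 f γ y.1) 0 :=
    (analyticAt_pull1 hf hγ).comp_at (by fun_prop) rfl
  have c2 : AnalyticAt ℂ (fun y : (ℂ × ℂ) × ℂ => pull2 f γ y.1) 0 :=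
    (analyticAt_pull2 hf hγ).comp_at (by fun_prop) rfl
  have c3 : AnalyticAt ℂ (fun y : (ℂ × ℂ) × ℂ => pull3 f γ y.1) 0 :=
    (analyticAt_pull3 hf hγ).comp_at (by fun_prop) rfl
  unfold pullback
  fun_prop

lemma tendsto_left₂ : Tendsto (fun w : ℂ => ((0, w) : ℂ × ℂ)) (𝓝 0) (𝓝 0) :=
  tendsto_of_analyticAt (by fun_prop) rfl

lemma NormalizedMap.tendsto_jetOf (h : NormalizedMap f γ) :
    Tendsto (fun w : ℂ => jetOf f γ (0, w)) (𝓝 0) (𝓝 jetBase) := by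
  have hf := h.analyticAt_fst
  have hγ := h.analyticAt_snd
  exact (tendsto_of_analyticAt (by fun_prop) h.jetOf_zero).comp tendsto_left₂

lemma NormalizedMap.cf_pullback (h : NormalizedMap f γ) (hΨ : AnalyticAt ℂ Ψ 0) :
    ∀ᶠ w in 𝓝 0,
      cf 0 (fun ζ => pullback f γ Ψ ((0, w), ζ)) = jetSCoeff Ψ 0 (jetOf f γ (0, w)) + pull0 f γ (0, w) ∧
      cf 1 (fun ζ => pullback f γ Ψ ((0, w), ζ)) = jetSCoeff Ψ 1 (jetOf f γ (0, w)) + pull1 f γ (0, w) ∧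
      cf 2 (fun ζ => pullback f γ Ψ ((0, w), ζ)) = jetSCoeff Ψ 2 (jetOf f γ (0, w)) + pull2 f γ (0, w) ∧
      cf 3 (fun ζ => pullback f γ Ψ ((0, w), ζ)) = jetSCoeff Ψ 3 (jetOf f γ (0, w)) + pull3 f γ (0, w)
      := by
  have hc : Tendsto (fun m : V7 => (m, (0 : ℂ))) (𝓝 jetBase) (𝓝 (jetBase, 0)) :=
    Continuous.tendsto (f := fun m : V7 => (m, (0 : ℂ))) (by fun_prop) _
  filter_upwards [h.tendsto_jetOf.eventually (hc.eventually
    (analyticAt_jetS hΨ).eventually_analyticAt)] with w hw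
  have h1 : AnalyticAt ℂ (fun ζ => jetS Ψ (jetOf f γ (0, w), ζ)) 0 := hw.comp_at (by fun_prop) rfl
  exact cf_cubic h1 _ _ _ _

lemma hasDerivAt_jetOf {z w : ℂ} (hf : AnalyticAt ℂ f (z, w)) (hγ : AnalyticAt ℂ γ (z, w)) :
    HasDerivAt (fun s => jetOf f γ (s, w)) (dz f (z, w), dz γ (z, w), 0, dz (dz f) (z, w),
      dz (dz γ) (z, w), dw (dz f) (z, w), dw (dz γ) (z, w)) z := by
  rw [← dz_dw hf, ← dz_dw hγ]
  exact (hasDerivAt_dz hf).prodMk ((hasDerivAt_dz hγ).prodMk ((hasDerivAt_const _ _).prodMk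
    ((hasDerivAt_dz (by fun_prop)).prodMk ((hasDerivAt_dz (by fun_prop)).prodMk
      ((hasDerivAt_dz (by fun_prop)).prodMk (hasDerivAt_dz (by fun_prop)))))))

lemma NormalizedMap.cf_pd_pullback (h : NormalizedMap f γ) (hΨ : AnalyticAt ℂ Ψ 0) :
    ∀ᶠ w in 𝓝 0,
      let m' : V7 := (dz f (0, w), dz γ (0, w), 0, dz (dz f) (0, w),
        dz (dz γ) (0, w), dw (dz f) (0, w), dw (dz γ) (0, w))
      cf 2 (fun ζ => pd ((1, 0), 0) (pullback f γ Ψ) ((0, w), ζ)) =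
        pd m' (jetSCoeff Ψ 2) (jetOf f γ (0, w)) + dz (pull2 f γ) (0, w) ∧
      cf 3 (fun ζ => pd ((1, 0), 0) (pullback f γ Ψ) ((0, w), ζ)) =
        pd m' (jetSCoeff Ψ 3) (jetOf f γ (0, w)) + dz (pull3 f γ) (0, w) := by
  have hc : Tendsto (fun m : V7 => (m, (0 : ℂ))) (𝓝 jetBase) (𝓝 (jetBase, 0)) :=
    Continuous.tendsto (f := fun m : V7 => (m, (0 : ℂ))) (by fun_prop) _
  have hc2 : Tendsto (fun y : ℂ × ℂ => (((0, y.1), y.2) : (ℂ × ℂ) × ℂ)) (𝓝 0) (𝓝 0) :=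
    tendsto_of_analyticAt (by fun_prop) rfl
  have hc3 : Tendsto (fun y : ℂ × ℂ => ((jetOf f γ (0, y.1), y.2) : V7 × ℂ)) (𝓝 0)
      (𝓝 (jetBase, 0)) := by
    have h1 : Tendsto (fun y : ℂ × ℂ => y.1) (𝓝 0) (𝓝 0) := tendsto_of_analyticAt (by fun_prop) rfl
    have h2 : Tendsto (fun y : ℂ × ℂ => y.2) (𝓝 0) (𝓝 0) := tendsto_of_analyticAt (by fun_prop) rfl
    rw [nhds_prod_eq (x := jetBase)]
    exact (h.tendsto_jetOf.comp h1).prodMk h2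
  filter_upwards [h.tendsto_jetOf.eventually (hc.eventually
    (analyticAt_jetS hΨ).eventually_analyticAt),
    tendsto_left₂.eventually h.analyticAt_fst.eventually_analyticAt,
    tendsto_left₂.eventually h.analyticAt_snd.eventually_analyticAt,
    eventually_slice (hc2.eventually (h.analyticAt_pullback hΨ).eventually_analyticAt),
    eventually_slice (hc3.eventually (analyticAt_jetS hΨ).eventually_analyticAt)] with w hw hf hγ hp hS
  intro m'
  have h1 : AnalyticAt ℂ (fun ζ => pd (m', 0) (jetS Ψ) (jetOf f γ (0, w), ζ)) 0 :=
    (analyticAt_pd _ hw).comp_at (by fun_prop) rfl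
  have e : (fun ζ => pd ((1, 0), 0) (pullback f γ Ψ) ((0, w), ζ)) =ᶠ[𝓝 0]
      fun ζ => pd (m', 0) (jetS Ψ) (jetOf f γ (0, w), ζ) + (dz (pull0 f γ) (0, w)
        + dz (pull1 f γ) (0, w) * ζ + dz (pull2 f γ) (0, w) * ζ ^ 2
        + dz (pull3 f γ) (0, w) * ζ ^ 3) := by
    filter_upwards [hp, hS] with ζ hζ hSζ
    have d1 := hasDerivAt_comp_pd (G := pullback f γ Ψ) (t := 0) (c := fun s => ((s, w), ζ))
      hζ.differentiableAt (((hasDerivAt_id (0 : ℂ)).prodMk (hasDerivAt_const _ _)).prodMk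
        (hasDerivAt_const _ _))
    have d2 := hasDerivAt_comp_pd (G := jetS Ψ) (t := 0) (c := fun s => (jetOf f γ (s, w), ζ))
      hSζ.differentiableAt ((hasDerivAt_jetOf hf hγ).prodMk (hasDerivAt_const _ _))
    exact d1.unique (d2.fun_add ((((hasDerivAt_dz (analyticAt_pull0 hf hγ)).fun_add
      ((hasDerivAt_dz (analyticAt_pull1 hf hγ)).mul_const ζ)).fun_add
      ((hasDerivAt_dz (analyticAt_pull2 hf hγ)).mul_const (ζ ^ 2))).fun_add
      ((hasDerivAt_dz (analyticAt_pull3 hf hγ)).mul_const (ζ ^ 3))))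
  rw [cf_congr 2 e, cf_congr 3 e]
  unfold jetSCoeff
  rw [pd_cf 2 m' hw, pd_cf 3 m' hw]
  exact (cf_cubic h1 _ _ _ _).2.2

end Transformation

/-! ### The system evaluated on the Cauchy data of a transformation -/

section System

variable (f γ : ℂ × ℂ → ℂ)

/-- The Cauchy data at `z = 0` of the transformation `(f, w e ^ γ)`. -/
noncomputable def cauchyData (w : ℂ) : V4 := (γ (0, w), dz γ (0, w), f (0, w), dz f (0, w) - 1)

variable {f γ} {Ψ Λ : ℂ × ℂ × ℂ → ℂ} {c : ℂ}

lemma euler_tuple {a b d e : ℂ → ℂ} {w : ℂ} (ha : AnalyticAt ℂ a w) (hb : AnalyticAt ℂ b w)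
    (hd : AnalyticAt ℂ d w) (he : AnalyticAt ℂ e w) :
    euler (fun w => ((a w, b w, d w, e w) : V4)) w = (euler a w, euler b w, euler d w, euler e w) := by
  have := ha.differentiableAt.hasDerivAt.prodMk (hb.differentiableAt.hasDerivAt.prodMk
    (hd.differentiableAt.hasDerivAt.prodMk he.differentiableAt.hasDerivAt))
  rw [euler, this.deriv]; rfl

lemma NormalizedMap.cauchyData_zero (h : NormalizedMap f γ) : cauchyData f γ 0 = 0 := by
  have e : ((0, 0) : ℂ × ℂ) = 0 := rfl
  simp [cauchyData, e, h.fst_zero, h.snd_zero, h.dz_fst, h.dz_snd]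

lemma analyticAt_slice_left {g : ℂ × ℂ → ℂ} {w : ℂ} (h : AnalyticAt ℂ g (0, w)) :
    AnalyticAt ℂ (fun w => g (0, w)) w := h.comp_at (by fun_prop) rfl

lemma analyticAt_cauchyData {w : ℂ} (hf : AnalyticAt ℂ f (0, w)) (hγ : AnalyticAt ℂ γ (0, w)) :
    AnalyticAt ℂ (cauchyData f γ) w := by
  have h1 := analyticAt_slice_left hf
  have h2 := analyticAt_slice_left hγ
  have h3 := analyticAt_slice_left (analyticAt_dz hf)
  have h4 := analyticAt_slice_left (analyticAt_dz hγ)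
  unfold cauchyData
  fun_prop

lemma NormalizedMap.eventually_analyticAt (h : NormalizedMap f γ) :
    ∀ᶠ w in 𝓝 (0 : ℂ), AnalyticAt ℂ f (0, w) ∧ AnalyticAt ℂ γ (0, w) :=
  (tendsto_left₂.eventually h.analyticAt_fst.eventually_analyticAt).and
    (tendsto_left₂.eventually h.analyticAt_snd.eventually_analyticAt)

lemma euler_cauchyData {w : ℂ} (hf : AnalyticAt ℂ f (0, w)) (hγ : AnalyticAt ℂ γ (0, w)) :
    euler (cauchyData f γ) w =
      (dw γ (0, w), dw (dz γ) (0, w), dw f (0, w), dw (dz f) (0, w)) := by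
  have h1 := analyticAt_slice_left hf
  have h2 := analyticAt_slice_left hγ
  have h3 := analyticAt_slice_left (analyticAt_dz hf)
  have h4 := analyticAt_slice_left (analyticAt_dz hγ)
  rw [dw_left hf, dw_left hγ, dw_left (analyticAt_dz hf), dw_left (analyticAt_dz hγ)]
  unfold cauchyData
  rw [euler_tuple h2 h4 h1 (h3.fun_sub analyticAt_const)]
  simp [euler]

lemma NormalizedMap.cauchyData_jet (h : NormalizedMap f γ) : ∀ᶠ w in 𝓝 0,
    (w, cauchyData f γ w, euler (cauchyData f γ) w, euler (euler (cauchyData f γ)) w) =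
      (w, (γ (0, w), dz γ (0, w), f (0, w), dz f (0, w) - 1),
        (dw γ (0, w), dw (dz γ) (0, w), dw f (0, w), dw (dz f) (0, w)),
        (dw (dw γ) (0, w), dw (dw (dz γ)) (0, w), dw (dw f) (0, w), dw (dw (dz f)) (0, w))) := by
  filter_upwards [h.eventually_analyticAt.eventually_nhds] with w hw
  obtain ⟨hf, hγ⟩ := hw.self_of_nhds
  have e : euler (cauchyData f γ) =ᶠ[𝓝 w]
      fun w => (dw γ (0, w), dw (dz γ) (0, w), dw f (0, w), dw (dz f) (0, w)) :=
    hw.mono fun v hv => euler_cauchyData hv.1 hv.2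
  rw [euler_congr e, e.eq_of_nhds, euler_tuple (analyticAt_slice_left (analyticAt_dw hγ))
    (analyticAt_slice_left (analyticAt_dw (analyticAt_dz hγ)))
    (analyticAt_slice_left (analyticAt_dw hf))
    (analyticAt_slice_left (analyticAt_dw (analyticAt_dz hf))),
    ← dw_left (analyticAt_dw hγ), ← dw_left (analyticAt_dw (analyticAt_dz hγ)),
    ← dw_left (analyticAt_dw hf), ← dw_left (analyticAt_dw (analyticAt_dz hf))]
  rfl

lemma NormalizedMap.jetPt_jet (h : NormalizedMap f γ) : ∀ᶠ w in 𝓝 0,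
    jetVal (w, cauchyData f γ w, euler (cauchyData f γ) w) = jetOf f γ (0, w) ∧
    jetJac (w, cauchyData f γ w, euler (cauchyData f γ) w) = logJac f γ (0, w) := by
  filter_upwards [h.eventually_analyticAt] with w hw
  rw [euler_cauchyData hw.1 hw.2]
  simp [cauchyData, jetVal, jetOf, jetJac, logJac]

lemma eventually_logJac_ne (hn : NormalizedMap f γ) : ∀ᶠ w in 𝓝 0, logJac f γ (0, w) ≠ 0 := by
  have hf := hn.analyticAt_fst
  have hγ := hn.analyticAt_snd
  have e : logJac f γ 0 = 1 := by simp [logJac, hn.dz_fst, hn.dz_snd, dw]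
  have := tendsto_left₂.eventually ((analyticAt_logJac hf hγ).continuousAt.eventually_ne
    (y := 0) (by rw [e]; exact one_ne_zero))
  exact this

variable (hn : NormalizedMap f γ) (hΨ : AnalyticAt ℂ Ψ 0) (h : LogAdmissible c Λ) (hc : c ≠ 0)
  (hpb : ∀ᶠ x : ℂ × ℂ × ℂ in 𝓝 0,
    pd (1, 0, 0) (pd (1, 0, 0) Λ) x * logJac f γ (x.1, x.2.2 * exp (Λ x)) =
      pullback f γ Ψ ((x.1, x.2.2 * exp (Λ x)), pd (1, 0, 0) Λ x))

include hn hΨ h hc hpb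

/-- The second derivatives at `z = 0` are determined by the Cauchy data. -/
lemma second_derivatives : ∀ᶠ w in 𝓝 0,
    jetG2 Ψ (w, cauchyData f γ w, euler (cauchyData f γ) w) = dz (dz γ) (0, w) ∧
    jetF2 Ψ (w, cauchyData f γ w, euler (cauchyData f γ) w) = dz (dz f) (0, w) := by
  filter_upwards [h.cf_jet_zero hpb, h.coeff_eq_zero, hn.cf_pullback hΨ, hn.jetPt_jet,
    hn.eventually_analyticAt, eventually_logJac_ne hn] with w h1 h2 h3 h4 h5 h6
  have e0 := h1 0
  have e1 := h1 1
  rw [h3.1, h2.1] at e0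
  rw [h3.2.1, h2.2.1, pow_one, mul_zero, mul_eq_zero, or_iff_right hc] at e1
  rw [pow_zero, one_mul, mul_zero] at e0
  unfold jetG2 jetF2 jetX
  rw [h4.1, h4.2, div_eq_iff h6, div_eq_iff h6, euler_cauchyData h5.1 h5.2]
  simp only [cauchyData, logJac, pull0, pull1] at *
  constructor
  · linear_combination (1 + dw γ (0, w)) * e0 - dz γ (0, w) * e1
  · linear_combination dw f (0, w) * e0 - dz f (0, w) * e1

/-- The preceding identities hold along the curve `w ↦ (w, H, δH)`; applying `w d/dw` to them gives
these. -/
lemma pd_second_derivatives : ∀ᶠ w in 𝓝 0,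
    pd (w, euler (cauchyData f γ) w, euler (euler (cauchyData f γ)) w) (jetG2 Ψ)
      (w, cauchyData f γ w, euler (cauchyData f γ) w) = dw (dz (dz γ)) (0, w) ∧
    pd (w, euler (cauchyData f γ) w, euler (euler (cauchyData f γ)) w) (jetF2 Ψ)
      (w, cauchyData f γ w, euler (cauchyData f γ) w) = dw (dz (dz f)) (0, w) := by
  have hd : AnalyticAt ℂ (cauchyData f γ) 0 :=
    analyticAt_cauchyData hn.analyticAt_fst hn.analyticAt_snd
  have ht : Tendsto (fun w => (w, cauchyData f γ w, euler (cauchyData f γ) w)) (𝓝 0) (𝓝 0) :=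
    tendsto_of_analyticAt (by fun_prop) (by rw [hn.cauchyData_zero, euler_zero]; rfl)
  filter_upwards [(second_derivatives hn hΨ h hc hpb).eventually_nhds,
    ht.eventually (analyticAt_jetG2 hΨ).eventually_analyticAt,
    ht.eventually (analyticAt_jetF2 hΨ).eventually_analyticAt, hd.eventually_analyticAt,
    hn.eventually_analyticAt] with w h1 h2 h3 h4 h5
  have hcurve := (hasDerivAt_id w).prodMk (h4.differentiableAt.hasDerivAt.prodMk
    (analyticAt_euler h4).differentiableAt.hasDerivAt)
  have ev : (w, euler (cauchyData f γ) w, euler (euler (cauchyData f γ)) w) =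
      w • ((1, deriv (cauchyData f γ) w, deriv (euler (cauchyData f γ)) w) : ℂ × V4 × V4) := by
    simp [euler]
  have d1 := hasDerivAt_comp_pd (G := jetG2 Ψ) h2.differentiableAt hcurve
  have d2 := hasDerivAt_comp_pd (G := jetF2 Ψ) h3.differentiableAt hcurve
  have e1 : (fun w => jetG2 Ψ (w, cauchyData f γ w, euler (cauchyData f γ) w)) =ᶠ[𝓝 w]
      fun w => dz (dz γ) (0, w) := h1.mono fun v hv => hv.1
  have e2 : (fun w => jetF2 Ψ (w, cauchyData f γ w, euler (cauchyData f γ) w)) =ᶠ[𝓝 w]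
      fun w => dz (dz f) (0, w) := h1.mono fun v hv => hv.2
  rw [ev, pd_smul, pd_smul, dw_left (analyticAt_dz (analyticAt_dz h5.1)),
    dw_left (analyticAt_dz (analyticAt_dz h5.2)), ← euler_congr e1, ← euler_congr e2]
  exact ⟨congrArg (w • ·) d1.deriv.symm, congrArg (w • ·) d2.deriv.symm⟩

/-- The system for the Cauchy data, in terms of the coefficients of the transformed equation. -/
theorem sys_cauchyData : ∀ᶠ w in 𝓝 0,
    let x := (w, cauchyData f γ w, euler (cauchyData f γ) w, euler (euler (cauchyData f γ)) w)
    let J := logJac f γ (0, w)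
    let J' := dz (logJac f γ) (0, w)
    c ^ 2 * sysA Ψ x = J * (secondCoeff Λ 2 w - c ^ 2 * coeffAt Ψ 2 0) ∧
    c ^ 3 * sysB Ψ x = J * (secondCoeff Λ 3 w - c ^ 3 * coeffAt Ψ 3 0) ∧
    c ^ 3 * sysC Ψ x = c * J * (thirdCoeff Λ 2 w - c ^ 2 * deriv (coeffAt Ψ 2) 0)
      + c * J' * (secondCoeff Λ 2 w - c ^ 2 * coeffAt Ψ 2 0) ∧
    c ^ 4 * sysD Ψ x = J * (c * thirdCoeff Λ 3 w - c ^ 2 * (w * deriv (secondCoeff Λ 2) w)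
      - 2 * secondCoeff Λ 2 w ^ 2 - c ^ 4 * deriv (coeffAt Ψ 3) 0)
      + c * J' * (secondCoeff Λ 3 w - c ^ 3 * coeffAt Ψ 3 0) := by
  filter_upwards [h.cf_jet_zero hpb, h.cf_jet_one (hn.analyticAt_pullback hΨ)
    (analyticAt_logJac hn.analyticAt_fst hn.analyticAt_snd) hpb, hn.cf_pullback hΨ,
    hn.cf_pd_pullback hΨ, hn.jetPt_jet, hn.eventually_analyticAt,
    second_derivatives hn hΨ h hc hpb, pd_second_derivatives hn hΨ h hc hpb,
    hn.cauchyData_jet] with w h1 h2 h3 h4 h5 h6 h7 h8 h9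
  intro x J J'
  obtain ⟨hf, hγ⟩ := h6
  have e2 := h1 2
  have e3 := h1 3
  rw [h3.2.2.1] at e2
  rw [h3.2.2.2] at e3
  rw [h4.1, h4.2] at h2
  obtain ⟨k2, k3⟩ := h2
  have hx : jetPt x = (w, cauchyData f γ w, euler (cauchyData f γ) w) := rfl
  have hv : jetVel x = (w, euler (cauchyData f γ) w, euler (euler (cauchyData f γ)) w) := rfl
  -- The Jacobian and the cubic coefficients `pull2`, `pull3` are differentiated in `z` and written
  -- through `w ∂_w` of pure `z`-derivatives, which are the entries of the Cauchy data jet.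
  have hJ' : J' = dz (dz f) (0, w) * (1 + dw γ (0, w)) + dz f (0, w) * dw (dz γ) (0, w)
      - (dz (dz γ) (0, w) * dw f (0, w) + dz γ (0, w) * dw (dz f) (0, w)) := by
    rw [← dz_dw hf, ← dz_dw hγ]
    exact (hasDerivAt_dz (analyticAt_logJac hf hγ)).unique
      (((hasDerivAt_dz (analyticAt_dz hf)).fun_mul
        ((hasDerivAt_dz (analyticAt_dw hγ)).const_add 1)).fun_sub
      ((hasDerivAt_dz (analyticAt_dz hγ)).fun_mul (hasDerivAt_dz (analyticAt_dw hf))))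
  have hjd : jacDeriv Ψ (jetPt x) = J' := by
    rw [hJ', jacDeriv, hx, h7.1, h7.2, euler_cauchyData hf hγ]
    simp only [cauchyData]; ring
  have hdir : jetDir Ψ (jetPt x) = (dz f (0, w), dz γ (0, w), 0, dz (dz f) (0, w),
      dz (dz γ) (0, w), dw (dz f) (0, w), dw (dz γ) (0, w)) := by
    rw [jetDir, hx, h7.1, h7.2, euler_cauchyData hf hγ]
    simp [cauchyData]
  have hp2 : dz (pull2 f γ) (0, w) =
      - 2 * (dw (dz f) (0, w) * dw (dz γ) (0, w) + dw f (0, w) * dw (dz (dz γ)) (0, w))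
      - (dz (dz f) (0, w) * dw (dw γ) (0, w) + dz f (0, w) * dw (dw (dz γ)) (0, w))
      + 2 * (dw (dz γ) (0, w) * dw (dz f) (0, w) + (1 + dw γ (0, w)) * dw (dz (dz f)) (0, w))
      + (dz (dz γ) (0, w) * dw (dw f) (0, w) + dz γ (0, w) * dw (dw (dz f)) (0, w)) := by
    have q1 := (hasDerivAt_dz (analyticAt_pull2 hf hγ)).unique
      ((((((hasDerivAt_dz (analyticAt_dw hf)).const_mul (-2)).fun_mul
        (hasDerivAt_dz (analyticAt_dw (analyticAt_dz hγ)))).fun_sub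
      ((hasDerivAt_dz (analyticAt_dz hf)).fun_mul
        (hasDerivAt_dz (analyticAt_dw (analyticAt_dw hγ))))).fun_add
      ((((hasDerivAt_dz (analyticAt_dw hγ)).const_add 1).const_mul 2).fun_mul
        (hasDerivAt_dz (analyticAt_dw (analyticAt_dz hf))))).fun_add
      ((hasDerivAt_dz (analyticAt_dz hγ)).fun_mul
        (hasDerivAt_dz (analyticAt_dw (analyticAt_dw hf)))))
    rw [q1, dz_dw hf, dz_dw hγ, dz_dw (analyticAt_dz hf), dz_dw (analyticAt_dz hγ),
      dz_dw (analyticAt_dw hf), dz_dw (analyticAt_dw hγ),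
      (dw_eventuallyEq (dz_dw_eventuallyEq hf)).eq_of_nhds,
      (dw_eventuallyEq (dz_dw_eventuallyEq hγ)).eq_of_nhds]
    ring
  have hp3 : dz (pull3 f γ) (0, w) =
      - (dw (dz f) (0, w) * dw (dw γ) (0, w) + dw f (0, w) * dw (dw (dz γ)) (0, w))
      + (dw (dz γ) (0, w) * dw (dw f) (0, w) + (1 + dw γ (0, w)) * dw (dw (dz f)) (0, w)) := by
    have q1 := (hasDerivAt_dz (analyticAt_pull3 hf hγ)).unique
      (((hasDerivAt_dz (analyticAt_dw hf)).fun_neg.fun_mul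
        (hasDerivAt_dz (analyticAt_dw (analyticAt_dw hγ)))).fun_add
      (((hasDerivAt_dz (analyticAt_dw hγ)).const_add 1).fun_mul
        (hasDerivAt_dz (analyticAt_dw (analyticAt_dw hf)))))
    rw [q1, dz_dw hf, dz_dw hγ,
      dz_dw (analyticAt_dw hf), dz_dw (analyticAt_dw hγ),
      (dw_eventuallyEq (dz_dw_eventuallyEq hf)).eq_of_nhds,
      (dw_eventuallyEq (dz_dw_eventuallyEq hγ)).eq_of_nhds]
    ring
  have hs : ∀ j, jetSDeriv Ψ j (jetPt x) = pd (dz f (0, w), dz γ (0, w), 0, dz (dz f) (0, w),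
      dz (dz γ) (0, w), dw (dz f) (0, w), dw (dz γ) (0, w)) (jetSCoeff Ψ j) (jetOf f γ (0, w)) := by
    intro j
    rw [jetSDeriv, hdir, hx, h5.1]
  have hJ : jetJac (jetPt x) = J := by rw [hx, h5.2]
  have hval : jetVal (jetPt x) = jetOf f γ (0, w) := by rw [hx, h5.1]
  have hx9 : x = _ := h9
  rw [hp2] at k2
  rw [hp3] at k3
  change _ = c * (J * _ + J' * _) at k2
  change _ = c * (J * _ + J' * _) - c ^ 2 * (w * J) * _ - J * _ at k3
  refine ⟨?_, ?_, ?_, ?_⟩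
  · rw [sysA, hval, hJ, hx9]
    simp only [pull2] at e2 ⊢
    linear_combination e2
  · rw [sysB, hval, hJ, hx9]
    simp only [pull3] at e3 ⊢
    linear_combination e3
  · rw [sysC, hs, hjd, hJ, hv, hx, h8.1, h8.2, h7.1, h7.2, hx9]
    simp only
    linear_combination k2
  · rw [sysD, hs, hjd, hJ, hx9]
    simp only
    linear_combination k3

end System

/-! ### The normal form condition as a system for the Cauchy data -/

section ConstantJet

/-- The normal form condition in terms of the jet in `z` at `z = 0`. -/
def ConstantJet (Λ : ℂ × ℂ × ℂ → ℂ) : Prop := ∀ᶠ τ in 𝓝 0,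
  secondCoeff Λ 2 τ = secondCoeff Λ 2 0 ∧ secondCoeff Λ 3 τ = secondCoeff Λ 3 0 ∧
  thirdCoeff Λ 2 τ = thirdCoeff Λ 2 0 ∧ thirdCoeff Λ 3 τ = thirdCoeff Λ 3 0

lemma ConstantJet.deriv_eq {Λ : ℂ × ℂ × ℂ → ℂ} (h : ConstantJet Λ) :
    ∀ᶠ τ in 𝓝 0, deriv (secondCoeff Λ 2) τ = 0 := by
  filter_upwards [h.eventually_nhds] with τ hτ
  have e : secondCoeff Λ 2 =ᶠ[𝓝 τ] fun _ => secondCoeff Λ 2 0 := hτ.mono fun y hy => hy.1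
  rw [e.deriv_eq]; simp

variable {f γ : ℂ × ℂ → ℂ} {Ψ Λ : ℂ × ℂ × ℂ → ℂ} {c : ℂ}

/-- A transformation is normalizing precisely if its Cauchy data satisfy the system. -/
theorem constantJet_iff (hn : NormalizedMap f γ) (hΨ : AnalyticAt ℂ Ψ 0) (h2 : OrderTwo Ψ)
    (h : LogAdmissible c Λ) (hc : c ≠ 0)
    (hpb : ∀ᶠ x : ℂ × ℂ × ℂ in 𝓝 0,
      pd (1, 0, 0) (pd (1, 0, 0) Λ) x * logJac f γ (x.1, x.2.2 * exp (Λ x)) =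
        pullback f γ Ψ ((x.1, x.2.2 * exp (Λ x)), pd (1, 0, 0) Λ x)) :
    ConstantJet Λ ↔ ∀ᶠ w in 𝓝 0, sys Ψ (w, cauchyData f γ w, euler (cauchyData f γ) w,
      euler (euler (cauchyData f γ)) w) = 0 := by
  have key := sys_cauchyData hn hΨ h hc hpb
  constructor
  · intro hcj
    -- At `w = 0` the system holds automatically and the Jacobian is `1`. This identifies the
    -- constants of the jet with the coefficients of `Ψ` at the origin.
    have k0 := key.self_of_nhds
    have hz : ((0, cauchyData f γ 0, euler (cauchyData f γ) 0, euler (euler (cauchyData f γ)) 0) :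
        ℂ × V4 × V4 × V4) = 0 := by
      rw [hn.cauchyData_zero, euler_zero, euler_zero]; rfl
    have hs := sys_zero hΨ h2
    simp only [sys, Prod.mk_eq_zero] at hs
    have hJ : logJac f γ (0, 0) = 1 := by
      have : logJac f γ 0 = 1 := by simp [logJac, hn.dz_fst, hn.dz_snd, dw]
      exact this
    simp only [hz, hs.1, hs.2.1, hs.2.2.1, hs.2.2.2, hJ, mul_zero, one_mul, mul_one, zero_mul,
      sub_zero] at k0
    obtain ⟨k1, k2, k3, k4⟩ := k0
    rw [← k1, mul_zero, add_zero] at k3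
    rw [← k2, mul_zero, add_zero] at k4
    have k3' := (mul_eq_zero.1 k3.symm).resolve_left hc
    filter_upwards [key, hcj, hcj.deriv_eq] with w hw hj hd
    simp only [hj.1, hj.2.1, hj.2.2.1, hj.2.2.2, hd, ← k1, ← k2, k3', mul_zero, sub_zero,
      ← k4, add_zero, mul_eq_zero, pow_eq_zero_iff, hc, ne_eq, OfNat.ofNat_ne_zero,
      not_false_eq_true, false_or] at hw
    simp only [sys, Prod.mk_eq_zero]
    exact hw
  · intro hsys
    -- The Jacobian does not vanish, so the first two equations fix the second jet. The terms with
    -- its `w`-derivative and with the derivative of the Jacobian then drop out of the other two.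
    have k1 : ∀ᶠ w in 𝓝 0, secondCoeff Λ 2 w = c ^ 2 * coeffAt Ψ 2 0 ∧
        secondCoeff Λ 3 w = c ^ 3 * coeffAt Ψ 3 0 := by
      filter_upwards [key, hsys, eventually_logJac_ne hn] with w hw hs hJ
      simp only [sys, Prod.mk_eq_zero] at hs
      have e1 := hw.1
      have e2 := hw.2.1
      rw [hs.1, mul_zero] at e1
      rw [hs.2.1, mul_zero] at e2
      exact ⟨sub_eq_zero.1 ((mul_eq_zero.1 e1.symm).resolve_left hJ),
        sub_eq_zero.1 ((mul_eq_zero.1 e2.symm).resolve_left hJ)⟩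
    have kd : ∀ᶠ w in 𝓝 0, deriv (secondCoeff Λ 2) w = 0 := by
      filter_upwards [k1.eventually_nhds] with τ hτ
      have e : secondCoeff Λ 2 =ᶠ[𝓝 τ] fun _ => c ^ 2 * coeffAt Ψ 2 0 := hτ.mono fun y hy => hy.1
      rw [e.deriv_eq]; simp
    have k2 : ∀ᶠ w in 𝓝 0, thirdCoeff Λ 2 w = c ^ 2 * deriv (coeffAt Ψ 2) 0 ∧
        thirdCoeff Λ 3 w = (2 * (c ^ 2 * coeffAt Ψ 2 0) ^ 2 + c ^ 4 * deriv (coeffAt Ψ 3) 0) / c := by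
      filter_upwards [key, hsys, eventually_logJac_ne hn, k1, kd] with w hw hs hJ h1 hd
      simp only [sys, Prod.mk_eq_zero] at hs
      obtain ⟨-, -, e3, e4⟩ := hw
      rw [hs.2.2.1, h1.1, sub_self, mul_zero, mul_zero, add_zero] at e3
      rw [hs.2.2.2, h1.1, h1.2, sub_self, mul_zero, mul_zero, add_zero, hd] at e4
      refine ⟨sub_eq_zero.1 ((mul_eq_zero.1 e3.symm).resolve_left (mul_ne_zero hc hJ)), ?_⟩
      have := (mul_eq_zero.1 e4.symm).resolve_left hJ
      rw [eq_div_iff hc]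
      linear_combination this
    have z1 := k1.self_of_nhds
    have z2 := k2.self_of_nhds
    filter_upwards [k1, k2] with w h1 h2
    exact ⟨h1.1.trans z1.1.symm, h1.2.trans z1.2.symm, h2.1.trans z2.1.symm, h2.2.trans z2.2.symm⟩

end ConstantJet

/-! ### The logarithmic form of the complexified hypersurface -/

section LogForm

/-- The hypersurface `w - τ = (i/2) (w + τ) h(z, χ, (w + τ)/2)` has the equation
`w = τ e ^ Λ(z, χ, τ)`; here `w = u A` and `τ = u B`. -/
structure LogForm (h Λ : ℂ × ℂ × ℂ → ℂ) : Prop where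
  analyticAt : AnalyticAt ℂ Λ 0
  map_zero : Λ 0 = 0
  iff : ∀ᶠ y : (ℂ × ℂ × ℂ) × ℂ × ℂ in 𝓝 (0, 1, 1),
    (y.2.1 - y.2.2 = I / 2 * (y.2.1 + y.2.2) * h (y.1.1, y.1.2.1, y.1.2.2 * (y.2.1 + y.2.2) / 2) ↔
      y.2.1 = y.2.2 * exp (Λ (y.1.1, y.1.2.1, y.1.2.2 * y.2.2)))

variable {h Λ : ℂ × ℂ × ℂ → ℂ}

/-- The mean `U = (w + τ) / 2` is the solution of `U (1 - i h(z, χ, U) / 2) = τ`, and then `w = U (1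
+ i h / 2)`. Hence `Λ` is the logarithm of the quotient of the two factors. -/
lemma exists_logForm (hh : AnalyticAt ℂ h 0) (h0 : h 0 = 0) : ∃ Λ, LogForm h Λ := by
  obtain ⟨U, hU, hU0, hU1, hU2⟩ := exists_implicit (E := ℂ × ℂ × ℂ) (F := ℂ) (a := 0) (b := 0)
    (G := fun p => p.2 * (1 - I / 2 * h (p.1.1, p.1.2.1, p.2)) - p.1.2.2)
    (by
      have : AnalyticAt ℂ (fun p : (ℂ × ℂ × ℂ) × ℂ => h (p.1.1, p.1.2.1, p.2)) (0, 0) :=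
        hh.comp_at (by fun_prop) rfl
      fun_prop) (by simp) (by
      intro v hv
      have ha : AnalyticAt ℂ (fun p : (ℂ × ℂ × ℂ) × ℂ => h (p.1.1, p.1.2.1, p.2)) (0, 0) :=
        hh.comp_at (by fun_prop) rfl
      have hc : HasDerivAt (fun s : ℂ => (((0 : ℂ × ℂ × ℂ), s * v) : (ℂ × ℂ × ℂ) × ℂ)) (0, v) 0 := by
        refine (hasDerivAt_const _ _).prodMk ?_
        simpa using (hasDerivAt_id (0 : ℂ)).mul_const v
      have ha' : AnalyticAt ℂ (fun p : (ℂ × ℂ × ℂ) × ℂ =>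
        p.2 * (1 - I / 2 * h (p.1.1, p.1.2.1, p.2)) - p.1.2.2) (0, 0) := by fun_prop
      have d1 := hasDerivAt_comp_pd (t := 0) (G := fun p : (ℂ × ℂ × ℂ) × ℂ =>
        p.2 * (1 - I / 2 * h (p.1.1, p.1.2.1, p.2)) - p.1.2.2)
        (by rw [zero_mul]; exact ha'.differentiableAt) hc
      have d2 : HasDerivAt (fun s : ℂ => s * v) v 0 := by
        simpa using (hasDerivAt_id (0 : ℂ)).mul_const v
      have d3 := hasDerivAt_comp_pd (t := 0) (G := fun p : (ℂ × ℂ × ℂ) × ℂ =>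
        h (p.1.1, p.1.2.1, p.2)) (by rw [zero_mul]; exact ha.differentiableAt) hc
      have d4 := (d2.fun_mul ((d3.const_mul (I / 2)).const_sub 1)).sub_const 0
      have := d1.unique d4
      have e : h (0, 0, 0) = 0 := h0
      rw [zero_mul] at this
      rw [hv] at this
      simp [e] at this
      exact this.symm)
  set k : ℂ × ℂ × ℂ → ℂ := fun x => h (x.1, x.2.1, U x) with hk
  have hka : AnalyticAt ℂ k 0 := AnalyticAt.comp_at (y := 0) hh (by fun_prop) (by rw [hU0]; rfl)
  have hk0 : k 0 = 0 := by simp only [hk]; rw [hU0]; exact h0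
  refine ⟨fun x => log (1 + I / 2 * k x) - log (1 - I / 2 * k x), ?_, by simp [hk0], ?_⟩
  · exact AnalyticAt.fun_sub (AnalyticAt.clog (by fun_prop) (by simp [hk0]))
      (AnalyticAt.clog (by fun_prop) (by simp [hk0]))
  · have hne : ∀ᶠ x in 𝓝 0, 1 + I / 2 * k x ≠ 0 ∧ 1 - I / 2 * k x ≠ 0 := by
      have c1 : AnalyticAt ℂ (fun x => 1 + I / 2 * k x) 0 := by fun_prop
      have c2 : AnalyticAt ℂ (fun x => 1 - I / 2 * k x) 0 := by fun_prop
      exact (c1.continuousAt.eventually_ne (by simp [hk0])).and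
        (c2.continuousAt.eventually_ne (by simp [hk0]))
    have t1 : Tendsto (fun y : (ℂ × ℂ × ℂ) × ℂ × ℂ => ((y.1.1, y.1.2.1, y.1.2.2 * y.2.2) :
        ℂ × ℂ × ℂ)) (𝓝 (0, 1, 1)) (𝓝 0) := tendsto_of_analyticAt (by fun_prop) (by simp)
    have t2 : Tendsto (fun y : (ℂ × ℂ × ℂ) × ℂ × ℂ => (((y.1.1, y.1.2.1, y.1.2.2 * y.2.2),
        y.1.2.2 * (y.2.1 + y.2.2) / 2) : (ℂ × ℂ × ℂ) × ℂ)) (𝓝 (0, 1, 1)) (𝓝 (0, 0)) :=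
      tendsto_of_analyticAt (by fun_prop (disch := simp)) (by simp)
    filter_upwards [t1.eventually hne, t1.eventually hU1, t2.eventually hU2] with y h1 h2 h3
    obtain ⟨⟨z, χ, u⟩, A, B⟩ := y
    simp only at h1 h2 h3 ⊢
    rw [exp_sub, exp_log h1.1, exp_log h1.2]
    obtain ⟨hp, hq⟩ := h1
    have h2' : U (z, χ, u * B) * (1 - I / 2 * k (z, χ, u * B)) = u * B := sub_eq_zero.1 h2
    constructor
    -- The mean `u (A + B) / 2` satisfies the equation defining `U`, so the two agree by uniqueness.
    · intro hAB
      have e : u * (A + B) / 2 = U (z, χ, u * B) := by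
        apply h3
        linear_combination (u / 2) * hAB
      rw [e] at hAB
      change _ = I / 2 * (A + B) * k (z, χ, u * B) at hAB
      rw [← mul_div_assoc, eq_div_iff hq]
      linear_combination hAB
    · intro hAB
      rw [← mul_div_assoc, eq_div_iff hq] at hAB
      have e : u * (A + B) / 2 = U (z, χ, u * B) := by
        apply mul_right_cancel₀ hq
        rw [h2']
        linear_combination (u / 2) * hAB
      rw [e]
      change _ = I / 2 * (A + B) * k (z, χ, u * B)
      linear_combination hAB

/-- The relation between `h` and `Λ`. -/
lemma LogForm.eqn (hΛ : LogForm h Λ) : ∀ᶠ x : ℂ × ℂ × ℂ in 𝓝 0, exp (Λ x) - 1 =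
    I / 2 * (exp (Λ x) + 1) * h (x.1, x.2.1, x.2.2 * (exp (Λ x) + 1) / 2) := by
  have ha := hΛ.analyticAt
  have t : Tendsto (fun x : ℂ × ℂ × ℂ => (x, exp (Λ x), (1 : ℂ))) (𝓝 0) (𝓝 (0, 1, 1)) :=
    tendsto_of_analyticAt (by fun_prop) (by simp [hΛ.map_zero])
  filter_upwards [t.eventually hΛ.iff] with x hx
  exact hx.2 (by simp)

lemma eventually_exp_inj {α : Type*} {l : Filter α} {a : α → ℂ} (ha : Tendsto a l (𝓝 0)) :
    ∀ᶠ x in l, exp (a x) = 1 → a x = 0 := by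
  filter_upwards [ha.eventually (Metric.ball_mem_nhds 0 Real.pi_pos)] with x hx h
  have hx : ‖a x‖ < Real.pi := mem_ball_zero_iff.1 hx
  have hi : |(a x).im| < Real.pi := (Complex.abs_im_le_norm _).trans_lt hx
  rw [← Complex.log_exp (abs_lt.1 hi).1 (abs_lt.1 hi).2.le, h, log_one]

/-- The case `A = B = 1` of the equivalence: a zero of either function means `w = τ`. -/
lemma LogForm.eq_zero_iff (hΛ : LogForm h Λ) :
    ∀ᶠ x : ℂ × ℂ × ℂ in 𝓝 0, h x = 0 ↔ Λ x = 0 := by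
  have t : Tendsto (fun x : ℂ × ℂ × ℂ => (x, (1 : ℂ), (1 : ℂ))) (𝓝 0) (𝓝 (0, 1, 1)) :=
    tendsto_of_analyticAt (by fun_prop) rfl
  filter_upwards [t.eventually hΛ.iff, eventually_exp_inj
    (tendsto_of_analyticAt hΛ.analyticAt hΛ.map_zero)] with x hx he
  have e : x.2.2 * (1 + 1) / 2 = x.2.2 := by ring
  simp only [e, sub_self, one_mul, mul_one] at hx
  constructor
  · intro h0
    exact he (hx.1 (by rw [h0, mul_zero])).symm
  · intro h0
    have := hx.2 (by rw [h0, exp_zero])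
    have hI : I / 2 * (1 + 1) ≠ 0 := by simp [I_ne_zero]
    exact (mul_eq_zero.1 this.symm).resolve_left hI

lemma LogForm.tendsto (hΛ : LogForm h Λ) :
    Tendsto (fun x : ℂ × ℂ × ℂ => (x.1, x.2.1, x.2.2 * (exp (Λ x) + 1) / 2)) (𝓝 0) (𝓝 0) := by
  have ha := hΛ.analyticAt
  exact tendsto_of_analyticAt (by fun_prop (disch := simp)) (by simp)

/-- The derivative of the relation between `h` and `Λ` in the direction of `z` or `χ`. -/
lemma LogForm.pd_eqn (hΛ : LogForm h Λ) (hh : AnalyticAt ℂ h 0) (a b : ℂ) :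
    ∀ᶠ x : ℂ × ℂ × ℂ in 𝓝 0,
      pd (a, b, 0) h (x.1, x.2.1, x.2.2 * (exp (Λ x) + 1) / 2)
        + x.2.2 * exp (Λ x) * pd (a, b, 0) Λ x / 2
          * pd (0, 0, 1) h (x.1, x.2.1, x.2.2 * (exp (Λ x) + 1) / 2)
      = -I * (1 + h (x.1, x.2.1, x.2.2 * (exp (Λ x) + 1) / 2) ^ 2 / 4) * pd (a, b, 0) Λ x := by
  filter_upwards [hΛ.eqn.eventually_nhds, hΛ.analyticAt.eventually_analyticAt,
    hΛ.tendsto.eventually hh.eventually_analyticAt] with x h1 h2 h3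
  obtain ⟨z, χ, τ⟩ := x
  simp only at h3 ⊢
  have hl : HasDerivAt (fun s : ℂ => ((z + s * a, χ + s * b, τ) : ℂ × ℂ × ℂ)) (a, b, 0) 0 := by
    have := hasDerivAt_lin
    exact ((this a).const_add z).prodMk (((this b).const_add χ).prodMk (hasDerivAt_const _ _))
  have hl0 : ((z + 0 * a, χ + 0 * b, τ) : ℂ × ℂ × ℂ) = (z, χ, τ) := by simp
  have d1 := hasDerivAt_comp_pd (G := Λ) (t := 0) (by rw [hl0]; exact h2.differentiableAt) hl
  have d2 := (((d1.cexp.add_const 1).const_mul τ).div_const 2)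
  have d3 := hasDerivAt_comp_pd (G := h) (t := 0) (c := fun s => (z + s * a, χ + s * b,
    τ * (exp (Λ (z + s * a, χ + s * b, τ)) + 1) / 2)) (by rw [hl0]; simpa using h3.differentiableAt)
    (((hasDerivAt_lin a).const_add z).prodMk (((hasDerivAt_lin b).const_add χ).prodMk d2))
  have d4 := ((d1.cexp.add_const 1).const_mul (I / 2)).fun_mul d3
  have ht : Tendsto (fun s : ℂ => ((z + s * a, χ + s * b, τ) : ℂ × ℂ × ℂ)) (𝓝 0) (𝓝 (z, χ, τ)) := by
    have := hl.continuousAt.tendsto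
    rwa [hl0] at this
  have d5 := (d1.cexp.sub_const 1).unique (d4.congr_of_eventuallyEq (ht.eventually h1))
  have e0 := h1.self_of_nhds
  simp only [zero_mul, add_zero] at d5 e0
  rw [show ((a, b, τ * (exp (Λ (z, χ, τ)) * pd (a, b, 0) Λ (z, χ, τ)) / 2) : ℂ × ℂ × ℂ)
      = (a, b, 0) + (τ * (exp (Λ (z, χ, τ)) * pd (a, b, 0) Λ (z, χ, τ)) / 2) • (0, 0, 1) by simp,
    pd_add, pd_smul, smul_eq_mul] at d5
  set E := exp (Λ (z, χ, τ))
  set k := h (z, χ, τ * (E + 1) / 2)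
  set L := pd (a, b, 0) Λ (z, χ, τ)
  have hE : E + 1 ≠ 0 := by
    intro h0
    rw [h0] at e0
    have : E = 1 := by linear_combination e0
    rw [this] at h0
    norm_num at h0
  -- The relation is `k = 2 tan(Λ / (2 i))`, which is why its differential carries the factor `-i (1
  -- + k² / 4)`.
  have hk : (E + 1) * (1 + k ^ 2 / 4) * (E + 1) = 4 * E := by
    have : ((E + 1) * k) = -2 * I * (E - 1) := by rw [e0]; linear_combination (E + 1) * k * I_sq
    linear_combination ((E + 1) * k - 2 * I * (E - 1)) / 4 * this + (E - 1) ^ 2 * I_sq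
  apply mul_left_cancel₀ (mul_ne_zero hE hE)
  linear_combination (2 * I * (E + 1)) * d5 + (I * L) * hk - (2 * I * E * L) * e0
    + ((E + 1) ^ 2 * (pd (a, b, 0) h (z, χ, τ * (E + 1) / 2)
      + τ * (E * L) / 2 * pd (0, 0, 1) h (z, χ, τ * (E + 1) / 2))) * I_sq

end LogForm

/-! ### Comparing the jets of `h` and `Λ` at `z = 0` -/

section Transfer

variable {h Λ : ℂ × ℂ × ℂ → ℂ}

lemma tendsto_zero_left : Tendsto (fun x : ℂ × ℂ => ((0, x.1, x.2) : ℂ × ℂ × ℂ)) (𝓝 0) (𝓝 0) :=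
  tendsto_of_analyticAt (by fun_prop) rfl

lemma tendsto_zero_mid : Tendsto (fun x : ℂ × ℂ => ((x.1, 0, x.2) : ℂ × ℂ × ℂ)) (𝓝 0) (𝓝 0) :=
  tendsto_of_analyticAt (by fun_prop) rfl

lemma pd_right_of_slice {G : ℂ × ℂ × ℂ → ℂ} {z : ℂ} {g : ℂ → ℂ} (hG : AnalyticAt ℂ G 0)
    (h : ∀ᶠ x : ℂ × ℂ in 𝓝 0, G (z, x.1, x.2) = g x.1) (hz : z = 0) :
    ∀ᶠ x : ℂ × ℂ in 𝓝 0, pd (0, 0, 1) G (0, x.1, x.2) = 0 := by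
  subst hz
  filter_upwards [h.eventually_nhds, tendsto_zero_left.eventually hG.eventually_analyticAt]
    with x hx ha
  have hl : Tendsto (fun s : ℂ => (x.1, s)) (𝓝 x.2) (𝓝 x) :=
    tendsto_of_analyticAt (by fun_prop) rfl
  have h1 := hasDerivAt_comp₃ (G := G) (a := fun _ => 0) (b := fun _ => x.1) (c := fun s => s)
    (t := x.2) ha.differentiableAt (hasDerivAt_const _ _) (hasDerivAt_const _ _) (hasDerivAt_id _)
  have h2 := h1.congr_of_eventuallyEq (EventuallyEq.symm (hl.eventually hx))
  simpa using h2.unique (hasDerivAt_const x.2 (g x.1))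

lemma pd_right_of_slice_mid {G : ℂ × ℂ × ℂ → ℂ} {g : ℂ → ℂ} (hG : AnalyticAt ℂ G 0)
    (h : ∀ᶠ x : ℂ × ℂ in 𝓝 0, G (x.1, 0, x.2) = g x.1) :
    ∀ᶠ x : ℂ × ℂ in 𝓝 0, pd (0, 0, 1) G (x.1, 0, x.2) = 0 := by
  filter_upwards [h.eventually_nhds, tendsto_zero_mid.eventually hG.eventually_analyticAt]
    with x hx ha
  have hl : Tendsto (fun s : ℂ => (x.1, s)) (𝓝 x.2) (𝓝 x) :=
    tendsto_of_analyticAt (by fun_prop) rfl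
  have h1 := hasDerivAt_comp₃ (G := G) (a := fun _ => x.1) (b := fun _ => 0) (c := fun s => s)
    (t := x.2) ha.differentiableAt (hasDerivAt_const _ _) (hasDerivAt_const _ _) (hasDerivAt_id _)
  have h2 := h1.congr_of_eventuallyEq (EventuallyEq.symm (hl.eventually hx))
  simpa using h2.unique (hasDerivAt_const x.2 (g x.1))

/-- On `z = 0` both functions vanish, so the mean equals `τ` and the quadratic and `u`-derivative
terms of the differentiated relation disappear. -/
lemma LogForm.pd_left_iff (hΛ : LogForm h Λ) (hh : AnalyticAt ℂ h 0)
    (h0 : ∀ᶠ x : ℂ × ℂ in 𝓝 0, h (0, x.1, x.2) = 0) (hΛ0 : ∀ᶠ x : ℂ × ℂ in 𝓝 0, Λ (0, x.1, x.2) = 0) :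
    ∀ᶠ x : ℂ × ℂ in 𝓝 0, pd (1, 0, 0) h (0, x.1, x.2) = -I * pd (1, 0, 0) Λ (0, x.1, x.2) := by
  filter_upwards [h0, hΛ0, tendsto_zero_left.eventually (hΛ.pd_eqn hh 1 0),
    pd_right_of_slice (g := fun _ => 0) hh h0 rfl] with x h1 h2 h3 h4
  have e : x.2 * (1 + 1) / 2 = x.2 := by ring
  simp only [h2, exp_zero, e, h1, h4] at h3
  linear_combination h3

lemma LogForm.pd_right_iff (hΛ : LogForm h Λ) (hh : AnalyticAt ℂ h 0)
    (h0 : ∀ᶠ x : ℂ × ℂ in 𝓝 0, h (x.1, 0, x.2) = 0) (hΛ0 : ∀ᶠ x : ℂ × ℂ in 𝓝 0, Λ (x.1, 0, x.2) = 0) :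
    ∀ᶠ x : ℂ × ℂ in 𝓝 0, pd (0, 1, 0) h (x.1, 0, x.2) = -I * pd (0, 1, 0) Λ (x.1, 0, x.2) := by
  filter_upwards [h0, hΛ0, tendsto_zero_mid.eventually (hΛ.pd_eqn hh 0 1),
    pd_right_of_slice_mid (g := fun _ => 0) hh h0] with x h1 h2 h3 h4
  have e : x.2 * (1 + 1) / 2 = x.2 := by ring
  simp only [h2, exp_zero, e, h1, h4] at h3
  linear_combination h3

lemma LogForm.logAdmissible_iff (hΛ : LogForm h Λ) (hh : AnalyticAt ℂ h 0) (ε : ℂ) :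
    LogAdmissible ε h ↔ LogAdmissible (I * ε) Λ := by
  have k1 := tendsto_zero_left.eventually hΛ.eq_zero_iff
  have k2 := tendsto_zero_mid.eventually hΛ.eq_zero_iff
  constructor
  · intro ha
    have z1 : ∀ᶠ x : ℂ × ℂ in 𝓝 0, Λ (0, x.1, x.2) = 0 := by
      filter_upwards [k1, ha.left] with x h1 h2 using h1.1 h2
    have z2 : ∀ᶠ x : ℂ × ℂ in 𝓝 0, Λ (x.1, 0, x.2) = 0 := by
      filter_upwards [k2, ha.right] with x h1 h2 using h1.1 h2
    refine ⟨hΛ.analyticAt, z1, z2, ?_, ?_⟩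
    · filter_upwards [hΛ.pd_left_iff hh ha.left z1, ha.pd_left] with x h1 h2
      rw [h2] at h1
      linear_combination -I * h1 + pd (1, 0, 0) Λ (0, x.1, x.2) * I_sq
    · filter_upwards [hΛ.pd_right_iff hh ha.right z2, ha.pd_right] with x h1 h2
      rw [h2] at h1
      linear_combination -I * h1 + pd (0, 1, 0) Λ (x.1, 0, x.2) * I_sq
  · intro ha
    have z1 : ∀ᶠ x : ℂ × ℂ in 𝓝 0, h (0, x.1, x.2) = 0 := by
      filter_upwards [k1, ha.left] with x h1 h2 using h1.2 h2
    have z2 : ∀ᶠ x : ℂ × ℂ in 𝓝 0, h (x.1, 0, x.2) = 0 := by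
      filter_upwards [k2, ha.right] with x h1 h2 using h1.2 h2
    refine ⟨hh, z1, z2, ?_, ?_⟩
    · filter_upwards [hΛ.pd_left_iff hh z1 ha.left, ha.pd_left] with x h1 h2
      rw [h1, h2]
      linear_combination - ε * x.1 * I_sq
    · filter_upwards [hΛ.pd_right_iff hh z2 ha.right, ha.pd_right] with x h1 h2
      rw [h1, h2]
      linear_combination - ε * x.1 * I_sq

/-- Comparison of the jets of `h` and `Λ` at `z = 0`. -/
lemma LogForm.jets (hΛ : LogForm h Λ) {ε : ℂ} (ha : LogAdmissible ε h) :
    ∀ᶠ x : ℂ × ℂ in 𝓝 0, secondJet h x = -I * secondJet Λ x ∧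
      thirdJet h x + 3 / 2 * (I * ε) * x.1 * (x.2 * pd (1, 0) (secondJet h) x) =
        -I * thirdJet Λ x + I / 2 * (I * ε) ^ 3 * x.2 ^ 3 := by
  have hh := ha.analyticAt
  have hl := (hΛ.logAdmissible_iff hh ε).1 ha
  have sw : Tendsto (fun x : ℂ × ℂ => (x.2, x.1)) (𝓝 0) (𝓝 0) :=
    tendsto_of_analyticAt (by fun_prop) rfl
  -- On `z = 0` neither `h` nor `h_z` depends on `u`. Of the terms with `u`-derivatives only the one
  -- with `∂_u h_zz` survives in the third order.
  have v3 := pd_right_of_slice (g := fun _ => 0) hh ha.left rfl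
  have v33 := pd_right_of_slice (g := fun _ => 0) (analyticAt_pd _ hh) v3 rfl
  have v333 := pd_right_of_slice (g := fun _ => 0) (analyticAt_pd _ (analyticAt_pd _ hh)) v33 rfl
  have v31 := pd_right_of_slice (g := fun χ => ε * χ) (analyticAt_pd _ hh) ha.pd_left rfl
  have v331 := pd_right_of_slice (g := fun _ => 0) (analyticAt_pd _ (analyticAt_pd _ hh)) v31 rfl
  filter_upwards [sw.eventually ha.left, sw.eventually hl.left, sw.eventually hl.pd_left,
    sw.eventually ha.pd_left,
    sw.eventually v3, sw.eventually v33, sw.eventually v333, sw.eventually v31, sw.eventually v331,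
    tendsto_left.eventually hh.eventually_analyticAt.eventually_nhds,
    tendsto_left.eventually hl.analyticAt.eventually_analyticAt.eventually_nhds,
    tendsto_left.eventually (hΛ.pd_eqn hh 1 0).eventually_nhds] with
    x ha0 hl0 hl1 ha1 v3 v33 v333 v31 v331 an bn heq
  obtain ⟨τ, χ⟩ := x
  simp only at ha0 hl0 hl1 ha1 v3 v33 v333 v31 v331 an bn heq ⊢
  have hA := an.self_of_nhds
  have hB := bn.self_of_nhds
  set e1 : ℂ × ℂ × ℂ := (1, 0, 0) with he1
  set e3 : ℂ × ℂ × ℂ := (0, 0, 1) with he3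
  have tz : Tendsto (fun z : ℂ => ((z, χ, τ) : ℂ × ℂ × ℂ)) (𝓝 0) (𝓝 (0, χ, τ)) :=
    tendsto_of_analyticAt (by fun_prop) rfl
  set W : ℂ → ℂ := fun z => τ * (exp (Λ (z, χ, τ)) + 1) / 2 with hW
  have hLz : AnalyticAt ℂ (fun z => Λ (z, χ, τ)) 0 := hB.comp_at (by fun_prop) rfl
  have hWa : AnalyticAt ℂ W 0 := by
    have := hLz.cexp'
    simp only [hW]
    exact AnalyticAt.fun_div (by fun_prop) (by fun_prop) (by norm_num)
  have hW0 : W 0 = τ := by simp only [hW, hl0, exp_zero]; ring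
  have tc : Tendsto (fun z : ℂ => ((z, χ, W z) : ℂ × ℂ × ℂ)) (𝓝 0) (𝓝 (0, χ, τ)) :=
    tendsto_of_analyticAt (by fun_prop) (by rw [hW0])
  have chain : ∀ {G : ℂ × ℂ × ℂ → ℂ} {z : ℂ}, AnalyticAt ℂ G (z, χ, W z) → AnalyticAt ℂ W z →
      HasDerivAt (fun z => G (z, χ, W z)) (pd e1 G (z, χ, W z) + deriv W z * pd e3 G (z, χ, W z)) z :=
    fun {G z} hG hWz => by
      simpa using hasDerivAt_comp₃ (G := G) (b := fun _ => χ) hG.differentiableAt (hasDerivAt_id z)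
        (hasDerivAt_const _ _) hWz.differentiableAt.hasDerivAt
  have chain' : ∀ {G : ℂ × ℂ × ℂ → ℂ} {z : ℂ}, AnalyticAt ℂ G (z, χ, τ) →
      HasDerivAt (fun z => G (z, χ, τ)) (pd e1 G (z, χ, τ)) z :=
    fun {G z} hG => by
      simpa using hasDerivAt_comp₃ (G := G) (b := fun _ => χ) (c := fun _ => τ)
        hG.differentiableAt (hasDerivAt_id z) (hasDerivAt_const _ _) (hasDerivAt_const _ _)
  -- The function `h` along the mean `W(z)`. It is differentiated three times in two ways: by the
  -- chain rule, and from `φ' = -i (1 + φ² / 4) Λ_z`.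
  set φ : ℂ → ℂ := fun z => h (z, χ, W z) with hφ
  have hφ0 : φ 0 = 0 := by simp only [hφ, hW0, ha0]
  have evA := tc.eventually an
  have evB := tz.eventually bn
  have evW := hWa.eventually_analyticAt
  -- first derivatives
  have p1 : ∀ᶠ z in 𝓝 0, HasDerivAt φ
      (pd e1 h (z, χ, W z) + deriv W z * pd e3 h (z, χ, W z)) z := by
    filter_upwards [evA, evW] with z h1 h2 using chain h1 h2
  have hW1 : ∀ᶠ z in 𝓝 0, deriv W z = τ * exp (Λ (z, χ, τ)) * pd e1 Λ (z, χ, τ) / 2 := by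
    filter_upwards [evB] with z h1
    have := (((chain' h1).cexp.add_const 1).const_mul τ).div_const 2
    rw [this.deriv]; ring
  have q1 : ∀ᶠ z in 𝓝 0, HasDerivAt φ (-I * (1 + φ z ^ 2 / 4) * pd e1 Λ (z, χ, τ)) z := by
    filter_upwards [p1, tz.eventually heq, hW1] with z h1 h2 h3
    exact h1.congr_deriv (by rw [h3]; exact h2)
  -- second derivatives
  have p2 : ∀ᶠ z in 𝓝 0, HasDerivAt (deriv φ)
      (pd e1 (pd e1 h) (z, χ, W z) + deriv W z * pd e3 (pd e1 h) (z, χ, W z)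
        + (deriv (deriv W) z * pd e3 h (z, χ, W z) + deriv W z * (pd e1 (pd e3 h) (z, χ, W z)
          + deriv W z * pd e3 (pd e3 h) (z, χ, W z)))) z := by
    filter_upwards [p1.eventually_nhds, evA, evW] with z h1 h2 h3
    have e : deriv φ =ᶠ[𝓝 z] fun z => pd e1 h (z, χ, W z) + deriv W z * pd e3 h (z, χ, W z) :=
      h1.mono fun y hy => hy.deriv
    exact ((chain (analyticAt_pd _ h2) h3).fun_add (h3.deriv.differentiableAt.hasDerivAt.fun_mul
      (chain (analyticAt_pd _ h2) h3))).congr_of_eventuallyEq e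
  have q2 : ∀ᶠ z in 𝓝 0, HasDerivAt (deriv φ)
      (-I * (φ z * deriv φ z / 2) * pd e1 Λ (z, χ, τ)
        + -I * (1 + φ z ^ 2 / 4) * pd e1 (pd e1 Λ) (z, χ, τ)) z := by
    filter_upwards [q1.eventually_nhds, evB] with z h1 h2
    have e : deriv φ =ᶠ[𝓝 z] fun z => -I * (1 + φ z ^ 2 / 4) * pd e1 Λ (z, χ, τ) :=
      h1.mono fun y hy => hy.deriv
    have d := h1.self_of_nhds
    rw [← d.deriv] at d
    refine (((((d.fun_pow 2).div_const 4).const_add 1).const_mul (-I)).fun_mul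
      (chain' (analyticAt_pd _ h2))).congr_of_eventuallyEq e |>.congr_deriv ?_
    push_cast; ring
  -- third derivatives
  have hw1 := hWa.deriv.differentiableAt.hasDerivAt
  have hw2 := hWa.deriv.deriv.differentiableAt.hasDerivAt
  have ch : ∀ {G : ℂ × ℂ × ℂ → ℂ}, AnalyticAt ℂ G (0, χ, τ) → HasDerivAt (fun z => G (z, χ, W z))
      (pd e1 G (0, χ, W 0) + deriv W 0 * pd e3 G (0, χ, W 0)) 0 := fun {G} hG =>
    chain (by rw [hW0]; exact hG) hWa
  have p3 := HasDerivAt.congr_of_eventuallyEq (f₁ := deriv (deriv φ))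
    (((ch (analyticAt_pd e1 (analyticAt_pd e1 hA))).fun_add
      (hw1.fun_mul (ch (analyticAt_pd e3 (analyticAt_pd e1 hA))))).fun_add
      ((hw2.fun_mul (ch (analyticAt_pd e3 hA))).fun_add
        (hw1.fun_mul ((ch (analyticAt_pd e1 (analyticAt_pd e3 hA))).fun_add
          (hw1.fun_mul (ch (analyticAt_pd e3 (analyticAt_pd e3 hA))))))))
    (p2.mono fun y hy => hy.deriv)
  have d0 := q1.self_of_nhds
  have d1 := q2.self_of_nhds
  rw [← d0.deriv] at d0
  rw [← d1.deriv] at d1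
  have q3 := HasDerivAt.congr_of_eventuallyEq (f₁ := deriv (deriv φ))
    (((((d0.fun_mul d1).div_const 2).const_mul (-I)).fun_mul
      (chain' (analyticAt_pd e1 hB))).fun_add
      (((((d0.fun_pow 2).div_const 4).const_add 1).const_mul (-I)).fun_mul
        (chain' (analyticAt_pd e1 (analyticAt_pd e1 hB)))))
    (q2.mono fun y hy => hy.deriv)
  have r3 := p3.unique q3
  have r2 := p2.self_of_nhds.unique q2.self_of_nhds
  have r1 := q1.self_of_nhds.deriv
  have c13 : pd e1 (pd e3 h) =ᶠ[𝓝 (0, χ, τ)] pd e3 (pd e1 h) := by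
    filter_upwards [an] with y hy using pd_comm hy _ _
  have c1 : pd e1 (pd e3 h) (0, χ, τ) = 0 := c13.eq_of_nhds.trans v31
  have c2 : pd e1 (pd e3 (pd e1 h)) (0, χ, τ) = pd e3 (pd e1 (pd e1 h)) (0, χ, τ) :=
    pd_comm (analyticAt_pd _ hA) _ _
  have c3 : pd e1 (pd e1 (pd e3 h)) (0, χ, τ) = pd e3 (pd e1 (pd e1 h)) (0, χ, τ) :=
    (pd_congr e1 c13).trans c2
  have c4 : pd e3 (pd e1 (pd e3 h)) (0, χ, τ) = 0 := (pd_congr e3 c13).trans v331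
  have c5 : pd e1 (pd e3 (pd e3 h)) (0, χ, τ) = 0 := (pd_comm (analyticAt_pd _ hA) _ _).trans c4
  have hw := hW1.self_of_nhds
  have c6 : pd (1, 0) (secondJet h) (τ, χ) = pd e3 (pd e1 (pd e1 h)) (0, χ, τ) := by
    have t1 := hasDerivAt_comp₂ (G := secondJet h) (t := τ) (b := fun _ => χ)
      (analyticAt_secondJet hA).differentiableAt (hasDerivAt_id τ) (hasDerivAt_const _ _)
    have t2 := hasDerivAt_comp₃ (G := pd e1 (pd e1 h)) (t := τ) (a := fun _ => 0) (b := fun _ => χ)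
      (analyticAt_pd e1 (analyticAt_pd e1 hA)).differentiableAt (hasDerivAt_const _ _)
      (hasDerivAt_const _ _) (hasDerivAt_id τ)
    simpa using t1.unique t2
  have s2 : secondJet h (τ, χ) = pd e1 (pd e1 h) (0, χ, τ) := rfl
  have s3 : thirdJet h (τ, χ) = pd e1 (pd e1 (pd e1 h)) (0, χ, τ) := rfl
  have s2' : secondJet Λ (τ, χ) = pd e1 (pd e1 Λ) (0, χ, τ) := rfl
  have s3' : thirdJet Λ (τ, χ) = pd e1 (pd e1 (pd e1 Λ)) (0, χ, τ) := rfl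
  simp only [hW0, hφ0, v3, v33, v333, v31, v331, c1, c2, c3, c4, c5, hl0, hl1, exp_zero] at r1 r2 r3 hw
  rw [hw] at r3 r2
  rw [r1] at r3 r2
  rw [c6, s2, s3, s2', s3']
  constructor
  · linear_combination r2
  · push_cast at r3
    linear_combination r3 - I * (I * ε * χ) ^ 3 / 2 * I_sq

lemma LogAdmissible.third_coeff_aux {ε : ℂ} (ha : LogAdmissible ε h) (j : ℕ) : ∀ᶠ τ in 𝓝 0,
    cf (j + 1) (fun χ => χ * pd (1, 0) (secondJet h) (τ, χ)) = deriv (secondCoeff h j) τ := by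
  have hc : Tendsto (fun τ : ℂ => ((0, 0, τ) : ℂ × ℂ × ℂ)) (𝓝 0) (𝓝 0) :=
    tendsto_of_analyticAt (by fun_prop) rfl
  filter_upwards [hc.eventually ha.analyticAt.eventually_analyticAt] with τ hτ
  have hN : AnalyticAt ℂ (secondJet h) (τ, 0) := analyticAt_secondJet hτ
  have a3 : AnalyticAt ℂ (fun χ => pd (1, 0) (secondJet h) (τ, χ)) 0 :=
    (analyticAt_pd (1, 0) hN).comp_at (by fun_prop) rfl
  rw [cf_id_mul_succ j a3, ← pd_cf j 1 hN, pd, fderiv_apply_one_eq_deriv]; rfl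

/-- Comparison of the coefficients of the jets of `h` and `Λ`. -/
lemma LogForm.coeffs (hΛ : LogForm h Λ) {ε : ℂ} (ha : LogAdmissible ε h) : ∀ᶠ τ in 𝓝 0,
    (∀ j, secondCoeff h j τ = -I * secondCoeff Λ j τ) ∧
    thirdCoeff h 2 τ = -I * thirdCoeff Λ 2 τ ∧
    thirdCoeff h 3 τ + 3 / 2 * (I * ε) * τ * deriv (secondCoeff h 2) τ =
      -I * thirdCoeff Λ 3 τ + I / 2 * (I * ε) ^ 3 := by
  have hc : Tendsto (fun τ : ℂ => ((0, 0, τ) : ℂ × ℂ × ℂ)) (𝓝 0) (𝓝 0) :=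
    tendsto_of_analyticAt (by fun_prop) rfl
  filter_upwards [eventually_slice (hΛ.jets ha), hc.eventually ha.analyticAt.eventually_analyticAt,
    hc.eventually hΛ.analyticAt.eventually_analyticAt, ha.coeff_eq_zero.eventually_nhds,
    ha.third_coeff_aux 1, ha.third_coeff_aux 2] with τ h1 h2 h3 h4 h5 h6
  have d1 : deriv (secondCoeff h 1) τ = 0 := by
    have : secondCoeff h 1 =ᶠ[𝓝 τ] fun _ => 0 := h4.mono fun y hy => hy.2.1
    rw [this.deriv_eq]; simp
  have a2 : AnalyticAt ℂ (fun χ => thirdJet h (τ, χ)) 0 :=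
    (analyticAt_thirdJet (Λ := h) (x := (τ, 0)) h2).comp_at (by fun_prop) rfl
  have a2' : AnalyticAt ℂ (fun χ => thirdJet Λ (τ, χ)) 0 :=
    (analyticAt_thirdJet (Λ := Λ) (x := (τ, 0)) h3).comp_at (by fun_prop) rfl
  have a3 : AnalyticAt ℂ (fun χ => pd (1, 0) (secondJet h) (τ, χ)) 0 :=
    (analyticAt_pd (1, 0) (analyticAt_secondJet (Λ := h) (x := (τ, 0)) h2)).comp_at
      (by fun_prop) rfl
  have key : ∀ j, thirdCoeff h j τ + 3 / 2 * (I * ε) * τ *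
      cf j (fun χ => χ * pd (1, 0) (secondJet h) (τ, χ)) =
      -I * thirdCoeff Λ j τ + I / 2 * (I * ε) ^ 3 * cf j (fun χ => χ ^ 3) := by
    intro j
    rw [thirdCoeff, thirdCoeff, ← cf_const_mul, ← cf_const_mul, ← cf_const_mul,
      ← cf_add _ (by fun_prop) (by fun_prop), ← cf_add _ (by fun_prop) (by fun_prop)]
    exact cf_congr j (h1.mono fun χ hχ => hχ.2)
  have e3 : ∀ j, cf j (fun χ : ℂ => χ ^ 3) = if j = 3 then 1 else 0 := by
    intro j
    rw [cf, iteratedDeriv_fun_pow_zero]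
    by_cases hj : j = 3
    · subst hj; simp; norm_num
    · simp [hj]
  refine ⟨fun j => ?_, ?_, ?_⟩
  · rw [secondCoeff, secondCoeff, ← cf_const_mul]
    exact cf_congr j (h1.mono fun χ hχ => hχ.1)
  · have := key 2
    rw [h5, d1, e3] at this
    simpa using this
  · have := key 3
    rw [h6, e3] at this
    simpa using this

/-- Up to the factor `-i`, the coefficients differ only in the `χ³` term of the third jet. There the
difference is a constant plus a multiple of the derivative of a second jet coefficient, which
vanishes when that coefficient is constant. -/
lemma LogForm.constantJet_iff (hΛ : LogForm h Λ) {ε : ℂ} (ha : LogAdmissible ε h) :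
    ConstantJet h ↔ ConstantJet Λ := by
  have key := hΛ.coeffs ha
  have k0 := key.self_of_nhds
  simp only [mul_zero, zero_mul, add_zero] at k0
  constructor
  · intro hc
    filter_upwards [key, hc, hc.deriv_eq] with τ h1 h2 h3
    refine ⟨?_, ?_, ?_, ?_⟩ <;> apply mul_left_cancel₀ (neg_ne_zero.2 I_ne_zero)
    · rw [← h1.1, ← k0.1, h2.1]
    · rw [← h1.1, ← k0.1, h2.2.1]
    · rw [← h1.2.1, ← k0.2.1, h2.2.2.1]
    · have e1 := h1.2.2
      rw [h3, h2.2.2.2] at e1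
      linear_combination k0.2.2 - e1
  · intro hc
    have hd : ∀ᶠ τ in 𝓝 0, deriv (secondCoeff h 2) τ = 0 := by
      filter_upwards [key.eventually_nhds, hc.eventually_nhds] with τ h1 h2
      have e : secondCoeff h 2 =ᶠ[𝓝 τ] fun _ => -I * secondCoeff Λ 2 0 := by
        filter_upwards [h1, h2] with y h3 h4
        rw [h3.1, h4.1]
      rw [e.deriv_eq]; simp
    filter_upwards [key, hc, hd] with τ h1 h2 h3
    refine ⟨?_, ?_, ?_, ?_⟩
    · rw [h1.1, k0.1, h2.1]
    · rw [h1.1, k0.1, h2.2.1]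
    · rw [h1.2.1, k0.2.1, h2.2.2.1]
    · have e1 := h1.2.2
      rw [h3, h2.2.2.2] at e1
      linear_combination e1 - k0.2.2

end Transfer

/-! ### The coefficients `h_kl` in terms of the jets -/

section Coefficients

variable {h : ℂ × ℂ × ℂ → ℂ}

lemma tendsto_zero_zero : Tendsto (fun u : ℂ => ((0, 0, u) : ℂ × ℂ × ℂ)) (𝓝 0) (𝓝 0) :=
  tendsto_of_analyticAt (by fun_prop) rfl

lemma hCoeff_eq (hh : AnalyticAt ℂ h 0) : ∀ᶠ u in 𝓝 0, ∀ k l,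
    hCoeff h k l u = cf k (fun z => cf l fun χ => h (z, χ, u)) ∧
    hCoeff h k l u = cf l (fun χ => cf k fun z => h (z, χ, u)) := by
  filter_upwards [tendsto_zero_zero.eventually hh.eventually_analyticAt] with u hu k l
  have ha : AnalyticAt ℂ (fun x : ℂ × ℂ => h (x.1, x.2, u)) 0 := hu.comp_at (by fun_prop) rfl
  rw [hCoeff, taylorCoeff_eq_cf]
  exact ⟨rfl, cf_cf_swap (G := fun x : ℂ × ℂ => h (x.1, x.2, u)) k l ha⟩

lemma cf_line {G : ℂ × ℂ × ℂ → ℂ} {χ u : ℂ} (hG : AnalyticAt ℂ G (0, χ, u)) (k : ℕ) :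
    cf k (fun z => G (z, χ, u)) = (pd (1, 0, 0))^[k] G (0, χ, u) / k.factorial := by
  have := iteratedDeriv_line (G := G) (0, χ, u) (1, 0, 0) k (t := 0) (by simpa using hG)
  simp only [Prod.smul_mk, mul_zero, smul_eq_mul, mul_one, Prod.mk_add_mk, add_zero, zero_add]
    at this
  rw [cf, this]

lemma cf_line_mid {G : ℂ × ℂ × ℂ → ℂ} {z u : ℂ} (hG : AnalyticAt ℂ G (z, 0, u)) (k : ℕ) :
    cf k (fun χ => G (z, χ, u)) = (pd (0, 1, 0))^[k] G (z, 0, u) / k.factorial := by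
  have := iteratedDeriv_line (G := G) (z, 0, u) (0, 1, 0) k (t := 0) (by simpa using hG)
  simp only [Prod.smul_mk, mul_zero, smul_eq_mul, mul_one, Prod.mk_add_mk, add_zero, zero_add]
    at this
  rw [cf, this]

lemma hCoeff_eq_jet (hh : AnalyticAt ℂ h 0) : ∀ᶠ u in 𝓝 0, ∀ l,
    hCoeff h 2 l u = secondCoeff h l u / 2 ∧ hCoeff h 3 l u = thirdCoeff h l u / 6 := by
  filter_upwards [hCoeff_eq hh, eventually_slice (tendsto_left.eventually hh.eventually_analyticAt)]
    with u h1 h2 l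
  have e : ∀ k, hCoeff h k l u = (k.factorial : ℂ)⁻¹ *
      cf l (fun χ => (pd (1, 0, 0))^[k] h (0, χ, u)) := by
    intro k
    rw [(h1 k l).2, ← cf_const_mul]
    refine cf_congr l ?_
    filter_upwards [h2] with χ hχ
    rw [cf_line hχ, div_eq_inv_mul]
  rw [e 2, e 3]
  refine ⟨?_, ?_⟩
  · rw [div_eq_inv_mul]; rfl
  · rw [div_eq_inv_mul, show ((Nat.factorial 3 : ℕ) : ℂ) = 6 by norm_num [Nat.factorial]]; rfl

/-- Up to factorials, `h₂₂` and `h₂₃` are coefficients of the second jet, and `h₃₂` and `h₃₃` of the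
third. -/
lemma isInNormalForm_iff (hh : AnalyticAt ℂ h 0) : IsInNormalForm h ↔ ConstantJet h := by
  have key := hCoeff_eq_jet hh
  have k0 := key.self_of_nhds
  refine eventually_congr (key.mono fun u hu => ?_)
  rw [(hu 2).1, (hu 3).1, (hu 2).2, (hu 3).2, (k0 2).1, (k0 3).1, (k0 2).2, (k0 3).2]
  simp only [div_left_inj' (two_ne_zero : (2 : ℂ) ≠ 0), div_left_inj' (by norm_num : (6 : ℂ) ≠ 0)]

end Coefficients

/-! ### Admissibility by coefficients and by values along `z = 0` and `χ = 0` -/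

section Admissible

variable {h : ℂ × ℂ × ℂ → ℂ}

/-- Each of the four conditions concerns a germ in two variables, which is zero when all its Taylor
coefficients in the first one vanish. -/
lemma _root_.IsAdmissibleFunction.logAdmissible {ε : ℝ} (ha : IsAdmissibleFunction ε h) :
    LogAdmissible (ε : ℂ) h := by
  have hh := ha.analyticAt
  have hl : AnalyticAt ℂ (fun x : ℂ × ℂ => h (0, x.1, x.2)) 0 := hh.comp_at (by fun_prop) rfl
  have hr : AnalyticAt ℂ (fun x : ℂ × ℂ => h (x.1, 0, x.2)) 0 := hh.comp_at (by fun_prop) rfl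
  have hl1 : AnalyticAt ℂ (fun x : ℂ × ℂ => pd (1, 0, 0) h (0, x.1, x.2)) 0 :=
    (analyticAt_pd (1, 0, 0) hh).comp_at (by fun_prop) rfl
  have hr1 : AnalyticAt ℂ (fun x : ℂ × ℂ => pd (0, 1, 0) h (x.1, 0, x.2)) 0 :=
    (analyticAt_pd (0, 1, 0) hh).comp_at (by fun_prop) rfl
  have sw : Tendsto (fun x : ℂ × ℂ => ((0, x.2, x.1) : ℂ × ℂ × ℂ)) (𝓝 0) (𝓝 0) :=
    tendsto_of_analyticAt (by fun_prop) rfl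
  have sw' : Tendsto (fun x : ℂ × ℂ => ((x.2, 0, x.1) : ℂ × ℂ × ℂ)) (𝓝 0) (𝓝 0) :=
    tendsto_of_analyticAt (by fun_prop) rfl
  refine ⟨hh, eventually_eq_zero_of_cf₂ hl ?_, eventually_eq_zero_of_cf₂ hr ?_, ?_, ?_⟩
  · filter_upwards [hCoeff_eq hh, ha.coeff] with u h1 h2 j
    have := (h1 0 j).1
    rw [h2 0 j (by omega), if_neg (by simp), cf_zero] at this
    exact this.symm
  · filter_upwards [hCoeff_eq hh, ha.coeff] with u h1 h2 j
    have := (h1 j 0).2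
    rw [h2 j 0 (by omega), if_neg (by simp), cf_zero] at this
    exact this.symm
  · have key : ∀ᶠ x : ℂ × ℂ in 𝓝 0, pd (1, 0, 0) h (0, x.1, x.2) - ε * x.1 = 0 := by
      refine eventually_eq_zero_of_cf₂
        (G := fun x : ℂ × ℂ => pd (1, 0, 0) h (0, x.1, x.2) - ε * x.1) (by fun_prop) ?_
      filter_upwards [hCoeff_eq hh, ha.coeff, tendsto_zero_zero.eventually hh.eventually_analyticAt,
        eventually_slice (sw.eventually hh.eventually_analyticAt)] with u h1 h2 h3 h4 j
      have a1 : AnalyticAt ℂ (fun χ => pd (1, 0, 0) h (0, χ, u)) 0 :=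
        (analyticAt_pd (1, 0, 0) h3).comp_at (by fun_prop) rfl
      rw [cf_sub _ a1 (by fun_prop), cf_const_mul, cf_id]
      have := (h1 1 j).2
      have e : cf j (fun χ => pd (1, 0, 0) h (0, χ, u)) =
          cf j (fun χ => cf 1 fun z => h (z, χ, u)) := by
        refine cf_congr j ?_
        filter_upwards [h4] with χ hχ
        rw [cf_line hχ]; simp
      rw [e, ← this, h2 1 j (by omega)]
      by_cases hj : j = 1 <;> simp [hj]
    exact key.mono fun x hx => sub_eq_zero.1 hx
  · have key : ∀ᶠ x : ℂ × ℂ in 𝓝 0, pd (0, 1, 0) h (x.1, 0, x.2) - ε * x.1 = 0 := by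
      refine eventually_eq_zero_of_cf₂
        (G := fun x : ℂ × ℂ => pd (0, 1, 0) h (x.1, 0, x.2) - ε * x.1) (by fun_prop) ?_
      filter_upwards [hCoeff_eq hh, ha.coeff, tendsto_zero_zero.eventually hh.eventually_analyticAt,
        eventually_slice (sw'.eventually hh.eventually_analyticAt)] with u h1 h2 h3 h4 j
      have a1 : AnalyticAt ℂ (fun z => pd (0, 1, 0) h (z, 0, u)) 0 :=
        (analyticAt_pd (0, 1, 0) h3).comp_at (by fun_prop) rfl
      rw [cf_sub _ a1 (by fun_prop), cf_const_mul, cf_id]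
      have := (h1 j 1).1
      have e : cf j (fun z => pd (0, 1, 0) h (z, 0, u)) =
          cf j (fun z => cf 1 fun χ => h (z, χ, u)) := by
        refine cf_congr j ?_
        filter_upwards [h4] with z hz
        rw [cf_line_mid hz]; simp
      rw [e, ← this, h2 j 1 (by omega)]
      by_cases hj : j = 1 <;> simp [hj]
    exact key.mono fun x hx => sub_eq_zero.1 hx

lemma LogAdmissible.isAdmissibleFunction {ε : ℝ} (ha : LogAdmissible (ε : ℂ) h)
    (hε : ε = 1 ∨ ε = -1)
    (hr : ∀ᶠ x : ℂ × ℝ in 𝓝 0, (h (x.1, conj x.1, (x.2 : ℂ))).im = 0) :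
    IsAdmissibleFunction ε h := by
  have hh := ha.analyticAt
  have swap : Tendsto (fun x : ℂ × ℂ => (x.2, x.1)) (𝓝 0) (𝓝 0) :=
    tendsto_of_analyticAt (by fun_prop) rfl
  have sw : Tendsto (fun x : ℂ × ℂ => ((0, x.2, x.1) : ℂ × ℂ × ℂ)) (𝓝 0) (𝓝 0) :=
    tendsto_of_analyticAt (by fun_prop) rfl
  have sw' : Tendsto (fun x : ℂ × ℂ => ((x.2, 0, x.1) : ℂ × ℂ × ℂ)) (𝓝 0) (𝓝 0) :=
    tendsto_of_analyticAt (by fun_prop) rfl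
  refine ⟨hε, hh, hr, ?_⟩
  filter_upwards [hCoeff_eq hh, eventually_slice (swap.eventually ha.left),
    eventually_slice (swap.eventually ha.right), eventually_slice (swap.eventually ha.pd_left),
    eventually_slice (swap.eventually ha.pd_right),
    eventually_slice (sw.eventually hh.eventually_analyticAt),
    eventually_slice (sw'.eventually hh.eventually_analyticAt)] with u h1 l0 r0 l1 r1 a1 a2 k l hkl
  have hk0 : ∀ l, hCoeff h 0 l u = 0 := fun l => by
    rw [(h1 0 l).1, cf_zero, cf_congr l (g' := fun _ => 0) l0, cf_const]; simp
  have hl0 : ∀ k, hCoeff h k 0 u = 0 := fun k => by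
    rw [(h1 k 0).2, cf_zero, cf_congr k (g' := fun _ => 0) r0, cf_const]; simp
  have hk1 : ∀ l, hCoeff h 1 l u = if l = 1 then (ε : ℂ) else 0 := fun l => by
    rw [(h1 1 l).2, cf_congr l (g' := fun χ => (ε : ℂ) * χ), cf_const_mul, cf_id]
    · simp
    · filter_upwards [l1, a1] with χ e1 e2
      rw [cf_line e2]; simpa using e1
  have hl1 : ∀ k, hCoeff h k 1 u = if k = 1 then (ε : ℂ) else 0 := fun k => by
    rw [(h1 k 1).1, cf_congr k (g' := fun z => (ε : ℂ) * z), cf_const_mul, cf_id]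
    · simp
    · filter_upwards [r1, a2] with z e1 e2
      rw [cf_line_mid e2]; simpa using e1
  rcases hkl with hk | hl
  · interval_cases k
    · rw [hk0]; simp
    · rw [hk1]; simp
  · interval_cases l
    · rw [hl0]; simp
    · rw [hl1]; simp

end Admissible

/-! ### The differential equation of the Segre varieties -/

section AssociatedODE

variable {h Λ : ℂ × ℂ × ℂ → ℂ} {c : ℂ}

/-- The curves `log w = log τ + Λ(z, χ, τ)` are the solutions of a second order equation. -/
theorem LogAdmissible.exists_ode (ha : LogAdmissible c Λ) (hc : c ≠ 0) :
    ∃ Ψ : ℂ × ℂ × ℂ → ℂ, AnalyticAt ℂ Ψ 0 ∧ OrderTwo Ψ ∧ ∀ᶠ x : ℂ × ℂ × ℂ in 𝓝 0,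
      pd (1, 0, 0) (pd (1, 0, 0) Λ) x = Ψ (x.1, x.2.2 * exp (Λ x), pd (1, 0, 0) Λ x) := by
  have hΛ := ha.analyticAt
  set e1 : ℂ × ℂ × ℂ := (1, 0, 0) with he1
  have hΛ0 : Λ 0 = 0 := ha.left.self_of_nhds
  have hΛ1 : pd e1 Λ 0 = 0 := by
    exact ha.pd_left.self_of_nhds.trans (mul_zero c)
  have e21 : pd (0, 1, 0) (pd e1 Λ) 0 = c := by
    have := pd_slice_right (g := fun z => c * z) (g' := fun _ => c) (analyticAt_pd _ hΛ)
      (fun z => by simpa using (hasDerivAt_id z).const_mul c) ha.pd_right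
    rw [pd_comm hΛ]
    exact this.self_of_nhds
  have e31 : pd (0, 0, 1) (pd e1 Λ) 0 = 0 :=
    (pd_right_of_slice (g := fun χ => c * χ) (analyticAt_pd _ hΛ) ha.pd_left rfl).self_of_nhds
  set κ : (ℂ × ℂ × ℂ) × ℂ × ℂ → ℂ × ℂ × ℂ := fun p => (p.1.1, p.2.1, p.2.2) with hκ
  have hκa : ∀ p, AnalyticAt ℂ κ p := fun p => by simp only [hκ]; fun_prop
  have a1 : AnalyticAt ℂ (fun p => Λ (κ p)) (0, 0) := hΛ.comp_at (hκa _) rfl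
  have a2 : AnalyticAt ℂ (fun p => pd e1 Λ (κ p)) (0, 0) :=
    (analyticAt_pd e1 hΛ).comp_at (hκa _) rfl
  have aG : AnalyticAt ℂ (fun p : (ℂ × ℂ × ℂ) × ℂ × ℂ =>
      ((p.2.2 * exp (Λ (κ p)) - p.1.2.1, pd e1 Λ (κ p) - p.1.2.2) : ℂ × ℂ)) (0, 0) := by fun_prop
  -- The parameters `(χ, τ)` are eliminated from `w = τ e ^ Λ` and `ζ = Λ_z`. The differential in
  -- `(χ, τ) = (a, b)` is `(b, c a)`, which is injective because `c ≠ 0`.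
  obtain ⟨φ, hφ, hφ0, hφ1, hφ2⟩ := exists_implicit aG
    (by
      have e : κ (0, 0) = 0 := rfl
      simp [e, hΛ0, hΛ1]) (by
      rintro ⟨a, b⟩ hv
      have hl : HasDerivAt (fun s : ℂ => (((0 : ℂ × ℂ × ℂ), s * a, s * b) : (ℂ × ℂ × ℂ) × ℂ × ℂ))
          (0, a, b) 0 := (hasDerivAt_const _ _).prodMk ((hasDerivAt_lin a).prodMk (hasDerivAt_lin b))
      have hl' : HasDerivAt (fun s : ℂ => ((0, s * a, s * b) : ℂ × ℂ × ℂ)) (0, a, b) 0 :=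
        (hasDerivAt_const _ _).prodMk ((hasDerivAt_lin a).prodMk (hasDerivAt_lin b))
      have z3 : ((0, 0 * a, 0 * b) : ℂ × ℂ × ℂ) = 0 := by simp
      have z5 : (((0 : ℂ × ℂ × ℂ), 0 * a, 0 * b) : (ℂ × ℂ × ℂ) × ℂ × ℂ) = (0, 0) := by simp
      have d1 := hasDerivAt_comp_pd (t := 0) (G := fun p : (ℂ × ℂ × ℂ) × ℂ × ℂ =>
        ((p.2.2 * exp (Λ (κ p)) - p.1.2.1, pd e1 Λ (κ p) - p.1.2.2) : ℂ × ℂ))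
        (by rw [z5]; exact aG.differentiableAt) hl
      have d2 := hasDerivAt_comp_pd (t := 0) (G := Λ) (by rw [z3]; exact hΛ.differentiableAt) hl'
      have d3 := hasDerivAt_comp_pd (t := 0) (G := pd e1 Λ)
        (by rw [z3]; exact (analyticAt_pd e1 hΛ).differentiableAt) hl'
      have d4 := (((hasDerivAt_lin b).fun_mul d2.cexp).sub_const 0).prodMk (d3.sub_const 0)
      have := d1.unique d4
      rw [z5, hv, z3, pd_triple (pd e1 Λ), e21, e31, hΛ0] at this
      simp only [Prod.ext_iff] at this
      simp [hc] at this
      exact Prod.ext this.2 this.1.symm)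
  set Ψ : ℂ × ℂ × ℂ → ℂ := fun y => pd e1 (pd e1 Λ) (y.1, (φ y).1, (φ y).2) with hΨ
  have hΨa : AnalyticAt ℂ Ψ 0 := by
    refine AnalyticAt.comp_at (y := 0) (analyticAt_pd e1 (analyticAt_pd e1 hΛ)) (by fun_prop) ?_
    simp only [hφ0]; rfl
  have heq : ∀ᶠ x : ℂ × ℂ × ℂ in 𝓝 0,
      pd e1 (pd e1 Λ) x = Ψ (x.1, x.2.2 * exp (Λ x), pd e1 Λ x) := by
    have t : Tendsto (fun x : ℂ × ℂ × ℂ => (((x.1, x.2.2 * exp (Λ x), pd e1 Λ x), x.2) :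
        (ℂ × ℂ × ℂ) × ℂ × ℂ)) (𝓝 0) (𝓝 (0, 0)) :=
      tendsto_of_analyticAt (by fun_prop) (by simp [hΛ1])
    filter_upwards [t.eventually hφ2] with x hx
    have := hx (by simp [hκ])
    simp only [hΨ, ← this]
  refine ⟨Ψ, hΨa, ?_, heq⟩
  have p1 := pd_slice_right (g' := fun _ => 0) hΛ (fun z => hasDerivAt_const _ _) ha.right
  have p2 := pd_slice_right (g' := fun _ => 0) (analyticAt_pd _ hΛ) (fun z => hasDerivAt_const _ _) p1
  have q1 := pd_slice_right (g := fun z => c * z) (g' := fun _ => c) (analyticAt_pd _ hΛ)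
    (fun z => by simpa using (hasDerivAt_id z).const_mul c) ha.pd_right
  have q2 := pd_slice_right (g' := fun _ => 0) (analyticAt_pd _ (analyticAt_pd _ hΛ))
    (fun z => hasDerivAt_const _ _) q1
  -- Slope zero occurs for `χ = 0`, where `Λ_zz` vanishes.
  have v0 : ∀ᶠ x : ℂ × ℂ in 𝓝 0, Ψ (x.1, x.2, 0) = 0 := by
    filter_upwards [tendsto_zero_mid.eventually heq, ha.right, p1, p2] with x h1 h2 h3 h4
    simp only [h2, exp_zero, mul_one, he1, h3, h4] at h1
    exact h1.symm
  have tz : Tendsto (fun x : ℂ × ℂ => ((x.1, x.2, 0) : ℂ × ℂ × ℂ)) (𝓝 0) (𝓝 0) :=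
    tendsto_of_analyticAt (by fun_prop) rfl
  filter_upwards [v0.eventually_nhds, tz.eventually hΨa.eventually_analyticAt,
    tendsto_zero_mid.eventually heq.eventually_nhds,
    tendsto_zero_mid.eventually hΛ.eventually_analyticAt.eventually_nhds, ha.right, ha.pd_right,
    p1, p2, q1, q2] with x h0 hΨx heqx han r1 r2 s1 s2 s3 s4
  refine ⟨h0.self_of_nhds, ?_⟩
  obtain ⟨z, w⟩ := x
  simp only at *
  have hA := han.self_of_nhds
  have hw : pd (0, 1, 0) Ψ (z, w, 0) = 0 := by
    have hl : Tendsto (fun s : ℂ => (z, s)) (𝓝 w) (𝓝 (z, w)) :=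
      tendsto_of_analyticAt (by fun_prop) rfl
    have h1 := hasDerivAt_comp₃ (G := Ψ) (a := fun _ => z) (b := fun s => s) (c := fun _ => 0)
      (t := w) hΨx.differentiableAt (hasDerivAt_const _ _) (hasDerivAt_id _) (hasDerivAt_const _ _)
    have h2 := h1.congr_of_eventuallyEq (EventuallyEq.symm (hl.eventually h0))
    simpa using h2.unique (hasDerivAt_const _ _)
  have hd := hasDerivAt_comp₃ (G := Ψ) (a := fun _ => z) (b := fun _ => w) (c := fun s => s)
    (t := 0) hΨx.differentiableAt (hasDerivAt_const _ _) (hasDerivAt_const _ _) (hasDerivAt_id _)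
  simp only [zero_mul, zero_add, one_mul] at hd
  rw [hd.deriv]
  have lin : ∀ {G : ℂ × ℂ × ℂ → ℂ}, AnalyticAt ℂ G (z, 0, w) →
      HasDerivAt (fun χ => G (z, χ, w)) (pd (0, 1, 0) G (z, 0, w)) 0 := fun {G} hG => by
    simpa using hasDerivAt_comp₃ (G := G) (a := fun _ => z) (b := fun s => s) (c := fun _ => w)
      (t := 0) hG.differentiableAt (hasDerivAt_const _ _) (hasDerivAt_id _) (hasDerivAt_const _ _)
  -- The equation is differentiated in `χ` at `χ = 0`: there `Λ_zzχ = 0` and `Λ_zχ = c`, so `c Ψ_ζ =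
  -- 0`.
  have k1 := lin (analyticAt_pd e1 (analyticAt_pd e1 hA))
  have k2 := hasDerivAt_comp₃ (G := Ψ) (a := fun _ => z) (b := fun χ => w * exp (Λ (z, χ, w)))
    (c := fun χ => pd e1 Λ (z, χ, w)) (t := 0) (by simpa [r1, he1, s1] using hΨx.differentiableAt)
    (hasDerivAt_const _ _) ((lin hA).cexp.const_mul w) (lin (analyticAt_pd e1 hA))
  have hl : Tendsto (fun s : ℂ => ((z, s, w) : ℂ × ℂ × ℂ)) (𝓝 0) (𝓝 (z, 0, w)) :=
    tendsto_of_analyticAt (by fun_prop) rfl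
  have k3 := k1.unique (k2.congr_of_eventuallyEq (hl.eventually heqx))
  have c1 : pd (0, 1, 0) (pd e1 Λ) (z, 0, w) = c := (pd_comm hA _ _).trans s3
  have c2 : pd (0, 1, 0) (pd e1 (pd e1 Λ)) (z, 0, w) = 0 := by
    rw [pd_comm (analyticAt_pd _ hA)]
    refine Eq.trans (pd_congr e1 ?_) s4
    filter_upwards [han] with y hy using pd_comm hy _ _
  have s1' : pd e1 Λ (z, 0, w) = 0 := s1
  rw [c1, c2, r1, s1', exp_zero, mul_one, hw, mul_zero, add_zero, zero_mul, zero_add] at k3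
  exact (mul_eq_zero.1 k3.symm).resolve_left hc

lemma LogForm.isComplexDefiningFunction (hΛ : LogForm h Λ) :
    IsComplexDefiningFunction h fun x => x.2.2 * exp (Λ x) := by
  have ha := hΛ.analyticAt
  refine ⟨by fun_prop, by simp, ?_⟩
  filter_upwards [hΛ.eqn] with x hx
  have e : (x.2.2 * exp (Λ x) + x.2.2) / 2 = x.2.2 * (exp (Λ x) + 1) / 2 := by ring
  rw [e, div_eq_iff (by simp [I_ne_zero])]
  linear_combination x.2.2 * hx

/-- For `y = log w` one has `w'' / w = y'' + (y')²`. -/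
lemma isAssociatedODE_of_log {Ψ : ℂ × ℂ × ℂ → ℂ} (hΛ : AnalyticAt ℂ Λ 0)
    (hΨ : AnalyticAt ℂ Ψ 0) (h2 : OrderTwo Ψ) (heq : ∀ᶠ x : ℂ × ℂ × ℂ in 𝓝 0,
      pd (1, 0, 0) (pd (1, 0, 0) Λ) x = Ψ (x.1, x.2.2 * exp (Λ x), pd (1, 0, 0) Λ x)) :
    IsAssociatedODE (fun x => x.2.2 * exp (Λ x)) (fun x => Ψ x + x.2.2 ^ 2) := by
  refine ⟨by fun_prop, ?_, ?_⟩
  · have hc : Tendsto (fun x : ℂ × ℂ => ((x.1, x.2, 0) : ℂ × ℂ × ℂ)) (𝓝 0) (𝓝 0) :=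
      tendsto_of_analyticAt (by fun_prop) rfl
    filter_upwards [h2, hc.eventually hΨ.eventually_analyticAt] with x hx ha
    refine ⟨by simp [hx.1], ?_⟩
    have h1 : AnalyticAt ℂ (fun ζ => Ψ (x.1, x.2, ζ)) 0 := ha.comp_at (by fun_prop) rfl
    have h3 : HasDerivAt (fun ζ : ℂ => ζ ^ 2) 0 0 := by simpa using hasDerivAt_pow 2 (0 : ℂ)
    have := h1.differentiableAt.hasDerivAt.fun_add h3
    rw [hx.2, add_zero] at this
    exact this.deriv
  · filter_upwards [heq, hΛ.eventually_analyticAt.eventually_nhds] with x hx han hτ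
    obtain ⟨z, χ, τ⟩ := x
    simp only at *
    have lin : ∀ {G : ℂ × ℂ × ℂ → ℂ} {s : ℂ}, AnalyticAt ℂ G (s, χ, τ) →
        HasDerivAt (fun z => G (z, χ, τ)) (pd (1, 0, 0) G (s, χ, τ)) s := fun {G s} hG => by
      simpa using hasDerivAt_comp₃ (G := G) (b := fun _ => χ) (c := fun _ => τ)
        hG.differentiableAt (hasDerivAt_id s) (hasDerivAt_const _ _) (hasDerivAt_const _ _)
    have hl : Tendsto (fun s : ℂ => ((s, χ, τ) : ℂ × ℂ × ℂ)) (𝓝 z) (𝓝 (z, χ, τ)) :=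
      tendsto_of_analyticAt (by fun_prop) rfl
    have d1 : ∀ᶠ s in 𝓝 z, deriv (fun z => τ * exp (Λ (z, χ, τ))) s =
        τ * (exp (Λ (s, χ, τ)) * pd (1, 0, 0) Λ (s, χ, τ)) := by
      filter_upwards [hl.eventually han] with s hs
      exact ((lin hs).cexp.const_mul τ).deriv
    have d2 := (((lin han.self_of_nhds).cexp.fun_mul
      (lin (analyticAt_pd (1, 0, 0) han.self_of_nhds))).const_mul τ).congr_of_eventuallyEq d1
    rw [iteratedDeriv_succ, iteratedDeriv_one, d2.deriv, d1.self_of_nhds]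
    have e : τ * (exp (Λ (z, χ, τ)) * pd (1, 0, 0) Λ (z, χ, τ)) / (τ * exp (Λ (z, χ, τ))) =
        pd (1, 0, 0) Λ (z, χ, τ) := by
      have := exp_ne_zero (Λ (z, χ, τ))
      field_simp
    rw [e, ← hx]
    ring

lemma logODE_add (Ψ : ℂ × ℂ × ℂ → ℂ) : logODE (fun x => Ψ x + x.2.2 ^ 2) = Ψ := by
  ext x; simp [logODE]

end AssociatedODE

/-! ### Transformations and their companions on the complexified hypersurface -/

section Pair

/-- Germs of analytic functions vanishing at the origin which define a transformation
`(f, w e ^ γ)` together with a companion `(f', τ e ^ γ')` acting on the conjugate variables. -/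
structure TransformationGerms (f γ f' γ' : ℂ × ℂ → ℂ) : Prop where
  analyticAt_f : AnalyticAt ℂ f 0
  analyticAt_γ : AnalyticAt ℂ γ 0
  analyticAt_f' : AnalyticAt ℂ f' 0
  analyticAt_γ' : AnalyticAt ℂ γ' 0
  f_zero : f 0 = 0
  γ_zero : γ 0 = 0
  f'_zero : f' 0 = 0
  γ'_zero : γ' 0 = 0

/-- The transformation `(f, w e ^ γ)`, together with its companion `(f', τ e ^ γ')`, maps the complex
hypersurface `w = τ e ^ Λ₁(z, χ, τ)` into `w = τ e ^ Λ(z, χ, τ)`. -/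
structure TransformationPair (Λ₁ Λ : ℂ × ℂ × ℂ → ℂ) (f γ f' γ' : ℂ × ℂ → ℂ) : Prop extends
    TransformationGerms f γ f' γ' where
  rel : ∀ᶠ x : ℂ × ℂ × ℂ in 𝓝 0, γ (x.1, x.2.2 * exp (Λ₁ x)) + Λ₁ x =
    γ' x.2 + Λ (f (x.1, x.2.2 * exp (Λ₁ x)), f' x.2, x.2.2 * exp (γ' x.2))

variable {Λ₁ Λ Ψ : ℂ × ℂ × ℂ → ℂ} {f γ f' γ' : ℂ × ℂ → ℂ} {c : ℂ}

lemma hasDerivAt_slice {G : ℂ × ℂ × ℂ → ℂ} {z χ τ : ℂ} (hG : AnalyticAt ℂ G (z, χ, τ)) :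
    HasDerivAt (fun z => G (z, χ, τ)) (pd (1, 0, 0) G (z, χ, τ)) z := by
  simpa using hasDerivAt_comp₃ (G := G) (b := fun _ => χ) (c := fun _ => τ)
    hG.differentiableAt (hasDerivAt_id z) (hasDerivAt_const _ _) (hasDerivAt_const _ _)

lemma hasDerivAt_slice_mid {G : ℂ × ℂ × ℂ → ℂ} {z χ τ : ℂ} (hG : AnalyticAt ℂ G (z, χ, τ)) :
    HasDerivAt (fun χ => G (z, χ, τ)) (pd (0, 1, 0) G (z, χ, τ)) χ := by
  simpa using hasDerivAt_comp₃ (G := G) (a := fun _ => z) (c := fun _ => τ)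
    hG.differentiableAt (hasDerivAt_const _ _) (hasDerivAt_id χ) (hasDerivAt_const _ _)

namespace TransformationPair

variable (hp : TransformationPair Λ₁ Λ f γ f' γ')

include hp

/-- The equations for the Cauchy data at `z = 0`. -/
lemma data_eqns (h₁ : LogAdmissible c Λ₁) (hΛ : AnalyticAt ℂ Λ 0) : ∀ᶠ x : ℂ × ℂ in 𝓝 0,
    γ (0, x.2) = γ' x + Λ (f (0, x.2), f' x, x.2 * exp (γ' x)) ∧
    dz γ (0, x.2) + c * x.1 * (1 + dw γ (0, x.2)) =
      pd (1, 0, 0) Λ (f (0, x.2), f' x, x.2 * exp (γ' x)) *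
        (dz f (0, x.2) + c * x.1 * dw f (0, x.2)) := by
  have af := hp.analyticAt_f
  have ag := hp.analyticAt_γ
  have af' := hp.analyticAt_f'
  have ag' := hp.analyticAt_γ'
  have t2 : Tendsto (fun x : ℂ × ℂ => ((0, x.2) : ℂ × ℂ)) (𝓝 0) (𝓝 0) :=
    tendsto_of_analyticAt (by fun_prop) rfl
  have b1 : AnalyticAt ℂ (fun x : ℂ × ℂ => f (0, x.2)) 0 := af.comp_at (by fun_prop) rfl
  have t3 : Tendsto (fun x : ℂ × ℂ => (f (0, x.2), f' x, x.2 * exp (γ' x))) (𝓝 0) (𝓝 0) :=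
    tendsto_of_analyticAt (by fun_prop) (by
      have : f (0, 0) = 0 := hp.f_zero
      simp [this, hp.f'_zero])
  filter_upwards [tendsto_zero_left.eventually hp.rel.eventually_nhds, h₁.left, h₁.pd_left,
    t2.eventually af.eventually_analyticAt, t2.eventually ag.eventually_analyticAt,
    t3.eventually hΛ.eventually_analyticAt, tendsto_zero_left.eventually
    h₁.analyticAt.eventually_analyticAt] with x hr h0 h1 a1 a2 a3 a4
  obtain ⟨χ, τ⟩ := x
  simp only at *
  have r0 := hr.self_of_nhds
  simp only [h0, exp_zero, mul_one, add_zero] at r0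
  refine ⟨r0, ?_⟩
  have hl : Tendsto (fun s : ℂ => ((s, χ, τ) : ℂ × ℂ × ℂ)) (𝓝 0) (𝓝 (0, χ, τ)) :=
    tendsto_of_analyticAt (by fun_prop) rfl
  have d0 := hasDerivAt_slice a4
  have dW : HasDerivAt (fun z => τ * exp (Λ₁ (z, χ, τ)))
      ((fun z => τ * exp (Λ₁ (z, χ, τ))) 0 * (c * χ)) 0 :=
    (d0.cexp.const_mul τ).congr_deriv (by rw [h1]; simp only; ring)
  have e0 : τ * exp (Λ₁ (0, χ, τ)) = τ := by simp [h0]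
  have d1 := hasDerivAt_along (g := γ) (by simp only [e0]; exact a2) dW
  have d2 := hasDerivAt_along (g := f) (by simp only [e0]; exact a1) dW
  have d3 := hasDerivAt_comp₃ (G := Λ) (b := fun _ => f' (χ, τ))
    (c := fun _ => τ * exp (γ' (χ, τ))) (by simp only [e0]; exact a3.differentiableAt) d2
    (hasDerivAt_const _ _) (hasDerivAt_const _ _)
  have := (d1.fun_add d0).unique ((d3.const_add (γ' (χ, τ))).congr_of_eventuallyEq (hl.eventually hr))
  simp only [e0, h1] at this
  linear_combination this

/-- The only condition not assumed, `γ_z(0) = 0`, is the second equation for the data at the origin.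
-/
lemma normalizedMap (h₁ : LogAdmissible c Λ₁) (h : LogAdmissible c Λ) (hf : dz f 0 = 1) :
    NormalizedMap f γ := by
  refine ⟨hp.analyticAt_f, hp.analyticAt_γ, hp.f_zero, hp.γ_zero, hf, ?_⟩
  have := (hp.data_eqns h₁ h.analyticAt).self_of_nhds.2
  have e : pd (1, 0, 0) Λ (0, 0, 0) = 0 := h.pd_left.self_of_nhds.trans (mul_zero c)
  have ef : f (0, 0) = 0 := hp.f_zero
  simp only [Prod.snd_zero, Prod.fst_zero, mul_zero, zero_mul, add_zero, ef, hp.f'_zero] at this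
  rw [e, zero_mul] at this
  exact this

/-- The transformation rule for the associated differential equation. -/
lemma pullback_eq (h₁ : LogAdmissible c Λ₁) (h : LogAdmissible c Λ) (hdf : dz f 0 = 1)
    (hΨ : ∀ᶠ x : ℂ × ℂ × ℂ in 𝓝 0,
      pd (1, 0, 0) (pd (1, 0, 0) Λ) x = Ψ (x.1, x.2.2 * exp (Λ x), pd (1, 0, 0) Λ x)) :
    ∀ᶠ x : ℂ × ℂ × ℂ in 𝓝 0,
      pd (1, 0, 0) (pd (1, 0, 0) Λ₁) x * logJac f γ (x.1, x.2.2 * exp (Λ₁ x)) =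
        pullback f γ Ψ ((x.1, x.2.2 * exp (Λ₁ x)), pd (1, 0, 0) Λ₁ x) := by
  have af := hp.analyticAt_f
  have ag := hp.analyticAt_γ
  have af' := hp.analyticAt_f'
  have ag' := hp.analyticAt_γ'
  have aΛ₁ := h₁.analyticAt
  have aΛ := h.analyticAt
  have z1 : Λ₁ 0 = 0 := h₁.left.self_of_nhds
  have aW : AnalyticAt ℂ (fun x : ℂ × ℂ × ℂ => ((x.1, x.2.2 * exp (Λ₁ x)) : ℂ × ℂ)) 0 := by fun_prop
  have tW : Tendsto (fun x : ℂ × ℂ × ℂ => ((x.1, x.2.2 * exp (Λ₁ x)) : ℂ × ℂ)) (𝓝 0) (𝓝 0) :=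
    tendsto_of_analyticAt aW (by simp)
  have b1 : AnalyticAt ℂ (fun x : ℂ × ℂ × ℂ => f (x.1, x.2.2 * exp (Λ₁ x))) 0 :=
    af.comp_at aW (by simp)
  have b2 : AnalyticAt ℂ (fun x : ℂ × ℂ × ℂ => f' x.2) 0 := af'.comp_at (by fun_prop) rfl
  have b3 : AnalyticAt ℂ (fun x : ℂ × ℂ × ℂ => γ' x.2) 0 := ag'.comp_at (by fun_prop) rfl
  have tV : Tendsto (fun x : ℂ × ℂ × ℂ => (f (x.1, x.2.2 * exp (Λ₁ x)), f' x.2,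
      x.2.2 * exp (γ' x.2))) (𝓝 0) (𝓝 0) :=
    tendsto_of_analyticAt (b1.prod (b2.prod (AnalyticAt.fun_mul (by fun_prop) b3.cexp'))) (by
      have : f (0, 0) = 0 := hp.f_zero
      simp [this, hp.f'_zero])
  have c1 : AnalyticAt ℂ (fun x : ℂ × ℂ × ℂ => dz f (x.1, x.2.2 * exp (Λ₁ x))
      + pd (1, 0, 0) Λ₁ x * dw f (x.1, x.2.2 * exp (Λ₁ x))) 0 := by
    have k1 : AnalyticAt ℂ (fun x : ℂ × ℂ × ℂ => dz f (x.1, x.2.2 * exp (Λ₁ x))) 0 :=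
      (analyticAt_dz af).comp_at aW (by simp)
    have k2 : AnalyticAt ℂ (fun x : ℂ × ℂ × ℂ => dw f (x.1, x.2.2 * exp (Λ₁ x))) 0 :=
      (analyticAt_dw af).comp_at aW (by simp)
    fun_prop
  have hX' := c1.continuousAt.eventually_ne (y := 0) (by
    have : dz f (0, 0) = 1 := hdf
    have : dw f (0, 0) = 0 := by simp [dw]
    simp [*])
  filter_upwards [hp.rel.eventually_nhds, aΛ₁.eventually_analyticAt.eventually_nhds,
    (tW.eventually af.eventually_analyticAt).eventually_nhds,
    (tW.eventually ag.eventually_analyticAt).eventually_nhds,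
    (tV.eventually aΛ.eventually_analyticAt).eventually_nhds, tV.eventually hΨ, hX'] with
    x hr nΛ₁ nf nγ nΛ hode hne
  obtain ⟨z, χ, τ⟩ := x
  simp only at *
  set W : ℂ → ℂ := fun z => τ * exp (Λ₁ (z, χ, τ)) with hW
  set ζ : ℂ → ℂ := fun z => pd (1, 0, 0) Λ₁ (z, χ, τ) with hζ
  have hl : Tendsto (fun s : ℂ => ((s, χ, τ) : ℂ × ℂ × ℂ)) (𝓝 z) (𝓝 (z, χ, τ)) :=
    tendsto_of_analyticAt (by fun_prop) rfl
  have dW : ∀ᶠ s in 𝓝 z, HasDerivAt W (W s * ζ s) s := by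
    filter_upwards [hl.eventually nΛ₁] with s hs
    exact ((hasDerivAt_slice hs).cexp.const_mul τ).congr_deriv (by simp only [hW, hζ]; ring)
  have dζ : HasDerivAt ζ (pd (1, 0, 0) (pd (1, 0, 0) Λ₁) (z, χ, τ)) z :=
    hasDerivAt_slice (analyticAt_pd _ nΛ₁.self_of_nhds)
  set X : ℂ → ℂ := fun s => f (s, W s) with hX
  set X' : ℂ → ℂ := fun s => dz f (s, W s) + ζ s * dw f (s, W s) with hXd
  set Y' : ℂ → ℂ := fun s => dz γ (s, W s) + ζ s * dw γ (s, W s) + ζ s with hYd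
  set b := f' (χ, τ)
  set t := τ * exp (γ' (χ, τ)) with ht
  have dX : ∀ᶠ s in 𝓝 z, HasDerivAt X (X' s) s := by
    filter_upwards [hl.eventually nf, dW] with s h1 h2 using hasDerivAt_along h1 h2
  have dY : ∀ᶠ s in 𝓝 z, HasDerivAt (fun s => γ (s, W s) + Λ₁ (s, χ, τ)) (Y' s) s := by
    filter_upwards [hl.eventually nγ, dW, hl.eventually nΛ₁] with s h1 h2 h3
    exact (hasDerivAt_along h1 h2).fun_add (hasDerivAt_slice h3)
  -- The image of a Segre curve is the Segre curve with parameters `(b, t)`. Differentiating this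
  -- statement once more gives `Y''`.
  have eY : ∀ᶠ s in 𝓝 z, Y' s = pd (1, 0, 0) Λ (X s, b, t) * X' s := by
    filter_upwards [(hl.eventually hr).eventually_nhds, dX, dY, hl.eventually nΛ] with s h1 h2 h3 h4
    have := h3.unique (((hasDerivAt_comp₃ (G := Λ) (b := fun _ => b) (c := fun _ => t)
      h4.differentiableAt h2 (hasDerivAt_const _ _) (hasDerivAt_const _ _)).const_add
      (γ' (χ, τ))).congr_of_eventuallyEq h1)
    linear_combination this
  have dWz := dW.self_of_nhds
  have af2 : AnalyticAt ℂ f (z, W z) := nf.self_of_nhds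
  have ag2 : AnalyticAt ℂ γ (z, W z) := nγ.self_of_nhds
  have dX2 : HasDerivAt X' _ z := (hasDerivAt_along (analyticAt_dz af2) dWz).fun_add
    (dζ.fun_mul (hasDerivAt_along (analyticAt_dw af2) dWz))
  have dY2 : HasDerivAt Y' _ z := ((hasDerivAt_along (analyticAt_dz ag2) dWz).fun_add
    (dζ.fun_mul (hasDerivAt_along (analyticAt_dw ag2) dWz))).fun_add dζ
  have e2 := dY2.unique (((hasDerivAt_comp₃ (G := pd (1, 0, 0) Λ) (b := fun _ => b)
    (c := fun _ => t) (analyticAt_pd (1, 0, 0) nΛ.self_of_nhds).differentiableAt dX.self_of_nhds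
    (hasDerivAt_const _ _) (hasDerivAt_const _ _)).fun_mul dX2).congr_of_eventuallyEq eY)
  have e1 := eY.self_of_nhds
  rw [dz_dw af2, dz_dw ag2] at e2
  have er := hr.self_of_nhds
  change _ = γ' (χ, τ) + Λ (X z, b, t) at er
  -- The image point computed on the target curve and by the transformation.
  have eW : t * exp (Λ (X z, b, t)) = W z * exp (γ (z, W z)) := by
    rw [ht, hW]
    simp only
    rw [mul_assoc, mul_assoc, ← exp_add, ← exp_add, ← er, add_comm]
  change pd (1, 0, 0) (pd (1, 0, 0) Λ) (X z, b, t) = Ψ (X z, t * exp (Λ (X z, b, t)),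
    pd (1, 0, 0) Λ (X z, b, t)) at hode
  have hne' : X' z ≠ 0 := hne
  have eζ : pd (1, 0, 0) Λ (X z, b, t) = Y' z / X' z := by rw [eq_div_iff hne', e1]
  rw [eW, eζ] at hode
  change _ = pullback f γ Ψ ((z, W z), ζ z)
  change _ * logJac f γ (z, W z) = _
  have hS : jetS Ψ (jetOf f γ (z, W z), ζ z) =
      X' z ^ 3 * Ψ (X z, W z * exp (γ (z, W z)), Y' z / X' z) := by
    simp only [jetS, jetOf, hXd, hYd, hX]
    congr 4
    ring
  have hX'z : X' z = dz f (z, W z) + ζ z * dw f (z, W z) := rfl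
  have hY'z : Y' z = dz γ (z, W z) + ζ z * dw γ (z, W z) + ζ z := rfl
  rw [pullback, hS, ← hode]
  simp only [pull0, pull1, pull2, pull3, logJac]
  generalize pd (1, 0, 0) (pd (1, 0, 0) Λ) (X z, b, t) = Q at e2 ⊢
  generalize pd (1, 0, 0) Λ (X z, b, t) = P at e1 e2
  rw [hX'z, hY'z] at e1
  rw [hX'z] at e2 ⊢
  clear_value ζ W
  -- The combination `X' Y'' - X'' Y'`, in which the slope of the target curve cancels.
  linear_combination (dz f (z, W z) + ζ z * dw f (z, W z)) * e2 -
    (dz (dz f) (z, W z) + ζ z * dw (dz f) (z, W z) + (pd (1, 0, 0) (pd (1, 0, 0) Λ₁) (z, χ, τ) *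
      dw f (z, W z) + ζ z * (dw (dz f) (z, W z) + ζ z * dw (dw f) (z, W z)))) * e1

end TransformationPair

end Pair

lemma pd_eq_of_line {E F : Type*} [NormedAddCommGroup E] [NormedSpace ℂ E]
    [NormedAddCommGroup F] [NormedSpace ℂ F] {G : E → F} {x v : E} {d : F}
    (hG : DifferentiableAt ℂ G x) (h : HasDerivAt (fun s : ℂ => G (x + s • v)) d 0) :
    pd v G x = d := by
  have h1 : HasDerivAt (fun s : ℂ => x + s • v) v 0 := by
    simpa using ((hasDerivAt_id (0 : ℂ)).smul_const v).const_add x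
  have := hasDerivAt_comp_pd (G := G) (c := fun s : ℂ => x + s • v) (t := 0) (by simpa using hG) h1
  simpa using this.unique h

/-! ### The companion map determined by the Cauchy data -/

section Companion

variable {Λ : ℂ × ℂ × ℂ → ℂ} {c : ℂ} {g₀ g₁ f₀ f₁ : ℂ → ℂ}

/-- The equations satisfied by the companion map `y = (f', γ')` at `x = (χ, τ)`, in terms of the
Cauchy data `g₀, g₁, f₀, f₁` of the transformation. -/
noncomputable def companionEqn (c : ℂ) (Λ : ℂ × ℂ × ℂ → ℂ) (g₀ g₁ f₀ f₁ : ℂ → ℂ)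
    (p : (ℂ × ℂ) × ℂ × ℂ) : ℂ × ℂ :=
  (g₀ p.1.2 - (p.2.2 + Λ (f₀ p.1.2, p.2.1, p.1.2 * exp p.2.2)),
    pd (1, 0, 0) Λ (f₀ p.1.2, p.2.1, p.1.2 * exp p.2.2) * (f₁ p.1.2 + c * p.1.1 * euler f₀ p.1.2) -
      (g₁ p.1.2 + c * p.1.1 * (1 + euler g₀ p.1.2)))

lemma LogAdmissible.eventually_mid (h : LogAdmissible c Λ) : ∀ᶠ k in 𝓝 (0 : ℂ),
    Λ (0, k, 0) = 0 ∧ pd (1, 0, 0) Λ (0, k, 0) = c * k := by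
  have t : Tendsto (fun k : ℂ => ((k, 0) : ℂ × ℂ)) (𝓝 0) (𝓝 0) :=
    tendsto_of_analyticAt (by fun_prop) rfl
  filter_upwards [t.eventually h.left, t.eventually h.pd_left] with k h1 h2 using ⟨h1, h2⟩

lemma LogAdmissible.eventually_pd_right (h : LogAdmissible c Λ) : ∀ᶠ k in 𝓝 (0 : ℂ),
    pd (0, 1, 0) Λ (k, 0, 0) = c * k := by
  have t : Tendsto (fun k : ℂ => ((k, 0) : ℂ × ℂ)) (𝓝 0) (𝓝 0) :=
    tendsto_of_analyticAt (by fun_prop) rfl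
  exact t.eventually h.pd_right

/-- On `τ = 0` the two equations reduce to `-γ' = 0` and `c f' - c χ = 0`. So the implicit function
theorem applies, and the solution there is `(χ, 0)`, which gives the normalization. -/
lemma exists_companion (h : LogAdmissible c Λ) (hc : c ≠ 0)
    (ag₀ : AnalyticAt ℂ g₀ 0) (ag₁ : AnalyticAt ℂ g₁ 0) (af₀ : AnalyticAt ℂ f₀ 0)
    (af₁ : AnalyticAt ℂ f₁ 0) (hg₀ : g₀ 0 = 0) (hg₁ : g₁ 0 = 0) (hf₀ : f₀ 0 = 0) (hf₁ : f₁ 0 = 1) :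
    ∃ f' γ' : ℂ × ℂ → ℂ, NormalizedMap f' γ' ∧
      (∀ᶠ x in 𝓝 0, companionEqn c Λ g₀ g₁ f₀ f₁ (x, f' x, γ' x) = 0) ∧
      ∀ᶠ p : (ℂ × ℂ) × ℂ × ℂ in 𝓝 0, companionEqn c Λ g₀ g₁ f₀ f₁ p = 0 →
        p.2 = (f' p.1, γ' p.1) := by
  have aΛ := h.analyticAt
  have l0 := h.eventually_mid.self_of_nhds
  have B : AnalyticAt ℂ (fun p : (ℂ × ℂ) × ℂ × ℂ => (f₀ p.1.2, p.2.1, p.1.2 * exp p.2.2)) 0 := by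
    have : AnalyticAt ℂ (fun p : (ℂ × ℂ) × ℂ × ℂ => f₀ p.1.2) 0 := af₀.comp_at (by fun_prop) rfl
    fun_prop
  have hB : (fun p : (ℂ × ℂ) × ℂ × ℂ => (f₀ p.1.2, p.2.1, p.1.2 * exp p.2.2)) 0 = 0 := by
    simp [hf₀]
  have k1 : AnalyticAt ℂ (fun p : (ℂ × ℂ) × ℂ × ℂ => g₀ p.1.2) 0 := ag₀.comp_at (by fun_prop) rfl
  have k2 : AnalyticAt ℂ (fun p : (ℂ × ℂ) × ℂ × ℂ => g₁ p.1.2) 0 := ag₁.comp_at (by fun_prop) rfl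
  have k3 : AnalyticAt ℂ (fun p : (ℂ × ℂ) × ℂ × ℂ => f₁ p.1.2) 0 := af₁.comp_at (by fun_prop) rfl
  have k4 : AnalyticAt ℂ (fun p : (ℂ × ℂ) × ℂ × ℂ => euler f₀ p.1.2) 0 :=
    (analyticAt_euler af₀).comp_at (by fun_prop) rfl
  have k5 : AnalyticAt ℂ (fun p : (ℂ × ℂ) × ℂ × ℂ => euler g₀ p.1.2) 0 :=
    (analyticAt_euler ag₀).comp_at (by fun_prop) rfl
  have k6 : AnalyticAt ℂ (fun p : (ℂ × ℂ) × ℂ × ℂ =>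
      Λ (f₀ p.1.2, p.2.1, p.1.2 * exp p.2.2)) 0 := aΛ.comp_at B hB
  have k7 : AnalyticAt ℂ (fun p : (ℂ × ℂ) × ℂ × ℂ =>
      pd (1, 0, 0) Λ (f₀ p.1.2, p.2.1, p.1.2 * exp p.2.2)) 0 := (analyticAt_pd _ aΛ).comp_at B hB
  have aG : AnalyticAt ℂ (companionEqn c Λ g₀ g₁ f₀ f₁) 0 := by
    exact (k1.fun_sub (AnalyticAt.fun_add (by fun_prop) k6)).prod
      ((k7.fun_mul (k3.fun_add (AnalyticAt.fun_mul (by fun_prop) k4))).fun_sub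
        (k2.fun_add (AnalyticAt.fun_mul (by fun_prop) (analyticAt_const.fun_add k5))))
  have hG0 : companionEqn c Λ g₀ g₁ f₀ f₁ ((0, 0), 0, 0) = 0 := by
    simp [companionEqn, hf₀, hg₀, hg₁, l0.1, l0.2]
  obtain ⟨φ, aφ, φ0, hφ, huniq⟩ := exists_implicit (a := ((0, 0) : ℂ × ℂ)) (b := ((0, 0) : ℂ × ℂ))
    aG hG0 (by
    rintro ⟨k, g⟩ hv
    have : HasDerivAt (fun s : ℂ => companionEqn c Λ g₀ g₁ f₀ f₁
        (((0, 0), 0, 0) + s • ((0 : ℂ × ℂ), (k, g)))) (-g, c * k) 0 := by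
      have t : Tendsto (fun s : ℂ => s * k) (𝓝 0) (𝓝 0) :=
        tendsto_of_analyticAt (by fun_prop) (by simp)
      refine HasDerivAt.congr_of_eventuallyEq (f := fun s : ℂ => (-(s * g), c * (s * k)))
        ((hasDerivAt_lin g).neg.prodMk ((hasDerivAt_lin k).const_mul c)) ?_
      filter_upwards [t.eventually h.eventually_mid] with s hs
      simp [companionEqn, hf₀, hg₀, hg₁, hs.1, hs.2, hf₁, euler]
    have := (pd_eq_of_line aG.differentiableAt this).symm.trans hv
    simp only [Prod.mk_eq_zero, neg_eq_zero, mul_eq_zero, hc, false_or] at this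
    simp [this])
  have aφ1 : AnalyticAt ℂ (fun x => (φ x).1) 0 := analyticAt_fst.comp_at aφ rfl
  have aφ2 : AnalyticAt ℂ (fun x => (φ x).2) 0 := analyticAt_snd.comp_at aφ rfl
  have φ0' : φ 0 = 0 := φ0
  have hline : ∀ᶠ χ in 𝓝 (0 : ℂ), φ (χ, 0) = (χ, 0) := by
    have t : Tendsto (fun χ : ℂ => (((χ, 0), χ, 0) : (ℂ × ℂ) × ℂ × ℂ)) (𝓝 0)
      (𝓝 ((0, 0), (0, 0))) := tendsto_of_analyticAt (by fun_prop) rfl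
    filter_upwards [t.eventually huniq, h.eventually_mid] with χ h1 h2
    exact (h1 (by simp [companionEqn, hf₀, hg₀, hg₁, h2.1, h2.2, hf₁, euler])).symm
  refine ⟨fun x => (φ x).1, fun x => (φ x).2, ⟨aφ1, aφ2, by simp [φ0'], by simp [φ0'], ?_, ?_⟩,
    hφ, huniq⟩
  · refine (hasDerivAt_dz (z := 0) (w := 0) aφ1).unique ((hasDerivAt_id 0).congr_of_eventuallyEq ?_)
    filter_upwards [hline] with χ hχ using by rw [hχ]; rfl
  · refine (hasDerivAt_dz (z := 0) (w := 0) aφ2).unique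
      ((hasDerivAt_const 0 (0 : ℂ)).congr_of_eventuallyEq ?_)
    filter_upwards [hline] with χ hχ using by rw [hχ]

end Companion

namespace TransformationPair

variable {Λ₁ Λ : ℂ × ℂ × ℂ → ℂ} {f γ f' γ' : ℂ × ℂ → ℂ} {c : ℂ}

lemma companionEqn_eq_zero (hp : TransformationPair Λ₁ Λ f γ f' γ') (h₁ : LogAdmissible c Λ₁)
    (hΛ : AnalyticAt ℂ Λ 0) {g₀ g₁ f₀ f₁ : ℂ → ℂ} (hg₀ : ∀ᶠ w in 𝓝 0, γ (0, w) = g₀ w)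
    (hg₁ : ∀ᶠ w in 𝓝 0, dz γ (0, w) = g₁ w) (hf₀ : ∀ᶠ w in 𝓝 0, f (0, w) = f₀ w)
    (hf₁ : ∀ᶠ w in 𝓝 0, dz f (0, w) = f₁ w) :
    ∀ᶠ x in 𝓝 0, companionEqn c Λ g₀ g₁ f₀ f₁ (x, f' x, γ' x) = 0 := by
  have t : Tendsto (fun x : ℂ × ℂ => x.2) (𝓝 0) (𝓝 0) := tendsto_of_analyticAt (by fun_prop) rfl
  have t2 : Tendsto (fun x : ℂ × ℂ => ((0, x.2) : ℂ × ℂ)) (𝓝 0) (𝓝 0) :=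
    tendsto_of_analyticAt (by fun_prop) rfl
  filter_upwards [hp.data_eqns h₁ hΛ, t.eventually hg₀.eventually_nhds, t.eventually hg₁,
    t.eventually hf₀.eventually_nhds, t.eventually hf₁,
    t2.eventually hp.analyticAt_f.eventually_analyticAt,
    t2.eventually hp.analyticAt_γ.eventually_analyticAt] with x h1 h2 h3 h4 h5 a1 a2
  obtain ⟨e1, e2⟩ := h1
  rw [dw_left a2, dw_left a1, euler_congr h2, euler_congr h4, h3, h4.self_of_nhds, h5] at e2
  rw [h2.self_of_nhds, h4.self_of_nhds] at e1
  simp only [companionEqn]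
  rw [e1, ← e2]
  simp

/-- The Cauchy data determine the companion map. -/
lemma companion_unique {Λ₂ : ℂ × ℂ × ℂ → ℂ} {k δ k' δ' : ℂ × ℂ → ℂ}
    (hp : TransformationPair Λ₁ Λ f γ f' γ') (hq : TransformationPair Λ₂ Λ k δ k' δ')
    (h₁ : LogAdmissible c Λ₁) (h₂ : LogAdmissible c Λ₂) (h : LogAdmissible c Λ) (hc : c ≠ 0)
    (hf : dz f 0 = 1) (hd : cauchyData f γ =ᶠ[𝓝 0] cauchyData k δ) : f' =ᶠ[𝓝 0] k' ∧ γ' =ᶠ[𝓝 0] δ' := by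
  have hn := hp.normalizedMap h₁ h hf
  have e0 : ((0, 0) : ℂ × ℂ) = 0 := rfl
  obtain ⟨F, G, -, -, hu⟩ := exists_companion (g₀ := fun w => γ (0, w)) (g₁ := fun w => dz γ (0, w))
    (f₀ := fun w => f (0, w)) (f₁ := fun w => dz f (0, w)) h hc
    (analyticAt_slice_left hp.analyticAt_γ) (analyticAt_slice_left (analyticAt_dz hp.analyticAt_γ))
    (analyticAt_slice_left hp.analyticAt_f) (analyticAt_slice_left (analyticAt_dz hp.analyticAt_f))
    hp.γ_zero hn.dz_snd hp.f_zero hf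
  have c1 := hp.companionEqn_eq_zero h₁ h.analyticAt (.of_forall fun _ => rfl)
    (.of_forall fun _ => rfl) (.of_forall fun _ => rfl) (.of_forall fun _ => rfl)
  have c2 := hq.companionEqn_eq_zero (g₀ := fun w => γ (0, w)) (g₁ := fun w => dz γ (0, w))
    (f₀ := fun w => f (0, w)) (f₁ := fun w => dz f (0, w)) h₂ h.analyticAt
    (by filter_upwards [hd] with w hw; simp only [cauchyData, Prod.mk.injEq] at hw; exact hw.1.symm)
    (by filter_upwards [hd] with w hw; simp only [cauchyData, Prod.mk.injEq] at hw
        exact hw.2.1.symm)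
    (by filter_upwards [hd] with w hw; simp only [cauchyData, Prod.mk.injEq] at hw
        exact hw.2.2.1.symm)
    (by filter_upwards [hd] with w hw; simp only [cauchyData, Prod.mk.injEq, sub_left_inj] at hw
        exact hw.2.2.2.symm)
  have t1 : Tendsto (fun x : ℂ × ℂ => (x, f' x, γ' x)) (𝓝 0) (𝓝 0) :=
    tendsto_of_analyticAt (analyticAt_id.prod (hp.analyticAt_f'.prod hp.analyticAt_γ'))
      (by simp [hp.f'_zero, hp.γ'_zero])
  have t2 : Tendsto (fun x : ℂ × ℂ => (x, k' x, δ' x)) (𝓝 0) (𝓝 0) :=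
    tendsto_of_analyticAt (analyticAt_id.prod (hq.analyticAt_f'.prod hq.analyticAt_γ'))
      (by simp [hq.f'_zero, hq.γ'_zero])
  have key : ∀ᶠ x in 𝓝 0, (f' x, γ' x) = (k' x, δ' x) := by
    filter_upwards [c1, c2, t1.eventually hu, t2.eventually hu] with x h1 h2 h3 h4
    exact (h3 h1).trans (h4 h2).symm
  exact ⟨key.mono fun x hx => (Prod.mk.inj hx).1, key.mono fun x hx => (Prod.mk.inj hx).2⟩

end TransformationPair

/-! ### Reconstruction of a transformation from its Cauchy data -/

section Construction

variable {Λ : ℂ × ℂ × ℂ → ℂ} {c : ℂ} {f γ f' γ' : ℂ × ℂ → ℂ}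

/-- The base point `(x, f'(0, w), w e ^ γ'(0, w))`. -/
noncomputable def foot (f' γ' : ℂ × ℂ → ℂ) (w x : ℂ) : ℂ × ℂ × ℂ :=
  (x, f' (0, w), w * exp (γ' (0, w)))

/-- The equation for `x = f(z, w)` in terms of the companion map. -/
noncomputable def transformEqn (c : ℂ) (Λ : ℂ × ℂ × ℂ → ℂ) (f' γ' : ℂ × ℂ → ℂ)
    (p : (ℂ × ℂ) × ℂ) : ℂ :=
  pd (0, 1, 0) Λ (foot f' γ' p.1.2 p.2) * (dz f' (0, p.1.2) - c * p.1.1 * dw f' (0, p.1.2)) +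
    (1 + p.1.2 * exp (γ' (0, p.1.2)) * pd (0, 0, 1) Λ (foot f' γ' p.1.2 p.2)) *
      (dz γ' (0, p.1.2) - c * p.1.1 * (1 + dw γ' (0, p.1.2)))

/-- The relations between a transformation and its companion map along `z = 0` and `χ = 0`, to first
order. -/
structure InitialRelations (c : ℂ) (Λ : ℂ × ℂ × ℂ → ℂ) (f γ f' γ' : ℂ × ℂ → ℂ) : Prop where
  left : ∀ᶠ x : ℂ × ℂ in 𝓝 0,
    γ (0, x.2) = γ' x + Λ (f (0, x.2), f' x, x.2 * exp (γ' x))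
  dz_left : ∀ᶠ x : ℂ × ℂ in 𝓝 0, dz γ (0, x.2) + c * x.1 * (1 + dw γ (0, x.2)) =
    pd (1, 0, 0) Λ (f (0, x.2), f' x, x.2 * exp (γ' x)) *
      (dz f (0, x.2) + c * x.1 * dw f (0, x.2))
  right : ∀ᶠ x : ℂ × ℂ in 𝓝 0, γ x = γ' (0, x.2) + Λ (foot f' γ' x.2 (f x))
  dz_right : ∀ᶠ x : ℂ × ℂ in 𝓝 0, c * x.1 * (1 + dw γ x) =
    dz γ' (0, x.2) + c * x.1 * dw f x * pd (1, 0, 0) Λ (foot f' γ' x.2 (f x)) +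
      dz f' (0, x.2) * pd (0, 1, 0) Λ (foot f' γ' x.2 (f x)) +
      x.2 * exp (γ' (0, x.2)) * dz γ' (0, x.2) * pd (0, 0, 1) Λ (foot f' γ' x.2 (f x))

lemma analyticAt_foot (hn : NormalizedMap f' γ') :
    AnalyticAt ℂ (fun p : (ℂ × ℂ) × ℂ => foot f' γ' p.1.2 p.2) 0 := by
  have a1 : AnalyticAt ℂ (fun p : (ℂ × ℂ) × ℂ => f' (0, p.1.2)) 0 :=
    hn.analyticAt_fst.comp_at (by fun_prop) rfl
  have a2 : AnalyticAt ℂ (fun p : (ℂ × ℂ) × ℂ => γ' (0, p.1.2)) 0 :=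
    hn.analyticAt_snd.comp_at (by fun_prop) rfl
  exact analyticAt_snd.prod (a1.prod (AnalyticAt.fun_mul (by fun_prop) a2.cexp'))

lemma foot_zero (hn : NormalizedMap f' γ') (x : ℂ) : foot f' γ' 0 x = (x, 0, 0) := by
  have e1 : f' (0, 0) = 0 := hn.fst_zero
  simp [foot, e1]

/-- The equation arises from the relations `right` and `dz_right` along `χ = 0`: the first expresses
`γ`, and substituting its `w`-derivative in the second cancels `w f_w`, leaving an equation for the
value of `f` alone. For `w = 0` it reads `c x - c z = 0`. -/
lemma exists_fst (h : LogAdmissible c Λ) (hc : c ≠ 0) (hn : NormalizedMap f' γ') :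
    ∃ f : ℂ × ℂ → ℂ, AnalyticAt ℂ f 0 ∧ f 0 = 0 ∧ dz f 0 = 1 ∧
      (∀ᶠ x in 𝓝 0, transformEqn c Λ f' γ' (x, f x) = 0) ∧
      ∀ᶠ p in 𝓝 0, transformEqn c Λ f' γ' p = 0 → p.2 = f p.1 := by
  have aΛ := h.analyticAt
  have af := hn.analyticAt_fst
  have ag := hn.analyticAt_snd
  have aF := analyticAt_foot hn
  have F0 : foot f' γ' (0 : (ℂ × ℂ) × ℂ).1.2 (0 : (ℂ × ℂ) × ℂ).2 = 0 := foot_zero hn 0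
  have b0 : AnalyticAt ℂ (fun p : (ℂ × ℂ) × ℂ => ((0, p.1.2) : ℂ × ℂ)) 0 := by fun_prop
  have b1 : AnalyticAt ℂ (fun p : (ℂ × ℂ) × ℂ => dz f' (0, p.1.2)) 0 :=
    (analyticAt_dz af).comp_at b0 rfl
  have b2 : AnalyticAt ℂ (fun p : (ℂ × ℂ) × ℂ => dz γ' (0, p.1.2)) 0 :=
    (analyticAt_dz ag).comp_at b0 rfl
  have b3 : AnalyticAt ℂ (fun p : (ℂ × ℂ) × ℂ => dw f' (0, p.1.2)) 0 :=
    (analyticAt_dw af).comp_at b0 rfl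
  have b4 : AnalyticAt ℂ (fun p : (ℂ × ℂ) × ℂ => dw γ' (0, p.1.2)) 0 :=
    (analyticAt_dw ag).comp_at b0 rfl
  have b5 : AnalyticAt ℂ (fun p : (ℂ × ℂ) × ℂ => γ' (0, p.1.2)) 0 := ag.comp_at b0 rfl
  have b6 : AnalyticAt ℂ (fun p : (ℂ × ℂ) × ℂ => pd (0, 1, 0) Λ (foot f' γ' p.1.2 p.2)) 0 :=
    (analyticAt_pd _ aΛ).comp_at aF F0
  have b7 : AnalyticAt ℂ (fun p : (ℂ × ℂ) × ℂ => pd (0, 0, 1) Λ (foot f' γ' p.1.2 p.2)) 0 :=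
    (analyticAt_pd _ aΛ).comp_at aF F0
  have aG : AnalyticAt ℂ (transformEqn c Λ f' γ') 0 := by
    unfold transformEqn
    fun_prop
  have d1 : dz f' (0, 0) = 1 := hn.dz_fst
  have d2 : dz γ' (0, 0) = 0 := hn.dz_snd
  have d3 : ∀ g, dw g (0, 0) = 0 := fun g => by simp [dw]
  have hval : ∀ᶠ x in 𝓝 (0 : ℂ), ∀ z, transformEqn c Λ f' γ' ((z, 0), x) = c * x - c * z := by
    filter_upwards [h.eventually_pd_right] with x hx z
    simp only [transformEqn, foot_zero hn, hx, d1, d2, d3]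
    ring
  have hG0 : transformEqn c Λ f' γ' ((0, 0), 0) = 0 := by
    simpa using hval.self_of_nhds 0
  obtain ⟨f, af, f0, hf, huniq⟩ := exists_implicit (a := ((0, 0) : ℂ × ℂ)) (b := (0 : ℂ))
    aG hG0 (by
    intro v hv
    have : HasDerivAt (fun s : ℂ => transformEqn c Λ f' γ' (((0, 0), 0) + s • ((0 : ℂ × ℂ), v)))
        (c * v) 0 := by
      have t : Tendsto (fun s : ℂ => s * v) (𝓝 0) (𝓝 0) :=
        tendsto_of_analyticAt (by fun_prop) (by simp)
      refine HasDerivAt.congr_of_eventuallyEq (f := fun s : ℂ => c * (s * v))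
        ((hasDerivAt_lin v).const_mul c) ?_
      filter_upwards [t.eventually hval] with s hs
      simpa using hs 0
    have := (pd_eq_of_line aG.differentiableAt this).symm.trans hv
    simpa [hc] using this)
  refine ⟨f, af, f0, ?_, hf, huniq⟩
  refine (hasDerivAt_dz (z := 0) (w := 0) af).unique ((hasDerivAt_id 0).congr_of_eventuallyEq ?_)
  have t : Tendsto (fun χ : ℂ => (((χ, 0), χ) : (ℂ × ℂ) × ℂ)) (𝓝 0)
    (𝓝 ((0, 0), 0)) := tendsto_of_analyticAt (by fun_prop) rfl
  filter_upwards [t.eventually huniq, hval] with χ h1 h2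
  exact (h1 (by simpa using h2 χ)).symm

lemma hasDerivAt_swap {g : ℂ × ℂ → ℂ} {z w : ℂ} (h : AnalyticAt ℂ g (z, w)) :
    HasDerivAt (fun s => g (z, s)) (pd (0, 1) g (z, w)) w := by
  simpa using hasDerivAt_comp₂ (G := g) (a := fun _ => z) h.differentiableAt
    (hasDerivAt_const _ _) (hasDerivAt_id w)

/-- Every germ of analytic Cauchy data is attained by a transformation. -/
theorem exists_initialRelations (h : LogAdmissible c Λ) (hc : c ≠ 0) {D : ℂ → V4}
    (aD : AnalyticAt ℂ D 0) (hD : D 0 = 0) : ∃ f γ f' γ' : ℂ × ℂ → ℂ,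
      NormalizedMap f γ ∧ NormalizedMap f' γ' ∧ cauchyData f γ =ᶠ[𝓝 0] D ∧
        InitialRelations c Λ f γ f' γ' := by
  set g₀ : ℂ → ℂ := fun w => (D w).1 with hg₀
  set g₁ : ℂ → ℂ := fun w => (D w).2.1 with hg₁
  set f₀ : ℂ → ℂ := fun w => (D w).2.2.1 with hf₀
  set f₁ : ℂ → ℂ := fun w => 1 + (D w).2.2.2 with hf₁
  have ag₀ : AnalyticAt ℂ g₀ 0 := by fun_prop
  have ag₁ : AnalyticAt ℂ g₁ 0 := by fun_prop
  have af₀ : AnalyticAt ℂ f₀ 0 := by fun_prop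
  have af₁ : AnalyticAt ℂ f₁ 0 := by fun_prop
  have g₀0 : g₀ 0 = 0 := by simp [hg₀, hD]
  have g₁0 : g₁ 0 = 0 := by simp [hg₁, hD]
  have f₀0 : f₀ 0 = 0 := by simp [hf₀, hD]
  have f₁0 : f₁ 0 = 1 := by simp [hf₁, hD]
  obtain ⟨f', γ', hn', hcomp, -⟩ := exists_companion h hc ag₀ ag₁ af₀ af₁ g₀0 g₁0 f₀0 f₁0
  obtain ⟨f, af, f0, dzf, hf, huniq⟩ := exists_fst h hc hn'
  have aΛ := h.analyticAt
  have af' := hn'.analyticAt_fst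
  have ag' := hn'.analyticAt_snd
  have aF : AnalyticAt ℂ (fun x : ℂ × ℂ => foot f' γ' x.2 (f x)) 0 :=
    (analyticAt_foot hn').comp_at (g := fun x : ℂ × ℂ => (x, f x)) (analyticAt_id.prod af)
      (by simp [f0])
  have F0 : foot f' γ' (0 : ℂ × ℂ).2 (f 0) = 0 := by rw [f0]; exact foot_zero hn' 0
  have tF := tendsto_of_analyticAt aF F0
  have t0 : Tendsto (fun x : ℂ × ℂ => ((0, x.2) : ℂ × ℂ)) (𝓝 0) (𝓝 0) :=
    tendsto_of_analyticAt (by fun_prop) rfl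
  -- The choice of `γ` is forced by the relation along `χ = 0`.
  set γ : ℂ × ℂ → ℂ := fun x => γ' (0, x.2) + Λ (foot f' γ' x.2 (f x)) with hγ
  have aγ : AnalyticAt ℂ γ 0 := (ag'.comp_at (g := fun x : ℂ × ℂ => ((0, x.2) : ℂ × ℂ))
    (by fun_prop) rfl).fun_add (aΛ.comp_at aF F0)
  -- the equations along `χ = 0`
  have tV : Tendsto (fun x : ℂ × ℂ => ((f₀ x.2, f' x, x.2 * exp (γ' x)) : ℂ × ℂ × ℂ)) (𝓝 0)
      (𝓝 0) := by
    have k1 : AnalyticAt ℂ (fun x : ℂ × ℂ => f₀ x.2) 0 := af₀.comp_at (by fun_prop) rfl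
    exact tendsto_of_analyticAt (k1.prod (af'.prod (AnalyticAt.fun_mul (by fun_prop) ag'.cexp')))
      (by simp [f₀0, hn'.fst_zero])
  have hF₀ : ∀ᶠ w in 𝓝 0, foot f' γ' w (f₀ w) = (f₀ w, f' (0, w), w * exp (γ' (0, w))) :=
    .of_forall fun _ => rfl
  -- The companion equations at `χ = 0`: their values, their `χ`-derivatives, and the `w`-derivative
  -- of the first one.
  have S1 : ∀ᶠ w in 𝓝 (0 : ℂ), transformEqn c Λ f' γ' ((0, w), f₀ w) = 0 ∧
      (dz f' (0, w) * pd (0, 1, 0) (pd (1, 0, 0) Λ) (foot f' γ' w (f₀ w)) +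
        w * exp (γ' (0, w)) * dz γ' (0, w) * pd (0, 0, 1) (pd (1, 0, 0) Λ) (foot f' γ' w (f₀ w))) *
        f₁ w + pd (1, 0, 0) Λ (foot f' γ' w (f₀ w)) * (c * euler f₀ w) = c * (1 + euler g₀ w) ∧
      g₀ w = γ' (0, w) + Λ (foot f' γ' w (f₀ w)) ∧
      pd (1, 0, 0) Λ (foot f' γ' w (f₀ w)) * f₁ w = g₁ w ∧
      euler g₀ w = dw γ' (0, w) + euler f₀ w * pd (1, 0, 0) Λ (foot f' γ' w (f₀ w)) +
        dw f' (0, w) * pd (0, 1, 0) Λ (foot f' γ' w (f₀ w)) +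
        w * exp (γ' (0, w)) * (1 + dw γ' (0, w)) * pd (0, 0, 1) Λ (foot f' γ' w (f₀ w)) := by
    filter_upwards [tendsto_left₂.eventually hcomp.eventually_nhds,
      tendsto_left₂.eventually af'.eventually_analyticAt,
      tendsto_left₂.eventually ag'.eventually_analyticAt, ag₀.eventually_analyticAt,
      af₀.eventually_analyticAt,
      (tV.comp tendsto_left₂).eventually aΛ.eventually_analyticAt] with w hw a1 a2 a3 a4 a5
    have hl : Tendsto (fun s : ℂ => ((s, w) : ℂ × ℂ)) (𝓝 0) (𝓝 (0, w)) :=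
      tendsto_of_analyticAt (by fun_prop) rfl
    have hr : Tendsto (fun s : ℂ => ((0, s) : ℂ × ℂ)) (𝓝 w) (𝓝 (0, w)) :=
      tendsto_of_analyticAt (by fun_prop) rfl
    simp only [companionEqn, Prod.mk_eq_zero, sub_eq_zero] at hw
    have h0 := hw.self_of_nhds
    simp only [Function.comp] at a5
    have d1 := hasDerivAt_dz a1
    have d2 := hasDerivAt_dz a2
    have d3 := d2.cexp.const_mul w
    have e1 := hasDerivAt_swap a1
    have e2 := hasDerivAt_swap a2
    have e3 := (hasDerivAt_id w).fun_mul e2.cexp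
    have e4 := a4.differentiableAt.hasDerivAt
    have e5 := a3.differentiableAt.hasDerivAt
    have D1 := d2.fun_add (hasDerivAt_comp₃ (G := Λ) (a := fun _ => f₀ w) a5.differentiableAt
      (hasDerivAt_const _ _) d1 d3)
    have r1 := D1.unique ((hasDerivAt_const 0 (g₀ w)).congr_of_eventuallyEq
      ((hl.eventually hw).mono fun s hs => hs.1.symm))
    have D2 := (hasDerivAt_comp₃ (G := pd (1, 0, 0) Λ) (a := fun _ => f₀ w)
      (analyticAt_pd _ a5).differentiableAt (hasDerivAt_const _ _) d1 d3).fun_mul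
      ((((hasDerivAt_id (0 : ℂ)).const_mul c).mul_const (euler f₀ w)).const_add (f₁ w))
    have r2 := D2.unique (((((hasDerivAt_id (0 : ℂ)).const_mul c).mul_const
      (1 + euler g₀ w)).const_add (g₁ w)).congr_of_eventuallyEq
      ((hl.eventually hw).mono fun s hs => hs.2))
    have D3 := e2.fun_add (hasDerivAt_comp₃ (G := Λ) (a := f₀) a5.differentiableAt e4 e1 e3)
    have r3 := D3.unique (e5.congr_of_eventuallyEq ((hr.eventually hw).mono fun s hs => hs.1.symm))
    have e0 := h0.2
    simp only [mul_zero, zero_mul, add_zero] at e0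
    simp only [transformEqn, foot, euler, smul_eq_mul, dw, mul_zero, zero_mul, sub_zero, id,
      mul_one, one_mul, add_zero, zero_add] at r1 r2 r3 ⊢
    refine ⟨?_, ?_, h0.1, e0, ?_⟩
    · linear_combination r1
    · linear_combination r2
    · linear_combination - w * r3
  have tf₀ : Tendsto (fun w : ℂ => (((0, w), f₀ w) : (ℂ × ℂ) × ℂ)) (𝓝 0) (𝓝 0) :=
    tendsto_of_analyticAt (by fun_prop) (by simp [f₀0])
  -- Both sides solve the equation that determines `f` at `z = 0`.
  have hf0 : ∀ᶠ w in 𝓝 (0 : ℂ), f (0, w) = f₀ w := by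
    filter_upwards [S1, tf₀.eventually huniq] with w h1 h2 using (h2 h1.1).symm
  have hg0 : ∀ᶠ w in 𝓝 (0 : ℂ), γ (0, w) = g₀ w := by
    filter_upwards [S1, hf0] with w h1 h2
    rw [h1.2.2.1, hγ]
    simp only [h2]
  have tF₀ : Tendsto (fun w : ℂ => foot f' γ' w (f₀ w)) (𝓝 0) (𝓝 0) :=
    tendsto_of_analyticAt ((analyticAt_foot hn').comp_at (g := fun w : ℂ => (((0, w), f₀ w) :
      (ℂ × ℂ) × ℂ)) (by fun_prop) (by simp [f₀0])) (by rw [f₀0]; exact foot_zero hn' 0)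
  -- This factor multiplies `f_z(0, w)` when the equation for `f` is differentiated in `z`. At `w =
  -- 0` it equals `c`.
  have hM : ∀ᶠ w in 𝓝 (0 : ℂ),
      dz f' (0, w) * pd (0, 1, 0) (pd (1, 0, 0) Λ) (foot f' γ' w (f₀ w)) +
        w * exp (γ' (0, w)) * dz γ' (0, w) *
          pd (0, 0, 1) (pd (1, 0, 0) Λ) (foot f' γ' w (f₀ w)) ≠ 0 := by
    have c1 : pd (0, 1, 0) (pd (1, 0, 0) Λ) 0 = c := by
      have t : Tendsto (fun s : ℂ => ((s, 0) : ℂ × ℂ)) (𝓝 0) (𝓝 0) :=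
        tendsto_of_analyticAt (by fun_prop) rfl
      refine (hasDerivAt_slice_mid (G := pd (1, 0, 0) Λ) (z := 0) (χ := 0) (τ := 0)
        (analyticAt_pd _ aΛ)).unique ((((hasDerivAt_id (0 : ℂ)).const_mul c).congr_deriv
        (mul_one c)).congr_of_eventuallyEq ?_)
      filter_upwards [t.eventually h.pd_left] with s hs using hs
    have tw : Tendsto (fun w : ℂ => w) (𝓝 0) (𝓝 0) := tendsto_id
    have q1 : Tendsto (fun w : ℂ => dz f' (0, w)) (𝓝 0) (𝓝 (dz f' 0)) :=
      (analyticAt_dz af').continuousAt.tendsto.comp tendsto_left₂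
    have q2 : Tendsto (fun w : ℂ => dz γ' (0, w)) (𝓝 0) (𝓝 (dz γ' 0)) :=
      (analyticAt_dz ag').continuousAt.tendsto.comp tendsto_left₂
    have q3 : Tendsto (fun w : ℂ => exp (γ' (0, w))) (𝓝 0) (𝓝 (exp (γ' 0))) :=
      (ag'.cexp'.continuousAt.tendsto).comp tendsto_left₂
    have q4 := ((analyticAt_pd (0, 1, 0) (analyticAt_pd (1, 0, 0) aΛ)).continuousAt.tendsto).comp tF₀
    have q5 := ((analyticAt_pd (0, 0, 1) (analyticAt_pd (1, 0, 0) aΛ)).continuousAt.tendsto).comp tF₀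
    have := (q1.mul q4).add (((tw.mul q3).mul q2).mul q5)
    refine this.eventually_ne ?_
    rw [hn'.dz_fst, c1]
    simpa using hc
  have S2 : ∀ᶠ w in 𝓝 (0 : ℂ), dz f (0, w) = f₁ w ∧ dz γ (0, w) = g₁ w := by
    filter_upwards [S1, hM, hf0, tendsto_left₂.eventually hf.eventually_nhds,
      tendsto_left₂.eventually af.eventually_analyticAt,
      tendsto_left₂.eventually aγ.eventually_analyticAt,
      tF₀.eventually aΛ.eventually_analyticAt] with w ⟨_, s2, s3, s4, s5⟩ hM hf0 hw a1 a2 a3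
    have hl : Tendsto (fun s : ℂ => ((s, w) : ℂ × ℂ)) (𝓝 0) (𝓝 (0, w)) :=
      tendsto_of_analyticAt (by fun_prop) rfl
    rw [← hf0] at a3 s2 s4 s5 hM
    have d1 := hasDerivAt_dz a1
    have dl := fun (G : ℂ × ℂ × ℂ → ℂ) (hG : AnalyticAt ℂ G (foot f' γ' w (f (0, w)))) =>
      hasDerivAt_comp₃ (G := G) (b := fun _ => f' (0, w)) (c := fun _ => w * exp (γ' (0, w)))
        hG.differentiableAt d1 (hasDerivAt_const _ _) (hasDerivAt_const _ _)
    have dγ := (hasDerivAt_dz a2).unique ((dl Λ a3).const_add (γ' (0, w)))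
    have D1 := ((dl _ (analyticAt_pd (0, 1, 0) a3)).fun_mul ((((hasDerivAt_id (0 : ℂ)).const_mul
      c).mul_const (dw f' (0, w))).const_sub (dz f' (0, w)))).fun_add
      ((((dl _ (analyticAt_pd (0, 0, 1) a3)).const_mul (w * exp (γ' (0, w)))).const_add 1).fun_mul
      ((((hasDerivAt_id (0 : ℂ)).const_mul c).mul_const (1 + dw γ' (0, w))).const_sub
        (dz γ' (0, w))))
    have r1 := D1.unique ((hasDerivAt_const 0 (0 : ℂ)).congr_of_eventuallyEq
      ((hl.eventually hw).mono fun s hs => hs))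
    have k1 := pd_comm a3 (1, 0, 0) (0, 1, 0)
    have k2 := pd_comm a3 (1, 0, 0) (0, 0, 1)
    simp only [foot, id, mul_zero, zero_mul, add_zero, sub_zero, mul_one] at r1 dγ k1 k2 s2 s4 s5 hM
    rw [k1, k2] at r1
    -- The `z`-derivative of the equation for `f` and the `χ`-derivative of the second companion
    -- equation contain the same mixed derivatives of `Λ`; comparing them recovers the prescribed
    -- `f_z`.
    have hx : dz f (0, w) = f₁ w := by
      refine mul_left_cancel₀ hM ?_
      linear_combination r1 - s2 - c * s5
    refine ⟨hx, ?_⟩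
    rw [dγ, hx]
    linear_combination s4
  have hfe : ∀ᶠ w in 𝓝 (0 : ℂ), dw f (0, w) = euler f₀ w ∧ dw γ (0, w) = euler g₀ w := by
    filter_upwards [tendsto_left₂.eventually af.eventually_analyticAt,
      tendsto_left₂.eventually aγ.eventually_analyticAt, hf0.eventually_nhds,
      hg0.eventually_nhds] with w a1 a2 h1 h2
    exact ⟨by rw [dw_left a1, euler_congr h1], by rw [dw_left a2, euler_congr h2]⟩
  have e00 : ((0, 0) : ℂ × ℂ) = 0 := rfl
  have hn : NormalizedMap f γ := by
    refine ⟨af, aγ, f0, ?_, dzf, ?_⟩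
    · exact hg0.self_of_nhds.trans g₀0
    · exact S2.self_of_nhds.2.trans g₁0
  have ts : Tendsto (fun x : ℂ × ℂ => x.2) (𝓝 0) (𝓝 0) := tendsto_of_analyticAt (by fun_prop) rfl
  refine ⟨f, γ, f', γ', hn, hn', ?_, ?_, ?_, .of_forall fun x => rfl, ?_⟩
  · filter_upwards [hf0, hg0, S2] with w h1 h2 h3
    simp [cauchyData, h1, h2, h3.1, h3.2, hf₀, hg₀, hf₁, hg₁]
  · filter_upwards [ts.eventually hf0, ts.eventually hg0, hcomp] with x h1 h2 h3
    simp only [companionEqn, Prod.mk_eq_zero, sub_eq_zero] at h3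
    rw [h1, h2, h3.1]
  · filter_upwards [ts.eventually hf0, ts.eventually hfe, ts.eventually S2, hcomp] with x h1 h2 h4 h3
    simp only [companionEqn, Prod.mk_eq_zero, sub_eq_zero] at h3
    rw [h1, h2.1, h2.2, h4.1, h4.2, h3.2]
  · filter_upwards [hf, af.eventually_analyticAt, t0.eventually af'.eventually_analyticAt,
      t0.eventually ag'.eventually_analyticAt, tF.eventually aΛ.eventually_analyticAt,
      aγ.eventually_analyticAt] with x h1 a1 a2 a3 a4 a5
    obtain ⟨z, w⟩ := x
    simp only at a2 a3 a4 ⊢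
    have e2 := hasDerivAt_swap a3
    have d := (hasDerivAt_swap a5).unique (e2.fun_add (hasDerivAt_comp₃ (G := Λ)
      (b := fun s => f' (0, s)) (c := fun s => s * exp (γ' (0, s))) a4.differentiableAt
      (hasDerivAt_swap a1) (hasDerivAt_swap a2) ((hasDerivAt_id w).fun_mul e2.cexp)))
    simp only [transformEqn, foot, id, dw] at d h1 ⊢
    rw [d]
    linear_combination -h1

end Construction

/-! ### Admissibility of the transformed hypersurface -/

section Construction

variable {Λ Λ₁ : ℂ × ℂ × ℂ → ℂ} {c : ℂ} {f γ f' γ' : ℂ × ℂ → ℂ}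

/-- A germ related to an admissible one by a transformation with the correct initial relations is
admissible. -/
theorem InitialRelations.logAdmissible (hr : InitialRelations c Λ f γ f' γ')
    (hp : TransformationPair Λ₁ Λ f γ f' γ') (hΛ : AnalyticAt ℂ Λ 0) (aΛ₁ : AnalyticAt ℂ Λ₁ 0)
    (hΛ₁ : Λ₁ 0 = 0) : LogAdmissible c Λ₁ := by
  have af := hp.analyticAt_f
  have ag := hp.analyticAt_γ
  have af' := hp.analyticAt_f'
  have ag' := hp.analyticAt_γ'
  have f00 : f (0, 0) = 0 := hp.f_zero
  have g00 : γ (0, 0) = 0 := hp.γ_zero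
  have f'00 : f' (0, 0) = 0 := hp.f'_zero
  have g'00 : γ' (0, 0) = 0 := hp.γ'_zero
  have aW : AnalyticAt ℂ (fun p : (ℂ × ℂ × ℂ) × ℂ => ((p.1.1, p.1.2.2 * exp p.2) : ℂ × ℂ)) 0 := by
    fun_prop
  have b1 : AnalyticAt ℂ (fun p : (ℂ × ℂ × ℂ) × ℂ => f (p.1.1, p.1.2.2 * exp p.2)) 0 :=
    af.comp_at aW (by simp)
  have b2 : AnalyticAt ℂ (fun p : (ℂ × ℂ × ℂ) × ℂ => γ (p.1.1, p.1.2.2 * exp p.2)) 0 :=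
    ag.comp_at aW (by simp)
  have b3 : AnalyticAt ℂ (fun p : (ℂ × ℂ × ℂ) × ℂ => f' p.1.2) 0 :=
    af'.comp_at (by fun_prop) rfl
  have b4 : AnalyticAt ℂ (fun p : (ℂ × ℂ × ℂ) × ℂ => γ' p.1.2) 0 :=
    ag'.comp_at (by fun_prop) rfl
  have aV : AnalyticAt ℂ (fun p : (ℂ × ℂ × ℂ) × ℂ => ((f (p.1.1, p.1.2.2 * exp p.2), f' p.1.2,
      p.1.2.2 * exp (γ' p.1.2)) : ℂ × ℂ × ℂ)) 0 :=
    b1.prod (b3.prod (AnalyticAt.fun_mul (by fun_prop) b4.cexp'))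
  set P : (ℂ × ℂ × ℂ) × ℂ → ℂ := fun p => γ (p.1.1, p.1.2.2 * exp p.2) + p.2 - (γ' p.1.2 +
    Λ (f (p.1.1, p.1.2.2 * exp p.2), f' p.1.2, p.1.2.2 * exp (γ' p.1.2))) with hP
  have aP : AnalyticAt ℂ P 0 := (b2.fun_add analyticAt_snd).fun_sub (b4.fun_add
    (hΛ.comp_at aV (by simp [f00, hp.f'_zero])))
  have hΛ0 : Λ (0, 0, 0) = 0 := by
    have := hr.left.self_of_nhds
    simpa [f00, g00, f'00, g'00, hp.f'_zero, hp.γ'_zero] using this.symm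
  have hP0 : ∀ l, P ((0, 0, 0), l) = l := by intro l; simp [hP, f00, g00, f'00, g'00, hΛ0]
  -- The relation determines `Λ₁ x` as the only small root `l` of `P (x, l) = 0`, the `l`-derivative
  -- at the origin being `1`. Along `z = 0` and `χ = 0` the initial relations say that `l = 0` is a
  -- root.
  obtain ⟨φ, -, -, -, huniq⟩ := exists_implicit (a := ((0, 0, 0) : ℂ × ℂ × ℂ)) (b := (0 : ℂ))
    aP (hP0 0) (by
    intro v hv
    have : HasDerivAt (fun s : ℂ => P (((0, 0, 0), 0) + s • ((0 : ℂ × ℂ × ℂ), v))) v 0 :=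
      (hasDerivAt_lin v).congr_of_eventuallyEq (.of_forall fun s => by simpa using hP0 (s * v))
    exact (pd_eq_of_line aP.differentiableAt this).symm.trans hv)
  have tP : Tendsto (fun x : ℂ × ℂ × ℂ => (x, Λ₁ x)) (𝓝 0) (𝓝 ((0, 0, 0), 0)) :=
    tendsto_of_analyticAt (analyticAt_id.prod aΛ₁) (by simp only [hΛ₁]; rfl)
  have tP0 : Tendsto (fun x : ℂ × ℂ × ℂ => (x, (0 : ℂ))) (𝓝 0) (𝓝 ((0, 0, 0), 0)) :=
    tendsto_of_analyticAt (by fun_prop) rfl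
  have key : ∀ᶠ x : ℂ × ℂ × ℂ in 𝓝 0, P (x, 0) = 0 → Λ₁ x = 0 := by
    filter_upwards [tP.eventually huniq, tP0.eventually huniq, hp.rel] with x h1 h2 h3 h4
    exact (h1 (sub_eq_zero.2 h3)).trans (h2 h4).symm
  have tr : Tendsto (fun x : ℂ × ℂ => ((x.1, 0, x.2) : ℂ × ℂ × ℂ)) (𝓝 0) (𝓝 0) :=
    tendsto_of_analyticAt (by fun_prop) rfl
  have t2 : Tendsto (fun x : ℂ × ℂ => ((0, x.2) : ℂ × ℂ)) (𝓝 0) (𝓝 0) :=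
    tendsto_of_analyticAt (by fun_prop) rfl
  have left : ∀ᶠ x : ℂ × ℂ in 𝓝 0, Λ₁ (0, x.1, x.2) = 0 := by
    filter_upwards [tendsto_zero_left.eventually key, hr.left] with x h1 h2
    refine h1 ?_
    simp only [hP, exp_zero, mul_one, add_zero, sub_eq_zero]
    exact h2
  have right : ∀ᶠ x : ℂ × ℂ in 𝓝 0, Λ₁ (x.1, 0, x.2) = 0 := by
    filter_upwards [tr.eventually key, hr.right] with x h1 h2
    refine h1 ?_
    simp only [hP, exp_zero, mul_one, add_zero, sub_eq_zero]
    exact h2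
  -- The coefficient of the first derivative of `Λ₁` in the differentiated relation. Since it is
  -- nonzero, comparison with the initial relations of first order gives that derivative.
  have hne : ∀ᶠ q : (ℂ × ℂ) × ℂ × ℂ × ℂ in 𝓝 0,
      1 + dw γ q.1 - pd (1, 0, 0) Λ q.2 * dw f q.1 ≠ 0 := by
    have k1 : AnalyticAt ℂ (fun q : (ℂ × ℂ) × ℂ × ℂ × ℂ => dw γ q.1) 0 :=
      (analyticAt_dw ag).comp_at analyticAt_fst rfl
    have k2 : AnalyticAt ℂ (fun q : (ℂ × ℂ) × ℂ × ℂ × ℂ => dw f q.1) 0 :=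
      (analyticAt_dw af).comp_at analyticAt_fst rfl
    have k3 : AnalyticAt ℂ (fun q : (ℂ × ℂ) × ℂ × ℂ × ℂ => pd (1, 0, 0) Λ q.2) 0 :=
      (analyticAt_pd _ hΛ).comp_at analyticAt_snd rfl
    have : AnalyticAt ℂ (fun q : (ℂ × ℂ) × ℂ × ℂ × ℂ =>
      1 + dw γ q.1 - pd (1, 0, 0) Λ q.2 * dw f q.1) 0 := by fun_prop
    exact this.continuousAt.eventually_ne (by simp [dw])
  have tV : Tendsto (fun x : ℂ × ℂ × ℂ => ((x.1, x.2.2), (f (x.1, x.2.2), f' x.2,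
      x.2.2 * exp (γ' x.2)))) (𝓝 0) (𝓝 (0 : (ℂ × ℂ) × ℂ × ℂ × ℂ)) := by
    have c1 : AnalyticAt ℂ (fun x : ℂ × ℂ × ℂ => f (x.1, x.2.2)) 0 := af.comp_at (by fun_prop) rfl
    have c2 : AnalyticAt ℂ (fun x : ℂ × ℂ × ℂ => f' x.2) 0 := af'.comp_at (by fun_prop) rfl
    have c3 : AnalyticAt ℂ (fun x : ℂ × ℂ × ℂ => γ' x.2) 0 := ag'.comp_at (by fun_prop) rfl
    refine tendsto_of_analyticAt (AnalyticAt.prod (by fun_prop) (c1.prod (c2.prod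
      (AnalyticAt.fun_mul (by fun_prop) c3.cexp')))) ?_
    simp [f00, hp.f'_zero]
  have taΛ : ∀ᶠ q : (ℂ × ℂ) × ℂ × ℂ × ℂ in 𝓝 0, AnalyticAt ℂ Λ q.2 :=
    (tendsto_of_analyticAt (G := Prod.snd) analyticAt_snd rfl).eventually hΛ.eventually_analyticAt
  refine ⟨aΛ₁, left, right, ?_, ?_⟩
  · filter_upwards [hr.dz_left, left, (tV.comp tendsto_zero_left).eventually hne,
      (tV.comp tendsto_zero_left).eventually taΛ,
      t2.eventually af.eventually_analyticAt, t2.eventually ag.eventually_analyticAt,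
      tendsto_zero_left.eventually aΛ₁.eventually_analyticAt,
      tendsto_zero_left.eventually hp.rel.eventually_nhds] with x h1 h0 h2 aL a1 a2 a3 hrel
    obtain ⟨χ, τ⟩ := x
    simp only [Function.comp] at *
    have hl : Tendsto (fun s : ℂ => ((s, χ, τ) : ℂ × ℂ × ℂ)) (𝓝 0) (𝓝 (0, χ, τ)) :=
      tendsto_of_analyticAt (by fun_prop) rfl
    have d0 := hasDerivAt_slice a3
    have dW : HasDerivAt (fun z => τ * exp (Λ₁ (z, χ, τ)))
        ((τ * exp (Λ₁ (0, χ, τ))) * pd (1, 0, 0) Λ₁ (0, χ, τ)) 0 :=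
      (d0.cexp.const_mul τ).congr_deriv (by ring)
    have e0 : τ * exp (Λ₁ (0, χ, τ)) = τ := by simp [h0]
    have d1 := hasDerivAt_along (g := γ) (by simp only [e0]; exact a2) dW
    have d2 := hasDerivAt_along (g := f) (by simp only [e0]; exact a1) dW
    have d3 := hasDerivAt_comp₃ (G := Λ) (b := fun _ => f' (χ, τ))
      (c := fun _ => τ * exp (γ' (χ, τ))) (by simp only [e0]; exact aL.differentiableAt) d2
      (hasDerivAt_const _ _) (hasDerivAt_const _ _)
    have := (d1.fun_add d0).unique ((d3.const_add (γ' (χ, τ))).congr_of_eventuallyEq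
      (hl.eventually hrel))
    simp only [e0] at this
    refine sub_eq_zero.1 (mul_right_cancel₀ h2 ?_)
    linear_combination this - h1
  · filter_upwards [hr.dz_right, right, (tV.comp tr).eventually hne, (tV.comp tr).eventually taΛ,
      af.eventually_analyticAt, ag.eventually_analyticAt, t2.eventually af'.eventually_analyticAt,
      t2.eventually ag'.eventually_analyticAt, tr.eventually aΛ₁.eventually_analyticAt,
      tr.eventually hp.rel.eventually_nhds] with x h1 h0 h2 aL a1 a2 a1' a2' a3 hrel
    obtain ⟨z, τ⟩ := x
    simp only [Function.comp, foot] at *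
    have hl : Tendsto (fun s : ℂ => ((z, s, τ) : ℂ × ℂ × ℂ)) (𝓝 0) (𝓝 (z, 0, τ)) :=
      tendsto_of_analyticAt (by fun_prop) rfl
    have d0 := hasDerivAt_slice_mid a3
    have dW : HasDerivAt (fun s => τ * exp (Λ₁ (z, s, τ)))
        ((τ * exp (Λ₁ (z, 0, τ))) * pd (0, 1, 0) Λ₁ (z, 0, τ)) 0 :=
      (d0.cexp.const_mul τ).congr_deriv (by ring)
    have e0 : τ * exp (Λ₁ (z, 0, τ)) = τ := by simp [h0]
    have d1 := hasDerivAt_comp₂ (G := γ) (a := fun _ => z)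
      (by simp only [e0]; exact a2.differentiableAt) (hasDerivAt_const _ _) dW
    have d2 := hasDerivAt_comp₂ (G := f) (a := fun _ => z)
      (by simp only [e0]; exact a1.differentiableAt) (hasDerivAt_const _ _) dW
    have d4 := hasDerivAt_dz a1'
    have d5 := hasDerivAt_dz a2'
    have d3 := hasDerivAt_comp₃ (G := Λ) (b := fun s => f' (s, τ))
      (c := fun s => τ * exp (γ' (s, τ))) (by simp only [e0]; exact aL.differentiableAt) d2
      d4 (d5.cexp.const_mul τ)
    have := (d1.fun_add d0).unique ((d5.fun_add d3).congr_of_eventuallyEq (hl.eventually hrel))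
    simp only [e0] at this
    refine sub_eq_zero.1 (mul_right_cancel₀ h2 ?_)
    simp only [dw] at h1 ⊢
    linear_combination this - h1

end Construction

/-! ### Transforming the real defining function -/

section Polar

/-- With `w = u (1 + i t / 2)` and `τ = u (1 - i t / 2)`, the images of `w` and `τ` are `u` times
`polarLeft` and `u` times `polarRight`. Dropping the common factor `u` keeps the equation for `t`
nondegenerate at `u = 0`. -/
noncomputable def polarLeft (γ : ℂ × ℂ → ℂ) (p : (ℂ × ℂ × ℂ) × ℂ) : ℂ :=
  (1 + I / 2 * p.2) * exp (γ (p.1.1, p.1.2.2 * (1 + I / 2 * p.2)))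

noncomputable def polarRight (γ' : ℂ × ℂ → ℂ) (p : (ℂ × ℂ × ℂ) × ℂ) : ℂ :=
  (1 - I / 2 * p.2) * exp (γ' (p.1.2.1, p.1.2.2 * (1 - I / 2 * p.2)))

/-- The equation for `t = h₁(z, χ, u)` expressing that the transformation `(f, w e ^ γ)` with
companion `(f', τ e ^ γ')` maps the hypersurface `v = u h₁ / 2` into `v = u h / 2`. -/
noncomputable def polarEqn (h : ℂ × ℂ × ℂ → ℂ) (f γ f' γ' : ℂ × ℂ → ℂ)
    (p : (ℂ × ℂ × ℂ) × ℂ) : ℂ :=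
  polarLeft γ p - polarRight γ' p - I / 2 * (polarLeft γ p + polarRight γ' p) *
    h (f (p.1.1, p.1.2.2 * (1 + I / 2 * p.2)), f' (p.1.2.1, p.1.2.2 * (1 - I / 2 * p.2)),
      p.1.2.2 * (polarLeft γ p + polarRight γ' p) / 2)

variable {h h₁ Λ Λ₁ : ℂ × ℂ × ℂ → ℂ} {f γ f' γ' : ℂ × ℂ → ℂ} (hg : TransformationGerms f γ f' γ')

include hg

lemma TransformationGerms.analyticAt_polarLeft : AnalyticAt ℂ (polarLeft γ) 0 := by
  have : AnalyticAt ℂ (fun p : (ℂ × ℂ × ℂ) × ℂ => γ (p.1.1, p.1.2.2 * (1 + I / 2 * p.2))) 0 :=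
    hg.analyticAt_γ.comp_at (by fun_prop) (by simp)
  exact AnalyticAt.fun_mul (by fun_prop) this.cexp'

lemma TransformationGerms.analyticAt_polarRight : AnalyticAt ℂ (polarRight γ') 0 := by
  have : AnalyticAt ℂ (fun p : (ℂ × ℂ × ℂ) × ℂ => γ' (p.1.2.1, p.1.2.2 * (1 - I / 2 * p.2))) 0 :=
    hg.analyticAt_γ'.comp_at (by fun_prop) (by simp)
  exact AnalyticAt.fun_mul (by fun_prop) this.cexp'

lemma TransformationGerms.polar_zero (t : ℂ) : polarLeft γ (0, t) = 1 + I / 2 * t ∧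
    polarRight γ' (0, t) = 1 - I / 2 * t := by
  have h1 : γ (0, 0) = 0 := hg.γ_zero
  have h2 : γ' (0, 0) = 0 := hg.γ'_zero
  simp [polarLeft, polarRight, h1, h2]

/-- The map whose first component is the argument of `h` in `polarEqn`. -/
lemma TransformationGerms.analyticAt_polarArg : AnalyticAt ℂ (fun p : (ℂ × ℂ × ℂ) × ℂ =>
    (f (p.1.1, p.1.2.2 * (1 + I / 2 * p.2)), f' (p.1.2.1, p.1.2.2 * (1 - I / 2 * p.2)),
      p.1.2.2 * (polarLeft γ p + polarRight γ' p) / 2)) 0 := by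
  have k1 : AnalyticAt ℂ (fun p : (ℂ × ℂ × ℂ) × ℂ => f (p.1.1, p.1.2.2 * (1 + I / 2 * p.2))) 0 :=
    hg.analyticAt_f.comp_at (by fun_prop) (by simp)
  have k2 : AnalyticAt ℂ (fun p : (ℂ × ℂ × ℂ) × ℂ =>
      f' (p.1.2.1, p.1.2.2 * (1 - I / 2 * p.2))) 0 :=
    hg.analyticAt_f'.comp_at (by fun_prop) (by simp)
  have k3 := hg.analyticAt_polarLeft
  have k4 := hg.analyticAt_polarRight
  exact k1.prod (k2.prod ((AnalyticAt.fun_mul (by fun_prop) (k3.fun_add k4)).div_const))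

lemma TransformationGerms.polarArg_zero (t : ℂ) :
    ((f (0, 0 * (1 + I / 2 * t)), f' (0, 0 * (1 - I / 2 * t)),
      0 * (polarLeft γ (0, t) + polarRight γ' (0, t)) / 2) : ℂ × ℂ × ℂ) = 0 := by
  have h1 : f (0, 0) = 0 := hg.f_zero
  have h2 : f' (0, 0) = 0 := hg.f'_zero
  simp [h1, h2]

lemma TransformationGerms.analyticAt_polarEqn (hh : AnalyticAt ℂ h 0) :
    AnalyticAt ℂ (polarEqn h f γ f' γ') 0 := by
  have k3 := hg.analyticAt_polarLeft
  have k4 := hg.analyticAt_polarRight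
  have k5 := hh.comp_at hg.analyticAt_polarArg (hg.polarArg_zero 0)
  exact (k3.fun_sub k4).fun_sub ((analyticAt_const.fun_mul (k3.fun_add k4)).fun_mul k5)

/-- At the origin the equation reduces to `i t = 0`, so the implicit function theorem applies. -/
lemma TransformationGerms.exists_polar (hh : AnalyticAt ℂ h 0) (h0 : h 0 = 0) :
    ∃ h₁ : ℂ × ℂ × ℂ → ℂ, AnalyticAt ℂ h₁ 0 ∧ h₁ 0 = 0 ∧
      (∀ᶠ x in 𝓝 0, polarEqn h f γ f' γ' (x, h₁ x) = 0) ∧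
      ∀ᶠ p in 𝓝 0, polarEqn h f γ f' γ' p = 0 → p.2 = h₁ p.1 := by
  have hval : ∀ t : ℂ, polarEqn h f γ f' γ' (0, t) = I * t := by
    intro t
    have := hg.polarArg_zero t
    obtain ⟨e1, e2⟩ := hg.polar_zero t
    simp only [polarEqn, Prod.fst_zero, Prod.snd_zero]
    rw [this, h0, e1, e2]
    ring
  refine exists_implicit (hg.analyticAt_polarEqn hh) (by simpa using hval 0) ?_
  intro v hv
  have : HasDerivAt (fun s : ℂ => polarEqn h f γ f' γ' ((0, 0) + s • ((0 : ℂ × ℂ × ℂ), v)))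
      (I * v) 0 := by
    refine ((hasDerivAt_lin v).const_mul I).congr_of_eventuallyEq (.of_forall fun s => ?_)
    simpa using hval (s * v)
  simpa using (pd_eq_of_line (hg.analyticAt_polarEqn hh).differentiableAt this).symm.trans hv

/-- The relation between the two hypersurfaces in logarithmic form. -/
theorem TransformationGerms.transformationPair (hΛ : LogForm h Λ) (hΛ₁ : LogForm h₁ Λ₁)
    (hh₁ : AnalyticAt ℂ h₁ 0) (h₁0 : h₁ 0 = 0)
    (hpol : ∀ᶠ x in 𝓝 0, polarEqn h f γ f' γ' (x, h₁ x) = 0) :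
    TransformationPair Λ₁ Λ f γ f' γ' := by
  refine ⟨hg, ?_⟩
  have aΛ₁ := hΛ₁.analyticAt
  have aΛ := hΛ.analyticAt
  have Λ₁0 := hΛ₁.map_zero
  have aU : AnalyticAt ℂ (fun x : ℂ × ℂ × ℂ => ((x.1, x.2.1, x.2.2 * (exp (Λ₁ x) + 1) / 2) :
    ℂ × ℂ × ℂ)) 0 := by fun_prop
  have U0 : (fun x : ℂ × ℂ × ℂ => ((x.1, x.2.1, x.2.2 * (exp (Λ₁ x) + 1) / 2) :
    ℂ × ℂ × ℂ)) 0 = 0 := by simp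
  have tU := tendsto_of_analyticAt aU U0
  have aT : AnalyticAt ℂ (fun x : ℂ × ℂ × ℂ => h₁ (x.1, x.2.1, x.2.2 * (exp (Λ₁ x) + 1) / 2)) 0 :=
    hh₁.comp_at aU U0
  have aP : AnalyticAt ℂ (fun x : ℂ × ℂ × ℂ => ((x.1, x.2.1, x.2.2 * (exp (Λ₁ x) + 1) / 2),
    h₁ (x.1, x.2.1, x.2.2 * (exp (Λ₁ x) + 1) / 2))) 0 := aU.prod aT
  have P0 : (fun x : ℂ × ℂ × ℂ => ((x.1, x.2.1, x.2.2 * (exp (Λ₁ x) + 1) / 2),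
    h₁ (x.1, x.2.1, x.2.2 * (exp (Λ₁ x) + 1) / 2))) 0 = 0 := by
    simp only [Prod.snd_zero, Prod.fst_zero, zero_mul, zero_div]
    have : h₁ (0, 0, 0) = 0 := h₁0
    rw [this]; rfl
  have k1 : AnalyticAt ℂ (fun x : ℂ × ℂ × ℂ => f (x.1, x.2.2 * exp (Λ₁ x))) 0 :=
    hg.analyticAt_f.comp_at (by fun_prop) (by simp)
  have k2 : AnalyticAt ℂ (fun x : ℂ × ℂ × ℂ => γ (x.1, x.2.2 * exp (Λ₁ x))) 0 :=
    hg.analyticAt_γ.comp_at (by fun_prop) (by simp)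
  have k3 : AnalyticAt ℂ (fun x : ℂ × ℂ × ℂ => f' x.2) 0 :=
    hg.analyticAt_f'.comp_at (by fun_prop) rfl
  have k4 : AnalyticAt ℂ (fun x : ℂ × ℂ × ℂ => γ' x.2) 0 :=
    hg.analyticAt_γ'.comp_at (by fun_prop) rfl
  have f00 : f (0, 0) = 0 := hg.f_zero
  have g00 : γ (0, 0) = 0 := hg.γ_zero
  have t3 : AnalyticAt ℂ (fun x : ℂ × ℂ × ℂ => x.2.2 * (exp (Λ₁ x) + 1) / 2) 0 := by fun_prop
  have tY := tendsto_of_analyticAt ((k1.prod (k3.prod t3)).prod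
    ((hg.analyticAt_polarLeft.comp_at aP P0).prod (hg.analyticAt_polarRight.comp_at aP P0)))
    (y := (0, 1, 1)) (by
      have p0 : ((((0, 0, 0), 0) : (ℂ × ℂ × ℂ) × ℂ)) = (0, 0) := rfl
      have := hg.polar_zero 0
      simp only [mul_zero, add_zero, sub_zero] at this
      have h00 : h₁ (0, 0, 0) = 0 := h₁0
      simp [f00, hg.f'_zero, h00, p0, this])
  have t2 : Tendsto (fun x : ℂ × ℂ × ℂ => γ (x.1, x.2.2 * exp (Λ₁ x)) + Λ₁ x - (γ' x.2 +
      Λ (f (x.1, x.2.2 * exp (Λ₁ x)), f' x.2, x.2.2 * exp (γ' x.2)))) (𝓝 0) (𝓝 0) := by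
    refine tendsto_of_analyticAt ((k2.fun_add aΛ₁).fun_sub (k4.fun_add (aΛ.comp_at
      (k1.prod (k3.prod (AnalyticAt.fun_mul (by fun_prop) k4.cexp'))) ?_))) ?_
    · simp [f00, hg.f'_zero]
    · have : Λ (0, 0, 0) = 0 := hΛ.map_zero
      simp [f00, g00, hg.f'_zero, hg.γ'_zero, Λ₁0, this]
  filter_upwards [hΛ₁.eqn, tU.eventually hpol, tY.eventually hΛ.iff, eventually_exp_inj t2] with
    x h1 h2 h3 h4
  obtain ⟨z, χ, τ⟩ := x
  simp only [polarEqn, polarLeft, polarRight] at *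
  set e := exp (Λ₁ (z, χ, τ))
  set t := h₁ (z, χ, τ * (e + 1) / 2)
  -- For the mean `u = τ (e + 1) / 2` and `t = h₁`, the points `u (1 ± i t / 2)` are `w = τ e` and
  -- `τ`.
  have r1 : τ * (e + 1) / 2 * (1 + I / 2 * t) = τ * e := by linear_combination (- τ / 2) * h1
  have r2 : τ * (e + 1) / 2 * (1 - I / 2 * t) = τ := by linear_combination (τ / 2) * h1
  have r3 : (1 - I / 2 * t) * (e + 1) = 2 := by linear_combination h1
  have r4 : 1 - I / 2 * t ≠ 0 := fun h0 => by simp [h0] at r3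
  have r5 : 1 + I / 2 * t = e * (1 - I / 2 * t) := by linear_combination -h1
  rw [r1, r2] at h2 h3
  have h5 := h3.1 (sub_eq_zero.1 h2)
  rw [← mul_assoc (τ * (e + 1) / 2), r2, r5] at h5
  -- The two sides agree after exponentiation, and both exponents are small.
  refine sub_eq_zero.1 (h4 ?_)
  rw [exp_sub, exp_add, exp_add, div_eq_one_iff_eq (mul_ne_zero (exp_ne_zero _) (exp_ne_zero _))]
  exact mul_left_cancel₀ r4 (by linear_combination h5)

end Polar

/-! ### Complex conjugation of germs and of transformations -/

section Conj

/-- `conj (g (conj z, conj w))` -/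
noncomputable def conjGerm (g : ℂ × ℂ → ℂ) (x : ℂ × ℂ) : ℂ := conj (g (conj x.1, conj x.2))

/-- `conj (h (conj χ, conj z, conj u))` -/
noncomputable def conjSwap (h : ℂ × ℂ × ℂ → ℂ) (x : ℂ × ℂ × ℂ) : ℂ :=
  conj (h (conj x.2.1, conj x.1, conj x.2.2))

variable {h : ℂ × ℂ × ℂ → ℂ} {f γ f' γ' g : ℂ × ℂ → ℂ}

lemma analyticAt_conjGerm (hg : AnalyticAt ℂ g 0) : AnalyticAt ℂ (conjGerm g) 0 :=
  analyticAt_conj_conj conjPair (by rwa [map_zero])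

lemma analyticAt_conjSwap (hh : AnalyticAt ℂ h 0) : AnalyticAt ℂ (conjSwap h) 0 :=
  analyticAt_conj_conj conjTriple (G := fun x => h (x.2.1, x.1, x.2.2))
    (hh.comp_at (by fun_prop) (by simp [map_zero]))

lemma conjGerm_zero (hg : g 0 = 0) : conjGerm g 0 = 0 := by
  have : g (0, 0) = 0 := hg
  simp [conjGerm, this]

lemma conjSwap_zero (hh : h 0 = 0) : conjSwap h 0 = 0 := by
  have : h (0, 0, 0) = 0 := hh
  simp [conjSwap, this]

lemma TransformationGerms.conj (hg : TransformationGerms f γ f' γ') :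
    TransformationGerms (conjGerm f') (conjGerm γ') (conjGerm f) (conjGerm γ) :=
  ⟨analyticAt_conjGerm hg.analyticAt_f', analyticAt_conjGerm hg.analyticAt_γ',
    analyticAt_conjGerm hg.analyticAt_f, analyticAt_conjGerm hg.analyticAt_γ,
    conjGerm_zero hg.f'_zero, conjGerm_zero hg.γ'_zero, conjGerm_zero hg.f_zero,
    conjGerm_zero hg.γ_zero⟩

lemma tendsto_conjSwap : Tendsto (fun x : ℂ × ℂ × ℂ => (conj x.2.1, conj x.1, conj x.2.2)) (𝓝 0)
    (𝓝 0) := by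
  have : Continuous (fun x : ℂ × ℂ × ℂ => (conj x.2.1, conj x.1, conj x.2.2)) := by fun_prop
  simpa [Prod.zero_eq_mk] using this.tendsto 0

/-- Conjugation exchanges `z` with `χ` and `w` with `τ`, hence the transformation with its
companion. -/
lemma polarEqn_conj (p : (ℂ × ℂ × ℂ) × ℂ) :
    polarEqn (conjSwap h) (conjGerm f') (conjGerm γ') (conjGerm f) (conjGerm γ) p =
      -conj (polarEqn h f γ f' γ' ((conj p.1.2.1, conj p.1.1, conj p.1.2.2), conj p.2)) := by
  have hI : conj (I / 2) = -(I / 2) := by rw [map_div₀, conj_I, map_ofNat, neg_div]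
  have hc : ∀ p : ℂ, 1 - I / 2 * p = conj (1 + I / 2 * conj p) := fun p => by
    simp only [map_add, map_mul, map_one, hI, conj_conj]; ring
  have hc' : ∀ p : ℂ, 1 + I / 2 * p = conj (1 - I / 2 * conj p) := fun p => by
    simp only [map_sub, map_mul, map_one, hI, conj_conj]; ring
  have e1 : polarLeft (conjGerm γ') p =
      conj (polarRight γ' ((conj p.1.2.1, conj p.1.1, conj p.1.2.2), conj p.2)) := by
    simp only [polarLeft, polarRight, conjGerm, map_mul, ← exp_conj, hc' p.2, conj_conj]
  have e2 : polarRight (conjGerm γ) p =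
      conj (polarLeft γ ((conj p.1.2.1, conj p.1.1, conj p.1.2.2), conj p.2)) := by
    simp only [polarLeft, polarRight, conjGerm, map_mul, ← exp_conj, hc p.2, conj_conj]
  rw [polarEqn, polarEqn, e1, e2]
  generalize polarLeft γ ((conj p.1.2.1, conj p.1.1, conj p.1.2.2), conj p.2) = A
  generalize polarRight γ' ((conj p.1.2.1, conj p.1.1, conj p.1.2.2), conj p.2) = B
  have e3 : conjSwap h (conjGerm f' (p.1.1, p.1.2.2 * (1 + I / 2 * p.2)),
      conjGerm f (p.1.2.1, p.1.2.2 * (1 - I / 2 * p.2)), p.1.2.2 * (conj B + conj A) / 2) =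
      conj (h (f (conj p.1.2.1, conj p.1.2.2 * (1 + I / 2 * conj p.2)),
        f' (conj p.1.1, conj p.1.2.2 * (1 - I / 2 * conj p.2)), conj p.1.2.2 * (A + B) / 2)) := by
    simp only [conjSwap, conjGerm, hc p.2, hc' p.2, map_mul, conj_conj, map_div₀, map_add,
      map_ofNat, add_comm]
  rw [e3]
  simp only [map_sub, map_mul, map_add, hI]
  ring

/-- Real values at the points `χ = conj z`, `u` real, amount to invariance there, and these points
determine an analytic germ. -/
lemma eventually_conjSwap_eq_iff (hh : AnalyticAt ℂ h 0) : conjSwap h =ᶠ[𝓝 0] h ↔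
    ∀ᶠ x : ℂ × ℝ in 𝓝 0, (h (x.1, conj x.1, (x.2 : ℂ))).im = 0 := by
  have hc : ∀ x : ℂ × ℝ, conjSwap h (x.1, conj x.1, (x.2 : ℂ)) =
      conj (h (x.1, conj x.1, (x.2 : ℂ))) := fun x => by simp [conjSwap]
  constructor
  · intro he
    have t : Tendsto (fun x : ℂ × ℝ => ((x.1, conj x.1, (x.2 : ℂ)) : ℂ × ℂ × ℂ)) (𝓝 0) (𝓝 0) := by
      have : Continuous (fun x : ℂ × ℝ => ((x.1, conj x.1, (x.2 : ℂ)) : ℂ × ℂ × ℂ)) := by fun_prop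
      simpa [Prod.zero_eq_mk] using this.tendsto 0
    filter_upwards [t.eventually he] with x hx
    exact Complex.conj_eq_iff_im.1 ((hc x).symm.trans hx)
  · intro hr
    have := eventually_eq_zero_of_conj (G := fun x => conjSwap h x - h x)
      ((analyticAt_conjSwap hh).fun_sub hh) (by
        filter_upwards [hr] with x hx
        rw [hc, sub_eq_zero, Complex.conj_eq_iff_im.2 hx])
    exact this.mono fun x hx => sub_eq_zero.1 hx

lemma LogAdmissible.conjSwap {ε : ℝ} (ha : LogAdmissible (ε : ℂ) h) :
    LogAdmissible (ε : ℂ) (conjSwap h) := by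
  have hh := ha.analyticAt
  have t : Tendsto (fun x : ℂ × ℂ => ((conj x.1, conj x.2) : ℂ × ℂ)) (𝓝 0) (𝓝 0) := by
    have : Continuous (fun x : ℂ × ℂ => ((conj x.1, conj x.2) : ℂ × ℂ)) := by fun_prop
    simpa [Prod.zero_eq_mk] using this.tendsto 0
  have tl : Tendsto (fun x : ℂ × ℂ => ((0, x.1, x.2) : ℂ × ℂ × ℂ)) (𝓝 0) (𝓝 0) :=
    tendsto_of_analyticAt (by fun_prop) rfl
  have tr : Tendsto (fun x : ℂ × ℂ => ((x.1, 0, x.2) : ℂ × ℂ × ℂ)) (𝓝 0) (𝓝 0) :=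
    tendsto_of_analyticAt (by fun_prop) rfl
  refine ⟨analyticAt_conjSwap hh, ?_, ?_, ?_, ?_⟩
  · filter_upwards [t.eventually ha.right] with x hx
    simpa [InfiniteType.conjSwap] using hx
  · filter_upwards [t.eventually ha.left] with x hx
    simpa [InfiniteType.conjSwap] using hx
  · filter_upwards [t.eventually ha.pd_right, (tr.comp t).eventually hh.eventually_analyticAt,
      tl.eventually (analyticAt_conjSwap hh).eventually_analyticAt] with x hx a1 a2
    have d := (hasDerivAt_slice_mid a1).conj_conj
    have := (hasDerivAt_slice a2).unique (f := fun z => InfiniteType.conjSwap h (z, x.1, x.2))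
      (by simpa [InfiniteType.conjSwap, Function.comp_def] using d)
    rw [this, hx]; simp
  · filter_upwards [t.eventually ha.pd_left, (tl.comp t).eventually hh.eventually_analyticAt,
      tr.eventually (analyticAt_conjSwap hh).eventually_analyticAt] with x hx a1 a2
    have d := (hasDerivAt_slice a1).conj_conj
    have := (hasDerivAt_slice_mid a2).unique (f := fun z => InfiniteType.conjSwap h (x.1, z, x.2))
      (by simpa [InfiniteType.conjSwap, Function.comp_def] using d)
    rw [this, hx]; simp

lemma cf_conj_conj (k : ℕ) (g : ℂ → ℂ) : cf k (fun z => conj (g (conj z))) = conj (cf k g) := by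
  have : ∀ k, ∀ g : ℂ → ℂ, iteratedDeriv k (fun z => conj (g (conj z))) =
      fun z => conj (iteratedDeriv k g (conj z)) := by
    intro k
    induction k with
    | zero => intro g; simp [iteratedDeriv_zero]
    | succ k ih =>
      intro g
      rw [iteratedDeriv_succ', iteratedDeriv_succ', ← ih]
      congr 1
      exact deriv_conj_conj (f := g)
  simp [cf, this]

lemma IsInNormalForm.conjSwap (hh : AnalyticAt ℂ h 0) (hn : IsInNormalForm h) :
    IsInNormalForm (conjSwap h) := by
  have t : Tendsto (fun u : ℂ => conj u) (𝓝 0) (𝓝 0) := by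
    simpa using Complex.continuous_conj.tendsto 0
  have key : ∀ᶠ u in 𝓝 (0 : ℂ), ∀ k l,
      hCoeff (InfiniteType.conjSwap h) k l u = conj (hCoeff h l k (conj u)) := by
    filter_upwards [hCoeff_eq (analyticAt_conjSwap hh), t.eventually (hCoeff_eq hh)] with u h1 h2 k l
    rw [(h1 k l).1, (h2 l k).2, ← cf_conj_conj]
    simp only [← cf_conj_conj, InfiniteType.conjSwap]
  have k0 := key.self_of_nhds
  filter_upwards [key, t.eventually hn] with u h1 h2
  simp only [h1, k0, map_zero]
  simp only [h2.1, h2.2.1, h2.2.2.1, h2.2.2.2, and_self]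

end Conj

/-! ### Existence of a real normalizing transformation -/

section Normalization

variable {h h₁ h' : ℂ × ℂ × ℂ → ℂ} {f γ f' γ' k' δ' g : ℂ × ℂ → ℂ}

lemma conjGerm_conjGerm : conjGerm (conjGerm g) = g := by ext x; simp [conjGerm]

lemma dz_conjGerm (hg : AnalyticAt ℂ g 0) : dz (conjGerm g) 0 = conj (dz g 0) := by
  change dz (conjGerm g) (0, 0) = conj (dz g (0, 0))
  have d := (hasDerivAt_dz (z := 0) (w := 0) hg).conj_conj
  exact (hasDerivAt_dz (z := 0) (w := 0) (analyticAt_conjGerm hg)).unique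
    (by simpa [conjGerm, Function.comp_def] using d)

lemma TransformationGerms.polarEqn_congr (hg : TransformationGerms f γ f' γ') (hh : h =ᶠ[𝓝 0] h')
    (hf : f' =ᶠ[𝓝 0] k') (hγ : γ' =ᶠ[𝓝 0] δ') :
    polarEqn h f γ f' γ' =ᶠ[𝓝 0] polarEqn h' f γ k' δ' := by
  have t : Tendsto (fun p : (ℂ × ℂ × ℂ) × ℂ => ((p.1.2.1, p.1.2.2 * (1 - I / 2 * p.2)) : ℂ × ℂ))
    (𝓝 0) (𝓝 0) := tendsto_of_analyticAt (by fun_prop) (by simp)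
  filter_upwards [t.eventually hf, t.eventually hγ, (tendsto_of_analyticAt hg.analyticAt_polarArg
    (hg.polarArg_zero 0)).eventually hh] with p h1 h2 h3
  have e : polarRight γ' p = polarRight δ' p := by simp only [polarRight, h2]
  rw [polarEqn, h3, polarEqn, e, h1]

/-- If the target is real, the conjugate transformation maps the conjugate hypersurface into it. -/
lemma TransformationGerms.polarEqn_conjSwap (hg : TransformationGerms f γ f' γ')
    (hr : conjSwap h =ᶠ[𝓝 0] h) (hh₁ : AnalyticAt ℂ h₁ 0) (h₁0 : h₁ 0 = 0)
    (hpol : ∀ᶠ x in 𝓝 0, polarEqn h f γ f' γ' (x, h₁ x) = 0) :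
    ∀ᶠ x in 𝓝 0, polarEqn h (conjGerm f') (conjGerm γ') (conjGerm f) (conjGerm γ)
      (x, conjSwap h₁ x) = 0 := by
  have t : Tendsto (fun x : ℂ × ℂ × ℂ => (x, conjSwap h₁ x)) (𝓝 0) (𝓝 0) :=
    tendsto_of_analyticAt (analyticAt_id.prod (analyticAt_conjSwap hh₁))
      (by simp [conjSwap_zero h₁0])
  filter_upwards [t.eventually (hg.conj.polarEqn_congr hr.symm .rfl .rfl),
    tendsto_conjSwap.eventually hpol] with x h1 h2
  rw [h1, polarEqn_conj]
  simp only [conjSwap, conj_conj]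
  rw [h2, map_zero, neg_zero]

/-- A transformation commuting with the conjugation preserves reality. -/
lemma TransformationGerms.conjSwap_eventuallyEq
    (hg : TransformationGerms f γ (conjGerm f) (conjGerm γ))
    (hr : conjSwap h =ᶠ[𝓝 0] h) (hh₁ : AnalyticAt ℂ h₁ 0) (h₁0 : h₁ 0 = 0)
    (hpol : ∀ᶠ x in 𝓝 0, polarEqn h f γ (conjGerm f) (conjGerm γ) (x, h₁ x) = 0)
    (hpu : ∀ᶠ p in 𝓝 0, polarEqn h f γ (conjGerm f) (conjGerm γ) p = 0 → p.2 = h₁ p.1) :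
    conjSwap h₁ =ᶠ[𝓝 0] h₁ := by
  have t : Tendsto (fun x : ℂ × ℂ × ℂ => (x, conjSwap h₁ x)) (𝓝 0) (𝓝 0) :=
    tendsto_of_analyticAt (analyticAt_id.prod (analyticAt_conjSwap hh₁))
      (by simp [conjSwap_zero h₁0])
  have := hg.polarEqn_conjSwap hr hh₁ h₁0 hpol
  rw [conjGerm_conjGerm, conjGerm_conjGerm] at this
  filter_upwards [this, t.eventually hpu] with x e1 e2 using e2 e1

/-- A real admissible germ satisfying the non-resonance condition can be transformed into normal
form by a transformation commuting with the conjugation. -/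
theorem exists_normalization {ε : ℝ} {Λ Ψ : ℂ × ℂ × ℂ → ℂ} (ha : IsAdmissibleFunction ε h)
    (hΛ : LogForm h Λ) (hΨ : AnalyticAt ℂ Ψ 0) (h2 : OrderTwo Ψ)
    (heq : ∀ᶠ x in 𝓝 0, pd (1, 0, 0) (pd (1, 0, 0) Λ) x =
      Ψ (x.1, x.2.2 * exp (Λ x), pd (1, 0, 0) Λ x))
    (hres : IsNonResonantODE fun x => Ψ x + x.2.2 ^ 2) :
    ∃ (f γ : ℂ × ℂ → ℂ) (h₁ : ℂ × ℂ × ℂ → ℂ), TransformationGerms f γ (conjGerm f) (conjGerm γ) ∧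
      dz f 0 = 1 ∧ IsAdmissibleFunction ε h₁ ∧ IsInNormalForm h₁ ∧
      (∀ᶠ x in 𝓝 0, polarEqn h f γ (conjGerm f) (conjGerm γ) (x, h₁ x) = 0) ∧
      ∀ᶠ p in 𝓝 0, polarEqn h f γ (conjGerm f) (conjGerm γ) p = 0 → p.2 = h₁ p.1 := by
  have hh := ha.analyticAt
  have hla := ha.logAdmissible
  have h0 : h 0 = 0 := hla.left.self_of_nhds
  have hLa := (hΛ.logAdmissible_iff hh ε).1 hla
  have hc : I * (ε : ℂ) ≠ 0 := by
    rcases ha.sign with e | e <;> simp [e]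
  have hr := (eventually_conjSwap_eq_iff hh).2 ha.real
  -- Non-resonance enters only here, giving both the Cauchy data to be realized and their
  -- uniqueness.
  obtain ⟨⟨D, aD, D0, hD⟩, huniq⟩ := exists_cauchyData (Φ := fun x => Ψ x + x.2.2 ^ 2)
    (by fun_prop) (isAssociatedODE_of_log hΛ.analyticAt hΨ h2 heq).order_two hres
  rw [logODE_add] at hD huniq
  obtain ⟨f, γ, f', γ', hn, hn', hcd, hrel⟩ := exists_initialRelations hLa hc aD D0
  have hg : TransformationGerms f γ f' γ' := ⟨hn.analyticAt_fst, hn.analyticAt_snd,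
    hn'.analyticAt_fst, hn'.analyticAt_snd, hn.fst_zero, hn.snd_zero, hn'.fst_zero, hn'.snd_zero⟩
  obtain ⟨h₁, ah₁, h₁0, hpol, hpu⟩ := hg.exists_polar hh h0
  obtain ⟨Λ₁, hΛ₁⟩ := exists_logForm ah₁ h₁0
  have hp := hg.transformationPair hΛ hΛ₁ ah₁ h₁0 hpol
  have hLa₁ := hrel.logAdmissible hp hΛ.analyticAt hΛ₁.analyticAt hΛ₁.map_zero
  have hla₁ := (hΛ₁.logAdmissible_iff ah₁ ε).2 hLa₁
  have hsys : ∀ᶠ w in 𝓝 0, sys Ψ (w, cauchyData f γ w, euler (cauchyData f γ) w,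
      euler (euler (cauchyData f γ)) w) = 0 := by
    filter_upwards [hD, hcd, euler_eventuallyEq hcd,
      euler_eventuallyEq (euler_eventuallyEq hcd)] with w e1 e2 e3 e4
    rw [e2, e3, e4, e1]
  have hcj := (constantJet_iff hn hΨ h2 hLa₁ hc (hp.pullback_eq hLa₁ hLa hn.dz_fst heq)).2 hsys
  have hnf : IsInNormalForm h₁ := (isInNormalForm_iff ah₁).2 ((hΛ₁.constantJet_iff hla₁).2 hcj)
  -- the conjugate transformation
  have ah₂ := analyticAt_conjSwap ah₁
  obtain ⟨Λ₂, hΛ₂⟩ := exists_logForm ah₂ (conjSwap_zero h₁0)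
  have hpol₂ := hg.polarEqn_conjSwap hr ah₁ h₁0 hpol
  have hp₂ := hg.conj.transformationPair hΛ hΛ₂ ah₂ (conjSwap_zero h₁0) hpol₂
  have hla₂ := hla₁.conjSwap
  have hLa₂ := (hΛ₂.logAdmissible_iff ah₂ ε).1 hla₂
  have hdf₂ : dz (conjGerm f') 0 = 1 := by rw [dz_conjGerm hn'.analyticAt_fst, hn'.dz_fst, map_one]
  have hn₂ := hp₂.normalizedMap hLa₂ hLa hdf₂
  have hcj₂ : ConstantJet Λ₂ := (hΛ₂.constantJet_iff hla₂).1
    ((isInNormalForm_iff ah₂).1 (IsInNormalForm.conjSwap ah₁ hnf))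
  have hsys₂ := (constantJet_iff hn₂ hΨ h2 hLa₂ hc (hp₂.pullback_eq hLa₂ hLa hdf₂ heq)).1 hcj₂
  -- Both transformations normalize into the same target equation, so their Cauchy data coincide,
  -- and with them their companions. The companion of the conjugate one is the conjugate of `(f,
  -- γ)`.
  have hdd := huniq _ _ (analyticAt_cauchyData hn.analyticAt_fst hn.analyticAt_snd)
    hn.cauchyData_zero hsys (analyticAt_cauchyData hn₂.analyticAt_fst hn₂.analyticAt_snd)
    hn₂.cauchyData_zero hsys₂
  obtain ⟨ef, eγ⟩ := hp.companion_unique hp₂ hLa₁ hLa₂ hLa hc hn.dz_fst hdd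
  have hgc : TransformationGerms f γ (conjGerm f) (conjGerm γ) :=
    ⟨hg.analyticAt_f, hg.analyticAt_γ, analyticAt_conjGerm hg.analyticAt_f,
      analyticAt_conjGerm hg.analyticAt_γ, hg.f_zero, hg.γ_zero, conjGerm_zero hg.f_zero,
      conjGerm_zero hg.γ_zero⟩
  have hcongr := hg.polarEqn_congr (.refl _ h) ef eγ
  have t1 : Tendsto (fun x : ℂ × ℂ × ℂ => (x, h₁ x)) (𝓝 0) (𝓝 0) :=
    tendsto_of_analyticAt (analyticAt_id.prod ah₁) (by simp [h₁0])
  have hpolc : ∀ᶠ x in 𝓝 0, polarEqn h f γ (conjGerm f) (conjGerm γ) (x, h₁ x) = 0 := by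
    filter_upwards [hpol, t1.eventually hcongr] with x e1 e2 using e2.symm.trans e1
  have hpuc : ∀ᶠ p in 𝓝 0, polarEqn h f γ (conjGerm f) (conjGerm γ) p = 0 → p.2 = h₁ p.1 := by
    filter_upwards [hpu, hcongr] with p e1 e2 e3 using e1 (e2.trans e3)
  have hreal := hgc.conjSwap_eventuallyEq hr ah₁ h₁0 hpolc hpuc
  exact ⟨f, γ, h₁, hgc, hn.dz_fst, hla₁.isAdmissibleFunction ha.sign
    ((eventually_conjSwap_eq_iff ah₁).1 hreal), hnf, hpolc, hpuc⟩

end Normalization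

/-! ### From the complexified relation back to real hypersurfaces -/

section Graph

variable {h h₁ : ℂ × ℂ × ℂ → ℂ} {f γ : ℂ × ℂ → ℂ}

/-- `x` lies on the hypersurface `v = u h(z, z̄, u) / 2`. -/
def OnGraph (h : ℂ × ℂ × ℂ → ℂ) (x : ℂ × ℂ) : Prop :=
  ((x.2.im : ℝ) : ℂ) = 1 / 2 * ((x.2.re : ℝ) : ℂ) * h (x.1, conj x.1, ((x.2.re : ℝ) : ℂ))

/-- The map `(z, w) ↦ (f, w e ^ γ)`. -/
noncomputable def expMap (f γ : ℂ × ℂ → ℂ) (x : ℂ × ℂ) : ℂ × ℂ := (f x, x.2 * exp (γ x))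

/-- At a real point, `u` times `polarLeft` and `u` times `polarRight` are the second component of
the image and its conjugate; their sum and difference give its real and imaginary parts. -/
lemma polarEqn_of_real (x : ℂ × ℂ) (t : ℝ) (ht : x.2.im = x.2.re * t / 2) :
    (x.2.re : ℂ) * polarEqn h f γ (conjGerm f) (conjGerm γ)
      ((x.1, conj x.1, ((x.2.re : ℝ) : ℂ)), (t : ℂ)) =
    2 * I * ((((expMap f γ x).2.im : ℝ) : ℂ) - 1 / 2 * (((expMap f γ x).2.re : ℝ) : ℂ) *
      h ((expMap f γ x).1, conj (expMap f γ x).1, (((expMap f γ x).2.re : ℝ) : ℂ))) := by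
  obtain ⟨z, w⟩ := x
  simp only at ht ⊢
  set a : ℝ := w.re with ha
  have hw : (a : ℂ) * (1 + I / 2 * t) = w := by
    conv_rhs => rw [← re_add_im w, ht]
    push_cast; ring
  have hw' : (a : ℂ) * (1 - I / 2 * t) = conj w := by
    rw [← hw]
    simp only [map_mul, conj_ofReal, map_add, map_one, map_div₀, conj_I, map_ofNat]; ring
  have hA : polarLeft γ ((z, conj z, (a : ℂ)), (t : ℂ)) = (1 + I / 2 * t) * exp (γ (z, w)) := by
    simp only [polarLeft, hw]
  have hB : polarRight (conjGerm γ) ((z, conj z, (a : ℂ)), (t : ℂ)) =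
      (1 - I / 2 * t) * conj (exp (γ (z, w))) := by
    simp only [polarRight, hw', conjGerm, conj_conj, exp_conj]
  have hre : (a : ℂ) * ((1 + I / 2 * t) * exp (γ (z, w)) + (1 - I / 2 * t) *
      conj (exp (γ (z, w)))) / 2 = ((w * exp (γ (z, w))).re : ℂ) := by
    have : (w * exp (γ (z, w))) + conj (w * exp (γ (z, w))) =
      ((2 * (w * exp (γ (z, w))).re : ℝ) : ℂ) := Complex.add_conj _
    rw [map_mul] at this
    push_cast at this
    linear_combination (1 / 2 : ℂ) * this + (1 / 2 : ℂ) * exp (γ (z, w)) * hw +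
      (1 / 2 : ℂ) * conj (exp (γ (z, w))) * hw'
  have him : (a : ℂ) * ((1 + I / 2 * t) * exp (γ (z, w)) - (1 - I / 2 * t) *
      conj (exp (γ (z, w)))) = 2 * I * ((w * exp (γ (z, w))).im : ℂ) := by
    have : (w * exp (γ (z, w))) - conj (w * exp (γ (z, w))) =
      ((2 * (w * exp (γ (z, w))).im : ℝ) : ℂ) * I := Complex.sub_conj _
    rw [map_mul] at this
    push_cast at this
    linear_combination this + exp (γ (z, w)) * hw - conj (exp (γ (z, w))) * hw'
  simp only [polarEqn, hA, hB, hw, hw', expMap, conjGerm, conj_conj, hre]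
  set H := h (f (z, w), conj (f (z, w)), ((w * exp (γ (z, w))).re : ℂ))
  linear_combination him - I * H * hre

lemma eventually_onGraph_iff (hg : TransformationGerms f γ (conjGerm f) (conjGerm γ))
    (hh : AnalyticAt ℂ h 0) (h0 : h 0 = 0)
    (hpol : ∀ᶠ x in 𝓝 0, polarEqn h f γ (conjGerm f) (conjGerm γ) (x, h₁ x) = 0)
    (hpu : ∀ᶠ p in 𝓝 0, polarEqn h f γ (conjGerm f) (conjGerm γ) p = 0 → p.2 = h₁ p.1) :
    ∀ᶠ x in 𝓝 0, OnGraph h (expMap f γ x) ↔ OnGraph h₁ x := by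
  -- If the image lies on the graph then `w` is a real multiple of `κ`. So the slope `2 Im w / Re
  -- w`, which is not continuous at `w = 0`, equals `2 Im κ / Re κ`, which is continuous and small
  -- near the origin; this puts it in reach of the local uniqueness of `h₁`.
  set κ : ℂ × ℂ → ℂ := fun x => (1 + I / 2 * h ((expMap f γ x).1, conj (expMap f γ x).1,
    (((expMap f γ x).2.re : ℝ) : ℂ))) * exp (-γ x) with hκ
  have cf : ContinuousAt f 0 := hg.analyticAt_f.continuousAt
  have cγ : ContinuousAt γ 0 := hg.analyticAt_γ.continuousAt
  have cm : ContinuousAt (expMap f γ) 0 := cf.prodMk (continuousAt_snd.mul cγ.cexp)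
  have m0 : expMap f γ 0 = 0 := by simp [expMap, hg.f_zero]
  have cκ : ContinuousAt κ 0 := by
    have c1 : Continuous fun y : ℂ × ℂ => ((y.1, conj y.1, ((y.2.re : ℝ) : ℂ)) : ℂ × ℂ × ℂ) := by
      fun_prop
    have c2 : ContinuousAt (fun x => h ((expMap f γ x).1, conj (expMap f γ x).1,
        (((expMap f γ x).2.re : ℝ) : ℂ))) 0 := by
      refine ContinuousAt.comp' (g := h) ?_ (c1.continuousAt.comp' cm)
      simp only [m0, Prod.fst_zero, Prod.snd_zero, map_zero, zero_re, ofReal_zero]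
      exact hh.continuousAt
    exact (continuousAt_const.add (continuousAt_const.mul c2)).mul cγ.neg.cexp
  have κ0 : κ 0 = 1 := by
    have : h (0, 0, 0) = 0 := h0
    simp [hκ, m0, this, hg.γ_zero]
  have κre : ∀ᶠ x in 𝓝 0, (κ x).re ≠ 0 :=
    (continuous_re.continuousAt.comp' cκ).eventually_ne (by simp [κ0])
  have ct : ContinuousAt (fun x => 2 * (κ x).im / (κ x).re) 0 :=
    (continuousAt_const.mul (continuous_im.continuousAt.comp' cκ)).div
      (continuous_re.continuousAt.comp' cκ) (by simp [κ0])
  have c1 : Continuous fun y : ℂ × ℂ => ((y.1, conj y.1, ((y.2.re : ℝ) : ℂ)) : ℂ × ℂ × ℂ) := by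
    fun_prop
  have t1 : Tendsto (fun y : ℂ × ℂ => ((y.1, conj y.1, ((y.2.re : ℝ) : ℂ)) : ℂ × ℂ × ℂ)) (𝓝 0)
      (𝓝 0) := by simpa [Prod.zero_eq_mk] using c1.tendsto 0
  have t2 : Tendsto (fun y : ℂ × ℂ => (((y.1, conj y.1, ((y.2.re : ℝ) : ℂ)),
      ((2 * (κ y).im / (κ y).re : ℝ) : ℂ)) : (ℂ × ℂ × ℂ) × ℂ)) (𝓝 0) (𝓝 0) := by
    have := (c1.continuousAt (x := 0)).prodMk (continuous_ofReal.continuousAt.comp' ct)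
    have κ00 : κ (0, 0) = 1 := κ0
    simpa [ContinuousAt, κ00, Prod.zero_eq_mk] using this
  filter_upwards [κre, t1.eventually hpol, t2.eventually hpu] with x hκre e1 e2
  constructor
  · intro hx
    have key : x.2 = ((expMap f γ x).2.re : ℂ) * κ x := by
      have h3 : (expMap f γ x).2 = ((expMap f γ x).2.re : ℂ) * (1 + I / 2 *
          h ((expMap f γ x).1, conj (expMap f γ x).1, (((expMap f γ x).2.re : ℝ) : ℂ))) := by
        conv_lhs => rw [← re_add_im (expMap f γ x).2]
        rw [OnGraph] at hx
        rw [hx]; ring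
      rw [hκ]
      simp only
      rw [← mul_assoc, ← h3, expMap]
      simp only
      rw [mul_assoc, ← exp_add]; simp
    set u := (expMap f γ x).2.re with hu
    have hre : x.2.re = u * (κ x).re := by rw [key]; simp
    have him : x.2.im = u * (κ x).im := by rw [key]; simp
    -- Here `w = 0`, and such points lie on every graph of this form.
    by_cases hu0 : u = 0
    · simp [OnGraph, hre, him, hu0]
    have hp := polarEqn_of_real (h := h) (f := f) (γ := γ) x (2 * (κ x).im / (κ x).re) (by
      rw [hre, him]; field_simp)
    have ha : (x.2.re : ℂ) ≠ 0 := by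
      rw [hre]; exact_mod_cast mul_ne_zero hu0 hκre
    rw [OnGraph] at hx
    rw [sub_eq_zero.2 hx, mul_zero] at hp
    have h4 := e2 ((mul_eq_zero.1 hp).resolve_left ha)
    rw [OnGraph, ← h4]
    rw [hre, him]
    push_cast
    have : ((κ x).re : ℂ) ≠ 0 := by exact_mod_cast hκre
    field_simp
  · intro hx
    by_cases ha : x.2.re = 0
    · have : x.2 = 0 := by
        apply Complex.ext
        · simpa using ha
        · rw [OnGraph, ha] at hx
          simpa using hx
      simp [OnGraph, expMap, this]
    have ha' : (x.2.re : ℂ) ≠ 0 := by exact_mod_cast ha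
    have h3 : ((2 * x.2.im / x.2.re : ℝ) : ℂ) = h₁ (x.1, conj x.1, ((x.2.re : ℝ) : ℂ)) := by
      rw [OnGraph] at hx
      push_cast
      rw [hx]
      field_simp
    have hp := polarEqn_of_real (h := h) (f := f) (γ := γ) x (2 * x.2.im / x.2.re) (by
      field_simp)
    rw [h3, e1, mul_zero] at hp
    simp only [zero_eq_mul, mul_eq_zero, OfNat.ofNat_ne_zero, I_ne_zero, or_false, false_or] at hp
    exact sub_eq_zero.1 hp

end Graph

/-! ### Passing from transformations to coordinates of the hypersurface -/

section Coordinates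

lemma isInvertible_of_injective {E : Type*} [NormedAddCommGroup E] [NormedSpace ℂ E]
    [FiniteDimensional ℂ E] {L : E →L[ℂ] E} (h : ∀ v, L v = 0 → v = 0) : L.IsInvertible := by
  have hi : Function.Injective L.toLinearMap := by
    rw [← LinearMap.ker_eq_bot, LinearMap.ker_eq_bot']
    exact h
  exact ⟨(LinearEquiv.ofInjectiveEndo L.toLinearMap hi).toContinuousLinearEquiv, by ext v; rfl⟩

lemma eq_zero_of_isInvertible {E : Type*} [NormedAddCommGroup E] [NormedSpace ℂ E]
    {L : E →L[ℂ] E} (h : L.IsInvertible) {v : E} (hv : L v = 0) : v = 0 := by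
  obtain ⟨e, rfl⟩ := h
  exact e.map_eq_zero_iff.1 hv

lemma exists_local_inverse {E : Type*} [NormedAddCommGroup E] [NormedSpace ℂ E]
    [FiniteDimensional ℂ E] {T : E → E} {a b : E} (hT : AnalyticAt ℂ T a) (hb : T a = b)
    (hinj : ∀ v, fderiv ℂ T a v = 0 → v = 0) : ∃ S : E → E, AnalyticAt ℂ S b ∧ S b = a ∧
      (∀ᶠ y in 𝓝 b, T (S y) = y) ∧ ∀ᶠ x in 𝓝 a, S (T x) = x := by
  have : CompleteSpace E := FiniteDimensional.complete ℂ E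
  have hG : AnalyticAt ℂ (fun q : E × E => T q.2 - q.1) (b, a) :=
    (hT.comp_at analyticAt_snd rfl).fun_sub analyticAt_fst
  obtain ⟨S, aS, S0, h1, h2⟩ := exists_implicit hG (by simp [hb]) (by
    intro v hv
    refine hinj v ?_
    have d : HasDerivAt (fun s : ℂ => T (a + s • v) - b) (fderiv ℂ T a v) 0 := by
      have h1 : HasDerivAt (fun s : ℂ => a + s • v) v 0 := by
        simpa using ((hasDerivAt_id (0 : ℂ)).smul_const v).const_add a
      have := hasDerivAt_comp_pd (G := T) (c := fun s : ℂ => a + s • v) (t := 0)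
        (by simpa using hT.differentiableAt) h1
      simpa [pd] using this.sub_const b
    rw [← hv]
    exact (pd_eq_of_line hG.differentiableAt (by simpa using d)).symm)
  have t : Tendsto (fun x => (T x, x)) (𝓝 a) (𝓝 (b, a)) :=
    tendsto_of_analyticAt (hT.prod analyticAt_id) (by simp [hb])
  refine ⟨S, aS, S0, h1.mono fun x hx => sub_eq_zero.1 hx, ?_⟩
  filter_upwards [t.eventually h2] with x hx using (hx (sub_self _)).symm

variable {M : Set (ℂ × ℂ)} {p : ℂ × ℂ} {Z T : ℂ × ℂ → ℂ × ℂ} {f γ : ℂ × ℂ → ℂ}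
  {h h₁ : ℂ × ℂ × ℂ → ℂ} {ε : ℝ}

lemma exists_coordinates (hZ : IsLocalBiholomorphism Z p) (hT : AnalyticAt ℂ T 0) (hT0 : T 0 = 0)
    (hinj : ∀ v, fderiv ℂ T 0 v = 0 → v = 0) :
    ∃ Z' : ℂ × ℂ → ℂ × ℂ, IsLocalBiholomorphism Z' p ∧ ∀ᶠ q in 𝓝 p, Z q = T (Z' q) := by
  obtain ⟨S, aS, S0, h1, -⟩ := exists_local_inverse hT hT0 hinj
  have aSZ : AnalyticAt ℂ (fun q => S (Z q)) p := aS.comp_at hZ.analyticAt hZ.map_base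
  have e : ∀ᶠ q in 𝓝 p, Z q = T (S (Z q)) := by
    filter_upwards [(tendsto_of_analyticAt hZ.analyticAt hZ.map_base).eventually h1] with q hq
      using hq.symm
  have hp0 : S (Z p) = 0 := by rw [hZ.map_base, S0]
  refine ⟨fun q => S (Z q), ⟨aSZ, hp0, ?_⟩, e⟩
  refine isInvertible_of_injective fun v hv => eq_zero_of_isInvertible hZ.isInvertible ?_
  have hT' : DifferentiableAt ℂ T (S (Z p)) := by rw [hp0]; exact hT.differentiableAt
  have : fderiv ℂ Z p = (fderiv ℂ T (S (Z p))).comp (fderiv ℂ (fun q => S (Z q)) p) := by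
    rw [Filter.EventuallyEq.fderiv_eq e]
    exact fderiv_fun_comp (f := fun q => S (Z q)) p hT' aSZ.differentiableAt
  rw [this, ContinuousLinearMap.comp_apply, hv, map_zero]

lemma analyticAt_expMap (hf : AnalyticAt ℂ f 0) (hγ : AnalyticAt ℂ γ 0) :
    AnalyticAt ℂ (expMap f γ) 0 :=
  hf.prod (analyticAt_snd.fun_mul hγ.cexp')

/-- The differential at the origin is triangular, with diagonal entries `f_z(0)` and `e ^ γ(0)`. -/
lemma eq_zero_of_fderiv_expMap (hf : AnalyticAt ℂ f 0) (hγ : AnalyticAt ℂ γ 0)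
    (hdf : dz f 0 ≠ 0) (v : ℂ × ℂ) (hv : fderiv ℂ (expMap f γ) 0 v = 0) : v = 0 := by
  obtain ⟨a, b⟩ := v
  have e00 : ((0, 0) : ℂ × ℂ) = 0 := rfl
  have d1 := hasDerivAt_comp₂ (G := f) (t := 0) (by simpa [e00] using hf.differentiableAt)
    (hasDerivAt_lin a) (hasDerivAt_lin b)
  have d2 := hasDerivAt_comp₂ (G := γ) (t := 0) (by simpa [e00] using hγ.differentiableAt)
    (hasDerivAt_lin a) (hasDerivAt_lin b)
  have d := d1.prodMk ((hasDerivAt_lin b).fun_mul d2.cexp)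
  have := (pd_eq_of_line (v := (a, b)) (analyticAt_expMap hf hγ).differentiableAt
    (by simpa [expMap] using d)).symm.trans hv
  simp only [Prod.mk_eq_zero, mul_eq_zero, exp_ne_zero, or_false, e00] at this
  obtain ⟨h1, h2⟩ := this
  rw [h2, zero_mul, add_zero] at h1
  rw [h2, (mul_eq_zero.1 h1).resolve_right hdf]
  rfl

/-- A transformation of the defining function gives a change of coordinates. -/
lemma exists_admissibleCoordinates (hZ : IsLocalBiholomorphism Z p)
    (hM : ∀ᶠ q in 𝓝 p, q ∈ M ↔ OnGraph h (Z q))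
    (hg : TransformationGerms f γ (conjGerm f) (conjGerm γ)) (hdf : dz f 0 ≠ 0)
    (hh : AnalyticAt ℂ h 0) (h0 : h 0 = 0) (ha₁ : IsAdmissibleFunction ε h₁)
    (hpol : ∀ᶠ x in 𝓝 0, polarEqn h f γ (conjGerm f) (conjGerm γ) (x, h₁ x) = 0)
    (hpu : ∀ᶠ p in 𝓝 0, polarEqn h f γ (conjGerm f) (conjGerm γ) p = 0 → p.2 = h₁ p.1) :
    ∃ Z' : ℂ × ℂ → ℂ × ℂ, IsAdmissibleCoordinates M p Z' ε h₁ := by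
  obtain ⟨Z', hZ', e⟩ := exists_coordinates hZ (analyticAt_expMap hg.analyticAt_f hg.analyticAt_γ)
    (by simp [expMap, hg.f_zero]) (eq_zero_of_fderiv_expMap hg.analyticAt_f hg.analyticAt_γ hdf)
  refine ⟨Z', hZ', ha₁, ?_⟩
  filter_upwards [hM, e, (tendsto_of_analyticAt hZ'.analyticAt hZ'.map_base).eventually
    (eventually_onGraph_iff hg hh h0 hpol hpu)] with q h1 h2 h3
  rw [h1, h2, h3]
  rfl

theorem exists_isNormalizing (hZ : IsAdmissibleCoordinates M p Z ε h) (hres : IsNonResonantAt M p) :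
    ∃ H : ℂ × ℂ → ℂ × ℂ, IsNormalizing M p H := by
  have ha := hZ.admissible
  have hh := ha.analyticAt
  have h0 : h 0 = 0 := ha.logAdmissible.left.self_of_nhds
  obtain ⟨Λ, hΛ⟩ := exists_logForm hh h0
  have hLa := (hΛ.logAdmissible_iff hh ε).1 ha.logAdmissible
  obtain ⟨Ψ, hΨ, h2, heq⟩ := hLa.exists_ode (by rcases ha.sign with e | e <;> simp [e])
  obtain ⟨f, γ, h₁, hg, hdf, ha₁, hn, hpol, hpu⟩ := exists_normalization ha hΛ hΨ h2 heq
    (hres Z ε h _ _ hZ hΛ.isComplexDefiningFunction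
      (isAssociatedODE_of_log hΛ.analyticAt hΨ h2 heq))
  obtain ⟨Z', hZ'⟩ := exists_admissibleCoordinates hZ.biholomorphism hZ.graph hg (by simp [hdf])
    hh h0 ha₁ hpol hpu
  exact ⟨Z', ε, h₁, hZ', hn⟩

end Coordinates

/-! ### The change of `z` that produces admissible coordinates -/

section Initial

lemma eq_zero_of_mul_eq_zero {g : ℂ → ℂ} (hg : ContinuousAt g 0)
    (h : ∀ᶠ s in 𝓝 (0 : ℂ), s * g s = 0) : g 0 = 0 := by
  refine tendsto_nhds_unique (hg.tendsto.mono_left nhdsWithin_le_nhds)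
    ((tendsto_const_nhds (x := (0 : ℂ))).congr' ?_) (l := 𝓝[≠] 0)
  filter_upwards [h.filter_mono nhdsWithin_le_nhds, self_mem_nhdsWithin] with s h1 h2
  exact ((mul_eq_zero.1 h1).resolve_left h2).symm

lemma eventually_eq_zero_of_mul {G : ℂ × ℂ × ℂ → ℂ} (hG : AnalyticAt ℂ G 0)
    (h : ∀ᶠ x in 𝓝 0, x.2.2 * G x = 0) : ∀ᶠ x in 𝓝 0, G x = 0 := by
  filter_upwards [h.eventually_nhds, hG.eventually_analyticAt] with x hx ax
  obtain ⟨z, χ, u⟩ := x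
  by_cases hu : u = 0
  · subst hu
    have c : Continuous fun s : ℂ => ((z, χ, s) : ℂ × ℂ × ℂ) := by fun_prop
    exact eq_zero_of_mul_eq_zero (g := fun s => G (z, χ, s))
      (ContinuousAt.comp' (g := G) ax.continuousAt c.continuousAt) ((c.tendsto 0).eventually hx)
  · exact (mul_eq_zero.1 hx.self_of_nhds).resolve_left hu

lemma tendsto_conj_zero : Tendsto (fun u : ℂ => conj u) (𝓝 0) (𝓝 0) := by
  simpa using Complex.continuous_conj.tendsto 0

/-- A real germ `b` with `b 0 ≠ 0` is, up to sign, the square of a real germ. -/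
lemma exists_sqrt_germ {b : ℂ → ℂ} (hb : AnalyticAt ℂ b 0) (hb0 : b 0 ≠ 0)
    (hr : ∀ᶠ w in 𝓝 0, conj (b (conj w)) = b w) : ∃ (ε : ℝ) (a : ℂ → ℂ), (ε = 1 ∨ ε = -1) ∧
      AnalyticAt ℂ a 0 ∧ a 0 ≠ 0 ∧ (∀ᶠ w in 𝓝 0, a w ^ 2 = ε * b w) ∧
      ∀ᶠ w in 𝓝 0, conj (a (conj w)) = a w := by
  have him : (b 0).im = 0 := Complex.conj_eq_iff_im.1 (by simpa using hr.self_of_nhds)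
  have hre : ((b 0).re : ℂ) = b 0 := Complex.ext (by simp) (by simp [him])
  have hre0 : (b 0).re ≠ 0 := fun h0 => hb0 (by rw [← hre, h0, ofReal_zero])
  obtain ⟨ε, hε, hpos⟩ : ∃ ε : ℝ, (ε = 1 ∨ ε = -1) ∧ 0 < ε * (b 0).re := by
    rcases lt_or_gt_of_ne hre0 with h | h
    · exact ⟨-1, .inr rfl, by linarith⟩
    · exact ⟨1, .inl rfl, by linarith⟩
  set r : ℝ := √(ε * (b 0).re) with hrdef
  have hrr : (r : ℂ) ^ 2 = ε * b 0 := by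
    rw [← hre, ← ofReal_mul, ← ofReal_pow, Real.sq_sqrt hpos.le]
  have hr0 : (r : ℂ) ≠ 0 := by exact_mod_cast (Real.sqrt_pos.2 hpos).ne'
  have aG : AnalyticAt ℂ (fun p : ℂ × ℂ => p.2 ^ 2 - ε * b p.1) (0, (r : ℂ)) := by
    have : AnalyticAt ℂ (fun p : ℂ × ℂ => b p.1) (0, (r : ℂ)) := hb.comp_at (by fun_prop) rfl
    fun_prop
  obtain ⟨a, aa, a0, h1, h2⟩ := exists_implicit aG (by simp [hrr]) (by
    intro v hv
    have d := (((hasDerivAt_lin v).const_add (r : ℂ)).fun_pow 2).sub_const ((ε : ℂ) * b 0)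
    have := (pd_eq_of_line (v := ((0 : ℂ), v)) aG.differentiableAt (by simpa using d)).symm.trans hv
    simpa [hr0] using this)
  refine ⟨ε, a, hε, aa, by rwa [a0], h1.mono fun w hw => sub_eq_zero.1 hw, ?_⟩
  -- The conjugate of `a` solves the same equation with the same real value `r` at `0`, so it agrees
  -- with `a`.
  have t : Tendsto (fun w => (w, conj (a (conj w)))) (𝓝 0) (𝓝 (0, (r : ℂ))) := by
    have c : ContinuousAt (fun w => conj (a (conj w))) 0 := by
      refine Complex.continuous_conj.continuousAt.comp' (ContinuousAt.comp' (g := a) ?_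
        Complex.continuous_conj.continuousAt)
      rw [map_zero]
      exact aa.continuousAt
    have := (continuousAt_id (x := (0 : ℂ))).prodMk c
    simpa [ContinuousAt, a0] using this
  filter_upwards [t.eventually h2, tendsto_conj_zero.eventually h1, hr] with w e1 e2 e3
  refine e1 ?_
  rw [← map_pow, sub_eq_zero.1 e2, map_mul, conj_ofReal, e3, sub_self]

variable {h Λ : ℂ × ℂ × ℂ → ℂ}

lemma dz_conjGerm_apply {g : ℂ × ℂ → ℂ} {w : ℂ} (hg : AnalyticAt ℂ g (0, conj w))
    (hg' : AnalyticAt ℂ (conjGerm g) (0, w)) :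
    dz (conjGerm g) (0, w) = conj (dz g (0, conj w)) := by
  have d := (hasDerivAt_dz hg).conj_conj
  exact (hasDerivAt_dz hg').unique (by simpa [conjGerm, Function.comp_def] using d)

/-- The coefficient of `χ`, as a function of `(z, u)`. -/
noncomputable def rightCoeff (h : ℂ × ℂ × ℂ → ℂ) (x : ℂ × ℂ) : ℂ := pd (0, 1, 0) h (x.1, 0, x.2)

lemma analyticAt_rightCoeff (hh : AnalyticAt ℂ h 0) : AnalyticAt ℂ (rightCoeff h) 0 :=
  (analyticAt_pd (0, 1, 0) hh).comp_at (g := fun x : ℂ × ℂ => ((x.1, 0, x.2) : ℂ × ℂ × ℂ))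
    (by fun_prop) rfl

lemma conjGerm_rightCoeff (hh : AnalyticAt ℂ h 0) (hr : conjSwap h =ᶠ[𝓝 0] h) :
    ∀ᶠ x : ℂ × ℂ in 𝓝 0, conjGerm (rightCoeff h) x = pd (1, 0, 0) h (0, x.1, x.2) := by
  have t : Tendsto (fun x : ℂ × ℂ => ((conj x.1, conj x.2) : ℂ × ℂ)) (𝓝 0) (𝓝 0) := by
    have : Continuous (fun x : ℂ × ℂ => ((conj x.1, conj x.2) : ℂ × ℂ)) := by fun_prop
    simpa [Prod.zero_eq_mk] using this.tendsto 0
  filter_upwards [(tendsto_zero_mid.comp t).eventually hh.eventually_analyticAt,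
    tendsto_zero_left.eventually (analyticAt_conjSwap hh).eventually_analyticAt,
    tendsto_zero_left.eventually (pd_eventuallyEq (1, 0, 0) hr)] with x a1 a2 e
  rw [← e]
  change conj (pd (0, 1, 0) h (conj x.1, 0, conj x.2)) = _
  have d := (hasDerivAt_slice_mid a1).conj_conj
  exact ((hasDerivAt_slice a2).unique (f := fun z => conjSwap h (z, x.1, x.2))
    (by simpa [conjSwap, Function.comp_def] using d)).symm

/-- Reality exchanges the coefficients of `z` and `χ`, and the mixed derivative is symmetric; thus
`h₁₁` is a real germ. -/
lemma conj_dz_rightCoeff (hh : AnalyticAt ℂ h 0) (hr : conjSwap h =ᶠ[𝓝 0] h) :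
    ∀ᶠ w in 𝓝 0, conj (dz (rightCoeff h) (0, conj w)) = dz (rightCoeff h) (0, w) := by
  have aB := analyticAt_rightCoeff hh
  filter_upwards [(tendsto_left₂.comp tendsto_conj_zero).eventually aB.eventually_analyticAt,
    tendsto_left₂.eventually aB.eventually_analyticAt,
    tendsto_left₂.eventually (analyticAt_conjGerm aB).eventually_analyticAt,
    tendsto_left₂.eventually (conjGerm_rightCoeff hh hr).eventually_nhds,
    (tendsto_zero_left.comp tendsto_left₂).eventually hh.eventually_analyticAt] with w a1 a2 a3 e a4
  have hl : Tendsto (fun s : ℂ => ((s, w) : ℂ × ℂ)) (𝓝 0) (𝓝 (0, w)) :=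
    tendsto_of_analyticAt (by fun_prop) rfl
  rw [← dz_conjGerm_apply a1 a3, (hasDerivAt_dz a3).unique
    ((hasDerivAt_slice_mid (analyticAt_pd (1, 0, 0) a4)).congr_of_eventuallyEq (hl.eventually e)),
    (hasDerivAt_dz a2).unique (hasDerivAt_slice (analyticAt_pd (0, 1, 0) a4))]
  exact pd_comm a4 _ _

/-- Let `b = h₁₁(w)` and choose a real germ `a` with `a² = ε b`. Taking `ε a(w) z` as the
coefficient of `χ` after substitution defines `f`, with `f(0, w) = 0` and `f_z(0, w) = 1 / a`. The
change `(f, w)` with conjugate companion then makes the terms linear in `z` or in `χ` equal to `ε z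
χ`. -/
lemma exists_admissible_germ (hh : AnalyticAt ℂ h 0) (hΛ : LogForm h Λ)
    (hr : conjSwap h =ᶠ[𝓝 0] h) (hl : ∀ᶠ x : ℂ × ℂ in 𝓝 0, h (0, x.1, x.2) = 0)
    (hrt : ∀ᶠ x : ℂ × ℂ in 𝓝 0, h (x.1, 0, x.2) = 0) (h11 : dz (rightCoeff h) (0, 0) ≠ 0) :
    ∃ (ε : ℝ) (f : ℂ × ℂ → ℂ), (ε = 1 ∨ ε = -1) ∧ AnalyticAt ℂ f 0 ∧ f 0 = 0 ∧ dz f 0 ≠ 0 ∧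
      InitialRelations (I * ε) Λ f (fun _ => 0) (conjGerm f) (fun _ => 0) := by
  have aB := analyticAt_rightCoeff hh
  have ab : AnalyticAt ℂ (fun w => dz (rightCoeff h) (0, w)) 0 := analyticAt_slice_left (analyticAt_dz aB)
  obtain ⟨ε, a, hε, aa, a0, hab, hac⟩ := exists_sqrt_germ ab h11 (conj_dz_rightCoeff hh hr)
  have hε2 : (ε : ℂ) * ε = 1 := by rcases hε with e | e <;> simp [e]
  have hε0 : (ε : ℂ) ≠ 0 := left_ne_zero_of_mul_eq_one hε2
  have hB0 : ∀ᶠ w in 𝓝 (0 : ℂ), rightCoeff h (0, w) = 0 := by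
    filter_upwards [tendsto_left₂.eventually hl.eventually_nhds,
      (tendsto_zero_left.comp tendsto_left₂).eventually hh.eventually_analyticAt] with w e a4
    have ht : Tendsto (fun s : ℂ => ((s, w) : ℂ × ℂ)) (𝓝 0) (𝓝 (0, w)) :=
      tendsto_of_analyticAt (by fun_prop) rfl
    exact (hasDerivAt_slice_mid a4).unique ((hasDerivAt_const _ _).congr_of_eventuallyEq
      (ht.eventually e))
  have B00 : rightCoeff h (0, 0) = 0 := hB0.self_of_nhds
  have aG : AnalyticAt ℂ (fun p : (ℂ × ℂ) × ℂ =>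
      rightCoeff h (p.2, p.1.2) - ε * a p.1.2 * p.1.1) 0 := by
    have k1 : AnalyticAt ℂ (fun p : (ℂ × ℂ) × ℂ => rightCoeff h (p.2, p.1.2)) 0 :=
      aB.comp_at (by fun_prop) rfl
    have k2 : AnalyticAt ℂ (fun p : (ℂ × ℂ) × ℂ => a p.1.2) 0 := aa.comp_at (by fun_prop) rfl
    fun_prop
  obtain ⟨f, af, f0, hf, huniq⟩ := exists_implicit (a := ((0, 0) : ℂ × ℂ)) (b := (0 : ℂ))
    aG (by simp [B00]) (by
    intro v hv
    have d := hasDerivAt_comp₂ (G := rightCoeff h) (t := 0) (b := fun _ => 0)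
      (by simp only [zero_mul]; exact aB.differentiableAt) (hasDerivAt_lin v) (hasDerivAt_const _ _)
    have := (pd_eq_of_line (v := ((0 : ℂ × ℂ), v)) aG.differentiableAt
      (by simpa using d)).symm.trans hv
    exact (mul_eq_zero.1 this).resolve_right h11)
  have f00 : f 0 = 0 := f0
  have hf0 : ∀ᶠ w in 𝓝 (0 : ℂ), f (0, w) = 0 := by
    have t : Tendsto (fun w : ℂ => (((0, w), 0) : (ℂ × ℂ) × ℂ)) (𝓝 0) (𝓝 ((0, 0), 0)) :=
      tendsto_of_analyticAt (by fun_prop) rfl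
    filter_upwards [t.eventually huniq, hB0] with w h1 h2
    exact (h1 (by simp [h2])).symm
  have hdf : ∀ᶠ w in 𝓝 (0 : ℂ), dz f (0, w) * dz (rightCoeff h) (0, w) = ε * a w := by
    filter_upwards [tendsto_left₂.eventually hf.eventually_nhds, hf0,
      tendsto_left₂.eventually af.eventually_analyticAt,
      tendsto_left₂.eventually aB.eventually_analyticAt] with w e e0 a1 a2
    have ht : Tendsto (fun s : ℂ => ((s, w) : ℂ × ℂ)) (𝓝 0) (𝓝 (0, w)) :=
      tendsto_of_analyticAt (by fun_prop) rfl
    have d := hasDerivAt_comp₂ (G := rightCoeff h) (b := fun _ => w)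
      (by rw [e0]; exact a2.differentiableAt) (hasDerivAt_dz a1) (hasDerivAt_const _ _)
    have := d.unique (((hasDerivAt_id (0 : ℂ)).const_mul (ε * a w)).congr_of_eventuallyEq
      ((ht.eventually e).mono fun s hs => sub_eq_zero.1 hs))
    rw [e0] at this
    change dz f (0, w) * pd (1, 0) (rightCoeff h) (0, w) = ε * a w
    simpa using this
  -- From `f_z b = ε a` and `a² = ε b`, with `ε² = 1` and `b ≠ 0`.
  have hone : ∀ᶠ w in 𝓝 (0 : ℂ), a w * dz f (0, w) = 1 := by
    filter_upwards [hdf, hab, ab.continuousAt.eventually_ne h11] with w e1 e2 e3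
    refine mul_right_cancel₀ e3 ?_
    linear_combination a w * e1 + ε * e2 + dz (rightCoeff h) (0, w) * hε2
  have hdwf : ∀ᶠ w in 𝓝 (0 : ℂ), dw f (0, w) = 0 := by
    filter_upwards [hf0.eventually_nhds, tendsto_left₂.eventually af.eventually_analyticAt]
      with w e a1
    rw [dw_left a1, euler_congr (H' := fun _ => 0) e]
    simp [euler]
  -- the conjugate germ
  have afc := analyticAt_conjGerm af
  have hfc : ∀ᶠ x : ℂ × ℂ in 𝓝 0, pd (1, 0, 0) h (0, conjGerm f x, x.2) = ε * a x.2 * x.1 := by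
    have t : Tendsto (fun x : ℂ × ℂ => ((conj x.1, conj x.2) : ℂ × ℂ)) (𝓝 0) (𝓝 0) := by
      have : Continuous (fun x : ℂ × ℂ => ((conj x.1, conj x.2) : ℂ × ℂ)) := by fun_prop
      simpa [Prod.zero_eq_mk] using this.tendsto 0
    have t2 : Tendsto (fun x : ℂ × ℂ => ((conjGerm f x, x.2) : ℂ × ℂ)) (𝓝 0) (𝓝 0) :=
      tendsto_of_analyticAt (afc.prod analyticAt_snd) (by simp [conjGerm_zero f00])
    have t3 : Tendsto (fun x : ℂ × ℂ => x.2) (𝓝 0) (𝓝 0) := tendsto_of_analyticAt (by fun_prop) rfl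
    filter_upwards [t.eventually hf, t2.eventually (conjGerm_rightCoeff hh hr),
      t3.eventually hac] with x e1 e2 e3
    rw [← e2, conjGerm]
    simp only [conjGerm, conj_conj]
    rw [sub_eq_zero.1 e1, map_mul, map_mul, conj_ofReal, e3, conj_conj]
  have hfc0 : ∀ᶠ w in 𝓝 (0 : ℂ), conjGerm f (0, w) = 0 := by
    filter_upwards [tendsto_conj_zero.eventually hf0] with w e
    simp [conjGerm, e]
  have honec : ∀ᶠ w in 𝓝 (0 : ℂ), a w * dz (conjGerm f) (0, w) = 1 := by
    filter_upwards [tendsto_conj_zero.eventually hone, hac,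
      (tendsto_left₂.comp tendsto_conj_zero).eventually af.eventually_analyticAt,
      tendsto_left₂.eventually afc.eventually_analyticAt] with w e1 e2 a1 a2
    rw [dz_conjGerm_apply a1 a2, ← e2, ← map_mul, e1, map_one]
  have z1 : ∀ᶠ x : ℂ × ℂ in 𝓝 0, Λ (0, x.1, x.2) = 0 := by
    filter_upwards [tendsto_zero_left.eventually hΛ.eq_zero_iff, hl] with x h1 h2 using h1.1 h2
  have z2 : ∀ᶠ x : ℂ × ℂ in 𝓝 0, Λ (x.1, 0, x.2) = 0 := by
    filter_upwards [tendsto_zero_mid.eventually hΛ.eq_zero_iff, hrt] with x h1 h2 using h1.1 h2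
  have ts : Tendsto (fun x : ℂ × ℂ => x.2) (𝓝 0) (𝓝 0) := tendsto_of_analyticAt (by fun_prop) rfl
  have tf : Tendsto (fun x : ℂ × ℂ => ((f x, x.2) : ℂ × ℂ)) (𝓝 0) (𝓝 0) :=
    tendsto_of_analyticAt (af.prod analyticAt_snd) (by simp [f00])
  have tfc : Tendsto (fun x : ℂ × ℂ => ((conjGerm f x, x.2) : ℂ × ℂ)) (𝓝 0) (𝓝 0) :=
    tendsto_of_analyticAt (afc.prod analyticAt_snd) (by simp [conjGerm_zero f00])
  have z2' : ∀ᶠ x : ℂ × ℂ in 𝓝 0, pd (1, 0, 0) Λ (x.1, 0, x.2) = 0 := by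
    filter_upwards [z2.eventually_nhds,
      tendsto_zero_mid.eventually hΛ.analyticAt.eventually_analyticAt] with x e a4
    have ht : Tendsto (fun s : ℂ => ((s, x.2) : ℂ × ℂ)) (𝓝 x.1) (𝓝 x) :=
      tendsto_of_analyticAt (by fun_prop) rfl
    exact (hasDerivAt_slice a4).unique ((hasDerivAt_const _ _).congr_of_eventuallyEq
      (ht.eventually e))
  have dz0 : ∀ x, dz (fun _ : ℂ × ℂ => (0 : ℂ)) x = 0 := fun x => by simp [dz, pd]
  have dw0 : ∀ x, dw (fun _ : ℂ × ℂ => (0 : ℂ)) x = 0 := fun x => by simp [dw, pd]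
  have df0 : dz f 0 ≠ 0 := fun e => by simpa [show dz f (0, 0) = 0 from e] using hone.self_of_nhds
  refine ⟨ε, f, hε, af, f00, df0, ?_, ?_, ?_, ?_⟩
  · filter_upwards [ts.eventually hf0, tfc.eventually z1] with x e1 e2
    simp [e1, e2]
  · filter_upwards [ts.eventually hf0, ts.eventually hdwf, ts.eventually hone, hfc,
      tfc.eventually (hΛ.pd_left_iff hh hl z1)] with x e1 e2 e3 e4 e5
    simp only [e1, e2, dz0, dw0, exp_zero, mul_one, mul_zero, add_zero, zero_add]
    rw [e4] at e5
    linear_combination (-I * ε * x.1) * e3 + I * dz f (0, x.2) * e5 -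
      dz f (0, x.2) * pd (1, 0, 0) Λ (0, conjGerm f x, x.2) * I_sq
  · filter_upwards [ts.eventually hfc0, tf.eventually z2] with x e1 e2
    simp [foot, e1, e2]
  · filter_upwards [ts.eventually hfc0, tf.eventually z2', ts.eventually honec, hf,
      tf.eventually (hΛ.pd_right_iff hh hrt z2)] with x e1 e2 e3 e4 e5
    simp only [foot, e1, e2, dz0, dw0, exp_zero, mul_one, mul_zero, add_zero, zero_add, zero_mul]
    rw [show pd (0, 1, 0) h (f x, 0, x.2) = ε * a x.2 * x.1 from sub_eq_zero.1 e4] at e5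
    linear_combination (-I * ε * x.1) * e3 + I * dz (conjGerm f) (0, x.2) * e5 -
      dz (conjGerm f) (0, x.2) * pd (0, 1, 0) Λ (f x, 0, x.2) * I_sq

end Initial

/-! ### Admissible coordinates at a generic point of 1-infinite type -/

section Initial

variable {h : ℂ × ℂ × ℂ → ℂ} {M : Set (ℂ × ℂ)} {p : ℂ × ℂ}

lemma taylorCoeff_one_one (hh : AnalyticAt ℂ h 0) :
    taylorCoeff (fun z χ => h (z, χ, 0)) 1 1 = dz (rightCoeff h) (0, 0) := by
  have t : Tendsto (fun z : ℂ => ((z, 0, 0) : ℂ × ℂ × ℂ)) (𝓝 0) (𝓝 0) :=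
    tendsto_of_analyticAt (by fun_prop) rfl
  have aB := analyticAt_rightCoeff hh
  rw [taylorCoeff_eq_cf, cf_congr (g' := fun z => rightCoeff h (z, 0)), cf_one]
  · exact (hasDerivAt_dz aB).deriv
  · filter_upwards [t.eventually hh.eventually_analyticAt] with z hz
    rw [cf_one]
    exact (hasDerivAt_slice_mid hz).deriv

lemma conjGerm_const_zero : conjGerm (fun _ => 0) = fun _ => 0 := by ext x; simp [conjGerm]

/-- A hypersurface `v = u h / 2` with nondegenerate `h` has admissible coordinates. -/
lemma exists_isAdmissibleCoordinates_of_graph {Z : ℂ × ℂ → ℂ × ℂ} (hZ : IsLocalBiholomorphism Z p)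
    (hM : ∀ᶠ q in 𝓝 p, q ∈ M ↔ OnGraph h (Z q)) (hh : AnalyticAt ℂ h 0)
    (hr : conjSwap h =ᶠ[𝓝 0] h) (hl : ∀ᶠ x : ℂ × ℂ in 𝓝 0, h (0, x.1, x.2) = 0)
    (hrt : ∀ᶠ x : ℂ × ℂ in 𝓝 0, h (x.1, 0, x.2) = 0) (h11 : dz (rightCoeff h) (0, 0) ≠ 0) :
    ∃ (Z' : ℂ × ℂ → ℂ × ℂ) (ε : ℝ) (h₁ : ℂ × ℂ × ℂ → ℂ), IsAdmissibleCoordinates M p Z' ε h₁ := by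
  have h0 : h 0 = 0 := hl.self_of_nhds
  obtain ⟨Λ, hΛ⟩ := exists_logForm hh h0
  obtain ⟨ε, f, hε, af, f0, hdf, hrel⟩ := exists_admissible_germ hh hΛ hr hl hrt h11
  have hg : TransformationGerms f (fun _ => 0) (conjGerm f) (conjGerm fun _ => 0) := by
    rw [conjGerm_const_zero]
    exact ⟨af, analyticAt_const, analyticAt_conjGerm af, analyticAt_const, f0, rfl,
      conjGerm_zero f0, rfl⟩
  obtain ⟨h₁, ah₁, h₁0, hpol, hpu⟩ := hg.exists_polar hh h0
  obtain ⟨Λ₁, hΛ₁⟩ := exists_logForm ah₁ h₁0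
  have hp := hg.transformationPair hΛ hΛ₁ ah₁ h₁0 hpol
  have hreal := hg.conjSwap_eventuallyEq hr ah₁ h₁0 hpol hpu
  rw [conjGerm_const_zero] at hp
  have hLa₁ := hrel.logAdmissible hp hΛ.analyticAt hΛ₁.analyticAt hΛ₁.map_zero
  have ha₁ := ((hΛ₁.logAdmissible_iff ah₁ ε).2 hLa₁).isAdmissibleFunction hε
    ((eventually_conjSwap_eq_iff ah₁).1 hreal)
  obtain ⟨Z', hZ'⟩ := exists_admissibleCoordinates hZ hM hg hdf hh h0 ha₁ hpol hpu
  exact ⟨Z', ε, h₁, hZ'⟩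

theorem exists_isAdmissibleCoordinates (hp : IsGenericInfiniteTypeAt 1 M p) :
    ∃ (Z : ℂ × ℂ → ℂ × ℂ) (ε : ℝ) (h : ℂ × ℂ × ℂ → ℂ), IsAdmissibleCoordinates M p Z ε h := by
  obtain ⟨-, Z, F, ψ, hN, aψ, hF, h11⟩ := hp
  simp only [pow_one] at hF
  have t1 : Tendsto (fun x : ℂ × ℂ × ℂ => ((0, x.2.1, x.2.2) : ℂ × ℂ × ℂ)) (𝓝 0) (𝓝 0) :=
    tendsto_of_analyticAt (by fun_prop) rfl
  have t2 : Tendsto (fun x : ℂ × ℂ × ℂ => ((x.1, 0, x.2.2) : ℂ × ℂ × ℂ)) (𝓝 0) (𝓝 0) :=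
    tendsto_of_analyticAt (by fun_prop) rfl
  have s1 : Tendsto (fun x : ℂ × ℂ × ℂ => ((x.2.1, x.2.2) : ℂ × ℂ)) (𝓝 0) (𝓝 0) :=
    tendsto_of_analyticAt (by fun_prop) rfl
  have s2 : Tendsto (fun x : ℂ × ℂ × ℂ => ((x.1, x.2.2) : ℂ × ℂ)) (𝓝 0) (𝓝 0) :=
    tendsto_of_analyticAt (by fun_prop) rfl
  -- The normalization and the reality of `F = u ψ` pass to `ψ` on dividing by `u`, by continuity at
  -- `u = 0`.
  have l0 := eventually_eq_zero_of_mul (G := fun x => ψ (0, x.2.1, x.2.2))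
    (aψ.comp_at (by fun_prop) rfl) (by
      filter_upwards [t1.eventually hF, s1.eventually hN.left_zero] with x e1 e2
      exact e1.symm.trans e2)
  have r0 := eventually_eq_zero_of_mul (G := fun x => ψ (x.1, 0, x.2.2))
    (aψ.comp_at (by fun_prop) rfl) (by
      filter_upwards [t2.eventually hF, s2.eventually hN.right_zero] with x e1 e2
      exact e1.symm.trans e2)
  have hreal := eventually_eq_zero_of_mul (G := fun x => conjSwap ψ x - ψ x)
    ((analyticAt_conjSwap aψ).fun_sub aψ) (by
      filter_upwards [hF, tendsto_conjSwap.eventually hF,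
        (eventually_conjSwap_eq_iff hN.analyticAt).2 hN.real] with x e1 e2 e3
      rw [e1, conjSwap, e2, map_mul, conj_conj] at e3
      rw [mul_sub, sub_eq_zero]
      exact e3)
  -- The factor `2` matches `u ψ` with `u h / 2`.
  have ah : AnalyticAt ℂ (fun x => 2 * ψ x) 0 := by fun_prop
  refine exists_isAdmissibleCoordinates_of_graph (h := fun x => 2 * ψ x) hN.biholomorphism ?_ ah
    ?_ ?_ ?_ ?_
  · have c : Continuous fun y : ℂ × ℂ => ((y.1, conj y.1, ((y.2.re : ℝ) : ℂ)) : ℂ × ℂ × ℂ) := by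
      fun_prop
    have t : Tendsto (fun y : ℂ × ℂ => ((y.1, conj y.1, ((y.2.re : ℝ) : ℂ)) : ℂ × ℂ × ℂ)) (𝓝 0)
      (𝓝 0) := by simpa [Prod.zero_eq_mk] using c.tendsto 0
    filter_upwards [hN.graph, (t.comp (tendsto_of_analyticAt hN.biholomorphism.analyticAt
      hN.biholomorphism.map_base)).eventually hF] with q e1 e2
    simp only [Function.comp] at e2
    rw [e1, e2, OnGraph]
    ring_nf
  · filter_upwards [hreal] with x e
    simp only [conjSwap, map_mul, map_ofNat] at e ⊢
    rw [sub_eq_zero.1 e]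
  · filter_upwards [tendsto_zero_left.eventually l0] with x e
    rw [e, mul_zero]
  · filter_upwards [tendsto_zero_mid.eventually r0] with x e
    rw [e, mul_zero]
  · rw [← taylorCoeff_one_one ah, taylorCoeff_eq_cf]
    simp only [cf_const_mul]
    rw [← taylorCoeff_eq_cf (fun z χ => ψ (z, χ, 0))]
    exact mul_ne_zero two_ne_zero h11

end Initial

/-! ### Rigidity of transformations between normal forms -/

section Uniqueness

variable {h h₁ h₂ : ℂ × ℂ × ℂ → ℂ} {f γ : ℂ × ℂ → ℂ} {ε₁ ε₂ : ℝ} {G : ℂ × ℂ → ℂ × ℂ}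

lemma _root_.IsAdmissibleFunction.map_zero {ε : ℝ} (ha : IsAdmissibleFunction ε h) : h 0 = 0 :=
  ha.logAdmissible.left.self_of_nhds

lemma onGraph_of_real (z : ℂ) (u : ℝ) (hr : (h (z, conj z, (u : ℂ))).im = 0) :
    OnGraph h (z, (u : ℂ) * (1 + I / 2 * h (z, conj z, (u : ℂ)))) ∧
      ((u : ℂ) * (1 + I / 2 * h (z, conj z, (u : ℂ)))).re = u ∧
      ((u : ℂ) * (1 + I / 2 * h (z, conj z, (u : ℂ)))).im =
        u * (h (z, conj z, (u : ℂ))).re / 2 := by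
  have e : h (z, conj z, (u : ℂ)) = (((h (z, conj z, (u : ℂ))).re : ℝ) : ℂ) :=
    Complex.ext (by simp) (by simp [hr])
  set t := (h (z, conj z, (u : ℂ))).re with ht
  have e2 : (u : ℂ) * (1 + I / 2 * t) = (u : ℂ) + ((u * t / 2 : ℝ) : ℂ) * I := by push_cast; ring
  have e3 : ((u : ℂ) * (1 + I / 2 * t)).re = u := by rw [e2]; simp
  have e4 : ((u : ℂ) * (1 + I / 2 * t)).im = u * t / 2 := by rw [e2]; simp
  rw [e]
  refine ⟨?_, e3, e4⟩
  rw [OnGraph]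
  simp only
  rw [e3, e4, e]
  push_cast
  ring

lemma tendsto_real : Tendsto (fun x : ℂ × ℝ => ((x.1, conj x.1, (x.2 : ℂ)) : ℂ × ℂ × ℂ)) (𝓝 0)
    (𝓝 0) := by
  have : Continuous (fun x : ℂ × ℝ => ((x.1, conj x.1, (x.2 : ℂ)) : ℂ × ℂ × ℂ)) := by fun_prop
  simpa [Prod.zero_eq_mk] using this.tendsto 0

/-- A transformation between real hypersurfaces, complexified. -/
lemma TransformationGerms.polarEqn_eq_zero
    (hg : TransformationGerms f γ (conjGerm f) (conjGerm γ)) (hh₂ : AnalyticAt ℂ h₂ 0)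
    (ha₁ : IsAdmissibleFunction ε₁ h₁)
    (hM : ∀ᶠ y in 𝓝 0, OnGraph h₁ y → OnGraph h₂ (expMap f γ y)) :
    ∀ᶠ x in 𝓝 0, polarEqn h₂ f γ (conjGerm f) (conjGerm γ) (x, h₁ x) = 0 := by
  have ah₁ := ha₁.analyticAt
  have h₁0 := ha₁.map_zero
  have aP : AnalyticAt ℂ (fun x : ℂ × ℂ × ℂ =>
      polarEqn h₂ f γ (conjGerm f) (conjGerm γ) (x, h₁ x)) 0 :=
    (hg.analyticAt_polarEqn hh₂).comp_at (analyticAt_id.prod ah₁) (by simp [h₁0])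
  -- Real points give the vanishing of `u` times the polar equation only; this suffices, because `u`
  -- can be cancelled after complexification.
  refine eventually_eq_zero_of_mul aP (eventually_eq_zero_of_conj
    (G := fun x => x.2.2 * polarEqn h₂ f γ (conjGerm f) (conjGerm γ) (x, h₁ x))
    (AnalyticAt.fun_mul (by fun_prop) aP) ?_)
  have t : Tendsto (fun x : ℂ × ℂ × ℂ => ((x.1, x.2.2 * (1 + I / 2 * h₁ x)) : ℂ × ℂ)) (𝓝 0)
      (𝓝 0) := tendsto_of_analyticAt (by fun_prop) (by simp)
  filter_upwards [ha₁.real, (t.comp tendsto_real).eventually hM] with x hr hx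
  obtain ⟨z, u⟩ := x
  simp only [Function.comp] at hr hx ⊢
  obtain ⟨e1, e2, e3⟩ := onGraph_of_real z u hr
  have e : h₁ (z, conj z, (u : ℂ)) = (((h₁ (z, conj z, (u : ℂ))).re : ℝ) : ℂ) :=
    Complex.ext (by simp) (by simp [hr])
  have := polarEqn_of_real (h := h₂) (f := f) (γ := γ)
    (z, (u : ℂ) * (1 + I / 2 * h₁ (z, conj z, (u : ℂ)))) (h₁ (z, conj z, (u : ℂ))).re
    (by simp only; rw [e2, e3])
  rw [sub_eq_zero.2 (hx e1), mul_zero] at this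
  simp only [e2] at this
  rw [← e] at this
  exact this

/-- A transformation between two germs in normal form, tangent to the identity, is the identity. -/
theorem TransformationGerms.eventuallyEq_id
    (hg : TransformationGerms f γ (conjGerm f) (conjGerm γ)) (hdf : dz f 0 = 1)
    (ha₁ : IsAdmissibleFunction ε₁ h₁) (hn₁ : IsInNormalForm h₁)
    (ha₂ : IsAdmissibleFunction ε₂ h₂) (hn₂ : IsInNormalForm h₂)
    (hM : ∀ᶠ y in 𝓝 0, OnGraph h₁ y → OnGraph h₂ (expMap f γ y))
    (hres : ∀ Θ Φ, IsComplexDefiningFunction h₂ Θ → IsAssociatedODE Θ Φ → IsNonResonantODE Φ) :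
    ∀ᶠ y in 𝓝 0, expMap f γ y = y := by
  have ah₁ := ha₁.analyticAt
  have ah₂ := ha₂.analyticAt
  have hpol := hg.polarEqn_eq_zero ah₂ ha₁ hM
  obtain ⟨Λ₁, hΛ₁⟩ := exists_logForm ah₁ ha₁.map_zero
  obtain ⟨Λ, hΛ⟩ := exists_logForm ah₂ ha₂.map_zero
  have hp := hg.transformationPair hΛ hΛ₁ ah₁ ha₁.map_zero hpol
  have hL₁ := (hΛ₁.logAdmissible_iff ah₁ ε₁).1 ha₁.logAdmissible
  have hL := (hΛ.logAdmissible_iff ah₂ ε₂).1 ha₂.logAdmissible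
  have hdfc : dz (conjGerm f) 0 = 1 := by rw [dz_conjGerm hg.analyticAt_f, hdf, map_one]
  have hc : I * (ε₂ : ℂ) ≠ 0 := by rcases ha₂.sign with e | e <;> simp [e]
  -- the signs agree
  have hεε : I * (ε₁ : ℂ) = I * ε₂ := by
    have t1 : Tendsto (fun χ : ℂ => ((χ, 0) : ℂ × ℂ)) (𝓝 0) (𝓝 0) :=
      tendsto_of_analyticAt (by fun_prop) rfl
    have t2 : Tendsto (fun χ : ℂ => conjGerm f (χ, 0)) (𝓝 0) (𝓝 0) :=
      tendsto_of_analyticAt (hg.analyticAt_f'.comp_at (by fun_prop) rfl) hg.f'_zero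
    have d := (hasDerivAt_dz (z := 0) (w := 0) hg.analyticAt_f').const_mul (I * (ε₂ : ℂ))
    have e00 : ((0, 0) : ℂ × ℂ) = 0 := rfl
    -- On `τ = 0` the second equation for the data is `γ_z(0) + i ε₁ χ = i ε₂ f'(χ, 0)`, and the
    -- companion `f'` has derivative `1` at `χ = 0`.
    have := d.unique ((((hasDerivAt_id (0 : ℂ)).const_mul (I * (ε₁ : ℂ))).const_add
      (dz γ (0, 0))).congr_of_eventuallyEq (by
        filter_upwards [t1.eventually (hp.data_eqns hL₁ hL.analyticAt),
          t2.eventually hL.eventually_mid] with χ h1 h2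
        have e1 := h1.2
        simp only [dw, zero_mul, mul_zero, add_zero, e00, hg.f_zero, hdf, mul_one] at e1 h2 ⊢
        rw [h2.2] at e1
        exact e1.symm))
    rw [e00, hdfc] at this
    simpa using this.symm
  rw [hεε] at hL₁
  obtain ⟨Ψ, hΨ, h2, heq⟩ := hL.exists_ode hc
  have hode := isAssociatedODE_of_log hΛ.analyticAt hΨ h2 heq
  obtain ⟨-, huniq⟩ := exists_cauchyData (Φ := fun x => Ψ x + x.2.2 ^ 2) (by fun_prop)
    hode.order_two (hres _ _ hΛ.isComplexDefiningFunction hode)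
  rw [logODE_add] at huniq
  -- the identity transformation
  have hgi : TransformationGerms Prod.fst (fun _ => 0) Prod.fst (fun _ => 0) :=
    ⟨analyticAt_fst, analyticAt_const, analyticAt_fst, analyticAt_const, rfl, rfl, rfl, rfl⟩
  have hpi : TransformationPair Λ Λ Prod.fst (fun _ => 0) Prod.fst (fun _ => 0) :=
    ⟨hgi, .of_forall fun x => by simp⟩
  have hdi : dz (Prod.fst : ℂ × ℂ → ℂ) 0 = 1 :=
    (hasDerivAt_dz (z := 0) (w := 0) analyticAt_fst).unique (hasDerivAt_id 0)
  have hn := hp.normalizedMap hL₁ hL hdf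
  have hni := hpi.normalizedMap hL hL hdi
  have hs := (constantJet_iff hn hΨ h2 hL₁ hc (hp.pullback_eq hL₁ hL hdf heq)).1
    ((hΛ₁.constantJet_iff ha₁.logAdmissible).1 ((isInNormalForm_iff ah₁).1 hn₁))
  have hsi := (constantJet_iff hni hΨ h2 hL hc (hpi.pullback_eq hL hL hdi heq)).1
    ((hΛ.constantJet_iff ha₂.logAdmissible).1 ((isInNormalForm_iff ah₂).1 hn₂))
  have hdd := huniq _ _ (analyticAt_cauchyData hn.analyticAt_fst hn.analyticAt_snd)
    hn.cauchyData_zero hs (analyticAt_cauchyData hni.analyticAt_fst hni.analyticAt_snd)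
    hni.cauchyData_zero hsi
  -- The companion agrees with that of the identity. Since it is the conjugate of `(f, γ)`, this
  -- determines the transformation itself.
  obtain ⟨ef, eγ⟩ := hp.companion_unique hpi hL₁ hL hL hc hdf hdd
  have t : Tendsto (fun x : ℂ × ℂ => ((conj x.1, conj x.2) : ℂ × ℂ)) (𝓝 0) (𝓝 0) := by
    have : Continuous (fun x : ℂ × ℂ => ((conj x.1, conj x.2) : ℂ × ℂ)) := by fun_prop
    simpa [Prod.zero_eq_mk] using this.tendsto 0
  filter_upwards [t.eventually ef, t.eventually eγ] with y e1 e2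
  simp only [conjGerm, conj_conj] at e1 e2
  have e1' : f y = y.1 := (starRingEnd ℂ).injective e1
  have e2' : γ y = 0 := (map_eq_zero (starRingEnd ℂ)).1 e2
  simp [expMap, e1', e2']

end Uniqueness

/-! ### The second component of a map between admissible hypersurfaces -/

section Factor

variable {h₁ h₂ : ℂ × ℂ × ℂ → ℂ} {ε₁ ε₂ : ℝ} {G : ℂ × ℂ → ℂ × ℂ}

/-- The complexification of a map between two hypersurfaces `v = u h(z, z̄, u) / 2`. -/
lemma eventually_graph_eqn (hG : AnalyticAt ℂ G 0) (hG0 : G 0 = 0)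
    (ha₁ : IsAdmissibleFunction ε₁ h₁) (hh₂ : AnalyticAt ℂ h₂ 0)
    (hM : ∀ᶠ y in 𝓝 0, OnGraph h₁ y → OnGraph h₂ (G y)) :
    ∀ᶠ x : ℂ × ℂ in 𝓝 0, (G x).2 * (1 - I / 2 * h₂ ((G x).1, conjGerm (fun y => (G y).1) (0, x.2),
        ((G x).2 + conjGerm (fun y => (G y).2) (0, x.2)) / 2)) =
      conjGerm (fun y => (G y).2) (0, x.2) *
        (1 + I / 2 * h₂ ((G x).1, conjGerm (fun y => (G y).1) (0, x.2),
        ((G x).2 + conjGerm (fun y => (G y).2) (0, x.2)) / 2)) := by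
  have ah₁ := ha₁.analyticAt
  have h₁0 := ha₁.map_zero
  have a1 : AnalyticAt ℂ (fun y => (G y).1) 0 := analyticAt_fst.comp_at hG rfl
  have a2 : AnalyticAt ℂ (fun y => (G y).2) 0 := analyticAt_snd.comp_at hG rfl
  have z1 : (fun y => (G y).1) 0 = 0 := by simp [hG0]
  have z2 : (fun y => (G y).2) 0 = 0 := by simp [hG0]
  have b1 := analyticAt_conjGerm a1
  have b2 := analyticAt_conjGerm a2
  have y1 := conjGerm_zero (g := fun y => (G y).1) z1
  have y2 := conjGerm_zero (g := fun y => (G y).2) z2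
  -- The complexified source is parametrized by the pairs `p = (z, w)` and `q = (χ, τ)`.
  set p : ℂ × ℂ × ℂ → ℂ × ℂ := fun x => (x.1, x.2.2 * (1 + I / 2 * h₁ x)) with hp
  set q : ℂ × ℂ × ℂ → ℂ × ℂ := fun x => (x.2.1, x.2.2 * (1 - I / 2 * h₁ x)) with hq
  have ap : AnalyticAt ℂ p 0 := by fun_prop
  have aq : AnalyticAt ℂ q 0 := by fun_prop
  have p0 : p 0 = 0 := by simp [hp]
  have q0 : q 0 = 0 := by simp [hq]
  have c1 := a1.comp_at ap p0
  have c2 := a2.comp_at ap p0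
  have c3 := b1.comp_at aq q0
  have c4 := b2.comp_at aq q0
  set E : ℂ × ℂ × ℂ → ℂ := fun x => (G (p x)).2 - conjGerm (fun y => (G y).2) (q x) -
    I / 2 * ((G (p x)).2 + conjGerm (fun y => (G y).2) (q x)) *
      h₂ ((G (p x)).1, conjGerm (fun y => (G y).1) (q x),
        ((G (p x)).2 + conjGerm (fun y => (G y).2) (q x)) / 2) with hE
  have aE : AnalyticAt ℂ E 0 := by
    have : AnalyticAt ℂ (fun x => h₂ ((G (p x)).1, conjGerm (fun y => (G y).1) (q x),
        ((G (p x)).2 + conjGerm (fun y => (G y).2) (q x)) / 2)) 0 := by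
      refine hh₂.comp_at (c1.prod (c3.prod ((c2.fun_add c4).fun_div analyticAt_const two_ne_zero)))
        ?_
      rw [p0, q0, y1, y2, hG0]
      simp
    exact (c2.fun_sub c4).fun_sub ((analyticAt_const.fun_mul (c2.fun_add c4)).fun_mul this)
  have key : ∀ᶠ x in 𝓝 0, E x = 0 := by
    refine eventually_eq_zero_of_conj aE ?_
    filter_upwards [ha₁.real, ((tendsto_of_analyticAt ap p0).comp tendsto_real).eventually hM]
      with x hr hx
    obtain ⟨z, u⟩ := x
    simp only [Function.comp] at hr hx ⊢
    obtain ⟨e1, -, -⟩ := onGraph_of_real z u hr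
    have e : conj (h₁ (z, conj z, (u : ℂ))) = h₁ (z, conj z, (u : ℂ)) := Complex.conj_eq_iff_im.2 hr
    have eq : q (z, conj z, (u : ℂ)) = (conj z, conj (p (z, conj z, (u : ℂ))).2) := by
      simp only [hp, hq, map_mul, map_add, map_one, map_div₀, conj_I, map_ofNat, conj_ofReal, e]
      ring_nf
    have hx' := hx e1
    rw [hE]
    simp only
    rw [eq]
    have e3 : ((z, (p (z, conj z, (u : ℂ))).2) : ℂ × ℂ) = p (z, conj z, (u : ℂ)) := rfl
    simp only [conjGerm, conj_conj, e3]
    set y := G (p (z, conj z, (u : ℂ))) with hy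
    have ere : (y.2 + conj y.2) / 2 = ((y.2.re : ℝ) : ℂ) := by
      rw [Complex.add_conj]; push_cast; ring
    have eim := Complex.sub_conj y.2
    have ead := Complex.add_conj y.2
    rw [ere, eim, ead]
    rw [OnGraph] at hx'
    push_cast
    rw [hx']
    ring
  have t : Tendsto (fun x : ℂ × ℂ => ((x.1, 0, x.2) : ℂ × ℂ × ℂ)) (𝓝 0) (𝓝 0) :=
    tendsto_of_analyticAt (by fun_prop) rfl
  -- For `χ = 0` the function `h₁` vanishes, so `p = (z, u)` and `q = (0, u)`.
  filter_upwards [t.eventually key, ha₁.logAdmissible.right] with x e1 e2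
  simp only [hE, hp, hq, e2, mul_zero, add_zero, sub_zero, mul_one] at e1
  linear_combination e1

/-- A map between two hypersurfaces `v = u h(z, z̄, u) / 2` is of the form `(f, μ w e ^ γ)`. -/
theorem exists_snd_eq_mul_exp (hG : AnalyticAt ℂ G 0) (hG0 : G 0 = 0)
    (hd : fderiv ℂ (fun y => (G y).2) 0 ≠ 0)
    (ha₁ : IsAdmissibleFunction ε₁ h₁) (hh₂ : AnalyticAt ℂ h₂ 0) (h₂0 : h₂ 0 = 0)
    (hM : ∀ᶠ y in 𝓝 0, OnGraph h₁ y → OnGraph h₂ (G y)) :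
    ∃ (μ : ℝ) (γ : ℂ × ℂ → ℂ), μ ≠ 0 ∧ AnalyticAt ℂ γ 0 ∧ γ 0 = 0 ∧
      ∀ᶠ y in 𝓝 0, (G y).2 = (μ : ℂ) * (y.2 * exp (γ y)) := by
  have a1 : AnalyticAt ℂ (fun y => (G y).1) 0 := analyticAt_fst.comp_at hG rfl
  have a2 : AnalyticAt ℂ (fun y => (G y).2) 0 := analyticAt_snd.comp_at hG rfl
  have z1 : (fun y => (G y).1) 0 = 0 := by simp [hG0]
  have z2 : (fun y => (G y).2) 0 = 0 := by simp [hG0]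
  have y1 := conjGerm_zero (g := fun y => (G y).1) z1
  have y2 := conjGerm_zero (g := fun y => (G y).2) z2
  have b1 : AnalyticAt ℂ (fun w : ℂ => conjGerm (fun y => (G y).1) (0, w)) 0 :=
    (analyticAt_conjGerm a1).comp_at (by fun_prop) rfl
  have b2 : AnalyticAt ℂ (fun w : ℂ => conjGerm (fun y => (G y).2) (0, w)) 0 :=
    (analyticAt_conjGerm a2).comp_at (by fun_prop) rfl
  -- The conjugate of the second component, restricted to the axis, vanishes at `0`. Through the
  -- equation along `χ = 0` its factor `w` divides the second component of the map.
  obtain ⟨κ, aκ, hκ⟩ := exists_pow_smul_of_isLittleO (m := 0) b2 (by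
    simp only [pow_zero]
    rw [Asymptotics.isLittleO_one_iff]
    exact tendsto_of_analyticAt b2 y2)
  simp only [zero_add, pow_one, smul_eq_mul] at hκ
  set k : ℂ × ℂ → ℂ := fun x => h₂ ((G x).1, conjGerm (fun y => (G y).1) (0, x.2),
        ((G x).2 + conjGerm (fun y => (G y).2) (0, x.2)) / 2) with hk
  have c1 := b1.comp_at (g := fun x : ℂ × ℂ => x.2) (x := 0) analyticAt_snd rfl
  have c2 := b2.comp_at (g := fun x : ℂ × ℂ => x.2) (x := 0) analyticAt_snd rfl
  have e00 : ((0, 0) : ℂ × ℂ) = 0 := rfl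
  have arg0 : (((G 0).1, conjGerm (fun y => (G y).1) (0, (0 : ℂ × ℂ).2),
      ((G 0).2 + conjGerm (fun y => (G y).2) (0, (0 : ℂ × ℂ).2)) / 2) : ℂ × ℂ × ℂ) = 0 := by
    simp only [Prod.snd_zero, e00, y1, y2, hG0]
    simp
  have ak : AnalyticAt ℂ k 0 := hh₂.comp_at
    (a1.prod (c1.prod ((a2.fun_add c2).fun_div analyticAt_const two_ne_zero))) arg0
  have k0 : k 0 = 0 := by simp only [hk]; rw [arg0, h₂0]
  have ad : AnalyticAt ℂ (fun x => 1 - I / 2 * k x) 0 := by fun_prop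
  set g : ℂ × ℂ → ℂ := fun x => κ x.2 * ((1 + I / 2 * k x) / (1 - I / 2 * k x)) with hg
  have ag : AnalyticAt ℂ g 0 := (aκ.comp_at analyticAt_snd rfl).fun_mul
    (AnalyticAt.fun_div (by fun_prop) ad (by simp [k0]))
  have g0 : g 0 = κ 0 := by simp [hg, k0]
  have ts : Tendsto (fun x : ℂ × ℂ => x.2) (𝓝 0) (𝓝 0) :=
    tendsto_of_analyticAt analyticAt_snd rfl
  have hGg : ∀ᶠ x in 𝓝 0, (G x).2 = x.2 * g x := by
    filter_upwards [eventually_graph_eqn hG hG0 ha₁ hh₂ hM, ts.eventually hκ,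
      ad.continuousAt.eventually_ne (y := 0) (by simp [k0])] with x e1 e2 e3
    have e4 : (G x).2 * (1 - I / 2 * k x) =
      conjGerm (fun y => (G y).2) (0, x.2) * (1 + I / 2 * k x) := e1
    rw [e2] at e4
    simp only [hg]
    rw [← mul_assoc, ← mul_div_assoc, eq_div_iff e3, e4]
  -- Restricting to `z = 0` gives `κ(w) = conj (g(0, conj w))`, and `κ(0) = g(0)`.
  have hreal : conj (g 0) = g 0 := by
    have t : Tendsto (fun w : ℂ => ((0, conj w) : ℂ × ℂ)) (𝓝 0) (𝓝 0) := by
      have : Continuous (fun w : ℂ => ((0, conj w) : ℂ × ℂ)) := by fun_prop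
      simpa [Prod.zero_eq_mk] using this.tendsto 0
    have cg : ContinuousAt (fun w : ℂ => conj (g (0, conj w)) - κ w) 0 := by
      refine ContinuousAt.sub (continuous_conj.continuousAt.comp' ?_) aκ.continuousAt
      exact ContinuousAt.comp' (g := g) (by simpa [e00] using ag.continuousAt)
        (by fun_prop)
    have := eq_zero_of_mul_eq_zero cg (by
      filter_upwards [t.eventually hGg, hκ] with w e1 e2
      rw [conjGerm] at e2
      simp only [map_zero] at e2
      rw [e1, map_mul, conj_conj] at e2
      rw [mul_sub, e2, sub_self])
    rw [map_zero, e00, sub_eq_zero] at this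
    rw [this, g0]
  obtain ⟨μ, hμ⟩ : ∃ μ : ℝ, g 0 = (μ : ℂ) := ⟨(g 0).re, (Complex.conj_eq_iff_re.1 hreal).symm⟩
  -- Otherwise the differential of `w g` at the origin would vanish.
  have μ0 : (μ : ℂ) ≠ 0 := by
    intro h0
    apply hd
    rw [Filter.EventuallyEq.fderiv_eq hGg,
      fderiv_fun_mul (by fun_prop) ag.differentiableAt]
    rw [hμ, h0, Prod.snd_zero]
    ext <;> simp
  have ag' : AnalyticAt ℂ (fun x => g x / μ) 0 := ag.fun_div analyticAt_const μ0
  have g1 : g 0 / μ = 1 := by rw [hμ, div_self μ0]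
  refine ⟨μ, fun x => log (g x / μ), by exact_mod_cast μ0,
    AnalyticAt.clog ag' (by simp [g1]), by simp [g1], ?_⟩
  filter_upwards [hGg, ag'.continuousAt.eventually_ne (y := 0) (by simp [g1])] with x e1 e2
  rw [e1, exp_log e2]
  field_simp

end Factor

/-! ### Dilations and the uniqueness of normalizing maps -/

section NormalizingMaps

variable {M : Set (ℂ × ℂ)} {p : ℂ × ℂ} {H H₁ H₂ S : ℂ × ℂ → ℂ × ℂ} {h h₁ h₂ : ℂ × ℂ × ℂ → ℂ}
  {ε ε₁ ε₂ : ℝ}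

lemma fderiv_dilation (hH : DifferentiableAt ℂ H p) (r : ℂ) (v : ℂ × ℂ) :
    fderiv ℂ (fun q => ((H q).1, r * (H q).2)) p v =
      ((fderiv ℂ H p v).1, r * (fderiv ℂ H p v).2) := by
  have d := hH.hasFDerivAt
  rw [(d.fst.prodMk (d.snd.const_mul r)).fderiv]
  simp

lemma _root_.IsAdmissibleCoordinates.dilation (hH : IsAdmissibleCoordinates M p H ε h) {r : ℝ}
    (hr : r ≠ 0) : IsAdmissibleCoordinates M p (fun q => ((H q).1, (r : ℂ) * (H q).2)) ε
      (fun x => h (x.1, x.2.1, x.2.2 / r)) := by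
  have hr' : (r : ℂ) ≠ 0 := by exact_mod_cast hr
  obtain ⟨⟨aH, H0, hi⟩, ⟨hs, ah, hreal, hco⟩, hg⟩ := hH
  refine ⟨⟨?_, by simp [H0], ?_⟩, ⟨hs, ?_, ?_, ?_⟩, ?_⟩
  · exact (analyticAt_fst.comp_at aH rfl).prod
      (analyticAt_const.fun_mul (analyticAt_snd.comp_at aH rfl))
  · refine isInvertible_of_injective fun v hv => eq_zero_of_isInvertible hi ?_
    rw [fderiv_dilation aH.differentiableAt, Prod.mk_eq_zero, mul_eq_zero] at hv
    exact Prod.ext hv.1 (hv.2.resolve_left hr')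
  · exact ah.comp_at (analyticAt_fst.prod ((analyticAt_fst.comp_at analyticAt_snd rfl).prod
      ((analyticAt_snd.comp_at analyticAt_snd rfl).fun_div analyticAt_const hr'))) (by simp)
  · have t : Tendsto (fun x : ℂ × ℝ => ((x.1, x.2 / r) : ℂ × ℝ)) (𝓝 0) (𝓝 0) := by
      have : Continuous (fun x : ℂ × ℝ => ((x.1, x.2 / r) : ℂ × ℝ)) := by fun_prop
      simpa [Prod.zero_eq_mk] using this.tendsto 0
    filter_upwards [t.eventually hreal] with x hx
    simpa using hx
  · exact (tendsto_of_analyticAt (analyticAt_id.fun_div analyticAt_const hr')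
      (by simp)).eventually hco
  · filter_upwards [hg] with q hq
    rw [hq]
    simp only [re_ofReal_mul, im_ofReal_mul]
    push_cast
    rw [mul_div_cancel_left₀ _ hr', mul_left_comm (1 / 2 : ℂ), mul_assoc (r : ℂ),
      mul_right_inj' hr']

lemma _root_.IsInNormalForm.dilation (hn : IsInNormalForm h) (r : ℂ) :
    IsInNormalForm (fun x => h (x.1, x.2.1, x.2.2 / r)) := by
  have t : Tendsto (fun u : ℂ => u / r) (𝓝 0) (𝓝 0) := by
    have : Continuous (fun u : ℂ => u / r) := by fun_prop
    simpa using this.tendsto 0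
  filter_upwards [t.eventually hn] with u hu
  have e : ∀ k l u, hCoeff (fun x => h (x.1, x.2.1, x.2.2 / r)) k l u = hCoeff h k l (u / r) :=
    fun _ _ _ => rfl
  simpa only [e, zero_div] using hu

/-- The complex curve `w = 0` lies in the hypersurface, so every defining function is constant along
real curves inside it; the directions `1` and `i` give the two conditions. -/
lemma mem_holTangentSpace (hgr : ∀ᶠ q in 𝓝 p, q ∈ M ↔ OnGraph h (H q))
    (aS : AnalyticAt ℂ S 0) (hS0 : S 0 = p) (hS : ∀ᶠ y in 𝓝 0, H (S y) = y) :
    fderiv ℂ S 0 (1, 0) ∈ holTangentSpace M p := by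
  intro ρ hρ
  have key : ∀ d : ℂ, fderiv ℝ ρ p (d • fderiv ℂ S 0 (1, 0)) = 0 := by
    intro d
    have e0 : S (((0 : ℝ) : ℂ) * d, 0) = p := by simpa [Prod.zero_eq_mk] using hS0
    have d2 : HasDerivAt (fun t : ℝ => S ((t : ℂ) * d, 0)) (d • fderiv ℂ S 0 (1, 0)) 0 := by
      have d1 : HasDerivAt (fun t : ℝ => (((t : ℂ) * d, 0) : ℂ × ℂ)) (d, 0) 0 :=
        ((hasDerivAt_lin d).comp_ofReal (z := 0)).prodMk (hasDerivAt_const _ _)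
      have := aS.differentiableAt.hasFDerivAt.restrictScalars ℝ
      have := HasFDerivAt.comp_hasDerivAt_of_eq (0 : ℝ) this d1 (by simp [Prod.zero_eq_mk])
      rw [← map_smul]
      simpa [Function.comp_def] using this
    have d3 : HasDerivAt (fun t : ℝ => ρ (S ((t : ℂ) * d, 0)))
        (fderiv ℝ ρ p (d • fderiv ℂ S 0 (1, 0))) 0 := by
      have := hρ.analyticAt.differentiableAt.hasFDerivAt
      rw [← e0] at this
      rw [← e0]
      exact this.comp_hasDerivAt (0 : ℝ) d2
    refine d3.unique ((hasDerivAt_const (0 : ℝ) (0 : ℝ)).congr_of_eventuallyEq ?_)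
    have t1 : Tendsto (fun t : ℝ => (((t : ℂ) * d, 0) : ℂ × ℂ)) (𝓝 0) (𝓝 0) := by
      have : Continuous (fun t : ℝ => (((t : ℂ) * d, 0) : ℂ × ℂ)) := by fun_prop
      simpa [Prod.zero_eq_mk] using this.tendsto 0
    have t2 := (tendsto_of_analyticAt aS hS0).comp t1
    filter_upwards [t1.eventually hS, t2.eventually hgr, t2.eventually hρ.mem_iff] with t e1 e2 e3
    simp only [Function.comp] at e2 e3
    rw [e1] at e2
    exact e3.1 (e2.2 (by simp [OnGraph]))
  exact ⟨by simpa using key 1, key I⟩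

/-- The transition map `H₂ ∘ H₁⁻¹` is `(f, μ w e ^ γ)`. Composing `H₂` with the dilation by `1 / μ`
leaves a map between two normal forms with `f_z(0) = 1`, and such a map is the identity. -/
theorem eventuallyEq_dilation (hA₁ : IsAdmissibleCoordinates M p H₁ ε₁ h₁) (hn₁ : IsInNormalForm h₁)
    (hA₂ : IsAdmissibleCoordinates M p H₂ ε₂ h₂) (hn₂ : IsInNormalForm h₂)
    (hres : IsNonResonantAt M p)
    (hd : ∀ v ∈ holTangentSpace M p, fderiv ℂ H₁ p v = fderiv ℂ H₂ p v) :
    ∃ μ : ℝ, μ ≠ 0 ∧ ∀ᶠ q in 𝓝 p, H₂ q = ((H₁ q).1, (μ : ℂ) * (H₁ q).2) := by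
  obtain ⟨a₁, b₁, i₁⟩ := hA₁.biholomorphism
  obtain ⟨a₂, b₂, i₂⟩ := hA₂.biholomorphism
  obtain ⟨S, aS, S0, hHS, hSH⟩ := exists_local_inverse a₁ b₁ fun v => eq_zero_of_isInvertible i₁
  have dS := aS.differentiableAt
  have tS := tendsto_of_analyticAt aS S0
  have tH := tendsto_of_analyticAt a₁ b₁
  have e1 : ∀ v, fderiv ℂ H₁ p (fderiv ℂ S 0 v) = v := by
    intro v
    have d1 : HasFDerivAt H₁ (fderiv ℂ H₁ p) (S 0) := by
      rw [S0]; exact a₁.differentiableAt.hasFDerivAt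
    have := (d1.comp 0 dS.hasFDerivAt).unique ((hasFDerivAt_id 0).congr_of_eventuallyEq hHS)
    exact congrArg (fun L : (ℂ × ℂ) →L[ℂ] (ℂ × ℂ) => L v) this
  have e2 : ∀ v, fderiv ℂ S 0 (fderiv ℂ H₁ p v) = v := by
    intro v
    have d1 : HasFDerivAt S (fderiv ℂ S 0) (H₁ p) := by rw [b₁]; exact dS.hasFDerivAt
    have := (d1.comp p a₁.differentiableAt.hasFDerivAt).unique
      ((hasFDerivAt_id p).congr_of_eventuallyEq hSH)
    exact congrArg (fun L : (ℂ × ℂ) →L[ℂ] (ℂ × ℂ) => L v) this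
  have aG : AnalyticAt ℂ (fun y => H₂ (S y)) 0 := a₂.comp_at aS S0
  have dG : HasFDerivAt (fun y => H₂ (S y)) ((fderiv ℂ H₂ p).comp (fderiv ℂ S 0)) 0 := by
    have d1 : HasFDerivAt H₂ (fderiv ℂ H₂ p) (S 0) := by
      rw [S0]; exact a₂.differentiableAt.hasFDerivAt
    exact d1.comp 0 dS.hasFDerivAt
  have G0 : H₂ (S 0) = 0 := by rw [S0, b₂]
  have hdf : dz (fun y => (H₂ (S y)).1) 0 = 1 := by
    have h1 := hd _ (mem_holTangentSpace hA₁.graph aS S0 hHS)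
    rw [e1] at h1
    rw [dz, pd, dG.fst.fderiv]
    simp [← h1]
  have hds : fderiv ℂ (fun y => (H₂ (S y)).2) 0 ≠ 0 := by
    intro h0
    obtain ⟨e, he⟩ := i₂
    have h1 := congrArg (fun L : (ℂ × ℂ) →L[ℂ] ℂ => L (fderiv ℂ H₁ p (e.symm (0, 1)))) h0
    rw [dG.snd.fderiv] at h1
    simp [e2, ← he] at h1
  have hM : ∀ᶠ y in 𝓝 0, OnGraph h₁ y → OnGraph h₂ (H₂ (S y)) := by
    filter_upwards [hHS, tS.eventually hA₁.graph, tS.eventually hA₂.graph] with y h1 h2 h3 h4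
    rw [h1] at h2
    exact h3.1 (h2.2 h4)
  obtain ⟨μ, γ, hμ, aγ, γ0, hγ⟩ := exists_snd_eq_mul_exp aG G0 hds hA₁.admissible
    hA₂.admissible.analyticAt hA₂.admissible.map_zero hM
  have hμ' : (μ : ℂ) ≠ 0 := by exact_mod_cast hμ
  have af : AnalyticAt ℂ (fun y => (H₂ (S y)).1) 0 := analyticAt_fst.comp_at aG rfl
  have f0 : (fun y => (H₂ (S y)).1) 0 = 0 := by simp [G0]
  have hg : TransformationGerms (fun y => (H₂ (S y)).1) γ (conjGerm fun y => (H₂ (S y)).1)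
      (conjGerm γ) :=
    ⟨af, aγ, analyticAt_conjGerm af, analyticAt_conjGerm aγ, f0, γ0, conjGerm_zero f0,
      conjGerm_zero γ0⟩
  -- Non-resonance is available for the dilated coordinates too, since it is assumed in all
  -- admissible ones.
  have hA₃ := hA₂.dilation (inv_ne_zero hμ)
  have hM₃ : ∀ᶠ y in 𝓝 0, OnGraph h₁ y → OnGraph (fun x => h₂ (x.1, x.2.1, x.2.2 / (μ⁻¹ : ℝ)))
      (expMap (fun y => (H₂ (S y)).1) γ y) := by
    filter_upwards [hHS, tS.eventually hA₁.graph, tS.eventually hA₃.graph, hγ] with y h1 h2 h3 h4 h5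
    rw [h1] at h2
    have h6 := h3.1 (h2.2 h5)
    rw [h4] at h6
    push_cast at h6
    rw [inv_mul_cancel_left₀ hμ'] at h6
    simpa [OnGraph, expMap] using h6
  have hid := hg.eventuallyEq_id hdf hA₁.admissible hn₁ hA₃.admissible (hn₂.dilation _) hM₃
    fun Θ Φ => hres _ _ _ Θ Φ hA₃
  refine ⟨μ, hμ, ?_⟩
  filter_upwards [hSH, tH.eventually hid, tH.eventually hγ] with q h1 h2 h3
  rw [h1] at h3
  simp only [expMap, h1] at h2
  have h4 : (H₂ q).1 = (H₁ q).1 := (Prod.ext_iff.1 h2).1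
  have h5 : (H₁ q).2 * exp (γ (H₁ q)) = (H₁ q).2 := (Prod.ext_iff.1 h2).2
  exact Prod.ext h4 (by rw [h3, h5])

theorem eventuallyEq_of_fderiv_eq (hA₁ : IsAdmissibleCoordinates M p H₁ ε₁ h₁)
    (hn₁ : IsInNormalForm h₁) (hA₂ : IsAdmissibleCoordinates M p H₂ ε₂ h₂)
    (hn₂ : IsInNormalForm h₂) (hres : IsNonResonantAt M p)
    (hd : fderiv ℂ H₁ p = fderiv ℂ H₂ p) : H₁ =ᶠ[𝓝 p] H₂ := by
  obtain ⟨μ, -, h⟩ := eventuallyEq_dilation hA₁ hn₁ hA₂ hn₂ hres fun v _ => by rw [hd]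
  obtain ⟨a₁, -, e, he⟩ := hA₁.biholomorphism
  -- The dilation fixes the differential of `H₁`, which takes some vector to `(0, 1)`.
  have hμ : (μ : ℂ) = 1 := by
    have h1 := fderiv_dilation a₁.differentiableAt (μ : ℂ) (e.symm (0, 1))
    rw [← Filter.EventuallyEq.fderiv_eq h, ← hd, ← he] at h1
    simpa using (congrArg Prod.snd h1).symm
  filter_upwards [h] with q hq
  rw [hq, hμ, one_mul]

end NormalizingMaps

end InfiniteType

theorem mainTheorem1 (M : Set (ℂ × ℂ)) (p : ℂ × ℂ)
    (hM : IsRealAnalyticHypersurfaceAt M p)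
    (hp : IsGenericInfiniteTypeAt 1 M p)
    (hres : IsNonResonantAt M p) :
    (∃ H : ℂ × ℂ → ℂ × ℂ, IsNormalizing M p H) ∧
    (∀ H₁ H₂ : ℂ × ℂ → ℂ × ℂ, IsNormalizing M p H₁ → IsNormalizing M p H₂ →
      (∀ v ∈ holTangentSpace M p, fderiv ℂ H₁ p v = fderiv ℂ H₂ p v) →
      ∃ μ : ℝ, μ ≠ 0 ∧ ∀ᶠ q in 𝓝 p, H₂ q = ((H₁ q).1, (μ : ℂ) * (H₁ q).2)) ∧
    (∀ H₁ H₂ : ℂ × ℂ → ℂ × ℂ, IsNormalizing M p H₁ → IsNormalizing M p H₂ →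
      fderiv ℂ H₁ p = fderiv ℂ H₂ p → H₁ =ᶠ[𝓝 p] H₂) := by
  obtain ⟨Z, ε, h, hZ⟩ := InfiniteType.exists_isAdmissibleCoordinates hp
  refine ⟨InfiniteType.exists_isNormalizing hZ hres, ?_, ?_⟩
  · rintro H₁ H₂ ⟨_, _, hA₁, hn₁⟩ ⟨_, _, hA₂, hn₂⟩ hd
    exact InfiniteType.eventuallyEq_dilation hA₁ hn₁ hA₂ hn₂ hres hd
  · rintro H₁ H₂ ⟨_, _, hA₁, hn₁⟩ ⟨_, _, hA₂, hn₂⟩ hd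
    exact InfiniteType.eventuallyEq_of_fderiv_eq hA₁ hn₁ hA₂ hn₂ hres hd
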